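/- **Setting.** Fix $M>0$. For $|a|\le M$ let $r_+=M+\sqrt{M^2-a^2}$, $\Delta=r^2-2Mr+a^2$, $\Sigma=r^2+a^2\cos^2\theta$. Let $\iota:\mathbb R\to[0,1]$ be smooth (independent of $a$) with $\iota=1$ for $r\le\frac{17}{8}M$, $\iota=0$ for $r\ge\frac94M$, and $f:\mathbb R\to\mathbb R$ smooth with $f=0$ for $r\le3M$ and $f=r+2M\log r-3M^2/r+\mathrm{const}$ for $r\ge4M$. On the Kerr exterior $\mathcal M$ (horizon $r=r_+$ included) with metric, in ingoing Kerr coordinates, $$g=-\Big(1-\tfrac{2Mr}{\Sigma}\Big)d\bar t^2+2\,d\bar t\,dr+\Sigma\,d\theta^2+\tfrac{(r^2+a^2)^2-\Delta a^2\sin^2\theta}{\Sigma}\sin^2\theta\,d\bar\phi^2-2a\sin^2\theta\,dr\,d\bar\phi-\tfrac{4aMr}{\Sigma}\sin^2\theta\,d\bar t\,d\bar\phi ,$$ define $\tilde t^*=\bar t-\int^r[(1-\iota)\frac{r'^2+a^2}{\Delta}+\iota]\,dr'-f(r)$, $\tilde\phi^*=\bar\phi-\int^r(1-\iota)\frac a\Delta\,dr'$,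 $\Sigma_\tau=\{\tilde t^*=\tau\}$, $\mathbb S^2_{\tau,r}=\{\tilde t^*=\tau,\ r=\text{const}\}$, $d\Omega=\sin\theta\,d\theta\,d\tilde\phi^*$. Let (Boyer–Lindquist) $e_4=\frac{r^2+a^2}\Sigma\partial_t+\frac\Delta\Sigma\partial_r+\frac a\Sigma\partial_\phi$, $e_3=\frac{r^2+a^2}\Delta\partial_t-\partial_r+\frac a\Delta\partial_\phi$, so $g(e_3,e_4)=-2$. *Horizontal* tensors are covariant tensors vanishing on $e_3,e_4$ in each slot; $|\cdot|$, $\slashed\varepsilon$ are the induced norm and volume form on the orthogonal complement of $e_3,e_4$ (with $\slashed\varepsilon(e_1,e_2)=1$ for the oriented orthonormal frame with $e_1\parallel\partial_\theta$, $e_2$ the normalised horizontal part of $\partial_\phi$), ${}^\star\varsigma_A=\slashed\varepsilon_A{}^B\varsigma_B$, and $\slashed\nabla,\slashed\nabla_3,\slashed\nabla_4$ are the projections of $\nabla,\nabla_{e_3},\nabla_{e_4}$, with $\slashed{\mathrm{div}}\,\varsigma=\slashed\nabla^A\varsigma_A$, $\slashed{\mathrm{curl}}\,\varsigma=\slashed\varepsilon^{AB}\slashed\nabla_A\varsigma_B$.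 Put $\mathrm{tr}\chi=\frac{2r\Delta}{\Sigma^2}$, $\mathrm{tr}\underline\chi=-\frac{2r}\Sigma$, $\slashed\varepsilon\cdot\chi=\frac{2a\Delta\cos\theta}{\Sigma^2}$, $\slashed\varepsilon\cdot\underline\chi=\frac{2a\cos\theta}{\Sigma}$, $\hat\omega=-\frac{2}{\Sigma^2}(a^2(M-r)\cos^2\theta+a^2r-Mr^2)$, $$\mathfrak T(\varsigma)=\tfrac12\Sigma(\slashed\nabla_3\varsigma+\underline\chi^{\sharp_2}\!\cdot\varsigma),\qquad \underline{\mathfrak T}(\varsigma)=\tfrac12\Sigma(\slashed\nabla_4\varsigma+\chi^{\sharp_2}\!\cdot\varsigma+\hat\omega\varsigma),$$ where on one-forms $\chi^{\sharp_2}\cdot\varsigma=\frac12\mathrm{tr}\chi\,\varsigma+\frac12(\slashed\varepsilon\cdot\chi){}^\star\varsigma$ (likewise $\underline\chi$), extended to higher-rank horizontal tensors as a derivation over the slots. Let $A=\frac14\Sigma[(\mathrm{tr}\underline\chi)^2-(\slashed\varepsilon\cdot\underline\chi)^2]$, $B=\frac12\Sigma(\slashed\varepsilon\cdot\underline\chi)\,\mathrm{tr}\underline\chi$.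 **Equations.** A *modified Maxwell solution* $\mathfrak S=(\alpha,\underline\alpha,\hat\rho,\hat\sigma)$ consists of complex-valued horizontal one-forms $\alpha,\underline\alpha$ and functions $\hat\rho,\hat\sigma$, smooth on $\mathcal M\cap\{\tilde t^*\ge0\}$ up to the boundary, with $$\slashed\nabla_3\hat\sigma=\Sigma B\,\slashed{\mathrm{div}}\,\underline\alpha-\Sigma A\,\slashed{\mathrm{curl}}\,\underline\alpha,\qquad \slashed\nabla_3\hat\rho=-\Sigma A\,\slashed{\mathrm{div}}\,\underline\alpha-\Sigma B\,\slashed{\mathrm{curl}}\,\underline\alpha,$$ $$\slashed\nabla_4\hat\sigma=-B\,\slashed{\mathrm{div}}(\Sigma\alpha)-A\,\slashed{\mathrm{curl}}(\Sigma\alpha),\qquad \slashed\nabla_4\hat\rho=A\,\slashed{\mathrm{div}}(\Sigma\alpha)-B\,\slashed{\mathrm{curl}}(\Sigma\alpha),$$ $$\slashed\nabla\hat\sigma=-B(\mathfrak T(\alpha)-\underline{\mathfrak T}(\underline\alpha))-A({}^\star\mathfrak T(\alpha)+{}^\star\underline{\mathfrak T}(\underline\alpha)),\qquad \slashed\nabla\hat\rho=A(\mathfrak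 T(\alpha)-\underline{\mathfrak T}(\underline\alpha))-B({}^\star\mathfrak T(\alpha)+{}^\star\underline{\mathfrak T}(\underline\alpha)).$$ Its *seed data* are $\alpha|_{\Sigma_0},\underline\alpha|_{\Sigma_0},\hat\rho|_{\mathbb S^2_{0,r_+}},\hat\sigma|_{\mathbb S^2_{0,r_+}}$; they are *supported on the azimuthal mode* $m$ if $\mathcal L_{\partial_{\tilde\phi^*}}$ acts on each of them as multiplication by $im$. The *stationary solution* $\mathfrak S_{\mathfrak q_1,\mathfrak q_2}$ has $\alpha=\underline\alpha=0$, $\hat\rho=\mathfrak q_1$, $\hat\sigma=\mathfrak q_2$. **Energies** (in $[0,\infty]$; $\int_{\Sigma_\tau}$ is over $r>r_+$ with measure $dr\,d\Omega$). For $\varsigma=r^2\alpha$ (and its derivatives), $$\mathbb E^1[\varsigma]=\int_{\Sigma_\tau}|\slashed\nabla^2\varsigma|^2+|\slashed\nabla\slashed\nabla_4\varsigma|^2+|\slashed\nabla_4^2\varsigma|^2+r^2|\slashed\nabla_4\slashed\nabla_3\varsigma|^2+\tfrac\Delta{r^2}|\slashed\nabla_3^2\varsigma|^2+r^2|\slashed\nabla\slashed\nabla_3\varsigma|^2+|\slashed\nabla_3\varsigma|^2+|\slashed\nabla_4\varsigma|^2+|\slashed\nabla\varsigma|^2+r^{-2}|\varsigma|^2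 ;$$ for $\varsigma=r\underline\alpha$ (and its derivatives), with $\underline{\mathfrak T}_r(\varsigma):=r\,\underline{\mathfrak T}(r^{-1}\varsigma)$, $$\begin{aligned}\mathbb E^1[\varsigma]=\int_{\Sigma_\tau}&\tfrac{\Delta}{r^2}\big(|\slashed\nabla^2\varsigma|^2+\tfrac{(r-M)^2}{r^{2}}|\slashed\nabla_3\slashed\nabla\varsigma|^2+\tfrac{(r-M)^4}{r^{6}}|\slashed\nabla_3^2\varsigma|^2\big)+|\slashed\nabla_4\underline{\mathfrak T}_r\varsigma|^2+\tfrac\Delta{r^4}|\slashed\nabla_3\underline{\mathfrak T}_r\varsigma|^2+|\slashed\nabla\underline{\mathfrak T}_r\varsigma|^2\\&+r^{-2}|\underline{\mathfrak T}_r\varsigma|^2+\tfrac{(r-M)^2\Delta}{r^6}|\slashed\nabla_3\varsigma|^2+\tfrac{(r-M)^2}{r^2}\big(|\slashed\nabla\varsigma|^2+r^{-2}|\varsigma|^2\big);\end{aligned}$$ for both, $\mathbb E^{J}[\varsigma]=\sum_{j_1+j_2+j_3\le J-1}\mathbb E^1[((1-\frac Mr)\slashed\nabla_3)^{j_1}\slashed\nabla_4^{j_2}\slashed\nabla^{j_3}\varsigma]$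 for $J\ge1$. For $h\in\{\hat\rho,\hat\sigma\}$, $$\mathbb E^J[h]=\sum_{j_1+j_2+j_3\le J}\dot{\mathbb E}\big[((1-\tfrac Mr)\slashed\nabla_3)^{j_1}\slashed\nabla_4^{j_2}\slashed\nabla^{j_3}h\big]+\int_{\Sigma_\tau}r^{-2}|h|^2,\qquad \dot{\mathbb E}[\varsigma]=\int_{\Sigma_\tau}|\slashed\nabla_4\varsigma|^2+\Delta r^{-4}|\slashed\nabla_3\varsigma|^2+|\slashed\nabla\varsigma|^2 .$$ Finally $\mathbb E_{\mathcal H^+}[\varsigma](\tau,\infty)=\int_\tau^\infty\int_{\mathbb S^2_{\tilde t^*,r_+}}(|\varsigma|^2+|\slashed\nabla\varsigma|^2+|\slashed\nabla_4\varsigma|^2)\,d\Omega\,d\tilde t^*$. **Hypothesis (the conjectural Teukolsky estimates).** Let $\eta\in(0,1)$, $m\in\mathbb Z$, and let $\mathbb D^J_{\rm bdd}[r^2\alpha],\mathbb D^J_{\rm dec}[r^2\alpha],\mathbb D^J_{\rm bdd}[r\underline\alpha],\mathbb D^J_{\rm dec}[r\underline\alpha]\in[0,\infty]$ be any quantities depending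 only on $J$, $a$ and the seed data (with $M,m,\eta,\iota,f$ fixed). Assume: there is $J_{\min}\ge1$ such that for every $J_1\ge J_{\min}$ there are $J_2,J_3\ge J_1$ and $C>0$ such that, for all $|a|\le M$, all modified Maxwell solutions with seed data supported on the mode $m$, and all $\tau\ge0$, * $\mathbb E^{J_1}[r^2\alpha](\tau)\le C\,\mathbb D^{J_2}_{\rm bdd}[r^2\alpha]$ and $\mathbb E^{J_1}[r\underline\alpha](\tau)\le C\,\mathbb D^{J_2}_{\rm bdd}[r\underline\alpha]$; * $\mathbb E^{J_1}[r^2\alpha](\tau)\le\frac{C}{(1+\tau)^{1-\eta}}\mathbb D^{J_3}_{\rm dec}[r^2\alpha]$ and $\mathbb E^{J_1}[r\underline\alpha](\tau)\le\frac{C}{(1+\tau)^{1-\eta}}\mathbb D^{J_3}_{\rm dec}[r\underline\alpha]$; * $\mathbb E_{\mathcal H^+}[r^2\alpha](\tau,\infty)\le\frac{C}{(1+\tau)^{2-\eta}}\mathbb D^{J_3}_{\rm dec}[r^2\alpha]$, $\ \int_{\mathbb S^2_{\tau,r_+}}(|\slashed\nabla\mathfrak T(r^2\alpha)|^2+|\mathfrak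 T(r^2\alpha)|^2)d\Omega\le\frac{C}{(1+\tau)^{1-\eta}}\mathbb D^{J_3}_{\rm dec}[r^2\alpha]$, $\ \int_{\mathbb S^2_{\tau,r_+}}(|\slashed\nabla\underline{\mathfrak T}(r\underline\alpha)|^2+|\underline{\mathfrak T}(r\underline\alpha)|^2)d\Omega\le\frac{C}{(1+\tau)^{1-\eta}}\mathbb D^{J_3}_{\rm dec}[r\underline\alpha]$. **Theorem.** Under this hypothesis there are charges $\mathfrak q_1,\mathfrak q_2\in\mathbb C$ determined by $a$ and the seed data alone, real when the seed data are real, and there is $J_{\min}\ge1$ such that for every $J_1\ge J_{\min}$ there are $J_2,J_3\ge J_1$ and a constant $C>0$ (independent of $a$) such that, for every $|a|\le M$ and every modified Maxwell solution $\mathfrak S=(\alpha,\underline\alpha,\hat\rho,\hat\sigma)$ with seed data supported on the mode $m$, writing $\widetilde{\mathfrak S}=\mathfrak S-\mathfrak S_{\mathfrak q_1,\mathfrak q_2}$, one has $\alpha[\widetilde{\mathfrak S}]=\alpha[\mathfrak S]$, $\underline\alpha[\widetilde{\mathfrak S}]=\underline\alpha[\mathfrak S]$ and, for all $\tau\ge0$: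 * (degenerate boundedness) $\mathbb E^{J_1}[r^2\alpha](\tau)\le C\,\mathbb D^{J_2}_{\rm bdd}[r^2\alpha]$, $\ \mathbb E^{J_1}[r\underline\alpha](\tau)\le C\,\mathbb D^{J_2}_{\rm bdd}[r\underline\alpha]$, and $$\mathbb E^{J_1}[\hat\rho](\tau)+\mathbb E^{J_1}[\hat\sigma](\tau)\le C\big(\|\hat\rho\|^2_{L^2(\mathbb S^2_{0,r_+})}+\|\hat\sigma\|^2_{L^2(\mathbb S^2_{0,r_+})}\big)+C\big(\mathbb D^{J_3}_{\rm dec}[r^2\alpha]+\mathbb D^{J_2}_{\rm bdd}[r^2\alpha]\big)+C\big(\mathbb D^{J_3}_{\rm dec}[r\underline\alpha]+\mathbb D^{J_2}_{\rm bdd}[r\underline\alpha]\big),$$ the $L^2$ norms being with respect to $d\Omega$; * (degenerate decay, extremal components) $\mathbb E^{J_1}[r^2\alpha[\widetilde{\mathfrak S}]](\tau)\le\frac{C}{(1+\tau)^{1-\eta}}\mathbb D^{J_3}_{\rm dec}[r^2\alpha]$ and $\mathbb E^{J_1}[r\underline\alpha[\widetilde{\mathfrak S}]](\tau)\le\frac{C}{(1+\tau)^{1-\eta}}\mathbb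 D^{J_3}_{\rm dec}[r\underline\alpha]$; * (degenerate decay, middle components) $$\mathbb E^{J_1}[\hat\rho[\widetilde{\mathfrak S}]](\tau)+\mathbb E^{J_1}[\hat\sigma[\widetilde{\mathfrak S}]](\tau)\le\frac{C}{(1+\tau)^{1-\eta}}\big(\mathbb D^{J_3}_{\rm dec}[r^2\alpha]+\mathbb D^{J_2}_{\rm bdd}[r^2\alpha]+\mathbb D^{J_3}_{\rm dec}[r\underline\alpha]+\mathbb D^{J_2}_{\rm bdd}[r\underline\alpha]\big).$$ -/

import Mathlib

open scoped ENNReal ContDiff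

namespace Kerr

noncomputable section

/-! ### Coordinates, tensor fields

A point of the spacetime is given by its hyperboloidal Kerr-star coordinates in Cartesian form:
`p 0` is the time function and `(p 1, p 2, p 3) = r (sin θ cos φ, sin θ sin φ, cos θ)`. -/

/-- Coordinate space; also the space of components of vectors. -/
abbrev Pt : Type := Fin 4 → ℝ

/-- Complexified covariant `k`-tensor fields, through their components. Scalar functions are the
case `k = 0` and one-forms the case `k = 1`. -/
abbrev Tens (k : ℕ) : Type := Pt → (Fin k → Fin 4) → ℂ

/-- The coordinate vector `∂_μ`. -/
def stdVec (μ : Fin 4) : Pt := Pi.single μ 1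

/-- The radius `r`. -/
def rad (p : Pt) : ℝ := Real.sqrt (p 1 ^ 2 + p 2 ^ 2 + p 3 ^ 2)

/-- `cos θ`. -/
def cosT (p : Pt) : ℝ := p 3 / rad p

/-- `sin² θ`. -/
def sinT2 (p : Pt) : ℝ := 1 - cosT p ^ 2

/-- The point with coordinates `(τ, r, θ, φ)`. -/
def sph (τ r θ φ : ℝ) : Pt :=
  ![τ, r * Real.sin θ * Real.cos φ, r * Real.sin θ * Real.sin φ, r * Real.cos θ]

/-- The one-form `dr`. -/
def drForm (p v : Pt) : ℝ := (p 1 * v 1 + p 2 * v 2 + p 3 * v 3) / rad p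

/-- The one-form `sin² θ dφ`, `φ` being the angle of the Cartesian coordinates. -/
def dphiForm (p v : Pt) : ℝ := (p 1 * v 2 - p 2 * v 1) / rad p ^ 2

/-- Product of a tensor field and a real function. -/
def wt {k : ℕ} (w : Pt → ℝ) (T : Tens k) : Tens k := fun p I => (w p : ℂ) * T p I

/-- The Kerr parameters, the function `ι` entering the passage from ingoing Kerr coordinates to
Kerr-star coordinates, and the height function `f` of the hyperboloidal foliation. -/
structure Background where
  M : ℝ
  a : ℝ
  ι : ℝ → ℝ
  f : ℝ → ℝ

/-- `ι` is smooth with values in `[0,1]`, equal to `1` near the horizon and to `0` far away. -/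
def IsStarCutoff (M : ℝ) (ι : ℝ → ℝ) : Prop :=
  ContDiff ℝ ∞ ι ∧ (∀ r, ι r ∈ Set.Icc (0 : ℝ) 1) ∧
    (∀ r, r ≤ 17 * M / 8 → ι r = 1) ∧ (∀ r, 9 * M / 4 ≤ r → ι r = 0)

/-- `f` is smooth, vanishes for `r ≤ 3M`, and is `r + 2M log r - 3M²/r` for `r ≥ 4M`, up to a
constant (the normalisation of the logarithm). -/
def IsHeight (M : ℝ) (f : ℝ → ℝ) : Prop :=
  ContDiff ℝ ∞ f ∧ (∀ r, r ≤ 3 * M → f r = 0) ∧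
    ∃ c : ℝ, ∀ r, 4 * M ≤ r → f r = r + 2 * M * Real.log r - 3 * M ^ 2 / r + c

namespace Background

variable (B : Background)

/-- The horizon radius `r₊`. -/
def rPlus : ℝ := B.M + Real.sqrt (B.M ^ 2 - B.a ^ 2)

/-- The future of the initial hypersurface in the exterior, horizon included. -/
def region : Set Pt := {p | 0 ≤ p 0 ∧ B.rPlus ≤ rad p}

/-- The initial hypersurface `Σ_0`. -/
def initialSlice : Set Pt := {p | p 0 = 0 ∧ B.rPlus ≤ rad p}

/-- The horizon sphere in the initial hypersurface. -/
def initialSphere : Set Pt := {p | p 0 = 0 ∧ rad p = B.rPlus}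

/-- `Δ = r² - 2Mr + a²`. -/
def Del (p : Pt) : ℝ := rad p ^ 2 - 2 * B.M * rad p + B.a ^ 2

/-- `Σ = r² + a² cos² θ`. -/
def Sig (p : Pt) : ℝ := rad p ^ 2 + B.a ^ 2 * cosT p ^ 2

/-! ### The metric

The ingoing Kerr coordinates `(t̄, r, θ, φ̄)` satisfy `dt̄ = dp⁰ + hgt dr` and
`dφ̄ = dφ + twist dr`. The quotients by `Δ` have a factor vanishing identically near the
horizon. -/

/-- `dt̄/dr` at fixed hyperboloidal time. -/
def hgt (p : Pt) : ℝ :=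
  deriv B.f (rad p) + (1 - B.ι (rad p)) * (rad p ^ 2 + B.a ^ 2) / B.Del p + B.ι (rad p)

/-- `dφ̄/dr` at fixed star angle. -/
def twist (p : Pt) : ℝ := (1 - B.ι (rad p)) * B.a / B.Del p

/-- The one-form `dt̄`. -/
def dtIn (p v : Pt) : ℝ := v 0 + B.hgt p * drForm p v

/-- The one-form `sin² θ dφ̄`. -/
def dphiIn (p v : Pt) : ℝ := dphiForm p v + B.twist p * sinT2 p * drForm p v

/-- The symmetric form `dθ² + sin² θ dφ̄²`. -/
def roundForm (p u v : Pt) : ℝ :=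
  (u 1 * v 1 + u 2 * v 2 + u 3 * v 3 - drForm p u * drForm p v) / rad p ^ 2
    + B.twist p * (dphiForm p u * drForm p v + drForm p u * dphiForm p v)
    + B.twist p ^ 2 * sinT2 p * drForm p u * drForm p v

/-- The Kerr metric
`-(1-2Mr/Σ) dt̄² + 2 dt̄ dr + Σ dθ² + ((r²+a²)² - Δ a² sin²θ)/Σ sin²θ dφ̄²`
`- 2a sin²θ dr dφ̄ - (4aMr/Σ) sin²θ dt̄ dφ̄`, where the coefficient of `sin²θ dφ̄²` is written as
`Σ + a² sin²θ (1+2Mr/Σ)`. -/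
def met (p u v : Pt) : ℝ :=
  -(1 - 2 * B.M * rad p / B.Sig p) * (B.dtIn p u * B.dtIn p v)
    + (B.dtIn p u * drForm p v + drForm p u * B.dtIn p v)
    + B.Sig p * B.roundForm p u v
    + B.a ^ 2 * (1 + 2 * B.M * rad p / B.Sig p) * (B.dphiIn p u * B.dphiIn p v)
    - B.a * (drForm p u * B.dphiIn p v + B.dphiIn p u * drForm p v)
    - 2 * B.a * B.M * rad p / B.Sig p
        * (B.dtIn p u * B.dphiIn p v + B.dphiIn p u * B.dtIn p v)

/-- Components of the metric. -/
def gMat (p : Pt) : Matrix (Fin 4) (Fin 4) ℝ :=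
  Matrix.of fun μ ν => B.met p (stdVec μ) (stdVec ν)

/-- Components of the inverse metric. -/
def gInv (p : Pt) : Matrix (Fin 4) (Fin 4) ℝ := (B.gMat p)⁻¹

/-- The derivative `∂_l g_{μν}`. -/
def dMet (p : Pt) (l μ ν : Fin 4) : ℝ := fderiv ℝ (fun q => B.gMat q μ ν) p (stdVec l)

/-- Christoffel symbols `Γ^l_{μν}`. -/
def chr (p : Pt) (l μ ν : Fin 4) : ℝ :=
  ∑ s, B.gInv p l s * (B.dMet p μ s ν + B.dMet p ν s μ - B.dMet p s μ ν) / 2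

/-! ### The algebraically special null frame and its horizontal distribution -/

/-- The ingoing null vector, `((r²+a²)/Δ) ∂_t - ∂_r + (a/Δ) ∂_φ` in Boyer--Lindquist
coordinates, that is, `-∂_r` in ingoing Kerr coordinates. -/
def e3 (p : Pt) : Pt :=
  ![B.hgt p,
    -(p 1 / rad p) - B.twist p * p 2,
    -(p 2 / rad p) + B.twist p * p 1,
    -(p 3 / rad p)]

/-- The angular velocity component of `e4` with respect to the star angle. -/
def e4Ang (p : Pt) : ℝ := 2 * B.a / B.Sig p - B.twist p * B.Del p / B.Sig p

/-- The outgoing null vector, `((r²+a²)/Σ) ∂_t + (Δ/Σ) ∂_r + (a/Σ) ∂_φ` in Boyer--Lindquist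
coordinates. It is regular at the horizon, and `g(e3, e4) = -2`. -/
def e4 (p : Pt) : Pt :=
  ![2 * (rad p ^ 2 + B.a ^ 2) / B.Sig p - B.hgt p * B.Del p / B.Sig p,
    B.Del p / B.Sig p * (p 1 / rad p) - B.e4Ang p * p 2,
    B.Del p / B.Sig p * (p 2 / rad p) + B.e4Ang p * p 1,
    B.Del p / B.Sig p * (p 3 / rad p)]

/-- Components `Π_μ^ν` of the projection to the horizontal distribution, the orthogonal complement
of `e3, e4`. -/
def prj (p : Pt) (μ ν : Fin 4) : ℝ :=
  (if μ = ν then 1 else 0)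
    + (B.met p (B.e3 p) (stdVec μ) * B.e4 p ν + B.met p (B.e4 p) (stdVec μ) * B.e3 p ν) / 2

/-- The inverse of the induced metric on the horizontal distribution. -/
def hInv (p : Pt) (μ ν : Fin 4) : ℝ :=
  B.gInv p μ ν + (B.e3 p μ * B.e4 p ν + B.e4 p μ * B.e3 p ν) / 2

/-- The volume form of the horizontal distribution, positive on `(∂_θ, ∂_φ)`. -/
def vol (p : Pt) (μ ν : Fin 4) : ℝ :=
  Real.sqrt |(B.gMat p).det| *
    (Matrix.of ![stdVec μ, stdVec ν, B.e3 p, B.e4 p]).det / 2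

/-- The horizontal volume form with its second index raised. -/
def volMix (p : Pt) (μ ν : Fin 4) : ℝ := ∑ s, B.vol p μ s * B.hInv p s ν

/-- The horizontal volume form with both indices raised. -/
def volUp (p : Pt) (μ ν : Fin 4) : ℝ :=
  ∑ s, ∑ t, B.hInv p μ s * B.hInv p ν t * B.vol p s t

/-- Projection of all indices of a tensor field to the horizontal distribution. -/
def proj {k : ℕ} (T : Tens k) : Tens k :=
  fun p I => ∑ J : Fin k → Fin 4, (∏ i, (B.prj p (I i) (J i) : ℂ)) * T p J

/-- Spacetime covariant derivative; the new index comes first. Fields are differentiated within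
the region (one-sided derivatives at its boundary). -/
def cov {k : ℕ} (T : Tens k) : Tens (k + 1) := fun p I =>
  fderivWithin ℝ (fun q => T q (Fin.tail I)) B.region p (stdVec (I 0))
    - ∑ i, ∑ l, (B.chr p l (I 0) (Fin.tail I i) : ℂ) *
        T p (Function.update (Fin.tail I) i l)

/-- The horizontal covariant derivative `∇̸`. -/
def nab {k : ℕ} (T : Tens k) : Tens (k + 1) := B.proj (B.cov T)

/-- The projected covariant derivative `∇̸_X`. -/
def nabAlong {k : ℕ} (X : Pt → Pt) (T : Tens k) : Tens k :=
  B.proj fun p I => ∑ μ, (X p μ : ℂ) * B.cov T p (Fin.cons μ I)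

/-- `∇̸_3`. -/
def nab3 {k : ℕ} (T : Tens k) : Tens k := B.nabAlong B.e3 T

/-- `∇̸_4`. -/
def nab4 {k : ℕ} (T : Tens k) : Tens k := B.nabAlong B.e4 T

/-- `∇̸^j`. -/
def nabIter {k : ℕ} : (j : ℕ) → Tens k → Tens (k + j)
  | 0, T => T
  | j + 1, T => B.nab (nabIter j T)

/-- Squared norm of a horizontal tensor field. -/
def normSq {k : ℕ} (T : Tens k) (p : Pt) : ℝ :=
  (∑ I : Fin k → Fin 4, ∑ J : Fin k → Fin 4,
    (∏ i, (B.hInv p (I i) (J i) : ℂ)) * T p I * starRingEnd ℂ (T p J)).re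

/-- Horizontal Hodge dual of a one-form, `*ς_μ = ε_μ^ν ς_ν`. -/
def star (T : Tens 1) : Tens 1 :=
  fun p I => ∑ ν, (B.volMix p (I 0) ν : ℂ) * T p ![ν]

/-- Horizontal divergence of a one-form. -/
def div (T : Tens 1) : Tens 0 :=
  fun p _ => ∑ μ, ∑ ν, (B.hInv p μ ν : ℂ) * B.nab T p ![μ, ν]

/-- Horizontal curl of a one-form, `ε^{μν} ∇̸_μ ς_ν`. -/
def curl (T : Tens 1) : Tens 0 :=
  fun p _ => ∑ μ, ∑ ν, (B.volUp p μ ν : ℂ) * B.nab T p ![μ, ν]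

/-! ### Connection coefficients -/

/-- `tr χ`. -/
def trChi (p : Pt) : ℝ := 2 * rad p * B.Del p / B.Sig p ^ 2

/-- `tr χ̲`. -/
def trUChi (p : Pt) : ℝ := -(2 * rad p) / B.Sig p

/-- `ε̸ · χ`. -/
def epsChi (p : Pt) : ℝ := 2 * B.a * B.Del p * cosT p / B.Sig p ^ 2

/-- `ε̸ · χ̲`. -/
def epsUChi (p : Pt) : ℝ := 2 * B.a * cosT p / B.Sig p

/-- `ω̂`. -/
def omegaHat (p : Pt) : ℝ :=
  -(2 * (B.a ^ 2 * (B.M - rad p) * cosT p ^ 2 + B.a ^ 2 * rad p - B.M * rad p ^ 2))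
    / B.Sig p ^ 2

/-- The action on a tensor field, index by index (as a derivation), of the horizontal 2-tensor with
trace `t`, antitrace `s` and no trace-free symmetric part; `χ` and `χ̲` are of this form. On a
horizontal one-form it is `ς ↦ t/2 ς + s/2 *ς`. -/
def act {k : ℕ} (t s : Pt → ℝ) (T : Tens k) : Tens k := fun p I =>
  ∑ i, ∑ ν, ((t p / 2 * B.prj p (I i) ν + s p / 2 * B.volMix p (I i) ν : ℝ) : ℂ) *
    T p (Function.update I i ν)

/-- `𝔗(ς) = ½ Σ (∇̸_3 ς + χ̲ · ς)`. -/
def frakT {k : ℕ} (T : Tens k) : Tens k :=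
  wt (fun p => B.Sig p / 2) (B.nab3 T + B.act B.trUChi B.epsUChi T)

/-- `𝔗̲(ς) = ½ Σ (∇̸_4 ς + χ · ς + ω̂ ς)`. -/
def frakTU {k : ℕ} (T : Tens k) : Tens k :=
  wt (fun p => B.Sig p / 2) (B.nab4 T + B.act B.trChi B.epsChi T + wt B.omegaHat T)

/-- `𝔗̲` conjugated by the weight `r`: the field `r 𝔗̲(α̲)` as a function of `r α̲`. It agrees with
`𝔗̲(r α̲)` on the horizon. -/
def frakTUr {k : ℕ} (T : Tens k) : Tens k :=
  wt rad (B.frakTU (wt (fun p => (rad p)⁻¹) T))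

/-! ### The modified Maxwell equations -/

/-- `¼ Σ [(tr χ̲)² - (ε̸ · χ̲)²]`. -/
def cA (p : Pt) : ℝ := B.Sig p * (B.trUChi p ^ 2 - B.epsUChi p ^ 2) / 4

/-- `½ Σ (ε̸ · χ̲) (tr χ̲)`. -/
def cB (p : Pt) : ℝ := B.Sig p * (B.epsUChi p * B.trUChi p) / 2

/-- A one-form is horizontal on the region if it vanishes on `e3` and `e4`. -/
def IsHorizontal (T : Tens 1) : Prop :=
  ∀ p ∈ B.region, (∑ μ, (B.e3 p μ : ℂ) * T p ![μ] = 0) ∧ (∑ μ, (B.e4 p μ : ℂ) * T p ![μ] = 0)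

/-- Smoothness of a tensor field on the region, up to the boundary. -/
def IsSmooth {k : ℕ} (T : Tens k) : Prop := ∀ I, ContDiffOn ℝ ∞ (fun p => T p I) B.region

end Background

/-- The unknowns `(α, α̲, ρ̂, σ̂)`. -/
structure MaxwellFields where
  al : Tens 1
  ual : Tens 1
  rho : Tens 0
  sig : Tens 0

namespace MaxwellFields

/-- The stationary (charged) solution with charges `q₁, q₂`. -/
def stationary (q₁ q₂ : ℂ) : MaxwellFields where
  al := 0
  ual := 0
  rho := fun _ _ => q₁
  sig := fun _ _ => q₂

/-- Difference of two sets of fields. -/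
def sub (S S' : MaxwellFields) : MaxwellFields where
  al := S.al - S'.al
  ual := S.ual - S'.ual
  rho := S.rho - S'.rho
  sig := S.sig - S'.sig

/-- All components are real. -/
def IsReal (S : MaxwellFields) : Prop :=
  ∀ p, (∀ I, (S.al p I).im = 0) ∧ (∀ I, (S.ual p I).im = 0) ∧
    (∀ I, (S.rho p I).im = 0) ∧ (∀ I, (S.sig p I).im = 0)

/-- Rotation by the angle `φ` about the axis. -/
def rot (φ : ℝ) (v : Pt) : Pt :=
  ![v 0, Real.cos φ * v 1 - Real.sin φ * v 2, Real.sin φ * v 1 + Real.cos φ * v 2, v 3]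

/-- A one-form is supported on the azimuthal mode `m`: pulling it back by a rotation multiplies it
by `e^{imφ}`, equivalently its Lie derivative along `∂_φ` is `im` times it. -/
def HasMode₁ (m : ℤ) (T : Tens 1) : Prop :=
  ∀ (φ : ℝ) (p v : Pt),
    ∑ μ, (rot φ v μ : ℂ) * T (rot φ p) ![μ]
      = Complex.exp (Complex.I * m * φ) * ∑ μ, (v μ : ℂ) * T p ![μ]

/-- A scalar function is supported on the azimuthal mode `m`. -/
def HasMode₀ (m : ℤ) (T : Tens 0) : Prop :=
  ∀ (φ : ℝ) (p : Pt) (I : Fin 0 → Fin 4),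
    T (rot φ p) I = Complex.exp (Complex.I * m * φ) * T p I

/-- All fields are supported on the azimuthal mode `m`. -/
def HasMode (m : ℤ) (S : MaxwellFields) : Prop :=
  HasMode₁ m S.al ∧ HasMode₁ m S.ual ∧ HasMode₀ m S.rho ∧ HasMode₀ m S.sig

end MaxwellFields

namespace Background

variable (B : Background)

/-- `S` is a smooth solution of the modified Maxwell equations to the future of `Σ_0`. -/
structure IsSolution (S : MaxwellFields) : Prop where
  smooth_al : B.IsSmooth S.al
  smooth_ual : B.IsSmooth S.ual
  smooth_rho : B.IsSmooth S.rho
  smooth_sig : B.IsSmooth S.sig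
  horizontal_al : B.IsHorizontal S.al
  horizontal_ual : B.IsHorizontal S.ual
  nab3_sig : ∀ p ∈ B.region, B.nab3 S.sig p =
    (wt (fun p => B.Sig p * B.cB p) (B.div S.ual)
      - wt (fun p => B.Sig p * B.cA p) (B.curl S.ual)) p
  nab3_rho : ∀ p ∈ B.region, B.nab3 S.rho p =
    (-wt (fun p => B.Sig p * B.cA p) (B.div S.ual)
      - wt (fun p => B.Sig p * B.cB p) (B.curl S.ual)) p
  nab4_sig : ∀ p ∈ B.region, B.nab4 S.sig p =
    (-wt B.cB (B.div (wt B.Sig S.al)) - wt B.cA (B.curl (wt B.Sig S.al))) p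
  nab4_rho : ∀ p ∈ B.region, B.nab4 S.rho p =
    (wt B.cA (B.div (wt B.Sig S.al)) - wt B.cB (B.curl (wt B.Sig S.al))) p
  nab_sig : ∀ p ∈ B.region, B.nab S.sig p =
    (-wt B.cB (B.frakT S.al - B.frakTU S.ual)
      - wt B.cA (B.star (B.frakT S.al) + B.star (B.frakTU S.ual))) p
  nab_rho : ∀ p ∈ B.region, B.nab S.rho p =
    (wt B.cA (B.frakT S.al - B.frakTU S.ual)
      - wt B.cB (B.star (B.frakT S.al) + B.star (B.frakTU S.ual))) p

/-- The seed initial data of a solution: `α` and `α̲` on `Σ_0`, and `ρ̂` and `σ̂` on the horizon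
sphere of `Σ_0` (all set to zero elsewhere). -/
def seed (S : MaxwellFields) : MaxwellFields where
  al := B.initialSlice.indicator S.al
  ual := B.initialSlice.indicator S.ual
  rho := B.initialSphere.indicator S.rho
  sig := B.initialSphere.indicator S.sig

/-! ### Energies

All energies are integrals of nonnegative functions and take values in `[0,∞]`. -/

/-- `∫_{S²_{τ,r}} F dΩ`, with `dΩ = sin θ dθ dφ`. -/
def sphInt (F : Pt → ℝ) (τ r : ℝ) : ℝ≥0∞ :=
  ∫⁻ θ in Set.Ioo 0 Real.pi, ∫⁻ φ in Set.Ioo 0 (2 * Real.pi),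
    ENNReal.ofReal (F (sph τ r θ φ) * Real.sin θ)

/-- `∫_{Σ_τ} F dr dΩ`. -/
def sliceInt (F : Pt → ℝ) (τ : ℝ) : ℝ≥0∞ :=
  ∫⁻ r in Set.Ioi B.rPlus, sphInt F τ r

/-- `(1 - M/r) ∇̸_3`. -/
def degNab3 {k : ℕ} (T : Tens k) : Tens k := wt (fun p => 1 - B.M / rad p) (B.nab3 T)

/-- `((1 - M/r) ∇̸_3)^{j₁} ∇̸_4^{j₂} ∇̸^{j₃}`. -/
def comm {k : ℕ} (j₁ j₂ j₃ : ℕ) (T : Tens k) : Tens (k + j₃) :=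
  B.degNab3^[j₁] (B.nab4^[j₂] (B.nabIter j₃ T))

/-- The triples with `j₁ + j₂ + j₃ ≤ J`. -/
def orders (J : ℕ) : Finset (ℕ × ℕ × ℕ) :=
  (Finset.range (J + 1) ×ˢ Finset.range (J + 1) ×ˢ Finset.range (J + 1)).filter
    fun j => j.1 + j.2.1 + j.2.2 ≤ J

/-- Integrand of the basic energy of `ς = r² α`. -/
def densAl {k : ℕ} (T : Tens k) (p : Pt) : ℝ :=
  B.normSq (B.nab (B.nab T)) p + B.normSq (B.nab (B.nab4 T)) p + B.normSq (B.nab4 (B.nab4 T)) p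
    + rad p ^ 2 * B.normSq (B.nab4 (B.nab3 T)) p
    + B.Del p / rad p ^ 2 * B.normSq (B.nab3 (B.nab3 T)) p
    + rad p ^ 2 * B.normSq (B.nab (B.nab3 T)) p
    + B.normSq (B.nab3 T) p
    + B.normSq (B.nab4 T) p + B.normSq (B.nab T) p + B.normSq T p / rad p ^ 2

/-- Integrand of the basic energy of `ς = r α̲`. -/
def densUAl {k : ℕ} (T : Tens k) (p : Pt) : ℝ :=
  B.Del p / rad p ^ 2 *
      (B.normSq (B.nab (B.nab T)) p
        + (rad p - B.M) ^ 2 / rad p ^ 2 * B.normSq (B.nab3 (B.nab T)) p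
        + (rad p - B.M) ^ 4 / rad p ^ 6 * B.normSq (B.nab3 (B.nab3 T)) p)
    + B.normSq (B.nab4 (B.frakTUr T)) p
    + B.Del p / rad p ^ 4 * B.normSq (B.nab3 (B.frakTUr T)) p
    + B.normSq (B.nab (B.frakTUr T)) p
    + B.normSq (B.frakTUr T) p / rad p ^ 2
    + (rad p - B.M) ^ 2 * B.Del p / rad p ^ 6 * B.normSq (B.nab3 T) p
    + (rad p - B.M) ^ 2 / rad p ^ 2 * (B.normSq (B.nab T) p + B.normSq T p / rad p ^ 2)

/-- Integrand of the first-order energy of the middle components. -/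
def densMid {k : ℕ} (T : Tens k) (p : Pt) : ℝ :=
  B.normSq (B.nab4 T) p + B.Del p / rad p ^ 4 * B.normSq (B.nab3 T) p + B.normSq (B.nab T) p

/-- `𝔼^J[r² α](τ)` for `J ≥ 1`, as a function of `α`. -/
def energyAl (J : ℕ) (α : Tens 1) (τ : ℝ) : ℝ≥0∞ :=
  ∑ j ∈ orders (J - 1),
    B.sliceInt (B.densAl (B.comm j.1 j.2.1 j.2.2 (wt (fun p => rad p ^ 2) α))) τ

/-- `𝔼^J[r α̲](τ)` for `J ≥ 1`, as a function of `α̲`. -/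
def energyUAl (J : ℕ) (ua : Tens 1) (τ : ℝ) : ℝ≥0∞ :=
  ∑ j ∈ orders (J - 1),
    B.sliceInt (B.densUAl (B.comm j.1 j.2.1 j.2.2 (wt rad ua))) τ

/-- `𝔼^J[f](τ)` for a middle component `f`. -/
def energyMid (J : ℕ) (h : Tens 0) (τ : ℝ) : ℝ≥0∞ :=
  (∑ j ∈ orders J, B.sliceInt (B.densMid (B.comm j.1 j.2.1 j.2.2 h)) τ)
    + B.sliceInt (fun p => B.normSq h p / rad p ^ 2) τ

/-- `𝔼_{H⁺}[r² α](τ, ∞)`. -/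
def horizonFlux (α : Tens 1) (τ : ℝ) : ℝ≥0∞ :=
  ∫⁻ t in Set.Ioi τ, sphInt
    (fun p => B.normSq (wt (fun q => rad q ^ 2) α) p
      + B.normSq (B.nab (wt (fun q => rad q ^ 2) α)) p
      + B.normSq (B.nab4 (wt (fun q => rad q ^ 2) α)) p) t B.rPlus

/-- `∫ (|∇̸ ς|² + |ς|²) dΩ` over the horizon sphere at time `τ`. -/
def horizonH1 (T : Tens 1) (τ : ℝ) : ℝ≥0∞ :=
  sphInt (fun p => B.normSq (B.nab T) p + B.normSq T p) τ B.rPlus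

/-- Squared `L²` norm of a scalar function on the horizon sphere at time `τ`. -/
def horizonL2 (h : Tens 0) (τ : ℝ) : ℝ≥0∞ := sphInt (B.normSq h) τ B.rPlus

end Background

/-- An energy quantity of initial data, as a function of the rotation parameter, the order and the
seed initial data. -/
abbrev DataEnergy : Type := ℝ → ℕ → MaxwellFields → ℝ≥0∞

/-- The conjectured degenerate energy boundedness and decay estimates for the extremal components,
at the fixed azimuthal mode `m` and uniformly in `|a| ≤ M`. `Dbdd`, `Ddec` stand for the data
quantities of `r² α`, and `uDbdd`, `uDdec` for those of `r α̲`. -/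
def TeukolskyConjecture (M η : ℝ) (m : ℤ) (ι f : ℝ → ℝ) (Dbdd Ddec uDbdd uDdec : DataEnergy) :
    Prop :=
  ∃ Jmin : ℕ, 1 ≤ Jmin ∧ ∀ J₁, Jmin ≤ J₁ → ∃ J₂ J₃ : ℕ, J₁ ≤ J₂ ∧ J₁ ≤ J₃ ∧ ∃ C : ℝ, 0 < C ∧
    ∀ a : ℝ, |a| ≤ M → ∀ (B : Background), B = ⟨M, a, ι, f⟩ →
    ∀ S : MaxwellFields, B.IsSolution S → (B.seed S).HasMode m → ∀ τ : ℝ, 0 ≤ τ →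
      -- boundedness
      B.energyAl J₁ S.al τ ≤ ENNReal.ofReal C * Dbdd a J₂ (B.seed S) ∧
      B.energyUAl J₁ S.ual τ ≤ ENNReal.ofReal C * uDbdd a J₂ (B.seed S) ∧
      -- decay
      B.energyAl J₁ S.al τ
        ≤ ENNReal.ofReal (C / (1 + τ) ^ (1 - η)) * Ddec a J₃ (B.seed S) ∧
      B.energyUAl J₁ S.ual τ
        ≤ ENNReal.ofReal (C / (1 + τ) ^ (1 - η)) * uDdec a J₃ (B.seed S) ∧
      -- decay at the event horizon
      B.horizonFlux S.al τ
        ≤ ENNReal.ofReal (C / (1 + τ) ^ (2 - η)) * Ddec a J₃ (B.seed S) ∧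
      B.horizonH1 (B.frakT (wt (fun p => rad p ^ 2) S.al)) τ
        ≤ ENNReal.ofReal (C / (1 + τ) ^ (1 - η)) * Ddec a J₃ (B.seed S) ∧
      B.horizonH1 (B.frakTU (wt rad S.ual)) τ
        ≤ ENNReal.ofReal (C / (1 + τ) ^ (1 - η)) * uDdec a J₃ (B.seed S)

end

end Kerr

set_option linter.unusedSimpArgs false

namespace Kerr

open Real (sin cos pi norm_of_nonneg sin_sq_add_cos_sq)
open Complex (I norm_real norm_I I_sq ofReal_neg)
open ENNReal (ofReal ofReal_mul ofReal_le_ofReal ofReal_ne_top ofReal_pow ofReal_add)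
open Finset (sum_congr sum_comm mul_sum sum_mul sum_add_distrib sum_sub_distrib single_le_sum)
open Function (update update_eq_self iterate_succ_apply')
open Matrix (cons_val_zero cons_val_one of_apply det_mul det_succ_row_zero mul_apply)
open Derivation (leibniz leibniz_of_mul_eq_one leibniz_pow)
open Set (Ioo Icc Ioo_subset_Icc_self)

noncomputable section

/-- Kerr backgrounds with admissible parameters. -/
structure Adm where
  B : Background
  hM : 0 < B.M
  ha : |B.a| ≤ B.M
  hι : IsStarCutoff B.M B.ι
  hf : IsHeight B.M B.f

lemma sum_ext {α β : Type*} [AddCommMonoid β] {s : Finset α} {f g : α → β} (h : ∀ i, f i = g i) :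
    ∑ i ∈ s, f i = ∑ i ∈ s, g i := sum_congr rfl fun i _ => h i

namespace Adm

variable (X : Adm)

/-- The exterior in coordinates `(t, r, θ, φ)`, the horizon and the axis excluded. -/
def dom : Set Pt := {q | 0 ≤ q 0 ∧ X.B.rPlus < q 1 ∧ 0 < q 2 ∧ q 2 < pi}

def domI : Set Pt := {q | 0 < q 0 ∧ X.B.rPlus < q 1 ∧ 0 < q 2 ∧ q 2 < pi}

lemma isOpen_domI : IsOpen X.domI := by
  have h : ∀ i : Fin 4, Continuous fun q : Pt => q i := fun i => continuous_apply i
  refine (isOpen_lt continuous_const (h 0)).inter ((isOpen_lt continuous_const (h 1)).inter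
    ((isOpen_lt continuous_const (h 2)).inter (isOpen_lt (h 2) continuous_const)))

lemma domI_subset_dom : X.domI ⊆ X.dom := fun _ h => ⟨h.1.le, h.2⟩

lemma convex_dom : Convex ℝ X.dom := by
  intro p hp q hq s t hs ht hst
  obtain ⟨p0, p1, p2, p3⟩ := hp
  obtain ⟨q0, q1, q2, q3⟩ := hq
  have key : ∀ x y : ℝ, 0 < x → 0 < y → 0 < s * x + t * y := by
    intro x y hx hy; rcases hs.eq_or_lt with h | h
    · have : t = 1 := by linarith
      subst this; rw [← h]; linarith
    · have := mul_pos h hx; have := mul_nonneg ht hy.le; linarith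
  have e : s = 1 - t := by linarith
  refine ⟨?_, ?_, ?_, ?_⟩ <;> simp only [Pi.add_apply, Pi.smul_apply, smul_eq_mul]
  · positivity
  · have := key _ _ (sub_pos.2 p1) (sub_pos.2 q1); subst e; linarith
  · exact key _ _ p2 q2
  · have := key _ _ (sub_pos.2 p3) (sub_pos.2 q3); subst e; linarith

lemma domI_nonempty : X.domI.Nonempty := by
  refine ⟨![1, X.B.rPlus + 1, pi / 2, 0], ?_⟩
  have := Real.pi_pos
  simp [domI, this]

lemma interior_dom_nonempty : (interior X.dom).Nonempty :=
  X.domI_nonempty.mono (interior_maximal X.domI_subset_dom X.isOpen_domI)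

lemma uniqueDiffOn_dom : UniqueDiffOn ℝ X.dom := uniqueDiffOn_convex X.convex_dom X.interior_dom_nonempty

lemma dom_subset_closure : X.dom ⊆ closure (interior X.dom) := by
  rw [X.convex_dom.closure_interior_eq_closure_of_nonempty_interior X.interior_dom_nonempty]
  exact subset_closure

lemma rPlus_ge : X.B.M ≤ X.B.rPlus := by
  have := Real.sqrt_nonneg (X.B.M ^ 2 - X.B.a ^ 2)
  unfold Background.rPlus; linarith

lemma rPlus_pos : 0 < X.B.rPlus := X.hM.trans_le X.rPlus_ge

lemma beta_nonneg : 0 ≤ X.B.M ^ 2 - X.B.a ^ 2 := by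
  have := sq_le_sq' (abs_le.1 X.ha).1 (abs_le.1 X.ha).2
  linarith

/-- Extension by zero of a function on `dom`. -/
def ext (u : X.dom → ℂ) : Pt → ℂ := Function.extend Subtype.val u 0

lemma ext_apply (u : X.dom → ℂ) (q : X.dom) : X.ext u q = u q := Subtype.val_injective.extend_apply _ _ _

lemma ext_eqOn (F : Pt → ℂ) : Set.EqOn (X.ext fun q => F q) F X.dom := fun q hq => X.ext_apply _ ⟨q, hq⟩

/-- The algebra of smooth complex functions on `dom`. -/
def smoothSub : Subalgebra ℂ (X.dom → ℂ) where
  carrier := {u | ContDiffOn ℝ ∞ (X.ext u) X.dom}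
  mul_mem' {u v} hu hv := by
    refine (ContDiffOn.mul hu hv).congr fun q hq => ?_; lift q to X.dom using hq; simp [ext_apply]
  add_mem' {u v} hu hv := by
    refine (ContDiffOn.add hu hv).congr fun q hq => ?_; lift q to X.dom using hq; simp [ext_apply]
  algebraMap_mem' c := by
    refine (contDiffOn_const (c := c)).congr fun q hq => ?_; lift q to X.dom using hq; simp [ext_apply]

/-- The ring of smooth complex functions on `dom`, as a type. -/
def Sm : Type := X.smoothSub

instance : CommRing X.Sm := inferInstanceAs (CommRing X.smoothSub)
instance : Algebra ℂ X.Sm := inferInstanceAs (Algebra ℂ X.smoothSub)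

/-- The element of `Sm` given by a function smooth on `dom`. -/
def sm (F : Pt → ℂ) (hF : ContDiffOn ℝ ∞ F X.dom) : X.Sm := ⟨fun q => F q, hF.congr (X.ext_eqOn F)⟩

@[simp] lemma sm_apply (F : Pt → ℂ) (hF : ContDiffOn ℝ ∞ F X.dom) (q : X.dom) :
    (X.sm F hF).1 q = F q := rfl

variable {X}

@[simp] lemma add_ap (u v : X.Sm) (q : X.dom) : (u + v).1 q = u.1 q + v.1 q := rfl
@[simp] lemma sub_ap (u v : X.Sm) (q : X.dom) : (u - v).1 q = u.1 q - v.1 q := rfl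
@[simp] lemma neg_ap (u : X.Sm) (q : X.dom) : (-u).1 q = -u.1 q := rfl
@[simp] lemma mul_ap (u v : X.Sm) (q : X.dom) : (u * v).1 q = u.1 q * v.1 q := rfl
@[simp] lemma smul_ap (c : ℂ) (u : X.Sm) (q : X.dom) : (c • u).1 q = c * u.1 q := rfl
@[simp] lemma zero_ap (q : X.dom) : (0 : X.Sm).1 q = 0 := rfl
@[simp] lemma one_ap (q : X.dom) : (1 : X.Sm).1 q = 1 := rfl
@[simp] lemma pow_ap (u : X.Sm) (n : ℕ) (q : X.dom) : (u ^ n).1 q = u.1 q ^ n := rfl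
@[simp] lemma algebraMap_ap (c : ℂ) (q : X.dom) : (algebraMap ℂ X.Sm c).1 q = c := rfl
@[simp] lemma natCast_ap (n : ℕ) (q : X.dom) : ((n : X.Sm)).1 q = n := rfl
@[simp] lemma intCast_ap (n : ℤ) (q : X.dom) : ((n : X.Sm)).1 q = n := rfl
@[simp] lemma ofNat_ap (n : ℕ) [n.AtLeastTwo] (q : X.dom) :
    (ofNat(n) : X.Sm).1 q = ofNat(n) := rfl

@[simp] lemma sum_ap {α : Type*} (s : Finset α) (u : α → X.Sm) (q : X.dom) :
    (∑ i ∈ s, u i).1 q = ∑ i ∈ s, (u i).1 q := by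
  induction s using Finset.cons_induction with
  | empty => simp
  | cons i s hi ih => rw [Finset.sum_cons, Finset.sum_cons, add_ap, ih]

@[simp] lemma prod_ap {α : Type*} (s : Finset α) (u : α → X.Sm) (q : X.dom) :
    (∏ i ∈ s, u i).1 q = ∏ i ∈ s, (u i).1 q := by
  induction s using Finset.cons_induction with
  | empty => simp
  | cons i s hi ih => rw [Finset.prod_cons, Finset.prod_cons, mul_ap, ih]

@[ext] lemma hext {u v : X.Sm} (h : ∀ q, u.1 q = v.1 q) : u = v := Subtype.ext (funext h)

lemma contDiffOn_ext (u : X.Sm) : ContDiffOn ℝ ∞ (X.ext u.1) X.dom := u.2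

lemma differentiableWithinAt_ext (u : X.Sm) (q : X.dom) : DifferentiableWithinAt ℝ (X.ext u.1) X.dom q :=
  (contDiffOn_ext u).differentiableOn (by simp) q q.2

/-- Directional derivative, as a function on `dom`. -/
def pdFun (v : Pt) (u : X.Sm) : Pt → ℂ := fun q => fderivWithin ℝ (X.ext u.1) X.dom q v

lemma contDiffOn_pdFun (v : Pt) (u : X.Sm) : ContDiffOn ℝ ∞ (pdFun v u) X.dom :=
  ((contDiffOn_ext u).fderivWithin X.uniqueDiffOn_dom (by simp)).clm_apply contDiffOn_const

/-- The coordinate derivations of `Sm`. -/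
def pd (i : Fin 4) : Derivation ℂ X.Sm X.Sm := Derivation.mk'
    { toFun := fun u => X.sm (pdFun (stdVec i) u) (contDiffOn_pdFun _ u)
      map_add' := fun u v => by
        ext q : 1; have hs := X.uniqueDiffOn_dom q q.2
        have : fderivWithin ℝ (X.ext (u + v).1) X.dom q = fderivWithin ℝ (X.ext u.1 + X.ext v.1) X.dom q := by
          refine fderivWithin_congr (fun p hp => ?_) ?_
          · lift p to X.dom using hp; simp [ext_apply]
          · simp [ext_apply]
        simp only [sm_apply, add_ap, pdFun, this]
        rw [fderivWithin_add hs (differentiableWithinAt_ext u q) (differentiableWithinAt_ext v q)]; rfl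
      map_smul' := fun c u => by
        ext q : 1; have hs := X.uniqueDiffOn_dom q q.2
        have : fderivWithin ℝ (X.ext (c • u).1) X.dom q = fderivWithin ℝ (c • X.ext u.1) X.dom q := by
          refine fderivWithin_congr (fun p hp => ?_) ?_
          · lift p to X.dom using hp; simp [ext_apply]
          · simp [ext_apply]
        simp only [sm_apply, smul_ap, pdFun, this, RingHom.id_apply]
        rw [fderivWithin_const_smul hs (differentiableWithinAt_ext u q) c]; rfl }
    fun u v => by
      ext q : 1; have hs := X.uniqueDiffOn_dom q q.2
      have : fderivWithin ℝ (X.ext (u * v).1) X.dom q = fderivWithin ℝ (X.ext u.1 * X.ext v.1) X.dom q := by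
        refine fderivWithin_congr (fun p hp => ?_) ?_
        · lift p to X.dom using hp; simp [ext_apply]
        · simp [ext_apply]
      simp only [LinearMap.coe_mk, AddHom.coe_mk, sm_apply, smul_eq_mul, add_ap, mul_ap, pdFun, this]
      rw [fderivWithin_mul hs (differentiableWithinAt_ext u q) (differentiableWithinAt_ext v q)]; simp [ext_apply]

lemma pd_ap (i : Fin 4) (u : X.Sm) (q : X.dom) : (pd i u).1 q = fderivWithin ℝ (X.ext u.1) X.dom q (stdVec i) := rfl

lemma pd_sm (i : Fin 4) (F : Pt → ℂ) (hF) (q : X.dom) : (pd i (X.sm F hF)).1 q = fderivWithin ℝ F X.dom q (stdVec i) := by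
  have := fderivWithin_congr (𝕜 := ℝ) (X.ext_eqOn F) (X.ext_eqOn F q.2)
  exact congrArg (fun L => L (stdVec i)) this

lemma pd_sm_of_hasFDerivAt (i : Fin 4) {F : Pt → ℂ} {hF} {q : X.dom} {F' : Pt →L[ℝ] ℂ}
    (h : HasFDerivAt F F' q) : (pd i (X.sm F hF)).1 q = F' (stdVec i) := by
  rw [pd_sm, h.hasFDerivWithinAt.fderivWithin (X.uniqueDiffOn_dom q q.2)]

lemma two_le_smooth : (1 + 1 : WithTop ℕ∞) ≤ ((⊤ : ℕ∞) : WithTop ℕ∞) := by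
  have : ((2 : ℕ∞) : WithTop ℕ∞) ≤ ((⊤ : ℕ∞) : WithTop ℕ∞) := by exact_mod_cast le_top
  simpa [one_add_one_eq_two] using this

lemma pd_comm (i j : Fin 4) (u : X.Sm) : pd i (pd j u) = pd j (pd i u) := by
  ext q : 1
  have hs := X.uniqueDiffOn_dom
  have hc := contDiffOn_ext u
  have hd : DifferentiableWithinAt ℝ (fderivWithin ℝ (X.ext u.1) X.dom) X.dom q :=
    (hc.fderivWithin (m := 1) hs two_le_smooth).differentiableOn (by simp) q q.2
  have key : ∀ i j : Fin 4, (pd i (pd j u)).1 q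
      = fderivWithin ℝ (fderivWithin ℝ (X.ext u.1) X.dom) X.dom q (stdVec i) (stdVec j) := by
    intro i j; have : pd j u = X.sm (pdFun (stdVec j) u) (contDiffOn_pdFun _ u) := rfl; rw [this, pd_sm]; unfold pdFun
    rw [fderivWithin_clm_apply (hs q q.2) hd (differentiableWithinAt_const _)]; simp
  rw [key, key]
  have hsym := (hc q q.2).isSymmSndFDerivWithinAt (by simpa [one_add_one_eq_two] using two_le_smooth) hs
    (X.dom_subset_closure q.2) q.2
  exact hsym.eq _ _

section coords

variable (X)

lemma _root_.ContDiffOn.ofReal_comp {F : Pt → ℝ} {s : Set Pt} (h : ContDiffOn ℝ ∞ F s) :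
    ContDiffOn ℝ ∞ (fun q => (F q : ℂ)) s :=
  Complex.ofRealCLM.contDiff.comp_contDiffOn h

lemma r_pos (q : X.dom) : 0 < q.1 1 := X.rPlus_pos.trans q.2.2.1
lemma r_gt (q : X.dom) : X.B.M < q.1 1 := X.rPlus_ge.trans_lt q.2.2.1
lemma sin_pos (q : X.dom) : 0 < sin (q.1 2) := Real.sin_pos_of_pos_of_lt_pi q.2.2.2.1 q.2.2.2.2

lemma contDiff_coord (i : Fin 4) : ContDiff ℝ ∞ fun q : Pt => q i :=
  (ContinuousLinearMap.proj (R := ℝ) (φ := fun _ : Fin 4 => ℝ) i).contDiff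

lemma z_ne (q : X.dom) (ε : ℝ) : ((q.1 1 : ℝ) : ℂ) + I * ε * X.B.a * (cos (q.1 2) : ℝ) ≠ 0 := by
  intro h
  have := congrArg Complex.re h
  simp at this
  exact (X.r_pos q).ne' this

/-- A function of one coordinate. -/
def coordFun (j : Fin 4) (G : ℝ → ℝ) (hG : ContDiffOn ℝ ∞ (fun q : Pt => G (q j)) X.dom) : X.Sm :=
  X.sm (fun q => (G (q j) : ℂ)) hG.ofReal_comp

lemma pd_coordFun (i j : Fin 4) (G : ℝ → ℝ) (hG) (q : X.dom) {G' : ℝ} (h : HasDerivAt G G' (q.1 j)) :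
    (pd i (X.coordFun j G hG)).1 q = if i = j then (G' : ℂ) else 0 := by
  have h1 : HasFDerivAt (fun q : Pt => (G (q j) : ℂ)) (Complex.ofRealCLM.comp (G' • (ContinuousLinearMap.proj (R := ℝ)
        (φ := fun _ : Fin 4 => ℝ) j))) q.1 :=
    Complex.ofRealCLM.hasFDerivAt.comp q.1 (h.comp_hasFDerivAt q.1 (ContinuousLinearMap.proj (R := ℝ)
        (φ := fun _ : Fin 4 => ℝ) j).hasFDerivAt)
  rw [coordFun, pd_sm_of_hasFDerivAt i h1]
  rcases eq_or_ne i j with rfl | hij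
  · simp [stdVec]
  · simp [stdVec, hij, hij.symm]

def rS : X.Sm := X.coordFun 1 id ((contDiff_coord 1).contDiffOn)
/-- The cosine of the polar angle. -/
def cS : X.Sm := X.coordFun 2 cos ((Real.contDiff_cos.comp (contDiff_coord 2)).contDiffOn)
def sS : X.Sm := X.coordFun 2 sin ((Real.contDiff_sin.comp (contDiff_coord 2)).contDiffOn)
/-- The inverse radius. -/
def riS : X.Sm := X.coordFun 1 (fun r => r⁻¹) ((contDiff_coord 1).contDiffOn.inv fun q hq => (X.r_pos ⟨q, hq⟩).ne')
def siS : X.Sm := X.coordFun 2 (fun x => (sin x)⁻¹) ((Real.contDiff_sin.comp (contDiff_coord 2)).contDiffOn.inv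
    fun q hq => (X.sin_pos ⟨q, hq⟩).ne')
/-- The inverse of `r + i ε a cos θ`. -/
def zeS (ε : ℝ) : X.Sm := X.sm (fun q => (((q 1 : ℝ) : ℂ) + I * ε * X.B.a * (cos (q 2) : ℝ))⁻¹)
  (((contDiff_coord 1).contDiffOn.ofReal_comp.add (contDiffOn_const.mul
    (Real.contDiff_cos.comp (contDiff_coord 2)).contDiffOn.ofReal_comp)).inv
    fun q hq => X.z_ne ⟨q, hq⟩ ε)
/-- The factor `1/Σ`. -/
notation:max "ζ(" X ")" => Adm.zeS X 1 * Adm.zeS X (-1)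

@[simp] lemma rS_ap (q : X.dom) : X.rS.1 q = (q.1 1 : ℝ) := rfl
@[simp] lemma cS_ap (q : X.dom) : X.cS.1 q = (cos (q.1 2) : ℝ) := rfl
@[simp] lemma sS_ap (q : X.dom) : X.sS.1 q = (sin (q.1 2) : ℝ) := rfl
@[simp] lemma riS_ap (q : X.dom) : X.riS.1 q = ((q.1 1 : ℝ) : ℂ)⁻¹ := by simp [riS, coordFun]
@[simp] lemma siS_ap (q : X.dom) : X.siS.1 q = ((sin (q.1 2) : ℝ) : ℂ)⁻¹ := by simp [siS, coordFun]
lemma zeS_ap (ε : ℝ) (q : X.dom) : (X.zeS ε).1 q = (((q.1 1 : ℝ) : ℂ) + I * ε * X.B.a * (cos (q.1 2) : ℝ))⁻¹ := rfl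

abbrev kS (c : ℂ) : X.Sm := algebraMap ℂ X.Sm c

lemma pd_rS (i : Fin 4) : pd i X.rS = if i = 1 then 1 else 0 := by
  ext q : 1
  rw [rS, X.pd_coordFun i 1 id _ q (hasDerivAt_id _)]
  split_ifs <;> simp

lemma pd_cS (i : Fin 4) : pd i X.cS = if i = 2 then -X.sS else 0 := by
  ext q : 1
  rw [cS, X.pd_coordFun i 2 _ _ q (Real.hasDerivAt_cos _)]
  split_ifs <;> simp

lemma pd_sS (i : Fin 4) : pd i X.sS = if i = 2 then X.cS else 0 := by
  ext q : 1
  rw [sS, X.pd_coordFun i 2 _ _ q (Real.hasDerivAt_sin _)]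
  split_ifs <;> simp

lemma riS_mul : X.riS * X.rS = 1 := by
  ext q : 1
  have : ((q.1 1 : ℝ) : ℂ) ≠ 0 := by exact_mod_cast (X.r_pos q).ne'
  simp [this]

lemma siS_mul : X.siS * X.sS = 1 := by
  ext q : 1
  have : ((sin (q.1 2) : ℝ) : ℂ) ≠ 0 := by exact_mod_cast (X.sin_pos q).ne'
  simp only [mul_ap, siS_ap, sS_ap, one_ap]
  exact inv_mul_cancel₀ this

lemma zeS_mul (ε : ℝ) : X.zeS ε * (X.rS + X.kS (I * ε * X.B.a) * X.cS) = 1 := by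
  ext q : 1
  simp only [mul_ap, zeS_ap, add_ap, rS_ap, cS_ap, algebraMap_ap, one_ap]
  exact inv_mul_cancel₀ (X.z_ne q ε)

lemma pd_riS (i : Fin 4) : pd i X.riS = if i = 1 then -X.riS ^ 2 else 0 := by
  rw [leibniz_of_mul_eq_one _ X.riS_mul, pd_rS]
  split_ifs <;> simp

lemma pd_siS (i : Fin 4) : pd i X.siS = if i = 2 then -X.siS ^ 2 * X.cS else 0 := by
  rw [leibniz_of_mul_eq_one _ X.siS_mul, pd_sS]
  split_ifs <;> simp

lemma pd_kS (i : Fin 4) (c : ℂ) : pd i (X.kS c) = 0 := Derivation.map_algebraMap _ _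

lemma pd_zeS (i : Fin 4) (ε : ℝ) : pd i (X.zeS ε) = if i = 1 then -X.zeS ε ^ 2 else
    if i = 2 then X.kS (I * ε * X.B.a) * X.sS * X.zeS ε ^ 2 else 0 := by
  rw [leibniz_of_mul_eq_one _ (X.zeS_mul ε), map_add, leibniz, pd_rS, pd_cS, pd_kS]
  fin_cases i <;> simp
  ring

def delS : X.Sm := 1 - X.kS X.B.M * X.riS
/-- `M² - a²`. -/
def betaS : X.Sm := X.kS (X.B.M ^ 2 - X.B.a ^ 2)
def DelS : X.Sm := X.rS ^ 2 - 2 * X.kS X.B.M * X.rS + X.kS X.B.a ^ 2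

lemma del_pos (q : X.dom) : 0 < 1 - X.B.M / q.1 1 := by rw [sub_pos, div_lt_one (X.r_pos q)]; exact X.r_gt q

def kapS : X.Sm := X.coordFun 1 (fun r => (X.B.M ^ 2 - X.B.a ^ 2) / (1 - X.B.M / r))
  (contDiffOn_const.div (contDiffOn_const.sub (contDiffOn_const.div (contDiff_coord 1).contDiffOn
    fun q hq => (X.r_pos ⟨q, hq⟩).ne')) fun q hq => (X.del_pos ⟨q, hq⟩).ne')

@[simp] lemma delS_ap (q : X.dom) : X.delS.1 q = 1 - (X.B.M : ℂ) * ((q.1 1 : ℝ) : ℂ)⁻¹ := by simp [delS]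
@[simp] lemma DelS_ap (q : X.dom) : X.DelS.1 q =
    ((q.1 1 : ℝ) : ℂ) ^ 2 - 2 * (X.B.M : ℂ) * ((q.1 1 : ℝ) : ℂ) + (X.B.a : ℂ) ^ 2 := by
  simp [DelS]
@[simp] lemma kapS_ap (q : X.dom) : X.kapS.1 q =
    ((X.B.M : ℂ) ^ 2 - (X.B.a : ℂ) ^ 2) / (1 - (X.B.M : ℂ) / ((q.1 1 : ℝ) : ℂ)) := by
  simp [kapS, coordFun]

lemma r_ne (q : X.dom) : ((q.1 1 : ℝ) : ℂ) ≠ 0 := by exact_mod_cast (X.r_pos q).ne'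
lemma s_ne (q : X.dom) : ((sin (q.1 2) : ℝ) : ℂ) ≠ 0 := by exact_mod_cast (X.sin_pos q).ne'
lemma sq_c (x : ℝ) : ((sin x : ℝ) : ℂ) ^ 2 + ((cos x : ℝ) : ℂ) ^ 2 = 1 := by exact_mod_cast sin_sq_add_cos_sq x

@[simp] lemma betaS_ap (q : X.dom) : X.betaS.1 q = (X.B.M : ℂ) ^ 2 - (X.B.a : ℂ) ^ 2 := rfl

lemma kapS_mul : X.kapS * X.delS = X.betaS := by
  ext q : 1
  have h : (1 - (X.B.M : ℂ) / ((q.1 1 : ℝ) : ℂ)) ≠ 0 := by exact_mod_cast (X.del_pos q).ne'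
  simp only [mul_ap, kapS_ap, delS_ap, betaS_ap, ← div_eq_mul_inv]
  field_simp

lemma pd_delS (i : Fin 4) : pd i X.delS = if i = 1 then X.kS X.B.M * X.riS ^ 2 else 0 := by
  rw [delS, map_sub, leibniz, pd_kS, pd_riS]
  split_ifs
  · simp only [Derivation.map_one_eq_zero, smul_eq_mul]; ring
  · simp

lemma pd_DelS (i : Fin 4) : pd i X.DelS = if i = 1 then 2 * (X.rS - X.kS X.B.M) else 0 := by
  have : X.DelS = X.rS * X.rS - X.kS (2 * X.B.M) * X.rS + X.kS (X.B.a ^ 2) := by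
    ext q : 1; simp; ring
  rw [this, map_add, map_sub, leibniz, leibniz, pd_kS, pd_kS, pd_rS]
  split_ifs
  · ext q : 1; simp; ring
  · simp

/-- `dt̄/dr` at fixed hyperboloidal time, as a function of the radius. -/
def hgtFun (r : ℝ) : ℝ := deriv X.B.f r + (1 - X.B.ι r) * (r ^ 2 + X.B.a ^ 2) / (r ^ 2 - 2 * X.B.M * r + X.B.a ^ 2) + X.B.ι r
/-- `dφ̄/dr` at fixed star angle, as a function of the radius. -/
def twistFun (r : ℝ) : ℝ := (1 - X.B.ι r) * X.B.a / (r ^ 2 - 2 * X.B.M * r + X.B.a ^ 2)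

lemma Del_pos {r : ℝ} (h : X.B.rPlus < r) : 0 < r ^ 2 - 2 * X.B.M * r + X.B.a ^ 2 := by
  have h1 : Real.sqrt (X.B.M ^ 2 - X.B.a ^ 2) < r - X.B.M := by unfold Background.rPlus at h; linarith
  have h2 := Real.sq_sqrt X.beta_nonneg
  nlinarith [Real.sqrt_nonneg (X.B.M ^ 2 - X.B.a ^ 2)]

lemma contDiff_deriv_f : ContDiff ℝ ∞ (deriv X.B.f) := (contDiff_infty_iff_deriv.1 X.hf.1).2

lemma contDiffAt_hgtFun {r : ℝ} (h : X.B.rPlus < r) : ContDiffAt ℝ ∞ X.hgtFun r := by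
  unfold hgtFun
  have h1 := X.contDiff_deriv_f.contDiffAt (x := r)
  have h2 := X.hι.1.contDiffAt (x := r)
  exact (h1.add (((contDiffAt_const.sub h2).mul (by fun_prop)).div (by fun_prop) (X.Del_pos h).ne')).add h2

lemma contDiffAt_twistFun {r : ℝ} (h : X.B.rPlus < r) : ContDiffAt ℝ ∞ X.twistFun r := by
  unfold twistFun
  have h2 := X.hι.1.contDiffAt (x := r)
  exact ((contDiffAt_const.sub h2).mul contDiffAt_const).div (by fun_prop) (X.Del_pos h).ne'

lemma contDiffOn_hgtFun : ContDiffOn ℝ ∞ (fun q : Pt => X.hgtFun (q 1)) X.dom := fun q hq =>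
  (ContDiffAt.comp (f := fun q : Pt => q 1) q (X.contDiffAt_hgtFun hq.2.1) (contDiff_coord 1).contDiffAt).contDiffWithinAt

lemma contDiffOn_twistFun : ContDiffOn ℝ ∞ (fun q : Pt => X.twistFun (q 1)) X.dom := fun q hq =>
  (ContDiffAt.comp (f := fun q : Pt => q 1) q (X.contDiffAt_twistFun hq.2.1) (contDiff_coord 1).contDiffAt).contDiffWithinAt

def hS : X.Sm := X.coordFun 1 X.hgtFun X.contDiffOn_hgtFun
/-- The function `twist` on `dom`. -/
def wS : X.Sm := X.coordFun 1 X.twistFun X.contDiffOn_twistFun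

@[simp] lemma hS_ap (q : X.dom) : X.hS.1 q = (X.hgtFun (q.1 1) : ℝ) := rfl
@[simp] lemma wS_ap (q : X.dom) : X.wS.1 q = (X.twistFun (q.1 1) : ℝ) := rfl

lemma pd_hS (i : Fin 4) (hi : i ≠ 1) : pd i X.hS = 0 := by
  ext q : 1
  rw [hS, X.pd_coordFun i 1 _ _ q ((X.contDiffAt_hgtFun q.2.2.1).differentiableAt (by simp)).hasDerivAt, if_neg hi]
  rfl

lemma pd_wS (i : Fin 4) (hi : i ≠ 1) : pd i X.wS = 0 := by
  ext q : 1
  rw [wS, X.pd_coordFun i 1 _ _ q ((X.contDiffAt_twistFun q.2.2.1).differentiableAt (by simp)).hasDerivAt, if_neg hi]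
  rfl

/-- `∂_r` in ingoing Kerr coordinates. -/
def dP : Derivation ℂ X.Sm X.Sm := pd 1 - X.hS • pd 0 - X.wS • pd 3

lemma dP_apply (u : X.Sm) : X.dP u = pd 1 u - X.hS * pd 0 u - X.wS * pd 3 u := rfl

lemma pd_dP (i : Fin 4) (hi : i ≠ 1) (u : X.Sm) : pd i (X.dP u) = X.dP (pd i u) := by
  simp only [dP_apply, map_sub, leibniz, X.pd_hS i hi, X.pd_wS i hi, smul_eq_mul, mul_zero, add_zero, pd_comm i]

lemma dP_pd0 (u : X.Sm) : X.dP (pd 0 u) = pd 0 (X.dP u) := (X.pd_dP 0 (by decide) u).symm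
lemma pd2_dP (u : X.Sm) : pd 2 (X.dP u) = X.dP (pd 2 u) := X.pd_dP 2 (by decide) u
lemma pd3_dP (u : X.Sm) : pd 3 (X.dP u) = X.dP (pd 3 u) := X.pd_dP 3 (by decide) u
lemma pd2_pd0 (u : X.Sm) : pd 2 (pd 0 u) = pd 0 (pd 2 u) := pd_comm 2 0 u
lemma pd3_pd0 (u : X.Sm) : pd 3 (pd 0 u) = pd 0 (pd 3 u) := pd_comm 3 0 u
lemma pd3_pd2 (u : X.Sm) : pd 3 (pd 2 u) = pd 2 (pd 3 u) := pd_comm 3 2 u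

lemma dP_rS : X.dP X.rS = 1 := by simp [dP_apply, pd_rS]
lemma dP_cS : X.dP X.cS = 0 := by simp [dP_apply, pd_cS]
lemma dP_sS : X.dP X.sS = 0 := by simp [dP_apply, pd_sS]
lemma dP_siS : X.dP X.siS = 0 := by simp [dP_apply, pd_siS]
lemma dP_riS : X.dP X.riS = -X.riS ^ 2 := by simp [dP_apply, pd_riS]
lemma dP_zeS (ε : ℝ) : X.dP (X.zeS ε) = -X.zeS ε ^ 2 := by simp [dP_apply, pd_zeS]
lemma dP_delS : X.dP X.delS = X.kS X.B.M * X.riS ^ 2 := by simp [dP_apply, pd_delS]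
lemma dP_DelS : X.dP X.DelS = 2 * (X.rS - X.kS X.B.M) := by simp [dP_apply, pd_DelS]

lemma D_kapS (D : Derivation ℂ X.Sm X.Sm) (q : X.dom) :
    (D X.kapS).1 q = -X.kapS.1 q / (1 - (X.B.M : ℂ) / ((q.1 1 : ℝ) : ℂ)) * (D X.delS).1 q := by
  have h : (1 - (X.B.M : ℂ) / ((q.1 1 : ℝ) : ℂ)) ≠ 0 := by exact_mod_cast (X.del_pos q).ne'
  have h1 := congrArg (fun u => (D u).1 q) X.kapS_mul
  simp only [betaS, leibniz, Derivation.map_algebraMap, smul_eq_mul, add_ap, mul_ap,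
    zero_ap, delS_ap, ← div_eq_mul_inv] at h1
  field_simp
  linear_combination h1

/-- The constant `i a`. -/
def AS : X.Sm := X.kS (I * X.B.a)
/-- The constant `i`. -/
def iS : X.Sm := X.kS I

@[simp] lemma AS_ap (q : X.dom) : X.AS.1 q = I * X.B.a := rfl
@[simp] lemma iS_ap (q : X.dom) : X.iS.1 q = I := rfl
lemma D_AS (D : Derivation ℂ X.Sm X.Sm) : D X.AS = 0 := Derivation.map_algebraMap _ _
lemma D_iS (D : Derivation ℂ X.Sm X.Sm) : D X.iS = 0 := Derivation.map_algebraMap _ _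
lemma D_kS (D : Derivation ℂ X.Sm X.Sm) (c : ℂ) : D (X.kS c) = 0 := Derivation.map_algebraMap _ _
lemma D_ofNat (D : Derivation ℂ X.Sm X.Sm) (n : ℕ) [n.AtLeastTwo] : D (ofNat(n) : X.Sm) = 0 := D.map_natCast n
lemma zp_ap (q : X.dom) : (X.zeS 1).1 q = (((q.1 1 : ℝ) : ℂ) + I * X.B.a * (cos (q.1 2) : ℝ))⁻¹ := by simp [zeS_ap]
lemma zm_ap (q : X.dom) : (X.zeS (-1)).1 q = (((q.1 1 : ℝ) : ℂ) - I * X.B.a * (cos (q.1 2) : ℝ))⁻¹ := by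
  simp [zeS_ap, sub_eq_add_neg]
lemma zp_ne (q : X.dom) : ((q.1 1 : ℝ) : ℂ) + I * X.B.a * (cos (q.1 2) : ℝ) ≠ 0 := by simpa using X.z_ne q 1
lemma zm_ne (q : X.dom) : ((q.1 1 : ℝ) : ℂ) - I * X.B.a * (cos (q.1 2) : ℝ) ≠ 0 := by
  simpa [sub_eq_add_neg] using X.z_ne q (-1)
lemma pd_zp (i : Fin 4) : pd i (X.zeS 1) = if i = 1 then -X.zeS 1 ^ 2 else
    if i = 2 then X.AS * X.sS * X.zeS 1 ^ 2 else 0 := by simp [pd_zeS, AS]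
lemma pd_zm (i : Fin 4) : pd i (X.zeS (-1)) = if i = 1 then -X.zeS (-1) ^ 2 else
    if i = 2 then -(X.AS * X.sS * X.zeS (-1) ^ 2) else 0 := by
  simp [pd_zeS, AS]

/-- `e₄` on functions. -/
def e4op (u : X.Sm) : X.Sm := X.zeS 1 * X.zeS (-1) *
  (2 * (X.rS ^ 2 - X.AS ^ 2 * (X.sS ^ 2 + X.cS ^ 2)) * pd 0 u + X.DelS * X.dP u - 2 * X.AS * X.iS * pd 3 u)

/-- Minus the connection coefficient of the horizontal frame along `e₄`. -/
def gamS : X.Sm := 2 * X.AS * X.cS * X.DelS * X.zeS 1 ^ 2 * X.zeS (-1) ^ 2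

/-- `∇̸₃` on spin-weighted functions. -/
def op3 (u : X.Sm) : X.Sm := -X.dP u

/-- `∂_θ ± i (a sin θ ∂_t + ∂_φ / sin θ)`. -/
def Lop (ε : ℝ) (u : X.Sm) : X.Sm := pd 2 u + X.kS ε * (X.AS * X.sS * pd 0 u + X.iS * X.siS * pd 3 u)

/-- The zeroth-order part of the angular operators. -/
def kpS (ε : ℝ) : X.Sm := -(X.kS ε * (X.cS * X.siS)) + X.AS * X.sS * X.zeS (-ε)

end coords

/-- Derivatives spanning the commutation algebra. -/
inductive Letter
  | d | f | p | m
  deriving DecidableEq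

/-- The spin weight of an operator. -/
def Letter.sp : Letter → ℤ
  | .d => 0
  | .f => 0
  | .p => 1
  | .m => -1

/-- The operators `(1 - M/r) ∇̸₃`, `∇̸₄`, `∇̸_±` on functions of spin weight `s`. -/
def op (X : Adm) : Letter → ℤ → X.Sm → X.Sm
  | .d, _, u => X.delS * X.op3 u
  | .f, s, u => X.e4op u + (s : X.Sm) * X.gamS * u
  | .p, s, u => X.zeS (-1) * (X.Lop 1 u + (s : X.Sm) * X.kpS 1 * u)
  | .m, s, u => X.zeS 1 * (X.Lop (-1) u + (s : X.Sm) * X.kpS (-1) * u)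

section comm

variable (X)

def DZS : X.Sm := X.DelS * X.zeS 1 * X.zeS (-1)

def omS : X.Sm := (X.rS - X.kS X.B.M) * (X.rS ^ 2 - X.AS ^ 2 * X.cS ^ 2) - X.rS * X.DelS

/-- The commutators of the operators on components of spin `s`. -/
structure Comm (s : ℤ) (u : X.Sm) : Prop where
  dp : op X .d (s + 1) (op X .p s u) - op X .p s (op X .d s u) = X.delS * X.zeS (-1) * op X .p s u
      + (s : X.Sm) * (X.delS * X.AS * X.sS * X.zeS (-1) ^ 3) * u
  dm : op X .d (s - 1) (op X .m s u) - op X .m s (op X .d s u) = X.delS * X.zeS 1 * op X .m s u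
      + (s : X.Sm) * (X.delS * X.AS * X.sS * X.zeS 1 ^ 3) * u
  p3 : X.op3 (op X .p s u) - op X .p s (X.op3 u) = X.zeS (-1) * op X .p s u + (s : X.Sm) * (X.AS * X.sS * X.zeS (-1) ^ 3) * u
  m3 : X.op3 (op X .m s u) - op X .m s (X.op3 u) = X.zeS 1 * op X .m s u + (s : X.Sm) * (X.AS * X.sS * X.zeS 1 ^ 3) * u
  f3 : X.op3 (op X .f s u) - op X .f s (X.op3 u) = 2 * X.omS * X.zeS 1 ^ 2 * X.zeS (-1) ^ 2 * X.op3 u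
      - 2 * X.AS * X.sS * X.rS * X.zeS 1 ^ 2 * X.zeS (-1) * op X .p s u
      + 2 * X.AS * X.sS * X.rS * X.zeS 1 * X.zeS (-1) ^ 2 * op X .m s u
      + (s : X.Sm) * (-(2 * X.AS * X.rS * X.zeS 1 ^ 2 * X.zeS (-1) ^ 2 *
          (2 * X.cS - X.AS * X.sS ^ 2 * (X.zeS (-1) - X.zeS 1)))
        - 4 * X.AS * X.cS * X.zeS 1 ^ 2 * X.zeS (-1) ^ 2 * (X.rS - X.kS X.B.M - X.DelS * (X.zeS 1 + X.zeS (-1)))) * u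
  fp : op X .f (s + 1) (op X .p s u) - op X .p s (op X .f s u) = (X.gamS - X.DZS * X.zeS (-1)) * op X .p s u
      + 2 * X.AS ^ 2 * X.cS * X.sS * X.zeS 1 * X.zeS (-1) ^ 2 * op X .f s u
      + (s : X.Sm) * (X.zeS (-1) * (-(X.AS * X.sS * X.DZS * X.zeS (-1) ^ 2)
        - 2 * X.AS * X.DelS * X.sS * X.zeS 1 ^ 2 * X.zeS (-1) ^ 2 * (-1 - 4 * X.AS ^ 2 * X.cS ^ 2 * X.zeS 1 * X.zeS (-1))
        - 2 * X.AS ^ 2 * X.cS * X.sS * X.zeS 1 * X.zeS (-1) * X.gamS)) * u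
  fm : op X .f (s - 1) (op X .m s u) - op X .m s (op X .f s u) = (-X.gamS - X.DZS * X.zeS 1) * op X .m s u
      + 2 * X.AS ^ 2 * X.cS * X.sS * X.zeS 1 ^ 2 * X.zeS (-1) * op X .f s u
      + (s : X.Sm) * (X.zeS 1 * (-(X.AS * X.sS * X.DZS * X.zeS 1 ^ 2)
        - 2 * X.AS * X.DelS * X.sS * X.zeS 1 ^ 2 * X.zeS (-1) ^ 2 * (-1 - 4 * X.AS ^ 2 * X.cS ^ 2 * X.zeS 1 * X.zeS (-1))
        - 2 * X.AS ^ 2 * X.cS * X.sS * X.zeS 1 * X.zeS (-1) * X.gamS)) * u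
  pm : op X .p (s - 1) (op X .m s u) - op X .m (s + 1) (op X .p s u) = (X.AS * X.sS * X.zeS 1 * (X.zeS (-1) - X.zeS 1)
          - 2 * X.AS ^ 2 * X.cS * X.sS * X.zeS 1 ^ 2 * X.zeS (-1)) * op X .p s u
      + (X.AS * X.sS * X.zeS (-1) * (X.zeS 1 - X.zeS (-1))
          + 2 * X.AS ^ 2 * X.cS * X.sS * X.zeS 1 * X.zeS (-1) ^ 2) * op X .m s u
      - 2 * X.AS * X.cS * X.zeS 1 * X.zeS (-1) * op X .f s u
      - 2 * X.AS * X.cS * X.zeS 1 * X.zeS (-1) * X.DZS * X.op3 u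
      + (s : X.Sm) * (X.zeS 1 * X.zeS (-1) * (-2 + 2 * X.AS * X.cS * (X.zeS 1 - X.zeS (-1))
          + X.AS ^ 2 * X.sS ^ 2 * (X.zeS 1 ^ 2 + X.zeS (-1) ^ 2) + 2 * X.AS * X.cS * X.gamS
          - 2 * X.AS ^ 2 * X.cS * X.zeS 1 * X.zeS (-1) * (2 * X.cS + X.AS * X.sS ^ 2 * (X.zeS 1 - X.zeS (-1))))) * u

lemma comm (s : ℤ) (u : X.Sm) : X.Comm s u := by
  constructor <;>
  · ext q : 1; have hz := X.zp_ne q; have hzb := X.zm_ne q; have hr := X.r_ne q; have hs := X.s_ne q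
    simp only [gamS, omS, DZS, kpS, op, op3, Lop, e4op, leibniz, leibniz_pow, map_add, map_neg, map_sub, smul_eq_mul,
      pd2_dP, pd3_dP, dP_pd0, pd2_pd0, pd3_pd0, pd3_pd2, dP_zeS, dP_cS, dP_rS, dP_sS, dP_siS, dP_DelS, pd_delS, pd_DelS, pd_zp, pd_zm, pd_cS, pd_sS, pd_rS, pd_siS, D_AS, D_iS, D_kS, Derivation.map_intCast, D_ofNat, neg_neg,
      add_ap, mul_ap, neg_ap, pow_ap, sub_ap, zp_ap, zm_ap, cS_ap, rS_ap, sS_ap, siS_ap, delS_ap, DelS_ap, AS_ap, iS_ap, algebraMap_ap,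
      intCast_ap, nsmul_eq_mul, natCast_ap, zero_ap, one_ap, ofNat_ap, if_true, if_false, Fin.isValue, Fin.reduceEq]
    push_cast at hz hzb hs hr ⊢; generalize Complex.sin (q.1 2) = sn at *; generalize ((q.1 1 : ℝ) : ℂ) = r at *; field_simp
    ring

end comm

section coef

variable (X)

lemma rz_eq : X.rS * X.zeS 1 = 1 - X.AS * X.cS * X.zeS 1 := by
  have := X.zeS_mul 1
  simp only [Complex.ofReal_one, mul_one] at this
  change X.zeS 1 * (X.rS + X.AS * X.cS) = 1 at this
  linear_combination this

lemma rzb_eq : X.rS * X.zeS (-1) = 1 + X.AS * X.cS * X.zeS (-1) := by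
  ext q : 1
  have hzb := X.zm_ne q
  simp only [add_ap, mul_ap, zm_ap, cS_ap, AS_ap, one_ap, rS_ap]
  field_simp
  ring

lemma DZS_eq : X.DZS = X.delS ^ 2 * (1 - X.AS * X.cS * X.zeS 1) * (1 + X.AS * X.cS * X.zeS (-1))
    - X.betaS * X.zeS 1 * X.zeS (-1) := by
  have h1 : X.DelS = X.rS ^ 2 * X.delS ^ 2 - X.betaS := by
    ext q : 1; have hr := X.r_ne q; simp only [betaS_ap, mul_ap, pow_ap, sub_ap, delS_ap, DelS_ap, rS_ap]; field_simp; ring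
  rw [DZS, h1, ← rz_eq, ← rzb_eq]; ring

/-- `(Δ/Σ) / (1 - M/r)`. -/
def KDS : X.Sm := X.delS * (1 - X.AS * X.cS * X.zeS 1) * (1 + X.AS * X.cS * X.zeS (-1)) - X.kapS * X.zeS 1 * X.zeS (-1)

lemma KDS_mul : X.KDS * X.delS = X.DZS := by rw [DZS_eq, KDS, ← kapS_mul]; ring

lemma omS_eq : X.omS * X.zeS 1 ^ 2 * X.zeS (-1) ^ 2 =
    X.delS * ((X.kS X.B.M * (1 - X.AS * X.cS * X.zeS 1) - X.AS ^ 2 * X.cS ^ 2 * X.zeS 1)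
      * (1 - X.AS * X.cS * X.zeS 1) * X.zeS (-1) ^ 2)
    + X.betaS * ((1 - X.AS * X.cS * X.zeS 1) * X.zeS 1 * X.zeS (-1) ^ 2) := by
  ext q : 1
  have hz := X.zp_ne q
  have hzb := X.zm_ne q
  have hr := X.r_ne q
  simp only [omS, betaS_ap, add_ap, mul_ap, pow_ap, sub_ap, zp_ap, zm_ap, cS_ap, delS_ap,
    DelS_ap, AS_ap, one_ap, rS_ap, algebraMap_ap]
  field_simp
  ring

lemma gamS_eq : X.gamS = 2 * X.AS * X.cS * X.DZS * X.zeS 1 * X.zeS (-1) := by rw [gamS, DZS]; ring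

/-- The inverse radius as a real number. -/
def ri (q : X.dom) : ℝ := (q.1 1)⁻¹
/-- `1 - M/r` as a real number. -/
def de (q : X.dom) : ℝ := 1 - X.B.M / q.1 1

lemma ri_pos (q : X.dom) : 0 < X.ri q := inv_pos.2 (X.r_pos q)
lemma ri_le (q : X.dom) : X.ri q ≤ X.B.M⁻¹ := inv_anti₀ X.hM (X.r_gt q).le
lemma de_pos (q : X.dom) : 0 < X.de q := X.del_pos q
lemma de_le (q : X.dom) : X.de q ≤ 1 := by
  have := div_pos X.hM (X.r_pos q)
  unfold de; linarith

lemma norm_delS (q : X.dom) : ‖X.delS.1 q‖ = X.de q := by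
  rw [delS_ap, ← div_eq_mul_inv]
  have : (1 - (X.B.M : ℂ) / ((q.1 1 : ℝ) : ℂ)) = ((X.de q : ℝ) : ℂ) := by simp [de]
  rw [this, norm_real, norm_of_nonneg (X.de_pos q).le]

lemma norm_riS (q : X.dom) : ‖X.riS.1 q‖ = X.ri q := by
  rw [riS_ap, ← Complex.ofReal_inv, norm_real]; exact norm_of_nonneg (X.ri_pos q).le

lemma norm_zeS (ε : ℝ) (q : X.dom) : ‖(X.zeS ε).1 q‖ ≤ X.ri q := by
  rw [zeS_ap, norm_inv]
  refine inv_anti₀ (X.r_pos q) ?_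
  refine le_trans (le_of_eq ?_) (Complex.abs_re_le_norm _)
  simp [abs_of_pos (X.r_pos q)]

lemma beta_le (q : X.dom) : X.B.M ^ 2 - X.B.a ^ 2 ≤ 4 * X.B.M ^ 2 * X.de q ^ 2 := by
  have hr := X.r_pos q
  have hM := X.hM
  have h1 : X.B.M ^ 2 - X.B.a ^ 2 ≤ (q.1 1) ^ 2 * X.de q ^ 2 := by
    have := X.Del_pos q.2.2.1; have e : (q.1 1) ^ 2 * X.de q ^ 2 = (q.1 1 - X.B.M) ^ 2 := by unfold de; field_simp
    rw [e]; nlinarith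
  rcases le_total (q.1 1) (2 * X.B.M) with h | h
  · refine h1.trans ?_; have : (q.1 1) ^ 2 ≤ 4 * X.B.M ^ 2 := by nlinarith
    exact mul_le_mul_of_nonneg_right this (sq_nonneg _)
  · have : (1 : ℝ) / 2 ≤ X.de q := by
      have : X.B.M / q.1 1 ≤ 1 / 2 := by rw [div_le_iff₀ hr]; linarith
      unfold de; linarith
    nlinarith [sq_nonneg X.B.a, mul_pos hM hM, mul_le_mul this this (by norm_num) (by linarith)]

lemma norm_betaS (q : X.dom) : ‖X.betaS.1 q‖ ≤ 4 * X.B.M ^ 2 * X.de q ^ 2 := by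
  have : X.betaS.1 q = ((X.B.M ^ 2 - X.B.a ^ 2 : ℝ) : ℂ) := by simp
  rw [this, norm_real, norm_of_nonneg X.beta_nonneg]
  exact X.beta_le q

lemma norm_kapS (q : X.dom) : ‖X.kapS.1 q‖ ≤ 4 * X.B.M ^ 2 * X.de q := by
  have h := congrArg (fun u => ‖u.1 q‖) X.kapS_mul
  simp only [mul_ap, norm_mul, norm_delS] at h
  have := X.norm_betaS q
  rw [← h] at this
  have hd := X.de_pos q
  refine le_of_mul_le_mul_right (this.trans (le_of_eq ?_)) hd
  ring

lemma norm_AS (q : X.dom) : ‖X.AS.1 q‖ ≤ X.B.M := by simpa using X.ha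

/-- Stationary and axisymmetric elements. -/
def IsSt (u : X.Sm) : Prop := pd 0 u = 0 ∧ pd 3 u = 0

variable {X}

lemma op_mul (l : Letter) (s₁ s₂ : ℤ) (u v : X.Sm) : op X l (s₁ + s₂) (u * v) = op X l s₁ u * v + u * op X l s₂ v := by
  cases l <;> simp only [op, op3, e4op, Lop, leibniz, smul_eq_mul, Int.cast_add] <;> ring

lemma op_add (l : Letter) (s : ℤ) (u v : X.Sm) : op X l s (u + v) = op X l s u + op X l s v := by
  cases l <;> simp only [op, op3, e4op, Lop, map_add] <;> ring

lemma op_zero (l : Letter) (s : ℤ) : op X l s 0 = 0 := by cases l <;> simp [op, op3, e4op, Lop]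

lemma op_smul (l : Letter) (s : ℤ) (k : ℂ) (u : X.Sm) : op X l s (k • u) = k • op X l s u := by
  rw [Algebra.smul_def, Algebra.smul_def]
  cases l <;> simp only [op, op3, e4op, Lop, leibniz, smul_eq_mul, D_kS] <;> ring

lemma op3_mul (u v : X.Sm) : X.op3 (u * v) = X.op3 u * v + u * X.op3 v := by simp only [op3, leibniz, smul_eq_mul]; ring

lemma op3_add (u v : X.Sm) : X.op3 (u + v) = X.op3 u + X.op3 v := by simp only [op3, map_add]; ring

lemma op_f_of_isSt {u : X.Sm} (h : X.IsSt u) (s : ℤ) : op X .f s u = X.DZS * X.dP u + (s : X.Sm) * X.gamS * u := by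
  simp only [op, e4op, h.1, h.2, DZS]; ring

lemma op_p_of_isSt {u : X.Sm} (h : X.IsSt u) (s : ℤ) : op X .p s u = X.zeS (-1) * (pd 2 u + (s : X.Sm) * X.kpS 1 * u) := by
  simp only [op, Lop, h.1, h.2]; ring

lemma op_m_of_isSt {u : X.Sm} (h : X.IsSt u) (s : ℤ) : op X .m s u = X.zeS 1 * (pd 2 u + (s : X.Sm) * X.kpS (-1) * u) := by
  simp only [op, Lop, h.1, h.2]; ring

variable (X)

lemma isSt_riS : X.IsSt X.riS := by simp [IsSt, pd_riS]
lemma isSt_rS : X.IsSt X.rS := by simp [IsSt, pd_rS]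
lemma isSt_delS : X.IsSt X.delS := by simp [IsSt, pd_delS]
lemma isSt_cS : X.IsSt X.cS := by simp [IsSt, pd_cS]
lemma isSt_sS : X.IsSt X.sS := by simp [IsSt, pd_sS]
lemma isSt_zeS (ε : ℝ) : X.IsSt (X.zeS ε) := by simp [IsSt, pd_zeS]
lemma pd_kapS_eq_zero (i : Fin 4) (hi : i ≠ 1) : pd i X.kapS = 0 := by
  ext q : 1
  rw [D_kapS, pd_delS, if_neg hi]; simp
lemma isSt_kapS : X.IsSt X.kapS := ⟨X.pd_kapS_eq_zero 0 (by decide), X.pd_kapS_eq_zero 3 (by decide)⟩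

lemma del_dP_kapS : X.delS * X.dP X.kapS = -(X.kapS * X.kS X.B.M * X.riS ^ 2) := by
  have h := congrArg X.dP X.kapS_mul
  rw [leibniz, dP_delS, betaS, D_kS, smul_eq_mul, smul_eq_mul] at h
  linear_combination h

lemma sin_mul_kpS (ε : ℝ) : X.kpS ε * X.sS = -(X.kS ε * X.cS) + X.AS * X.sS ^ 2 * X.zeS (-ε) := by
  unfold kpS
  linear_combination -(X.kS ε * X.cS) * X.siS_mul

end coef

/-- Families of coefficient functions of spin weight `s` that are `O(r^{-w})` and vanish to order
`d` at the horizon of an extremal background. -/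
inductive Coef : ℤ → ℕ → ℕ → (∀ X : Adm, X.Sm) → Prop
  | zero (s : ℤ) (w d : ℕ) : Coef s w d fun _ => 0
  | const (z : ℂ) : Coef 0 0 0 fun X => X.kS z
  | rot : Coef 0 0 0 fun X => X.AS
  | mass : Coef 0 0 0 fun X => X.kS X.B.M
  | beta : Coef 0 0 2 fun X => X.betaS
  | ri : Coef 0 1 0 fun X => X.riS
  | del : Coef 0 0 1 fun X => X.delS
  | kap : Coef 0 0 1 fun X => X.kapS
  | cos : Coef 0 0 0 fun X => X.cS
  | sinp : Coef 1 0 0 fun X => X.sS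
  | sinm : Coef (-1) 0 0 fun X => X.sS
  | zp : Coef 0 1 0 fun X => X.zeS 1
  | zm : Coef 0 1 0 fun X => X.zeS (-1)
  | add {s w d c c'} : Coef s w d c → Coef s w d c' → Coef s w d fun X => c X + c' X
  | mul {s w d s₁ w₁ d₁ s₂ w₂ d₂ c c'} : Coef s₁ w₁ d₁ c → Coef s₂ w₂ d₂ c' → s = s₁ + s₂ →
      w ≤ w₁ + w₂ → d ≤ d₁ + d₂ → Coef s w d fun X => c X * c' X

namespace Coef

variable {s : ℤ} {w d : ℕ} {c c' : ∀ X : Adm, X.Sm}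

lemma congr (h : Coef s w d c) (e : ∀ X, c X = c' X) : Coef s w d c' := by rwa [← funext e]

lemma weak (h : Coef s w d c) {w' d' : ℕ} (hw : w' ≤ w := by simp) (hd : d' ≤ d := by simp) : Coef s w' d' c :=
  ((const 1).mul h (by simp) (hw.trans (by simp)) (hd.trans (by simp))).congr fun X => by simp

lemma mul' {t : ℤ} {w' d' : ℕ} (h : Coef s w d c) (h' : Coef t w' d' c') :
    Coef (s + t) (w + w') (d + d') fun X => c X * c' X :=
  h.mul h' rfl le_rfl le_rfl

lemma one : Coef 0 0 0 fun _ => 1 := (const 1).congr fun X => by simp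

lemma int (n : ℤ) : Coef 0 0 0 fun X => (n : X.Sm) := (const n).congr fun X => by simp

lemma neg (h : Coef s w d c) : Coef s w d fun X => -c X :=
  ((const (-1)).mul h (by simp) (by simp) (by simp)).congr fun X => by simp

lemma sub (h : Coef s w d c) (h' : Coef s w d c') : Coef s w d fun X => c X - c' X := (h.add h'.neg).congr fun X => by ring

lemma oneSub : Coef 0 0 0 fun X => 1 - X.AS * X.cS * X.zeS 1 := one.sub (((rot.mul' cos).mul' zp).weak (by simp) le_rfl)

lemma oneAdd : Coef 0 0 0 fun X => 1 + X.AS * X.cS * X.zeS (-1) := one.add (((rot.mul' cos).mul' zm).weak (by simp) le_rfl)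

lemma dzs : Coef 0 0 2 fun X => X.DZS := ((((((del.mul' del).mul' oneSub).mul' oneAdd)).sub
    (((beta.mul' zp).mul' zm).weak)).congr fun X => by rw [DZS_eq]; ring)

lemma kds : Coef 0 0 1 fun X => X.KDS := ((((del.mul' oneSub).mul' oneAdd)).sub (((kap.mul' zp).mul' zm).weak))

lemma gam : Coef 0 2 2 fun X => X.gamS := (((((const 2).mul' (rot.mul' (cos.mul' dzs))).mul' zp).mul' zm).congr
      fun X => by rw [gamS_eq, show X.kS 2 = 2 from map_ofNat _ 2]; ring)

/-- The gain of degeneracy of the operators on coefficients. -/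
def _root_.Kerr.Adm.Letter.dg : Letter → ℕ
  | .f => 1
  | _ => 0

lemma mulc {s₁ s₂ : ℤ} {w₁ d₁ w₂ d₂ : ℕ} (h : Coef s₁ w₁ d₁ c) (h' : Coef s₂ w₂ d₂ c')
    (hs : s = s₁ + s₂ := by simp [Letter.sp]) (hw : w ≤ w₁ + w₂ := by simp)
    (hd : d ≤ d₁ + d₂ := by simp [Letter.dg]) : Coef s w d fun X => c X * c' X :=
  h.mul h' hs hw hd

lemma op (h : Coef s w d c) (l : Letter) : Coef (s + l.sp) (w + 1) (d + l.dg) fun X => Adm.op X l s (c X) := by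
  induction h with
  | zero s w d => exact (zero _ _ _).congr fun X => by rw [op_zero]
  | const z =>
    refine (zero _ _ _).congr fun X => ?_
    cases l <;> simp [Adm.op, op3, e4op, Lop]
  | rot =>
    refine (zero _ _ _).congr fun X => ?_
    cases l <;> simp [Adm.op, op3, e4op, Lop, D_AS]
  | mass =>
    refine (zero _ _ _).congr fun X => ?_
    cases l <;> simp [Adm.op, op3, e4op, Lop]
  | beta =>
    refine (zero _ _ _).congr fun X => ?_
    cases l <;> simp [Adm.op, op3, e4op, Lop, betaS]
  | ri =>
    have h2 : Coef 0 2 0 fun X => X.riS * X.riS := ri.mul' ri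
    cases l
    · exact ((del.mulc h2).congr fun X => by simp only [Adm.op, op3, dP_riS]; ring)
    · exact ((dzs.mulc h2.neg).congr fun X => by rw [op_f_of_isSt X.isSt_riS, dP_riS]; push_cast; ring)
    · exact (zero _ _ _).congr fun X => by rw [op_p_of_isSt X.isSt_riS, pd_riS]; simp
    · exact (zero _ _ _).congr fun X => by rw [op_m_of_isSt X.isSt_riS, pd_riS]; simp
  | del =>
    have h2 : Coef 0 2 0 fun X => X.kS X.B.M * (X.riS * X.riS) := mass.mul' (ri.mul' ri)
    cases l
    · exact ((del.mulc h2.neg).congr fun X => by simp only [Adm.op, op3, dP_delS]; ring)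
    · exact ((dzs.mulc h2).congr fun X => by rw [op_f_of_isSt X.isSt_delS, dP_delS]; push_cast; ring)
    · exact (zero _ _ _).congr fun X => by rw [op_p_of_isSt X.isSt_delS, pd_delS]; simp
    · exact (zero _ _ _).congr fun X => by rw [op_m_of_isSt X.isSt_delS, pd_delS]; simp
  | kap =>
    have h2 : Coef 0 2 1 fun X => X.kapS * (X.kS X.B.M * (X.riS * X.riS)) := kap.mul' (mass.mul' (ri.mul' ri))
    cases l
    · exact ((h2.weak (by simp) (by simp [Letter.dg])).congr fun X => by
        have := X.del_dP_kapS; simp only [Adm.op, op3]; linear_combination this)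
    · exact ((kds.mulc h2.neg).congr fun X => by
        rw [op_f_of_isSt X.isSt_kapS, ← KDS_mul]; push_cast; linear_combination (-X.KDS) * X.del_dP_kapS)
    · exact (zero _ _ _).congr fun X => by rw [op_p_of_isSt X.isSt_kapS, X.pd_kapS_eq_zero 2 (by decide)]; simp
    · exact (zero _ _ _).congr fun X => by rw [op_m_of_isSt X.isSt_kapS, X.pd_kapS_eq_zero 2 (by decide)]; simp
  | cos =>
    cases l
    · exact (zero _ _ _).congr fun X => by simp only [Adm.op, op3, dP_cS]; ring
    · exact (zero _ _ _).congr fun X => by rw [op_f_of_isSt X.isSt_cS, dP_cS]; simp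
    · exact (zm.mulc sinp.neg).congr fun X => by rw [op_p_of_isSt X.isSt_cS, pd_cS]; simp
    · exact (zp.mulc sinm.neg).congr fun X => by rw [op_m_of_isSt X.isSt_cS, pd_cS]; simp
  | sinp =>
    cases l
    · exact (zero _ _ _).congr fun X => by simp only [Adm.op, op3, dP_sS]; ring
    · exact (gam.mulc sinp).congr fun X => by rw [op_f_of_isSt X.isSt_sS, dP_sS]; simp
    · refine (zm.mulc (rot.mul' ((sinp.mul' sinp).mul' zm))).congr fun X => ?_; rw [op_p_of_isSt X.isSt_sS, pd_sS]
      have := X.sin_mul_kpS 1; simp only [Complex.ofReal_one, map_one, one_mul] at this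
      simp only [Fin.isValue, if_true, Int.cast_one, one_mul, this]; ring
    · refine (zp.mulc (((const 2).mul' cos).add ((rot.mul' ((sinp.mul sinm (s := 0)
        rfl le_rfl le_rfl).mul' zp)).weak))).congr fun X => ?_
      rw [op_m_of_isSt X.isSt_sS, pd_sS]; have := X.sin_mul_kpS (-1)
      simp only [ofReal_neg, Complex.ofReal_one, map_neg, map_one, neg_neg] at this
      simp only [Fin.isValue, if_true, Int.cast_one, one_mul, this, map_ofNat]; ring
  | sinm =>
    cases l
    · exact (zero _ _ _).congr fun X => by simp only [Adm.op, op3, dP_sS]; ring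
    · exact (gam.neg.mulc sinm).congr fun X => by rw [op_f_of_isSt X.isSt_sS, dP_sS]; simp
    · refine (zm.mulc (((const 2).mul' cos).sub ((rot.mul' ((sinp.mul sinm (s := 0)
        rfl le_rfl le_rfl).mul' zm)).weak))).congr fun X => ?_
      rw [op_p_of_isSt X.isSt_sS, pd_sS]; have := X.sin_mul_kpS 1; simp only [Complex.ofReal_one, map_one, one_mul] at this
      simp only [Fin.isValue, if_true, Int.cast_neg, Int.cast_one, neg_mul, one_mul, this, map_ofNat]; ring
    · refine (zp.mulc (rot.mul' ((sinm.mul' sinm).mul' zp)).neg).congr fun X => ?_; rw [op_m_of_isSt X.isSt_sS, pd_sS]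
      have := X.sin_mul_kpS (-1); simp only [ofReal_neg, Complex.ofReal_one, map_neg, map_one, neg_neg] at this
      simp only [Fin.isValue, if_true, Int.cast_neg, Int.cast_one, neg_mul, one_mul, this]; ring
  | zp =>
    have h2 : Coef 0 2 0 fun X => X.zeS 1 * X.zeS 1 := zp.mul' zp
    cases l
    · exact ((del.mulc h2).congr fun X => by simp only [Adm.op, op3, dP_zeS]; ring)
    · exact ((dzs.mulc h2.neg).congr fun X => by rw [op_f_of_isSt (X.isSt_zeS 1), dP_zeS]; push_cast; ring)
    · exact (zm.mulc (rot.mul' (sinp.mul' h2))).congr fun X => by rw [op_p_of_isSt (X.isSt_zeS 1), pd_zp]; simp; ring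
    · exact (zp.mulc (rot.mul' (sinm.mul' h2))).congr fun X => by rw [op_m_of_isSt (X.isSt_zeS 1), pd_zp]; simp; ring
  | zm =>
    have h2 : Coef 0 2 0 fun X => X.zeS (-1) * X.zeS (-1) := zm.mul' zm
    cases l
    · exact ((del.mulc h2).congr fun X => by simp only [Adm.op, op3, dP_zeS]; ring)
    · exact ((dzs.mulc h2.neg).congr fun X => by rw [op_f_of_isSt (X.isSt_zeS (-1)), dP_zeS]; push_cast; ring)
    · exact (zm.mulc (rot.mul' (sinp.mul' h2.neg))).congr fun X => by rw [op_p_of_isSt (X.isSt_zeS (-1)), pd_zm]; simp; ring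
    · exact (zp.mulc (rot.mul' (sinm.mul' h2.neg))).congr fun X => by rw [op_m_of_isSt (X.isSt_zeS (-1)), pd_zm]; simp; ring
  | add _ _ h1 h2 => exact (h1.add h2).congr fun X => by rw [op_add]
  | mul h1 h2 hs hw hd i1 i2 =>
    subst hs
    refine ((i1.mul h2 (by ring) (by omega) (by omega)).add (h1.mul i2 (by ring) (by omega) (by omega))).congr fun X => ?_
    rw [op_mul]

end Coef

namespace Coef

variable {s t : ℤ} {w d w' d' : ℕ} {c c' : ∀ X : Adm, X.Sm}

lemma cast (h : Coef s w d c) (e : ∀ X, c X = c' X) (hs : s = t := by simp) (hw : w' ≤ w := by simp)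
    (hd : d' ≤ d := by simp) : Coef t w' d' c' := by
  subst hs
  exact (h.weak hw hd).congr e

lemma bound (h : Coef s w d c) {M : ℝ} (hM : 0 < M) : ∃ C : ℝ, 0 ≤ C ∧ ∀ X : Adm, X.B.M = M →
    ∀ q, ‖(c X).1 q‖ ≤ C * X.ri q ^ w * X.de q ^ d := by
  induction h with
  | zero s w d => exact ⟨0, le_rfl, fun X _ q => by simp⟩
  | const z => exact ⟨‖z‖, norm_nonneg _, fun X _ q => by simp⟩
  | rot => exact ⟨M, hM.le, fun X hX q => by simpa [hX] using X.norm_AS q⟩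
  | mass => exact ⟨M, hM.le, fun X hX q => by simp [hX, abs_of_pos hM]⟩
  | beta => exact ⟨4 * M ^ 2, by positivity, fun X hX q => by simpa [hX] using X.norm_betaS q⟩
  | ri => exact ⟨1, zero_le_one, fun X hX q => by simpa using (X.norm_riS q).le⟩
  | del => exact ⟨1, zero_le_one, fun X hX q => by rw [X.norm_delS q]; simp⟩
  | kap => exact ⟨4 * M ^ 2, by positivity, fun X hX q => by simpa [hX] using X.norm_kapS q⟩
  | cos =>
    refine ⟨1, zero_le_one, fun X hX q => ?_⟩; rw [cS_ap, norm_real]; simpa using Real.abs_cos_le_one _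
  | sinp =>
    refine ⟨1, zero_le_one, fun X hX q => ?_⟩; rw [sS_ap, norm_real]; simpa using Real.abs_sin_le_one _
  | sinm =>
    refine ⟨1, zero_le_one, fun X hX q => ?_⟩; rw [sS_ap, norm_real]; simpa using Real.abs_sin_le_one _
  | zp => exact ⟨1, zero_le_one, fun X hX q => by simpa using X.norm_zeS 1 q⟩
  | zm => exact ⟨1, zero_le_one, fun X hX q => by simpa using X.norm_zeS (-1) q⟩
  | add _ _ h1 h2 =>
    obtain ⟨C₁, hC₁, h1⟩ := h1; obtain ⟨C₂, hC₂, h2⟩ := h2; refine ⟨C₁ + C₂, by positivity, fun X hX q => ?_⟩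
    rw [add_ap]; refine (norm_add_le _ _).trans ((add_le_add (h1 X hX q) (h2 X hX q)).trans (le_of_eq ?_)); ring
  | @mul s w d s₁ w₁ d₁ s₂ w₂ d₂ c c' _ _ hs hw hd h1 h2 =>
    obtain ⟨C₁, hC₁, h1⟩ := h1; obtain ⟨C₂, hC₂, h2⟩ := h2
    refine ⟨C₁ * C₂ * (M⁻¹) ^ (w₁ + w₂ - w), by positivity, fun X hX q => ?_⟩
    rw [mul_ap, norm_mul]; have hr := X.ri_pos q; have hd0 := X.de_pos q
    have e1 : X.ri q ^ (w₁ + w₂) ≤ (M⁻¹) ^ (w₁ + w₂ - w) * X.ri q ^ w := by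
      obtain ⟨k, hk⟩ := Nat.exists_eq_add_of_le hw; rw [hk, Nat.add_sub_cancel_left, pow_add, mul_comm]; gcongr
      exact hX ▸ X.ri_le q
    have e2 : X.de q ^ (d₁ + d₂) ≤ X.de q ^ d := pow_le_pow_of_le_one hd0.le (X.de_le q) hd
    calc ‖(c X).1 q‖ * ‖(c' X).1 q‖
        ≤ (C₁ * X.ri q ^ w₁ * X.de q ^ d₁) * (C₂ * X.ri q ^ w₂ * X.de q ^ d₂) :=
          mul_le_mul (h1 X hX q) (h2 X hX q) (norm_nonneg _) (by positivity)
      _ = C₁ * C₂ * X.ri q ^ (w₁ + w₂) * X.de q ^ (d₁ + d₂) := by ring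
      _ ≤ C₁ * C₂ * ((M⁻¹) ^ (w₁ + w₂ - w) * X.ri q ^ w) * X.de q ^ d := by gcongr
      _ = _ := by ring

end Coef

/-- The composition of the operators of a word, the head being applied first. -/
def app (X : Adm) : List Letter → ℤ → X.Sm → X.Sm
  | [], _, u => u
  | l :: W, s, u => app X W (s + l.sp) (op X l s u)

/-- The spin weight of a word. -/
def wsp (W : List Letter) : ℤ := (W.map Letter.sp).sum

@[simp] lemma wsp_nil : wsp [] = 0 := rfl
@[simp] lemma wsp_cons (l : Letter) (W : List Letter) : wsp (l :: W) = l.sp + wsp W := by simp [wsp]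
@[simp] lemma wsp_append (W V : List Letter) : wsp (W ++ V) = wsp W + wsp V := by simp [wsp]

@[simp] lemma app_nil (s : ℤ) (u : X.Sm) : app X [] s u = u := rfl
lemma app_cons (l : Letter) (W : List Letter) (s : ℤ) (u : X.Sm) :
    app X (l :: W) s u = app X W (s + l.sp) (op X l s u) := rfl

lemma app_append (W V : List Letter) (s : ℤ) (u : X.Sm) : app X (W ++ V) s u = app X V (s + wsp W) (app X W s u) := by
  induction W generalizing s u with
  | nil => simp
  | cons l W ih => rw [List.cons_append, app_cons, app_cons, ih, wsp_cons, add_assoc]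

lemma app_concat (W : List Letter) (l : Letter) (s : ℤ) (u : X.Sm) :
    app X (W ++ [l]) s u = op X l (s + wsp W) (app X W s u) := by
  rw [app_append]; rfl

lemma app_add (W : List Letter) (s : ℤ) (u v : X.Sm) : app X W s (u + v) = app X W s u + app X W s v := by
  induction W generalizing s u v with
  | nil => rfl
  | cons l W ih => rw [app_cons, op_add, ih]; rfl

lemma op_neg (l : Letter) (s : ℤ) (u : X.Sm) : op X l s (-u) = -op X l s u := by
  have := op_smul (X := X) l s (-1) u
  simpa using this

lemma app_neg (W : List Letter) (s : ℤ) (u : X.Sm) : app X W s (-u) = -app X W s u := by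
  induction W generalizing s u with
  | nil => rfl
  | cons l W ih => rw [app_cons, op_neg, ih]; rfl

lemma app_sub (W : List Letter) (s : ℤ) (u v : X.Sm) : app X W s (u - v) = app X W s u - app X W s v := by
  rw [sub_eq_add_neg, app_add, app_neg, sub_eq_add_neg]

/-- Constraints on a word and on the weights of its coefficient. -/
abbrev Cstr : Type := List Letter → ℕ → ℕ → Prop

/-- Combinations, with coefficients of type `Coef`, of words subject to a constraint, acting on
functions of spin weight `s`. -/
inductive LC (s : ℤ) (Q : Cstr) : ℤ → (∀ X : Adm, X.Sm → X.Sm) → Prop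
  | zero (t : ℤ) : LC s Q t fun _ _ => 0
  | term {W t₁ w d t c} : Coef t₁ w d c → Q W w d → t = t₁ + (s + wsp W) → LC s Q t fun X u => c X * app X W s u
  | add {t F G} : LC s Q t F → LC s Q t G → LC s Q t fun X u => F X u + G X u

namespace LC

variable {s t : ℤ} {Q Q' : Cstr} {F G : ∀ X : Adm, X.Sm → X.Sm}

lemma congr (h : LC s Q t F) (e : ∀ X u, F X u = G X u) : LC s Q t G := by
  rwa [← show F = G from funext fun X => funext (e X)]

lemma mono (h : LC s Q t F) (hQ : ∀ W w d, Q W w d → Q' W w d) : LC s Q' t F := by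
  induction h with
  | zero t => exact zero t
  | term hc hq ht => exact term hc (hQ _ _ _ hq) ht
  | add _ _ h1 h2 => exact h1.add h2

lemma coef_mul {t₁ w₁ d₁ c} (hc : Coef t₁ w₁ d₁ c) (h : LC s Q t F) (hQ : ∀ W w d, Q W w d → Q' W (w₁ + w) (d₁ + d)) :
    LC s Q' (t₁ + t) fun X u => c X * F X u := by
  induction h with
  | zero t => exact (zero _).congr fun X u => by simp
  | term hc' hq ht =>
    exact (term (hc.mul' hc') (hQ _ _ _ hq) (by rw [ht]; ring)).congr fun X u => by ring
  | add _ _ h1 h2 => exact (h1.add h2).congr fun X u => by ring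

lemma neg (h : LC s Q t F) : LC s Q t fun X u => -F X u := by
  have := coef_mul (Q' := Q) (Coef.const (-1)) h (by simp)
  grind

lemma sub (h : LC s Q t F) (h' : LC s Q t G) : LC s Q t fun X u => F X u - G X u := (h.add h'.neg).congr fun X u => by ring

lemma comp_app {V : List Letter} (h : LC (s + wsp V) Q t F)
    (hQ : ∀ W w d, Q W w d → Q' (V ++ W) w d) : LC s Q' t fun X u => F X (Adm.app X V s u) := by
  induction h with
  | zero t => exact zero t
  | term hc hq ht =>
    exact (term hc (hQ _ _ _ hq) (by rw [ht, wsp_append]; ring)).congr fun X u => by rw [app_append]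
  | add _ _ h1 h2 => exact h1.add h2

lemma op (h : LC s Q t F) (l : Letter) (hQ : ∀ W w d, Q W w d → Q' (W ++ [l]) w d ∧ Q' W (w + 1) (d + l.dg)) :
    LC s Q' (t + l.sp) fun X u => Adm.op X l t (F X u) := by
  induction h with
  | zero t => exact (zero _).congr fun X u => (op_zero _ _).symm
  | @term W t₁ w d t c hc hq ht =>
    subst ht
    refine ((term (hc.op l) (hQ _ _ _ hq).2 (by ring)).add (term (W := W ++ [l]) hc
      (hQ _ _ _ hq).1 (by simp; ring))).congr fun X u => ?_
    rw [op_mul, app_concat]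
  | add _ _ h1 h2 => exact (h1.add h2).congr fun X u => (op_add _ _ _ _).symm

/-- A constraint preserved by the Leibniz rule. -/
def _root_.Kerr.Adm.Cstr.Stable (Q : Cstr) : Prop := ∀ l W w d, Q W w d → Q (W ++ [l]) w d ∧ Q W (w + 1) (d + l.dg)

lemma app_len (n : ℕ) (h : LC s (fun W w d => W.length ≤ n ∧ Q W w d) t F) (hQ : Q.Stable)
    (V : List Letter) : LC s (fun W w d => W.length ≤ n + V.length ∧ Q W w d) (t + wsp V)
      fun X u => Adm.app X V t (F X u) := by
  induction V generalizing n t F with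
  | nil => simpa using h
  | cons l V ih =>
    have := ih (n + 1) (h.op (Q' := fun W w d => W.length ≤ n + 1 ∧ Q W w d) l
      fun W w d hW => ⟨⟨by simpa using hW.1, (hQ l _ _ _ hW.2).1⟩, by omega, (hQ l _ _ _ hW.2).2⟩)
    rw [wsp_cons, ← add_assoc]; exact this.mono fun W w d hW => ⟨by simp only [List.length_cons]; omega, hW.2⟩

lemma map_add (h : LC s Q t F) (X : Adm) (u v : X.Sm) : F X (u + v) = F X u + F X v := by
  induction h with
  | zero t => simp
  | term hc hq ht => simp only [app_add]; ring
  | add _ _ h1 h2 => simp only [h1, h2]; ring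

lemma comp {t' n n' a a'} (h : LC t (fun W w _ => W.length ≤ n ∧ a ≤ w) t' F)
    (h' : LC s (fun W w _ => W.length ≤ n' ∧ a' ≤ w) t G) :
    LC s (fun W w _ => W.length ≤ n + n' ∧ a + a' ≤ w) t' fun X u => F X (G X u) := by
  induction h with
  | zero t => exact zero t
  | @term W t₁ w d t₂ c hc hq ht =>
    have := coef_mul (Q' := fun W w _ => W.length ≤ n + n' ∧ a + a' ≤ w) hc
      (h'.app_len (Q := fun W w _ => a' ≤ w) n' (fun l W w d h => ⟨h, by omega⟩) W)
      fun W w d h => ⟨by omega, by omega⟩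
    subst ht; exact this
  | add _ _ h1 h2 => exact h1.add h2

lemma term0 {t₁ w d c} (hc : Coef t₁ w d c) (hQ : Q [] w d) (ht : t = t₁ + s) : LC s Q t fun X u => c X * u :=
  term (W := []) hc hQ (by simpa using ht)

lemma term1 {t₁ w d c} (l : Letter) (hc : Coef t₁ w d c) (hQ : Q [l] w d) (ht : t = t₁ + (s + l.sp)) :
    LC s Q t fun X u => c X * Adm.op X l s u :=
  term (W := [l]) hc hQ (by simpa using ht)

end LC

/-- The errors of interchanging operators. -/
def QB (s : ℤ) : Cstr := fun W w _ => 1 ≤ w ∧ (W ≠ [] ∨ s ≠ 0)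

/-- The errors of interchanging operators in words containing `∇̸₄`. -/
def QF : Cstr := fun W w d =>
  (.f ∈ W ∧ 1 ≤ w) ∨ ((.p ∈ W ∨ .m ∈ W) ∧ 1 ≤ w ∧ 1 ≤ d) ∨ (2 ≤ w ∧ 1 ≤ d)

lemma stable_QB (s : ℤ) : (QB s).Stable := fun l W w d h =>
  ⟨⟨h.1, Or.inl (by simp)⟩, by omega, h.2⟩

lemma stable_QF : QF.Stable := by
  rintro l W w d (⟨h, h'⟩ | ⟨h, h'⟩ | h)
  · exact ⟨Or.inl ⟨by simp [h], h'⟩, Or.inl ⟨h, by omega⟩⟩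
  · refine ⟨Or.inr (Or.inl ⟨?_, h'⟩), Or.inr (Or.inl ⟨h, by omega, by omega⟩)⟩
    rcases h with h | h <;> simp [h]
  · exact ⟨Or.inr (Or.inr h), Or.inr (Or.inr (by omega))⟩

/-- Words of bounded length subject to a constraint. -/
def Cstr.len (n : ℕ) (Q : Cstr) : Cstr := fun W w d => W.length ≤ n ∧ Q W w d

open Coef

section table

variable (s : ℤ)

lemma coef_omS : Coef 0 2 1 fun X => X.omS * X.zeS 1 ^ 2 * X.zeS (-1) ^ 2 :=
  ((del.mul' ((((mass.mul' oneSub).sub (((rot.mul' rot).mul' ((cos.mul' cos).mul' zp)).weak (w' := 0)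
    (d' := 0))).mul' oneSub).mul' (zm.mul' zm))).add
    ((beta.mul' (oneSub.mul' (zp.mul' (zm.mul' zm)))).weak)).congr fun X => by rw [omS_eq]; ring

lemma coef_3f : Coef 0 2 0 fun X => (-(2 * X.AS * X.rS * X.zeS 1 ^ 2 * X.zeS (-1) ^ 2 *
          (2 * X.cS - X.AS * X.sS ^ 2 * (X.zeS (-1) - X.zeS 1)))
        - 4 * X.AS * X.cS * X.zeS 1 ^ 2 * X.zeS (-1) ^ 2 * (X.rS - X.kS X.B.M - X.DelS * (X.zeS 1 + X.zeS (-1)))) := by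
  have h1 : Coef 0 0 0 fun X => 2 * X.cS - X.AS * X.sS ^ 2 * (X.zeS (-1) - X.zeS 1) :=
    (((const 2).mul' cos).sub ((rot.mul' ((sinp.mul' sinm).mul' (zm.sub zp))).weak (w' := 0)
      (d' := 0))).congr fun X => by rw [show X.kS 2 = 2 from map_ofNat _ 2]; ring
  have h2 : Coef 0 3 0 fun X => X.AS * ((1 - X.AS * X.cS * X.zeS 1) * (X.zeS 1 * (X.zeS (-1) * X.zeS (-1)))) :=
    rot.mul' (oneSub.mul' (zp.mul' (zm.mul' zm)))
  have h3 : Coef 0 2 0 fun X => X.zeS 1 * X.zeS (-1) * ((1 - X.AS * X.cS * X.zeS 1) * X.zeS (-1)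
      - X.kS X.B.M * ζ(X) - X.DZS * (X.zeS 1 + X.zeS (-1))) :=
    ((zp.mul' zm).mul' (((oneSub.mul' zm).sub ((mass.mul' (zp.mul' zm)).weak)).sub ((dzs.mul' (zp.add zm)).weak))).weak
  refine (((((const (-2)).mul' (h2.mul' h1)).weak (w' := 2) (d' := 0))).add (((const (-4)).mul' (rot.mul' (cos.mul' h3))))).congr fun X => ?_
  simp only [← rz_eq, map_neg, map_ofNat, DZS]
  ring

/-- The bounds on the errors of interchanging two letters. -/
def QC (s : ℤ) (F : Prop) : Cstr := fun W w d => W.length ≤ 1 ∧ QB s W w d ∧ (F → QF W w d)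

lemma LC.spin {t w d c} {Q : Cstr} (hc : Coef t w d c) (hQ : s ≠ 0 → Q [] w d) {t' : ℤ}
    (ht : t' = t + s) : LC s Q t' fun X u => (s : X.Sm) * c X * u := by
  rcases eq_or_ne s 0 with rfl | hs
  · exact (LC.zero _).congr fun X u => by simp
  · refine LC.term0 (((int s).mul' hc).cast fun X => rfl) (hQ hs) ht

lemma LC_dp : LC s (QC s False) (s + 1) fun X u =>
    op X .d (s + 1) (op X .p s u) - op X .p s (op X .d s u) :=
  ((LC.term1 .p (del.mul' zm) (by simp [QC, QB]) (by simp [Letter.sp])).add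
    (LC.spin s (t := 1) (del.mul' (rot.mul' (sinp.mul' (zm.mul' (zm.mul' zm)))))
      (by simp [QC, QB]) (by ring))).congr fun X u => by rw [(X.comm _ _).dp]; ring

lemma LC_dm : LC s (QC s False) (s - 1) fun X u =>
    op X .d (s - 1) (op X .m s u) - op X .m s (op X .d s u) :=
  ((LC.term1 .m (del.mul' zp) (by simp [QC, QB]) (by simp [Letter.sp]; ring)).add
    (LC.spin s ((del.mul' (rot.mul' (sinm.mul' (zp.mul' (zp.mul' zp))))).cast (t := -1) (w' := 3) (d' := 0)
      fun _ => rfl) (by simp [QC, QB]) (by ring))).congr fun X u => by rw [(X.comm _ _).dm]; ring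

lemma LC_df : LC s (QC s True) s fun X u =>
    op X .d s (op X .f s u) - op X .f s (op X .d s u) := by
  have h1 := ((const 2).mul' coef_omS).sub (kds.mul' (mass.mul' (Coef.ri.mul' Coef.ri)))
  have h2 := (const (-2)).mul' (del.mul' (rot.mul' (sinm.mul' (oneSub.mul' (zp.mul' zm)))))
  have h3 := (const 2).mul' (del.mul' (rot.mul' (sinp.mul' (oneSub.mul' (zm.mul' zm)))))
  refine ((((LC.term1 .d h1 ?_ ?_).add (LC.term1 .p h2 ?_ ?_)).add (LC.term1 .m h3 ?_ ?_)).add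
    (LC.spin s (del.mul' coef_3f) ?_ ?_)).congr fun X u => ?_
  any_goals first | (simp [QC, QB, QF]; done) | (simp [Letter.sp]; done)
  have e := op_mul .f 0 s X.delS (X.op3 u)
  rw [zero_add, op_f_of_isSt X.isSt_delS, dP_delS, Int.cast_zero, zero_mul, zero_mul, add_zero] at e
  rw [show op X .d s u = X.delS * X.op3 u from rfl, e,
    show op X .d s (op X .f s u) = X.delS * X.op3 (op X .f s u) from rfl, ← KDS_mul]
  simp only [map_neg, map_ofNat, ← rz_eq]
  linear_combination -X.delS * (X.comm s u).f3

lemma coef_e4_ang : Coef 0 0 0 fun X => -1 - X.kS 4 * (X.AS * X.AS * (X.cS * X.cS * ζ(X))) :=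
  one.neg.sub ((const 4).mul' ((rot.mul' rot).mul' ((cos.mul' cos).mul' (zp.mul' zm)))).weak

lemma LC_fp : LC s (QC s True) (s + 1) fun X u =>
    op X .f (s + 1) (op X .p s u) - op X .p s (op X .f s u) := by
  have h1 := gam.weak.sub (dzs.mul' zm)
  have h2 := (const 2).mul' (rot.mul' (rot.mul' (cos.mul' (sinp.mul' (zp.mul' (zm.mul' zm))))))
  have h3 := zm.mul' (((rot.mul' (sinp.mul' (dzs.mul' (zm.mul' zm)))).neg.sub ((const 2).mul'
    (rot.mul' (dzs.mul' (sinp.mul' ((zp.mul' zm).mul' coef_e4_ang)))))).sub ((const 2).mul'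
    ((rot.mul' rot).mul' (cos.mul' (sinp.mul' ((zp.mul' zm).mul' gam))))).weak)
  refine (((LC.term1 .p h1 ?_ ?_).add (LC.term1 .f h2 ?_ ?_)).add (LC.spin s h3 ?_ ?_)).congr fun X u => ?_
  any_goals first | (simp [QC, QB, QF]; done) | (simp [Letter.sp]; done) | omega | (simp only [Letter.sp]; omega)
  rw [(X.comm _ _).fp]
  simp only [map_ofNat, DZS]
  ring

lemma LC_fm : LC s (QC s True) (s - 1) fun X u =>
    op X .f (s - 1) (op X .m s u) - op X .m s (op X .f s u) := by
  have h1 := gam.neg.weak.sub (dzs.mul' zp)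
  have h2 := (const 2).mul' (rot.mul' (rot.mul' (cos.mul' (sinm.mul' (zp.mul' (zp.mul' zm))))))
  have h3 := zp.mul' (((rot.mul' (sinm.mul' (dzs.mul' (zp.mul' zp)))).neg.sub ((const 2).mul'
    (rot.mul' (dzs.mul' (sinm.mul' ((zp.mul' zm).mul' coef_e4_ang)))))).sub ((const 2).mul'
    ((rot.mul' rot).mul' (cos.mul' (sinm.mul' ((zp.mul' zm).mul' gam))))).weak)
  refine (((LC.term1 .m h1 ?_ ?_).add (LC.term1 .f h2 ?_ ?_)).add (LC.spin s h3 ?_ ?_)).congr fun X u => ?_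
  any_goals first | (simp [QC, QB, QF]; done) | (simp [Letter.sp]; done) | omega | (simp only [Letter.sp]; omega)
  rw [(X.comm _ _).fm]
  simp only [map_ofNat, DZS]
  ring

lemma LC_pm : LC s (QC s False) s fun X u =>
    op X .p (s - 1) (op X .m s u) - op X .m (s + 1) (op X .p s u) := by
  have h1 := (rot.mul' (sinm.mul' (zp.mul' (zm.sub zp)))).sub ((const 2).mul' ((rot.mul' rot).mul'
    (cos.mul' (sinm.mul' (zp.mul' (zp.mul' zm)))))).weak
  have h2 := (rot.mul' (sinp.mul' (zm.mul' (zp.sub zm)))).add ((const 2).mul' ((rot.mul' rot).mul'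
    (cos.mul' (sinp.mul' (zp.mul' (zm.mul' zm)))))).weak
  have h3 := (const (-2)).mul' (rot.mul' (cos.mul' (zp.mul' zm)))
  have h4 := (const (-2)).mul' (rot.mul' (cos.mul' ((zp.mul' zm).mul' kds)))
  have a1 := ((const 2).mul' (rot.mul' (cos.mul' (zp.sub zm)))).weak (w' := 0) (d' := 0)
  have a2 := ((rot.mul' rot).mul' ((sinp.mul' sinm).mul' ((zp.mul' zp).add (zm.mul' zm)))).weak (w' := 0) (d' := 0)
  have a3 := ((const 2).mul' (rot.mul' (cos.mul' gam))).weak (w' := 0) (d' := 0)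
  have a4 := ((const 2).mul' cos).add ((rot.mul' ((sinp.mul' sinm).mul' (zp.sub zm))).weak (w' := 0) (d' := 0))
  have a5 := ((const 2).mul' ((rot.mul' rot).mul' (cos.mul' ((zp.mul' zm).mul' a4)))).weak (w' := 0) (d' := 0)
  have h5 := (zp.mul' zm).mul' (((((const (-2)).add a1).add a2).add a3).sub a5)
  refine (((((LC.term1 .p h1 ?_ ?_).add (LC.term1 .m h2 ?_ ?_)).add (LC.term1 .f h3 ?_ ?_)).add
    (LC.term1 .d h4 ?_ ?_)).add (LC.spin s h5 ?_ ?_)).congr fun X u => ?_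
  any_goals first | (simp [QC, QB, QF]; done) | (simp [Letter.sp]; done) | omega
  rw [(X.comm _ _).pm, ← KDS_mul]
  simp only [map_neg, map_ofNat, op]
  ring

lemma QC.mono {s : ℤ} {F F' : Prop} (h : F' → F) {W w d} (hQ : QC s F W w d) : QC s F' W w d :=
  ⟨hQ.1, hQ.2.1, fun hF => hQ.2.2 (h hF)⟩

lemma LC_swap (l l' : Letter) : LC s (QC s (l = .f ∨ l' = .f)) (s + l.sp + l'.sp) fun X u =>
    op X l (s + l'.sp) (op X l' s u) - op X l' (s + l.sp) (op X l s u) := by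
  have z : ∀ {t Q}, LC s Q t fun X u => (0 : X.Sm) := LC.zero _
  have n' : ∀ {P : Prop} {P' t t' F G}, LC s (QC s P) t F → (P' → P) → t = t' →
      (∀ X u, F X u = G X u) → LC s (QC s P') t' G := fun h h1 h2 h3 => by
    subst h2; exact (h.congr h3).mono fun _ _ _ => QC.mono h1
  have n : ∀ {P : Prop} {P' t t' F G}, LC s (QC s P) t F → (P' → P) → t = t' →
      (∀ X u, -F X u = G X u) → LC s (QC s P') t' G := fun h => n' h.neg
  cases l <;> cases l' <;> simp only [Letter.sp, add_zero]
  · exact z.congr fun X u => by simp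
  · exact n' (LC_df s) (by simp) rfl fun X u => rfl
  · exact n' (LC_dp s) (by simp) rfl fun X u => rfl
  · exact n' (LC_dm s) (by simp) rfl fun X u => rfl
  · exact n (LC_df s) (by simp) rfl fun X u => by ring
  · exact z.congr fun X u => by simp
  · exact n' (LC_fp s) (by simp) rfl fun X u => rfl
  · exact n' (LC_fm s) (by simp) rfl fun X u => rfl
  · exact n (LC_dp s) (by simp) rfl fun X u => by simp
  · exact n (LC_fp s) (by simp) rfl fun X u => by simp
  · exact z.congr fun X u => by simp
  · exact n' (LC_pm s) (by simp) (by ring) fun X u => rfl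
  · exact n (LC_dm s) (by simp) rfl fun X u => by simp [sub_eq_add_neg]
  · exact n (LC_fm s) (by simp) rfl fun X u => by simp [sub_eq_add_neg]
  · exact n (LC_pm s) (by simp) (by ring) fun X u => by simp [sub_eq_add_neg]
  · exact z.congr fun X u => by simp

end table

lemma LC.app_QF {s t : ℤ} {n : ℕ} {F} (V : List Letter) (hV : .f ∈ V) (h : LC s (Cstr.len n (QB s)) t F) :
    LC s (Cstr.len (n + V.length) QF) (t + wsp V) fun X u => Adm.app X V t (F X u) := by
  induction V generalizing n t F with
  | nil => simp at hV
  | cons l V ih =>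
    rw [wsp_cons, ← add_assoc]; rcases List.mem_cons.1 hV with hl | hV
    · subst hl
      have := (h.op (Q' := Cstr.len (n + 1) QF) .f fun W w d hW =>
        ⟨⟨by simpa using hW.1, Or.inl ⟨by simp, hW.2.1⟩⟩, (by simpa using hW.1.trans (by simp)),
          Or.inr (Or.inr ⟨by have := hW.2.1; omega, by simp [Letter.dg]⟩)⟩).app_len _ stable_QF V
      exact this.mono fun W w d hW => ⟨by simp only [List.length_cons]; have := hW.1; omega, hW.2⟩
    · have := ih hV (h.op (Q' := Cstr.len (n + 1) (QB s)) l fun W w d hW =>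
        ⟨⟨by simpa using hW.1, (stable_QB s l _ _ _ hW.2).1⟩, by have := hW.1; omega, (stable_QB s l _ _ _ hW.2).2⟩)
      exact this.mono fun W w d hW => ⟨by simp only [List.length_cons]; have := hW.1; omega, hW.2⟩

lemma QF.cons {W w d} (l : Letter) (h : QF W w d) : QF (l :: W) w d := by
  rcases h with ⟨h, h'⟩ | ⟨h, h'⟩ | h
  · exact Or.inl ⟨by simp [h], h'⟩
  · refine Or.inr (Or.inl ⟨?_, h'⟩)
    rcases h with h | h <;> simp [h]
  · exact Or.inr (Or.inr h)

lemma LC_perm {W₁ W₂ : List Letter} (h : W₁.Perm W₂) (s : ℤ) :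
    LC s (Cstr.len (W₁.length - 1) (QB s)) (s + wsp W₁) fun X u => app X W₁ s u - app X W₂ s u := by
  induction h generalizing s with
  | nil => exact (LC.zero _).congr fun X u => by simp
  | @cons l V₁ V₂ h ih =>
    rcases Nat.eq_zero_or_pos V₁.length with h0 | h0
    · have h1 := List.length_eq_zero_iff.1 h0; rw [h1] at h; rw [h1, h.nil_eq]; exact (LC.zero _).congr fun X u => by simp
    have := (ih (s + wsp [l])).comp_app (V := [l]) (Q' := Cstr.len V₁.length (QB s))
      fun W w d hW => ⟨by have := hW.1; simp; omega, hW.2.1, Or.inl (by simp)⟩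
    rw [show s + wsp (l :: V₁) = s + wsp [l] + wsp V₁ by simp; ring]
    exact this.congr fun X u => by simp [app_cons]
  | swap l l' W =>
    have := ((LC_swap s l l').mono (Q' := Cstr.len 1 (QB s)) fun W w d hW => ⟨hW.1, hW.2.1⟩).app_len 1 (stable_QB s) W
    rw [wsp_cons, wsp_cons, show s + (l'.sp + (l.sp + wsp W)) = s + l.sp + l'.sp + wsp W by ring]
    refine (this.mono fun W w d hW => ⟨hW.1.trans (by simp; omega), hW.2⟩).congr fun X u => ?_
    rw [app_sub, app_cons, app_cons, app_cons, app_cons, add_right_comm s]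
  | trans h1 h2 i1 i2 =>
    have e : ∀ {V V' : List Letter}, V.Perm V' → wsp V = wsp V' := fun h => (h.map _).sum_eq; have j2 := i2 s
    rw [← h1.length_eq, ← e h1] at j2; exact ((i1 s).add j2).congr fun X u => by ring

lemma LC_perm_f {W₁ W₂ : List Letter} (h : W₁.Perm W₂) (hf : .f ∈ W₁) (s : ℤ) :
    LC s (Cstr.len (W₁.length - 1) QF) (s + wsp W₁) fun X u => app X W₁ s u - app X W₂ s u := by
  induction h generalizing s with
  | nil => exact (LC.zero _).congr fun X u => by simp
  | @cons l V₁ V₂ h ih =>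
    rcases Nat.eq_zero_or_pos V₁.length with h0 | h0
    · have h1 := List.length_eq_zero_iff.1 h0; rw [h1] at h; rw [h1, h.nil_eq]; exact (LC.zero _).congr fun X u => by simp
    have key : LC (s + wsp [l]) (fun W w d => W.length ≤ V₁.length - 1 ∧ QF (l :: W) w d)
        (s + wsp [l] + wsp V₁) fun X u => app X V₁ (s + wsp [l]) u - app X V₂ (s + wsp [l]) u := by
      by_cases hl : l = .f
      · exact (LC_perm h _).mono fun W w d hW => ⟨hW.1, Or.inl ⟨by simp [hl], hW.2.1⟩⟩
      · exact (ih (by simpa [Ne.symm hl] using hf) _).mono fun W w d hW => ⟨hW.1, hW.2.cons l⟩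
    have := key.comp_app (V := [l]) (Q' := Cstr.len V₁.length QF) fun W w d hW => ⟨by have := hW.1; simp; omega, hW.2⟩
    rw [show s + wsp (l :: V₁) = s + wsp [l] + wsp V₁ by simp; ring]
    exact this.congr fun X u => by simp [app_cons]
  | swap l l' W =>
    rw [wsp_cons, wsp_cons, show s + (l'.sp + (l.sp + wsp W)) = s + l.sp + l'.sp + wsp W by ring]
    have key : LC s (Cstr.len (1 + W.length) QF) (s + l.sp + l'.sp + wsp W) fun X u =>
        app X W (s + l.sp + l'.sp) (op X l (s + l'.sp) (op X l' s u) - op X l' (s + l.sp) (op X l s u)) := by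
      by_cases hl : l = .f ∨ l' = .f
      · exact ((LC_swap s l l').mono (Q' := Cstr.len 1 QF) fun W w d hW => ⟨hW.1, hW.2.2 hl⟩).app_len 1 stable_QF W
      · exact LC.app_QF W (by simp [not_or] at hl; simpa [Ne.symm hl.1, Ne.symm hl.2] using hf)
          ((LC_swap s l l').mono (Q' := Cstr.len 1 (QB s)) fun W w d hW => ⟨hW.1, hW.2.1⟩)
    refine (key.mono fun W w d hW => ⟨hW.1.trans (by simp; omega), hW.2⟩).congr fun X u => ?_
    rw [app_sub, app_cons, app_cons, app_cons, app_cons, add_right_comm s]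
  | trans h1 h2 i1 i2 =>
    have e : ∀ {V V' : List Letter}, V.Perm V' → wsp V = wsp V' := fun h => (h.map _).sum_eq
    have j2 := i2 (h1.mem_iff.1 hf) s; rw [← h1.length_eq, ← e h1] at j2; exact ((i1 hf s).add j2).congr fun X u => by ring

/-- Words of length at most `n` with coefficients `O(r^{-a})`. -/
def QL (n a : ℕ) : Cstr := fun W w _ => W.length ≤ n ∧ a ≤ w

lemma LC_op3 (l : Letter) (s : ℤ) : ∃ F G : ∀ X : Adm, X.Sm → X.Sm, LC s (QL 0 0) (s + l.sp) F ∧ LC s (QL 1 1) (s + l.sp) G ∧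
    ∀ X u, X.op3 (op X l s u) = op X l s (X.op3 u) + F X (X.op3 u) + G X u := by
  have q0 : ∀ {w d}, QL 0 0 [] w d := by simp [QL]
  cases l
  · have h : Coef 0 2 0 fun X => -(X.kS X.B.M * (X.riS * X.riS)) := (mass.mul' (Coef.ri.mul' Coef.ri)).neg
    refine ⟨_, _, LC.term0 h q0 (by simp [Letter.sp]), LC.zero _, fun X u => ?_⟩
    simp only [op, op3_mul]; rw [show X.op3 X.delS = -(X.kS X.B.M * X.riS ^ 2) by rw [op3, dP_delS]]
    ring
  · have h1 := (const 2).mul' coef_omS; have h2 := (const (-2)).mul' (rot.mul' (sinm.mul' (oneSub.mul' (zp.mul' zm))))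
    have h3 := (const 2).mul' (rot.mul' (sinp.mul' (oneSub.mul' (zm.mul' zm))))
    refine ⟨_, _, LC.term0 h1 q0 (by simp [Letter.sp]), ((LC.term1 .p h2 (by simp [QL])
      (by simp [Letter.sp])).add (LC.term1 .m h3 (by simp [QL]) (by simp [Letter.sp]))).add
      (LC.spin s coef_3f (by simp [QL]) (by simp [Letter.sp])), fun X u => ?_⟩
    have := (X.comm s u).f3; simp only [map_neg, map_ofNat, ← rz_eq]; linear_combination this
  · refine ⟨_, _, LC.zero _, (LC.term1 .p zm (by simp [QL]) (by simp [Letter.sp])).add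
      (LC.spin s ((rot.mul' (sinp.mul' (zm.mul' (zm.mul' zm)))).cast (t := 1) (w' := 1) (d' := 0) fun _ => rfl) (by simp [QL]) (by simp [Letter.sp]; ring)),
      fun X u => ?_⟩
    linear_combination (X.comm s u).p3
  · refine ⟨_, _, LC.zero _, (LC.term1 .m zp (by simp [QL]) (by simp [Letter.sp])).add
      (LC.spin s ((rot.mul' (sinm.mul' (zp.mul' (zp.mul' zp)))).cast (t := -1) (w' := 1) (d' := 0) fun _ => rfl) (by simp [QL]) (by simp [Letter.sp]; ring)),
      fun X u => ?_⟩
    linear_combination (X.comm s u).m3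

def QS (n a : ℕ) : Cstr := fun W w _ => W.length < n ∧ a ≤ w

lemma LC.app_QL {s t n a F} (h : LC s (QL n a) t F) (V : List Letter) :
    LC s (QL (n + V.length) a) (t + wsp V) fun X u => Adm.app X V t (F X u) :=
  h.app_len (Q := fun _ w _ => a ≤ w) n (fun _ _ _ _ h => ⟨h, by omega⟩) V

lemma LC_op3_app (W : List Letter) (s : ℤ) : ∃ F G : ∀ X : Adm, X.Sm → X.Sm,
    LC s (QS W.length 0) (s + wsp W) F ∧ LC s (QL W.length 1) (s + wsp W) G ∧
    ∀ X u, X.op3 (app X W s u) = app X W s (X.op3 u) + F X (X.op3 u) + G X u := by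
  induction W generalizing s with
  | nil => exact ⟨_, _, LC.zero _, LC.zero _, fun X u => by simp⟩
  | cons l W ih =>
    obtain ⟨F, G, hF, hG, h⟩ := ih (s + l.sp); obtain ⟨F', G', hF', hG', h'⟩ := LC_op3 l s
    have e : s + wsp (l :: W) = s + l.sp + wsp W := by simp; ring
    rw [e]; rcases Nat.eq_zero_or_pos W.length with h0 | h0
    · have h0 := List.length_eq_zero_iff.1 h0; subst h0
      refine ⟨F', G', by simpa using hF'.mono (Q' := QS 1 0) (fun W w d hW => ⟨by have := hW.1; omega, hW.2⟩), by simpa using hG', fun X u => ?_⟩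
      exact h' X u
    · have hF2 : LC (s + l.sp) (QL (W.length - 1) 0) (s + l.sp + wsp W) F :=
        hF.mono fun V w d hV => ⟨by have := hV.1; omega, hV.2⟩
      have l1 : LC s (QL 1 0) (s + l.sp) fun X u => op X l s u :=
        (LC.term1 (Q := QL 1 0) l one (by simp [QL]) (by ring)).congr fun X u => by simp
      refine ⟨_, _, (((hF'.app_QL W).mono (Q' := QS (l :: W).length 0) ?_).add
        (((LC.comp hF2 l1).mono (Q' := QS (l :: W).length 0) ?_).add
          ((LC.comp hF2 hF').mono (Q' := QS (l :: W).length 0) ?_))),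
        ((hG'.app_QL W).mono (Q' := QL (l :: W).length 1) ?_).add
        (((LC.comp hF2 hG').mono (Q' := QL (l :: W).length 1) ?_).add
        ((LC.comp hG l1).mono (Q' := QL (l :: W).length 1) ?_)), fun X u => ?_⟩
      any_goals
        rintro V w d ⟨h1, h2⟩; exact ⟨by simp only [List.length_cons]; omega, by omega⟩
      simp only [app_cons]; rw [h X (op X l s u), h' X u, app_add, app_add, hF.map_add, hF.map_add]; ring

lemma coef_op_r (l : Letter) : ∃ c : ∀ X : Adm, X.Sm, Coef l.sp 1 l.dg c ∧ ∀ X : Adm, op X l 0 X.rS = X.rS * c X := by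
  cases l
  · refine ⟨_, (del.mul' Coef.ri).neg.cast (fun _ => rfl) rfl le_rfl (by simp [Letter.dg]), fun X => ?_⟩
    simp only [op, op3, dP_rS]; linear_combination X.delS * X.riS_mul
  · refine ⟨_, (dzs.mul' Coef.ri).cast (fun _ => rfl) rfl le_rfl (by simp [Letter.dg]), fun X => ?_⟩
    rw [op_f_of_isSt X.isSt_rS, dP_rS]; push_cast; linear_combination -X.DZS * X.riS_mul
  · exact ⟨_, Coef.zero _ _ _, fun X => by rw [op_p_of_isSt X.isSt_rS, pd_rS]; simp⟩
  · exact ⟨_, Coef.zero _ _ _, fun X => by rw [op_m_of_isSt X.isSt_rS, pd_rS]; simp⟩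

lemma LC.app_r {s t : ℤ} {Q : Cstr} {n G} (h : LC s (Cstr.len n Q) t G) (hQ : Q.Stable)
    (V : List Letter) : ∃ F, LC s (Cstr.len (n + V.length) Q) (t + wsp V) F ∧
      ∀ X u, Adm.app X V t (X.rS * G X u) = X.rS * F X u := by
  induction V generalizing n t G with
  | nil => exact ⟨G, by simpa using h, fun X u => rfl⟩
  | cons l V ih =>
    obtain ⟨c, hc, hr⟩ := coef_op_r l
    have h1 := h.op (Q' := Cstr.len (n + 1) Q) l fun W w d hW =>
      ⟨⟨by simpa using hW.1, (hQ l _ _ _ hW.2).1⟩, by have := hW.1; omega, (hQ l _ _ _ hW.2).2⟩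
    have h2 := LC.coef_mul (Q' := Cstr.len (n + 1) Q) hc h fun W w d hW =>
      ⟨by have := hW.1; omega, by rw [add_comm 1, add_comm _ d]; exact (hQ l _ _ _ hW.2).2⟩
    rw [add_comm l.sp t] at h2; obtain ⟨F, hF, e⟩ := ih (h2.add h1); refine ⟨F, ?_, fun X u => ?_⟩
    · rw [wsp_cons, ← add_assoc]; exact hF.mono fun W w d hW => ⟨by have := hW.1; simp only [List.length_cons]; omega, hW.2⟩
    · rw [app_cons, ← e X u]; have := op_mul (X := X) l 0 t X.rS (G X u); rw [zero_add] at this; rw [this, hr]; congr 1; ring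

/-- Words of the form occurring in the commuted energies. -/
def IsCan (W : List Letter) : Prop := ∃ (σ : List Letter) (j₂ j₁ : ℕ), (∀ l ∈ σ, l = .p ∨ l = .m) ∧
  W = σ ++ List.replicate j₂ .f ++ List.replicate j₁ .d

lemma exists_isCan_perm (W : List Letter) : ∃ W', IsCan W' ∧ W.Perm W' := by
  induction W with
  | nil => exact ⟨[], ⟨[], 0, 0, by simp⟩, .nil⟩
  | cons l W ih =>
    obtain ⟨_, ⟨σ, j₂, j₁, hσ, rfl⟩, h⟩ := ih
    cases l
    · refine ⟨_, ⟨σ, j₂, j₁ + 1, hσ, rfl⟩, (h.cons _).trans ?_⟩; rw [List.replicate_succ]; exact List.perm_middle.symm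
    · refine ⟨_, ⟨σ, j₂ + 1, j₁, hσ, rfl⟩, (h.cons _).trans ?_⟩
      rw [List.replicate_succ, List.append_assoc, List.append_assoc, List.cons_append]; exact List.perm_middle.symm
    · exact ⟨_, ⟨.p :: σ, j₂, j₁, by simpa using hσ, rfl⟩, h.cons _⟩
    · exact ⟨_, ⟨.m :: σ, j₂, j₁, by simpa using hσ, rfl⟩, h.cons _⟩

lemma exists_isCan_concat_perm {W : List Letter} {l : Letter} (hl : l ∈ W) :
    ∃ W', IsCan W' ∧ W.Perm (W' ++ [l]) ∧ W'.length + 1 = W.length := by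
  obtain ⟨W', h, hp⟩ := exists_isCan_perm (W.erase l)
  have := (List.perm_cons_erase hl).trans ((hp.cons l).trans (List.perm_append_singleton l W').symm)
  exact ⟨W', h, this, by simpa using this.length_eq.symm⟩

instance : Fintype Letter := ⟨{.d, .f, .p, .m}, fun l => by cases l <;> simp⟩

lemma word_induction (T : List Letter → ℝ → Prop) (hT : ∀ W C C', C ≤ C' → T W C → T W C') (n : ℕ)
    (step : ∀ W, W.length ≤ n → ∀ C, 0 ≤ C → (∀ V, V.length < W.length → T V C) →
      ∃ C', 0 ≤ C' ∧ T W C') : ∃ C, 0 ≤ C ∧ ∀ W, W.length ≤ n → T W C := by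
  suffices h : ∀ k, k ≤ n + 1 → ∃ C, 0 ≤ C ∧ ∀ W, W.length < k → T W C by
    obtain ⟨C, hC, h⟩ := h (n + 1) le_rfl; exact ⟨C, hC, fun W hW => h W (by omega)⟩
  intro k
  induction k with
  | zero => exact fun _ => ⟨0, le_rfl, fun W hW => by omega⟩
  | succ k ih =>
    intro hk; obtain ⟨C, hC, h⟩ := ih (by omega)
    have h' : ∀ W : List Letter, ∃ C', 0 ≤ C' ∧ (W.length = k → T W C') := fun W => by
      by_cases hW : W.length = k
      · obtain ⟨C', h1, h2⟩ := step W (by omega) C hC fun V hV => h V (by omega)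
        exact ⟨C', h1, fun _ => h2⟩
      · exact ⟨0, le_rfl, fun h => absurd h hW⟩
    choose D hD hD' using h'; obtain ⟨E, hE⟩ := ((List.finite_length_eq Letter k).image D).bddAbove
    refine ⟨max C E, le_max_of_le_left hC, fun W hW => ?_⟩; rcases Nat.lt_succ_iff_lt_or_eq.1 hW with hW | hW
    · exact hT _ _ _ (le_max_left _ _) (h W hW)
    · exact hT _ _ _ ((hE ⟨W, hW, rfl⟩).trans (le_max_right _ _)) (hD' W hW)

/-- Bounds on the commuted fields `ς = r² α` in the frame component `u`. -/
def HypA (X : Adm) (n : ℕ) (s : ℤ) (u : X.Sm) (q : X.dom) (K : ℝ) : Prop :=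
  0 ≤ K ∧ ∀ W, IsCan W → W.length ≤ n → (∀ l, ‖(op X l (s + wsp W) (app X W s u)).1 q‖ ≤ K) ∧
    ‖(X.op3 (app X W s u)).1 q‖ ≤ K ∧ X.ri q * ‖(app X W s u).1 q‖ ≤ K

lemma norm_tri {X : Adm} (u v : X.Sm) (q : X.dom) : ‖u.1 q‖ ≤ ‖(u - v).1 q‖ + ‖v.1 q‖ := by
  have : u.1 q = (u - v).1 q + v.1 q := by simp
  rw [this]; exact norm_add_le _ _

lemma isCan_nil : IsCan [] := ⟨[], 0, 0, by simp⟩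

lemma ri_pow_le (X : Adm) (q : X.dom) {a w : ℕ} (h : a ≤ w) : X.ri q ^ w ≤ (X.B.M⁻¹) ^ (w - a) * X.ri q ^ a := by
  obtain ⟨k, rfl⟩ := Nat.exists_eq_add_of_le h
  rw [Nat.add_sub_cancel_left, pow_add, mul_comm]
  have := X.ri_pos q
  gcongr
  exact X.ri_le q

/-- A bound for the powers of `1/r` which is uniform in the exponents of a combination. -/
lemma LC.bound' {s t : ℤ} {Q : Cstr} {F} (h : LC s Q t F) {M : ℝ} (hM : 0 < M) :
    ∃ C : ℝ, 0 ≤ C ∧ ∀ X : Adm, X.B.M = M → ∀ (u : X.Sm) (q : X.dom) (K : ℝ), (∀ W w d, Q W w d → ∃ a b, a ≤ w ∧ b ≤ d ∧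
        X.ri q ^ a * X.de q ^ b * ‖(Adm.app X W s u).1 q‖ ≤ K) →
      ‖(F X u).1 q‖ ≤ C * K := by
  induction h with
  | zero t => exact ⟨0, le_rfl, fun X _ u q K _ => by simp⟩
  | @term W t₁ w d t c hc hq ht =>
    obtain ⟨C, hC, h⟩ := hc.bound hM
    refine ⟨C * ∑ k ∈ Finset.range (w + 1), (M⁻¹) ^ k, by positivity, fun X hX u q K hK => ?_⟩
    obtain ⟨a, b, ha, hb, hK⟩ := hK _ _ _ hq; have hr := X.ri_pos q; have hd0 := X.de_pos q
    have e1 : X.ri q ^ w ≤ (∑ k ∈ Finset.range (w + 1), (M⁻¹) ^ k) * X.ri q ^ a := by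
      refine (X.ri_pow_le q ha).trans (mul_le_mul_of_nonneg_right ?_ (by positivity))
      rw [hX]; exact single_le_sum (f := fun k => (M⁻¹) ^ k) (fun _ _ => by positivity) (Finset.mem_range.2 (by omega))
    have e2 : X.de q ^ d ≤ X.de q ^ b := pow_le_pow_of_le_one hd0.le (X.de_le q) hb; rw [mul_ap, norm_mul]
    calc _ ≤ C * X.ri q ^ w * X.de q ^ d * ‖(Adm.app X W s u).1 q‖ :=
          mul_le_mul_of_nonneg_right (h X hX q) (norm_nonneg _)
      _ ≤ C * ((∑ k ∈ Finset.range (w + 1), (M⁻¹) ^ k) * X.ri q ^ a) * X.de q ^ b * ‖(Adm.app X W s u).1 q‖ := by gcongr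
      _ = C * (∑ k ∈ Finset.range (w + 1), (M⁻¹) ^ k) * (X.ri q ^ a * X.de q ^ b * ‖(Adm.app X W s u).1 q‖) := by ring
      _ ≤ _ := by gcongr
  | add _ _ h1 h2 =>
    obtain ⟨C₁, hC₁, h1⟩ := h1; obtain ⟨C₂, hC₂, h2⟩ := h2; refine ⟨C₁ + C₂, by positivity, fun X hX u q K hK => ?_⟩
    rw [add_ap, add_mul]; exact (norm_add_le _ _).trans (add_le_add (h1 X hX u q K hK) (h2 X hX u q K hK))

section alpha

variable {M : ℝ} (hM : 0 < M) (n : ℕ) (s : ℤ)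
include hM

lemma ri_mul_le {X : Adm} (hX : X.B.M = M) {q : X.dom} {x y : ℝ} (hx : 0 ≤ x) (h : x ≤ y) : X.ri q * x ≤ M⁻¹ * y :=
  mul_le_mul (hX ▸ X.ri_le q) h hx (by positivity)

lemma alpha_words : ∃ C, 0 ≤ C ∧ ∀ W : List Letter, W.length ≤ n + 1 → ∀ X : Adm, X.B.M = M →
    ∀ u q K, HypA X n s u q K → X.ri q * ‖(app X W s u).1 q‖ ≤ C * K ∧ (W ≠ [] → ‖(app X W s u).1 q‖ ≤ C * K) := by
  refine word_induction _ ?_ (n + 1) ?_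
  · intro W C C' h hW X hX u q K hK; have := mul_le_mul_of_nonneg_right h hK.1
    exact ⟨(hW X hX u q K hK).1.trans this, fun h => ((hW X hX u q K hK).2 h).trans this⟩
  intro W hn C hC ih
  obtain rfl | ⟨W, l, rfl⟩ : W = [] ∨ ∃ V l, W = V ++ [l] := by simpa using List.eq_nil_or_concat W
  · refine ⟨1, zero_le_one, fun X hX u q K hK => ⟨?_, by simp⟩⟩
    simpa using (hK.2 [] isCan_nil (by simp)).2.2
  obtain ⟨W', hW', hp, hl⟩ := exists_isCan_concat_perm (W := W ++ [l]) (l := l) (by simp)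
  obtain ⟨D, hD, h⟩ := (LC_perm hp s).bound' hM
  have key : ∀ X : Adm, X.B.M = M → ∀ u q K, HypA X n s u q K → ‖(app X (W ++ [l]) s u).1 q‖ ≤ (D * C + 1) * K := by
    intro X hX u q K hK
    have h1 := h X hX u q (C * K) fun V w d hV => ⟨1, 0, hV.2.1, by simp, by
      simpa using (ih V (by have := hV.1; simp at this ⊢; omega) X hX u q K hK).1⟩
    refine (norm_tri _ (app X (W' ++ [l]) s u) q).trans ((add_le_add h1 (?_ : _ ≤ 1 * K)).trans (le_of_eq (by ring)))
    rw [app_concat, one_mul]; exact (hK.2 W' hW' (by omega)).1 l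
  refine ⟨(1 + M⁻¹) * (D * C + 1), by positivity, fun X hX u q K hK => ?_⟩
  have h1 := key X hX u q K hK
  have h0 : 0 ≤ (D * C + 1) * K := by have := hK.1; positivity
  have h2 := ri_mul_le hM hX (q := q) (norm_nonneg _) h1
  have h3 : 0 ≤ M⁻¹ * ((D * C + 1) * K) := by positivity
  exact ⟨by linarith, fun _ => by linarith⟩

lemma alpha_words_op3 : ∃ C, 0 ≤ C ∧ ∀ W : List Letter, W.length ≤ n → ∀ X : Adm, X.B.M = M →
    ∀ u q K, HypA X n s u q K → ‖(app X W s (X.op3 u)).1 q‖ ≤ C * K := by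
  obtain ⟨C₁, hC₁, h1⟩ := alpha_words hM n s
  refine word_induction _ ?_ n ?_
  · intro W C C' h hW X hX u q K hK; exact (hW X hX u q K hK).trans (mul_le_mul_of_nonneg_right h hK.1)
  intro W hn C hC ih
  rcases Nat.eq_zero_or_pos W.length with h0 | h0
  · obtain rfl : W = [] := List.length_eq_zero_iff.1 h0
    exact ⟨1, zero_le_one, fun X hX u q K hK => by simpa using (hK.2 [] isCan_nil (by simp)).2.1⟩
  obtain ⟨W', hW', hp⟩ := exists_isCan_perm W
  obtain ⟨D, hD, h⟩ := (LC_perm hp s).bound' hM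
  obtain ⟨F, G, hF, hG, e⟩ := LC_op3_app W' s
  obtain ⟨D₁, hD₁, hF⟩ := hF.bound' hM
  obtain ⟨D₂, hD₂, hG⟩ := hG.bound' hM
  refine ⟨D * (M⁻¹ * C) + D₁ * C + D₂ * C₁ + 1, by positivity, fun X hX u q K hK => ?_⟩
  have hl := hp.length_eq
  have a1 := h X hX (X.op3 u) q (M⁻¹ * (C * K)) fun V w d hV => by
    exact ⟨1, 0, hV.2.1, by simp, by
      simpa using ri_mul_le hM hX (norm_nonneg _) (ih V (by have := hV.1; omega) X hX u q K hK)⟩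
  have a2 := hF X hX (X.op3 u) q (C * K) fun V w d hV => ⟨0, 0, by simp, by simp, by
    simpa using ih V (by have := hV.1; omega) X hX u q K hK⟩
  have a3 := hG X hX u q (C₁ * K) fun V w d hV => ⟨1, 0, hV.2, by simp, by
    simpa using (h1 V (by have := hV.1; omega) X hX u q K hK).1⟩
  have a4 := (hK.2 W' hW' (by omega)).2.1
  rw [e] at a4
  have a5 : ‖(app X W' s (X.op3 u)).1 q‖ ≤ K + D₁ * (C * K) + D₂ * (C₁ * K) := by
    have : (app X W' s (X.op3 u)).1 q = (app X W' s (X.op3 u) + F X (X.op3 u) + G X u).1 q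
        - (F X (X.op3 u)).1 q - (G X u).1 q := by simp only [add_ap]; ring
    rw [this]; refine (norm_sub_le _ _).trans ?_
    have := norm_sub_le ((app X W' s (X.op3 u) + F X (X.op3 u) + G X u).1 q) ((F X (X.op3 u)).1 q); linarith
  refine (norm_tri _ (app X W' s (X.op3 u)) q).trans ((add_le_add a1 a5).trans (le_of_eq (by ring)))

end alpha

/-- The zeroth-order part of `𝔗̲` on the `r`-weighted field of rank `k`. -/
def ES (X : Adm) (k : ℕ) (s : ℤ) : X.Sm := (k : X.Sm) * (X.rS * X.DZS * X.zeS 1 * X.zeS (-1)) - X.DZS * X.riS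
    - (s : X.Sm) * (X.AS * X.cS * X.DZS * X.zeS 1 * X.zeS (-1)) + 2 * X.omS * X.zeS 1 ^ 2 * X.zeS (-1) ^ 2

lemma coef_ES (k : ℕ) (s : ℤ) : Coef 0 1 1 fun X => ES X k s := by
  have h1 : Coef 0 1 1 fun X => (k : X.Sm) * ((1 - X.AS * X.cS * X.zeS 1) * X.DZS * X.zeS (-1)) :=
    (((const k).mul' ((oneSub.mul' dzs).mul' zm)).weak).congr fun X => by simp
  have h2 := ((int s).mul' ((((rot.mul' cos).mul' dzs).mul' zp).mul' zm)).weak (w' := 1) (d' := 1)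
  have h3 := ((const 2).mul' coef_omS).weak (w' := 1) (d' := 1)
  refine (((h1.sub ((dzs.mul' Coef.ri).weak)).sub h2).add h3).congr fun X => ?_
  simp only [map_ofNat, ES, ← rz_eq]
  ring

lemma coef_ES_one (s : ℤ) : Coef 0 2 1 fun X => ES X 1 s := by
  have h1 : Coef 0 2 1 fun X => X.DZS * X.riS * (X.AS * X.cS * X.zeS (-1) - X.AS * X.cS * X.zeS 1
      - X.AS * X.AS * (X.cS * X.cS * X.zeS 1 * X.zeS (-1))) :=
    ((dzs.mul' Coef.ri).mul' ((((rot.mul' cos).mul' zm).sub ((rot.mul' cos).mul' zp)).sub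
      (((rot.mul' rot).mul' (((cos.mul' cos).mul' zp).mul' zm)).weak))).weak
  have h2 := ((int s).mul' ((((rot.mul' cos).mul' dzs).mul' zp).mul' zm)).weak (w' := 2) (d' := 1)
  have h3 := ((const 2).mul' coef_omS).weak (w' := 2) (d' := 1)
  refine ((h1.sub h2).add h3).congr fun X => ?_
  have e : X.DZS * X.riS * (X.AS * X.cS * X.zeS (-1) - X.AS * X.cS * X.zeS 1
      - X.AS * X.AS * (X.cS * X.cS * X.zeS 1 * X.zeS (-1))) =
      X.rS * X.DZS * X.zeS 1 * X.zeS (-1) - X.DZS * X.riS := by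
    have : X.AS * X.cS * X.zeS (-1) - X.AS * X.cS * X.zeS 1 - X.AS * X.AS * (X.cS * X.cS * X.zeS 1 * X.zeS (-1)) =
      X.rS * X.zeS 1 * (X.rS * X.zeS (-1)) - 1 := by rw [rz_eq, rzb_eq]; ring
    rw [this]; linear_combination (X.DZS * X.rS * X.zeS 1 * X.zeS (-1)) * X.riS_mul
  simp only [map_ofNat, ES, e]
  push_cast
  ring

/-- Bounds on the commuted fields `ς = r α̲` in the frame component `u`. -/
def HypU (X : Adm) (n : ℕ) (s : ℤ) (u : X.Sm) (q : X.dom) (K : ℝ) : Prop := 0 ≤ K ∧ ∀ W, IsCan W → W.length ≤ n →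
    (∀ l, l = .p ∨ l = .m → X.de q * ‖(op X l (s + wsp W) (app X W s u)).1 q‖ ≤ K) ∧
    X.de q * X.ri q * ‖(app X W s u).1 q‖ ≤ K ∧
    (X.ri q)⁻¹ * ‖(op X .f (s + wsp W) (app X W s u)
      + ES X (1 + (W.filter fun l => l = .p ∨ l = .m).length) (s + wsp W) * app X W s u).1 q‖ ≤ K

section ualpha

variable {M : ℝ} (hM : 0 < M) (n : ℕ) (s : ℤ)
include hM

lemma ualpha_words_del : ∃ C, 0 ≤ C ∧ ∀ W : List Letter, W.length ≤ n → ∀ X : Adm, X.B.M = M →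
    ∀ u q K, HypU X n s u q K → X.de q * X.ri q * ‖(app X W s u).1 q‖ ≤ C * K := by
  refine word_induction _ ?_ n ?_
  · intro W C C' h hW X hX u q K hK; exact (hW X hX u q K hK).trans (mul_le_mul_of_nonneg_right h hK.1)
  intro W hn C hC ih
  obtain ⟨W', hW', hp⟩ := exists_isCan_perm W
  obtain ⟨D, hD, h⟩ := (LC_perm hp s).bound' hM
  rcases Nat.eq_zero_or_pos W.length with h0 | h0
  · obtain rfl : W = [] := List.length_eq_zero_iff.1 h0
    exact ⟨1, zero_le_one, fun X hX u q K hK => by simpa using (hK.2 [] isCan_nil (by simp)).2.1⟩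
  refine ⟨M⁻¹ * (D * C) + 1, by positivity, fun X hX u q K hK => ?_⟩
  have hr := X.ri_pos q
  have hd := X.de_pos q
  have a1 := h X hX u q (C * K * (X.de q)⁻¹) fun V w d hV => ⟨1, 0, hV.2.1, by simp, by
    rw [le_mul_inv_iff₀ hd]; refine le_trans (le_of_eq ?_) (ih V (by have := hV.1; omega) X hX u q K hK)
    ring⟩
  have a2 := (hK.2 W' hW' (by rw [← hp.length_eq]; exact hn)).2.1
  have a3 : X.de q * X.ri q * ‖((fun X u => app X W s u - app X W' s u) X u).1 q‖ ≤ M⁻¹ * (D * C) * K := by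
    refine (mul_le_mul_of_nonneg_left a1 (by positivity)).trans ?_
    have : X.de q * X.ri q * (D * (C * K * (X.de q)⁻¹)) = X.ri q * (D * C * K) := by field_simp
    have hK0 := hK.1; rw [this]; have h1 : X.ri q * (D * C * K) ≤ M⁻¹ * (D * C * K) := ri_mul_le hM hX (by positivity) le_rfl
    linarith
  refine (mul_le_mul_of_nonneg_left (norm_tri _ (app X W' s u) q) (by positivity)).trans ?_
  grind

lemma ualpha_words_ang : ∃ C, 0 ≤ C ∧ ∀ W : List Letter, W.length ≤ n + 1 → (.p ∈ W ∨ .m ∈ W) →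
    ∀ X : Adm, X.B.M = M → ∀ u q K, HypU X n s u q K → X.de q * ‖(app X W s u).1 q‖ ≤ C * K := by
  obtain ⟨C₁, hC₁, h1⟩ := ualpha_words_del hM n s
  refine word_induction _ ?_ (n + 1) ?_
  · intro W C C' h hW hW' X hX u q K hK; exact (hW hW' X hX u q K hK).trans (mul_le_mul_of_nonneg_right h hK.1)
  intro W hn C hC ih
  by_cases hm : .p ∈ W ∨ .m ∈ W
  swap
  · exact ⟨0, le_rfl, fun h => absurd h hm⟩
  obtain ⟨l, hl, hlW⟩ : ∃ l : Letter, (l = .p ∨ l = .m) ∧ l ∈ W := by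
    rcases hm with h | h
    · exact ⟨.p, by simp, h⟩
    · exact ⟨.m, by simp, h⟩
  obtain ⟨W', hW', hp, hlen⟩ := exists_isCan_concat_perm hlW
  obtain ⟨D, hD, h⟩ := (LC_perm hp s).bound' hM
  refine ⟨D * C₁ + 1, by positivity, fun _ X hX u q K hK => ?_⟩
  have hr := X.ri_pos q
  have hd := X.de_pos q
  have a1 := h X hX u q (C₁ * K * (X.de q)⁻¹) fun V w d hV => ⟨1, 0, hV.2.1, by simp, by
    rw [le_mul_inv_iff₀ hd]; refine le_trans (le_of_eq ?_) (h1 V (by have := hV.1; omega) X hX u q K hK)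
    ring⟩
  have a2 := (hK.2 W' hW' (by omega)).1 l hl
  rw [← app_concat] at a2
  have a3 : X.de q * ‖((fun X u => app X W s u - app X (W' ++ [l]) s u) X u).1 q‖ ≤ (D * C₁) * K := by
    refine (mul_le_mul_of_nonneg_left a1 hd.le).trans (le_of_eq ?_); field_simp
  refine (mul_le_mul_of_nonneg_left (norm_tri _ (app X (W' ++ [l]) s u) q) hd.le).trans ?_
  grind

lemma ualpha_can_f (W : List Letter) (hW : IsCan W) (hn : W.length ≤ n) : ∃ C, 0 ≤ C ∧
    ∀ X : Adm, X.B.M = M → ∀ u q K, HypU X n s u q K → (X.ri q)⁻¹ * ‖(op X .f (s + wsp W) (app X W s u)).1 q‖ ≤ C * K := by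
  obtain ⟨C₁, hC₁, h1⟩ := ualpha_words_del hM n s
  obtain ⟨C₂, hC₂, h2⟩ := ualpha_words_ang hM n s
  obtain ⟨D, hD, h⟩ : ∃ D, 0 ≤ D ∧ ∀ X : Adm, X.B.M = M → ∀ u q K, HypU X n s u q K →
      (X.ri q)⁻¹ * ‖(ES X (1 + (W.filter fun l => l = .p ∨ l = .m).length) (s + wsp W) * app X W s u).1 q‖ ≤ D * K := by
    by_cases hm : .p ∈ W ∨ .m ∈ W
    · obtain ⟨E, hE, hE'⟩ := (coef_ES (1 + (W.filter fun l => l = .p ∨ l = .m).length) (s + wsp W)).bound hM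
      refine ⟨E * C₂, by positivity, fun X hX u q K hK => ?_⟩
      have hr := X.ri_pos q; have := h2 W (by omega) hm X hX u q K hK
      rw [mul_ap, norm_mul]
      calc _ ≤ (X.ri q)⁻¹ * ((E * X.ri q ^ 1 * X.de q ^ 1) * ‖(app X W s u).1 q‖) := by
            gcongr; exact hE' X hX q
        _ = E * (X.de q * ‖(app X W s u).1 q‖) := by field_simp
        _ ≤ E * (C₂ * K) := by gcongr
        _ = _ := by ring
    · obtain ⟨E, hE, hE'⟩ := (coef_ES_one (s + wsp W)).bound hM
      have e : (W.filter fun l => l = .p ∨ l = .m) = [] := by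
        rw [List.filter_eq_nil_iff]; rintro l hl; simp only [decide_eq_true_eq]
        rintro (rfl | rfl) <;> simp [hl] at hm
      refine ⟨E * C₁, by positivity, fun X hX u q K hK => ?_⟩
      have hr := X.ri_pos q; have := h1 W hn X hX u q K hK; rw [mul_ap, norm_mul, e]
      calc _ ≤ (X.ri q)⁻¹ * ((E * X.ri q ^ 2 * X.de q ^ 1) * ‖(app X W s u).1 q‖) := by
            gcongr; exact hE' X hX q
        _ = E * (X.de q * X.ri q * ‖(app X W s u).1 q‖) := by field_simp
        _ ≤ E * (C₁ * K) := by gcongr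
        _ = _ := by ring
  refine ⟨1 + D, by positivity, fun X hX u q K hK => ?_⟩
  have hr := X.ri_pos q
  have a1 := (hK.2 W hW hn).2.2
  have a2 := h X hX u q K hK
  have : ‖(op X .f (s + wsp W) (app X W s u)).1 q‖ ≤ ‖(op X .f (s + wsp W) (app X W s u)
      + ES X (1 + (W.filter fun l => l = .p ∨ l = .m).length) (s + wsp W) * app X W s u).1 q‖
      + ‖(ES X (1 + (W.filter fun l => l = .p ∨ l = .m).length) (s + wsp W) * app X W s u).1 q‖ := by
    rw [add_ap]; exact norm_le_add_norm_add _ _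
  calc _ ≤ _ := mul_le_mul_of_nonneg_left this (inv_nonneg.2 hr.le)
    _ ≤ _ := by rw [mul_add, add_mul, one_mul]; exact add_le_add a1 a2

lemma ualpha_words_f : ∃ C, 0 ≤ C ∧ ∀ W : List Letter, W.length ≤ n + 1 → .f ∈ W →
    ∀ X : Adm, X.B.M = M → ∀ u q K, HypU X n s u q K → (X.ri q)⁻¹ * ‖(app X W s u).1 q‖ ≤ C * K := by
  obtain ⟨C₁, hC₁, h1⟩ := ualpha_words_del hM n s
  obtain ⟨C₂, hC₂, h2⟩ := ualpha_words_ang hM n s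
  refine word_induction _ ?_ (n + 1) ?_
  · intro W C C' h hW hW' X hX u q K hK; exact (hW hW' X hX u q K hK).trans (mul_le_mul_of_nonneg_right h hK.1)
  intro W hn C hC ih
  by_cases hf : .f ∈ W
  swap
  · exact ⟨0, le_rfl, fun h => absurd h hf⟩
  obtain ⟨W', hW', hp, hlen⟩ := exists_isCan_concat_perm hf
  obtain ⟨D, hD, h⟩ := (LC_perm_f hp hf s).bound' hM
  obtain ⟨E, hE, hE'⟩ := ualpha_can_f hM n s W' hW' (by omega)
  refine ⟨D * (M⁻¹ * C + C₂ + C₁) + E, by positivity, fun _ X hX u q K hK => ?_⟩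
  have hr := X.ri_pos q
  have hd := X.de_pos q
  have hK0 := hK.1
  have b1 : 0 ≤ M⁻¹ * C * K := by positivity
  have b2 : 0 ≤ C₂ * K := by positivity
  have b3 : 0 ≤ C₁ * K := by positivity
  have a1 := h X hX u q ((M⁻¹ * C + C₂ + C₁) * K * X.ri q) fun V w d hV => by
    rcases hV.2 with ⟨hfV, hw⟩ | ⟨hang, hw, hd'⟩ | ⟨hw, hd'⟩
    · refine ⟨1, 0, hw, by simp, ?_⟩
      have := ih V (by have := hV.1; omega) hfV X hX u q K hK
      rw [inv_mul_le_iff₀ hr] at this; have t := ri_mul_le hM hX (q := q) (norm_nonneg _) this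
      simp only [pow_one, pow_zero, mul_one]; nlinarith
    · refine ⟨1, 1, hw, hd', ?_⟩; have := h2 V (by have := hV.1; omega) hang X hX u q K hK
      simp only [pow_one]; nlinarith
    · refine ⟨2, 1, hw, hd', ?_⟩; have := h1 V (by have := hV.1; omega) X hX u q K hK
      simp only [pow_one]; nlinarith
  have a2 := hE' X hX u q K hK
  rw [← app_concat] at a2
  have a3 : (X.ri q)⁻¹ * ‖((fun X u => app X W s u - app X (W' ++ [.f]) s u) X u).1 q‖ ≤ (D * (M⁻¹ * C + C₂ + C₁)) * K := by
    refine (mul_le_mul_of_nonneg_left a1 (inv_nonneg.2 hr.le)).trans (le_of_eq ?_); field_simp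
  refine (mul_le_mul_of_nonneg_left (norm_tri _ (app X (W' ++ [.f]) s u) q) (inv_nonneg.2 hr.le)).trans ?_
  rw [mul_add, add_mul]
  exact add_le_add a3 a2

end ualpha

/-- Constraint for contributions of `α`. -/
def QA : Cstr := fun W w _ => W ≠ [] ∨ 1 ≤ w
/-- Constraint for contributions of `α̲`. -/
def QG : Cstr := fun W w d => .f ∈ W ∨ (2 ≤ w ∧ 1 ≤ d)
/-- Constraint for contributions of `α̲` to the derivative `∇̸₃`. -/
def QD : Cstr := fun W _ d => (.p ∈ W ∨ .m ∈ W) ∧ 1 ≤ d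

lemma stable_QA : QA.Stable := fun l W w d _ => ⟨Or.inl (by simp), Or.inr (by omega)⟩
lemma stable_QG : QG.Stable := by
  rintro l W w d (h | h)
  · exact ⟨Or.inl (by simp [h]), Or.inl h⟩
  · exact ⟨Or.inr h, Or.inr (by omega)⟩
lemma stable_QD : QD.Stable := by
  rintro l W w d ⟨h, h'⟩
  refine ⟨⟨?_, h'⟩, h, by omega⟩
  rcases h with h | h <;> simp [h]

lemma norm_rS {X : Adm} (u : X.Sm) (q : X.dom) : ‖(X.rS * u).1 q‖ = (X.ri q)⁻¹ * ‖u.1 q‖ := by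
  rw [mul_ap, norm_mul, rS_ap, norm_real, norm_of_nonneg (X.r_pos q).le, ri, inv_inv]

/-- First-order equations for a middle component, in terms of `α` and `α̲`. -/
structure MidEqs (sA sU : ℤ) (F₁ F₂ G : Letter → ∀ X : Adm, X.Sm → X.Sm) : Prop where
  hF₁ : ∀ l, l ≠ .d → LC sA (Cstr.len 0 fun _ _ _ => True) l.sp (F₁ l)
  hF₂ : ∀ l, l ≠ .d → LC sA (Cstr.len 1 QA) l.sp (F₂ l)
  hG : ∀ l, l ≠ .d → LC sU (Cstr.len 1 QG) l.sp (G l)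
  hGd : LC sU (Cstr.len 1 QD) 0 (G .d)

/-- The equations hold for given functions. -/
def MidEqs.Holds (F₁ F₂ G : Letter → ∀ X : Adm, X.Sm → X.Sm) (X : Adm) (h α u : X.Sm) : Prop :=
  (∀ l, l ≠ .d → op X l 0 h = F₁ l X (X.op3 α) + F₂ l X α + X.rS * G l X u) ∧ op X .d 0 h = X.rS * G .d X u

lemma mid_words {sA sU : ℤ} {F₁ F₂ G : Letter → ∀ X : Adm, X.Sm → X.Sm}
    (hE : MidEqs sA sU F₁ F₂ G) {M : ℝ} (hM : 0 < M) (n : ℕ) :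
    ∃ C, 0 ≤ C ∧ ∀ W : List Letter, W.length ≤ n → W ≠ [] →
    ∀ X : Adm, X.B.M = M → ∀ h α u q K, MidEqs.Holds F₁ F₂ G X h α u → HypA X n sA α q K → HypU X n sU u q K →
      X.ri q * ‖(app X W 0 h).1 q‖ ≤ C * K ∧ ((∃ l ∈ W, l ≠ Letter.d) → ‖(app X W 0 h).1 q‖ ≤ C * K) := by
  obtain ⟨A₁, hA₁, a1⟩ := alpha_words hM n sA
  obtain ⟨A₂, hA₂, a2⟩ := alpha_words_op3 hM n sA
  obtain ⟨U₁, hU₁, u1⟩ := ualpha_words_del hM n sU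
  obtain ⟨U₂, hU₂, u2⟩ := ualpha_words_ang hM n sU
  obtain ⟨U₃, hU₃, u3⟩ := ualpha_words_f hM n sU
  refine word_induction _ ?_ n ?_
  · intro W C C' h hW hW' X hX φ α u q K hφ hα hu; have := mul_le_mul_of_nonneg_right h hα.1
    have h2 := hW hW' X hX φ α u q K hφ hα hu; exact ⟨h2.1.trans this, fun h => (h2.2 h).trans this⟩
  intro W hn C hC ih
  by_cases hd : ∃ l ∈ W, l ≠ Letter.d
  · obtain ⟨l, hl, hld⟩ := hd; obtain ⟨W', hW'⟩ : ∃ W', W' = W.erase l := ⟨_, rfl⟩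
    have hp : W.Perm (l :: W') := hW' ▸ List.perm_cons_erase hl; have hlen := hp.length_eq; rw [List.length_cons] at hlen
    obtain ⟨D, hD, h⟩ := (LC_perm hp 0).bound' hM
    obtain ⟨D₁, hD₁, h1⟩ := ((hE.hF₁ l hld).app_len _ (fun _ _ _ _ _ => ⟨trivial, trivial⟩) W').bound' hM
    obtain ⟨D₂, hD₂, h2⟩ := ((hE.hF₂ l hld).app_len _ stable_QA W').bound' hM
    obtain ⟨R, hR, hRe⟩ := (hE.hG l hld).app_r stable_QG W'; obtain ⟨D₃, hD₃, h3⟩ := hR.bound' hM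
    have key : ∀ X : Adm, X.B.M = M → ∀ φ α u q K, MidEqs.Holds F₁ F₂ G X φ α u → HypA X n sA α q K → HypU X n sU u q K →
        ‖(app X W 0 φ).1 q‖ ≤ (D * C + (D₁ * A₂ + D₂ * A₁ + D₃ * (U₃ + U₁))) * K := by
      intro X hX φ α u q K hφ hα hu; have hr := X.ri_pos q; have hK0 := hα.1
      have b1 := h X hX φ q (C * K) fun V w d hV => ⟨1, 0, hV.2.1, by simp, by
        simpa using (ih V (by have := hV.1; omega) (by simpa using hV.2.2) X hX φ α u q K hφ hα hu).1⟩
      have b2 := h1 X hX (X.op3 α) q (A₂ * K) fun V w d hV => ⟨0, 0, by simp, by simp, by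
        simpa using a2 V (by have := hV.1; omega) X hX α q K hα⟩
      have b3 := h2 X hX α q (A₁ * K) fun V w d hV => by
        have := a1 V (by have := hV.1; omega) X hX α q K hα
        rcases hV.2 with hV | hw
        · exact ⟨0, 0, by simp, by simp, by simpa using this.2 hV⟩
        · exact ⟨1, 0, hw, by simp, by simpa using this.1⟩
      have b4 := h3 X hX u q ((U₃ + U₁) * K * X.ri q) fun V w d hV => by
        rcases hV.2 with hf | ⟨hw, hd⟩
        · refine ⟨0, 0, by simp, by simp, ?_⟩
          have := u3 V (by have := hV.1; omega) hf X hX u q K hu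
          rw [inv_mul_le_iff₀ hr] at this; have : 0 ≤ U₁ * K * X.ri q := by positivity
          simp only [pow_zero, one_mul]; nlinarith
        · refine ⟨2, 1, hw, hd, ?_⟩; have := u1 V (by have := hV.1; omega) X hX u q K hu
          have : 0 ≤ U₃ * K * X.ri q := by positivity
          simp only [pow_one]; nlinarith
      have b5 : ‖(X.rS * R X u).1 q‖ ≤ D₃ * (U₃ + U₁) * K := by
        rw [norm_rS]; refine (mul_le_mul_of_nonneg_left b4 (inv_nonneg.2 hr.le)).trans (le_of_eq ?_); field_simp
      have e : app X (l :: W') 0 φ = app X W' l.sp (F₁ l X (X.op3 α)) + app X W' l.sp (F₂ l X α) + X.rS * R X u := by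
        rw [app_cons, zero_add, hφ.1 l hld, app_add, app_add, hRe]
      refine (norm_tri _ (app X (l :: W') 0 φ) q).trans ?_; rw [add_mul]
      refine add_le_add (b1.trans (le_of_eq (by ring))) ?_
      rw [e, add_ap, add_ap]; refine (norm_add₃_le).trans ((add_le_add (add_le_add b2 b3) b5).trans (le_of_eq (by ring)))
    refine ⟨(1 + M⁻¹) * (D * C + (D₁ * A₂ + D₂ * A₁ + D₃ * (U₃ + U₁))), by positivity, fun _ X hX φ α u q K hφ hα hu => ?_⟩
    have k1 := key X hX φ α u q K hφ hα hu; have hK0 := hα.1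
    have k0 : 0 ≤ (D * C + (D₁ * A₂ + D₂ * A₁ + D₃ * (U₃ + U₁))) * K := by positivity
    have k2 := ri_mul_le hM hX (q := q) (norm_nonneg _) k1
    have k3 : 0 ≤ M⁻¹ * ((D * C + (D₁ * A₂ + D₂ * A₁ + D₃ * (U₃ + U₁))) * K) := by positivity
    exact ⟨by linarith, fun _ => by linarith⟩
  · rcases W with _ | ⟨l, W'⟩
    · exact ⟨0, le_rfl, fun h => absurd rfl h⟩
    obtain rfl : l = .d := by
      by_contra h; exact hd ⟨l, by simp, h⟩
    obtain ⟨R, hR, hRe⟩ := hE.hGd.app_r stable_QD W'; obtain ⟨D₃, hD₃, h3⟩ := hR.bound' hM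
    refine ⟨D₃ * U₂, by positivity, fun _ X hX φ α u q K hφ hα hu => ⟨?_, fun h => absurd h hd⟩⟩
    have hr := X.ri_pos q
    rw [app_cons, hφ.2, show (0 : ℤ) + Letter.d.sp = 0 from rfl, hRe, norm_rS, mul_inv_cancel_left₀ hr.ne', mul_assoc]
    refine h3 X hX u q (U₂ * K) fun V w d hV => ⟨0, 1, by simp, hV.2.2, ?_⟩
    simpa using u2 V (by have := hV.1; simp only [List.length_cons] at hn; omega) hV.2.1 X hX u q K hu

/-- Spherical coordinates. -/
def Sph (q : Pt) : Pt := sph (q 0) (q 1) (q 2) (q 3)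

lemma contDiff_Sph : ContDiff ℝ ∞ Sph := by
  have h : ∀ i : Fin 4, ContDiff ℝ ∞ fun q : Pt => q i := contDiff_coord
  rw [contDiff_pi]
  intro i
  fin_cases i
  · exact h 0
  · exact ((h 1).mul (Real.contDiff_sin.comp (h 2))).mul (Real.contDiff_cos.comp (h 3))
  · exact ((h 1).mul (Real.contDiff_sin.comp (h 2))).mul (Real.contDiff_sin.comp (h 3))
  · exact (h 1).mul (Real.contDiff_cos.comp (h 2))

lemma Sph_one (q : Pt) : Sph q 1 = q 1 * sin (q 2) * cos (q 3) := rfl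
lemma Sph_two (q : Pt) : Sph q 2 = q 1 * sin (q 2) * sin (q 3) := rfl
lemma Sph_three (q : Pt) : Sph q 3 = q 1 * cos (q 2) := rfl

lemma rad_Sph {q : Pt} (h : 0 ≤ q 1) : rad (Sph q) = q 1 := by
  rw [rad, Sph_one, Sph_two, Sph_three]
  have : (q 1 * sin (q 2) * cos (q 3)) ^ 2 + (q 1 * sin (q 2) * sin (q 3)) ^ 2 + (q 1 * cos (q 2)) ^ 2 = q 1 ^ 2 := by
    linear_combination (q 1) ^ 2 * sin (q 2) ^ 2 * sin_sq_add_cos_sq (q 3) + (q 1) ^ 2 * sin_sq_add_cos_sq (q 2)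
  rw [this, Real.sqrt_sq h]

lemma cosT_Sph {q : Pt} (h : 0 < q 1) : cosT (Sph q) = cos (q 2) := by
  rw [cosT, rad_Sph h.le, Sph_three]
  field_simp

lemma continuous_rad : Continuous rad := by
  unfold rad
  fun_prop

variable (X)

/-- The exterior in Cartesian coordinates, the horizon and the axis excluded. -/
def off : Set Pt := {p | 0 ≤ p 0 ∧ X.B.rPlus < rad p ∧ 0 < p 1 ^ 2 + p 2 ^ 2}

def offU : Set Pt := {p | X.B.rPlus < rad p ∧ 0 < p 1 ^ 2 + p 2 ^ 2}

lemma isOpen_offU : IsOpen X.offU := by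
  have h : Continuous fun p : Pt => p 1 ^ 2 + p 2 ^ 2 := by fun_prop
  exact (isOpen_lt continuous_const continuous_rad).inter (isOpen_lt continuous_const h)

lemma off_eq : X.off = {p | 0 ≤ p 0} ∩ X.offU := rfl

lemma off_eq' : X.off = X.B.region ∩ X.offU := by
  ext p
  exact ⟨fun h => ⟨⟨h.1, h.2.1.le⟩, h.2⟩, fun h => ⟨h.1.1, h.2⟩⟩

lemma off_subset_region : X.off ⊆ X.B.region := fun _ h => ⟨h.1, h.2.1.le⟩

lemma uniqueDiffOn_off : UniqueDiffOn ℝ X.off := by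
  rw [off_eq]
  refine UniqueDiffOn.inter ?_ X.isOpen_offU
  refine uniqueDiffOn_convex ?_ ⟨fun _ => 1, ?_⟩
  · intro p hp q hq s t hs ht _; have hp : 0 ≤ p 0 := hp; have hq : 0 ≤ q 0 := hq; show 0 ≤ s * p 0 + t * q 0; positivity
  · refine interior_maximal (s := {p : Pt | 0 ≤ p 0}) (t := {p : Pt | 0 < p 0}) (fun p (hp : 0 < p 0) => show 0 ≤ p 0 from hp.le)
      ?_ (by simp)
    exact isOpen_lt continuous_const (continuous_apply 0)

lemma fderivWithin_region {F : Pt → ℂ} {p : Pt} (hp : p ∈ X.off) :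
    fderivWithin ℝ F X.B.region p = fderivWithin ℝ F X.off p := by
  rw [off_eq', fderivWithin_inter (X.isOpen_offU.mem_nhds hp.2)]

lemma Sph_mem_off {q : Pt} (hq : q ∈ X.dom) : Sph q ∈ X.off := by
  have hr := X.r_pos ⟨q, hq⟩
  have hs := X.sin_pos ⟨q, hq⟩
  refine ⟨hq.1, by rw [rad_Sph hr.le]; exact hq.2.1, ?_⟩
  have : Sph q 1 ^ 2 + Sph q 2 ^ 2 = (q 1 * sin (q 2)) ^ 2 := by
    rw [Sph_one, Sph_two]; linear_combination (q 1) ^ 2 * sin (q 2) ^ 2 * sin_sq_add_cos_sq (q 3)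
  rw [this]
  positivity

lemma mapsTo_Sph : Set.MapsTo Sph X.dom X.off := fun _ h => X.Sph_mem_off h

/-- Smooth functions on `off`. -/
def Sf (F : Pt → ℂ) : Prop := ContDiffOn ℝ ∞ F X.off

variable {X}

lemma Sf.comp_Sph {F : Pt → ℂ} (h : X.Sf F) : ContDiffOn ℝ ∞ (fun q => F (Sph q)) X.dom :=
  ContDiffOn.comp h contDiff_Sph.contDiffOn X.mapsTo_Sph

lemma Sf.add {F G : Pt → ℂ} (h : X.Sf F) (h' : X.Sf G) : X.Sf fun p => F p + G p := ContDiffOn.add h h'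
lemma Sf.sub {F G : Pt → ℂ} (h : X.Sf F) (h' : X.Sf G) : X.Sf fun p => F p - G p := ContDiffOn.sub h h'
lemma Sf.neg {F : Pt → ℂ} (h : X.Sf F) : X.Sf fun p => -F p := ContDiffOn.neg h
lemma Sf.mul {F G : Pt → ℂ} (h : X.Sf F) (h' : X.Sf G) : X.Sf fun p => F p * G p := ContDiffOn.mul h h'
lemma Sf.sum {ι : Type*} {s : Finset ι} {F : ι → Pt → ℂ} (h : ∀ i ∈ s, X.Sf (F i)) :
    X.Sf fun p => ∑ i ∈ s, F i p := ContDiffOn.sum h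
lemma Sf.prod {ι : Type*} {s : Finset ι} {F : ι → Pt → ℂ} (h : ∀ i ∈ s, X.Sf (F i)) :
    X.Sf fun p => ∏ i ∈ s, F i p := contDiffOn_prod h
lemma Sf.const (c : ℂ) : X.Sf fun _ => c := contDiffOn_const
lemma Sf.ofReal {F : Pt → ℝ} (h : ContDiffOn ℝ ∞ F X.off) : X.Sf fun p => (F p : ℂ) := h.ofReal_comp

variable (X)

open Classical in
/-- Pullback of a function to spherical coordinates. -/
def pb (F : Pt → ℂ) : X.Sm := if h : X.Sf F then X.sm (fun q => F (Sph q)) h.comp_Sph else 0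

variable {X}

lemma pb_ap {F : Pt → ℂ} (h : X.Sf F) (q : X.dom) : (X.pb F).1 q = F (Sph q) := by rw [pb, dif_pos h, sm_apply]

/-- The coordinate derivative within the region. -/
def dW (X : Adm) (F : Pt → ℂ) (μ : Fin 4) : Pt → ℂ := fun p => fderivWithin ℝ F X.B.region p (stdVec μ)

lemma Sf.dW {F : Pt → ℂ} (h : X.Sf F) (μ : Fin 4) : X.Sf (X.dW F μ) := by
  have := (ContDiffOn.fderivWithin (m := ∞) h X.uniqueDiffOn_off (by simp)).clm_apply (contDiffOn_const (c := stdVec μ))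
  exact this.congr fun p hp => by rw [Adm.dW, X.fderivWithin_region hp]

lemma Sf_coord (μ : Fin 4) : X.Sf fun p => (p μ : ℂ) := Sf.ofReal (contDiff_coord μ).contDiffOn

variable (X) in
/-- The Cartesian coordinates. -/
def xS (μ : Fin 4) : X.Sm := X.pb fun p => (p μ : ℂ)

lemma xS_ap (μ : Fin 4) (q : X.dom) : (X.xS μ).1 q = (Sph q μ : ℝ) := pb_ap (Sf_coord μ) q

lemma pd_pb_ap {F : Pt → ℂ} (h : X.Sf F) (i : Fin 4) (q : X.dom) :
    (pd i (X.pb F)).1 q = fderivWithin ℝ F X.off (Sph q) (fderiv ℝ Sph q (stdVec i)) := by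
  have e : X.pb F = X.sm (fun q => F (Sph q)) h.comp_Sph := by rw [pb, dif_pos h]
  rw [e, pd_sm]
  have h1 : HasFDerivWithinAt F (fderivWithin ℝ F X.off (Sph q)) X.off (Sph q) :=
    ((h.differentiableOn (by simp)) _ (X.Sph_mem_off q.2)).hasFDerivWithinAt
  have h2 : HasFDerivWithinAt Sph (fderiv ℝ Sph q) X.dom q :=
    ((contDiff_Sph.differentiable (by simp)) _).hasFDerivAt.hasFDerivWithinAt
  have h3 := (h1.comp q.1 h2 X.mapsTo_Sph).fderivWithin (X.uniqueDiffOn_dom q q.2)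
  exact congrArg (fun L => L (stdVec i)) h3

lemma pd_pb {F : Pt → ℂ} (h : X.Sf F) (i : Fin 4) : pd i (X.pb F) = ∑ μ, pd i (X.xS μ) * X.pb (X.dW F μ) := by
  ext q : 1
  rw [pd_pb_ap h, sum_ap]
  have hp := X.Sph_mem_off q.2
  have hx : ∀ μ, (pd i (X.xS μ)).1 q = ((fderiv ℝ Sph q (stdVec i) μ : ℝ) : ℂ) := by
    intro μ; rw [xS, pd_pb_ap (Sf_coord μ)]
    have : HasFDerivAt (fun p : Pt => (p μ : ℂ)) (Complex.ofRealCLM.comp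
      (ContinuousLinearMap.proj (R := ℝ) (φ := fun _ : Fin 4 => ℝ) μ)) (Sph q) :=
      Complex.ofRealCLM.hasFDerivAt.comp _ (ContinuousLinearMap.proj (R := ℝ) (φ := fun _ : Fin 4 => ℝ) μ).hasFDerivAt
    rw [this.hasFDerivWithinAt.fderivWithin (X.uniqueDiffOn_off _ hp)]; rfl
  generalize fderiv ℝ Sph q (stdVec i) = v at *
  have hv : v = ∑ μ, v μ • stdVec μ := by
    ext ν; simp [stdVec, Finset.sum_apply, Pi.single_apply]
  conv_lhs => rw [hv]
  rw [map_sum]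
  refine sum_ext fun μ => ?_
  rw [mul_ap, pb_ap (h.dW μ), hx, dW, X.fderivWithin_region hp, map_smul, Complex.real_smul]

variable (X) in
/-- Vector fields, through their coefficients in the commuting frame `∂_t, ∂_r, ∂_θ, ∂_φ` of ingoing
Kerr coordinates. -/
abbrev VF : Type := Fin 4 → X.Sm

/-- The derivation given by a vector field. -/
def Vd (v : X.VF) : Derivation ℂ X.Sm X.Sm := v 0 • pd 0 + v 1 • X.dP + v 2 • pd 2 + v 3 • pd 3

lemma Vd_apply (v : X.VF) (u : X.Sm) : Vd v u = v 0 * pd 0 u + v 1 * X.dP u + v 2 * pd 2 u + v 3 * pd 3 u := rfl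

/-- The Cartesian components of a vector field. -/
def cart (v : X.VF) (μ : Fin 4) : X.Sm := Vd v (X.xS μ)

lemma Vd_pb {F : Pt → ℂ} (h : X.Sf F) (v : X.VF) : Vd v (X.pb F) = ∑ μ, cart v μ * X.pb (X.dW F μ) := by
  simp only [cart, Vd_apply, dP_apply, pd_pb h, Fin.sum_univ_four]
  ring

/-- The Lie bracket. -/
def brk (v w : X.VF) : X.VF := fun i => Vd v (w i) - Vd w (v i)

lemma Vd_brk (v w : X.VF) (u : X.Sm) : Vd (brk v w) u = Vd v (Vd w u) - Vd w (Vd v u) := by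
  have h01 := pd_comm (X := X) 0 0
  simp only [Vd_apply, brk, map_add, leibniz, smul_eq_mul, dP_pd0, pd2_dP, pd3_dP, pd2_pd0, pd3_pd0, pd3_pd2]
  ring

lemma cart_brk (v w : X.VF) (μ : Fin 4) : cart (brk v w) μ = Vd v (cart w μ) - Vd w (cart v μ) := Vd_brk _ _ _

variable (X) in
def cfS : X.Sm := X.coordFun 3 cos ((Real.contDiff_cos.comp (contDiff_coord 3)).contDiffOn)
variable (X) in
def sfS : X.Sm := X.coordFun 3 sin ((Real.contDiff_sin.comp (contDiff_coord 3)).contDiffOn)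
variable (X) in
def tS : X.Sm := X.coordFun 0 id ((contDiff_coord 0).contDiffOn)

lemma pd_cfS (i : Fin 4) : pd i X.cfS = if i = 3 then -X.sfS else 0 := by
  ext q : 1
  rw [cfS, X.pd_coordFun i 3 _ _ q (Real.hasDerivAt_cos _)]
  split_ifs <;> simp [sfS, coordFun]

lemma pd_sfS (i : Fin 4) : pd i X.sfS = if i = 3 then X.cfS else 0 := by
  ext q : 1
  rw [sfS, X.pd_coordFun i 3 _ _ q (Real.hasDerivAt_sin _)]
  split_ifs <;> simp [cfS, coordFun]

lemma pd_tS (i : Fin 4) : pd i X.tS = if i = 0 then 1 else 0 := by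
  ext q : 1
  rw [tS, X.pd_coordFun i 0 id _ q (hasDerivAt_id _)]
  split_ifs <;> simp

lemma xS_zero : X.xS 0 = X.tS := hext fun q => by rw [xS_ap]; rfl
lemma xS_one : X.xS 1 = X.rS * X.sS * X.cfS := hext fun q => by
  rw [xS_ap, Sph_one, Complex.ofReal_mul, Complex.ofReal_mul]; rfl
lemma xS_two : X.xS 2 = X.rS * X.sS * X.sfS := hext fun q => by
  rw [xS_ap, Sph_two, Complex.ofReal_mul, Complex.ofReal_mul]; rfl
lemma xS_three : X.xS 3 = X.rS * X.cS := hext fun q => by rw [xS_ap, Sph_three, Complex.ofReal_mul]; rfl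

lemma cart_zero (v : X.VF) : cart v 0 = v 0 - v 1 * X.hS := by
  simp only [cart, xS_zero, Vd_apply, dP_apply, pd_tS]
  simp
  ring

lemma cart_one (v : X.VF) : cart v 1 = v 1 * (X.sS * X.cfS + X.rS * X.sS * X.wS * X.sfS)
    + v 2 * (X.rS * X.cS * X.cfS) - v 3 * (X.rS * X.sS * X.sfS) := by
  simp only [cart, xS_one, Vd_apply, dP_apply, leibniz, pd_cfS, pd_rS, pd_sS, smul_eq_mul]
  simp
  ring

lemma cart_two (v : X.VF) : cart v 2 = v 1 * (X.sS * X.sfS - X.rS * X.sS * X.wS * X.cfS)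
    + v 2 * (X.rS * X.cS * X.sfS) + v 3 * (X.rS * X.sS * X.cfS) := by
  simp only [cart, xS_two, Vd_apply, dP_apply, leibniz, pd_sfS, pd_rS, pd_sS, smul_eq_mul]
  simp
  ring

lemma cart_three (v : X.VF) : cart v 3 = v 1 * X.cS - v 2 * (X.rS * X.sS) := by
  simp only [cart, xS_three, Vd_apply, dP_apply, leibniz, pd_cS, pd_rS, smul_eq_mul]
  simp
  ring

section smooth

variable (X)

lemma rad_pos_of_mem {p : Pt} (h : p ∈ X.offU) : 0 < rad p := X.rPlus_pos.trans h.1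

lemma smooth_coord (i : Fin 4) : ContDiffOn ℝ ∞ (fun p : Pt => p i) X.offU := (contDiff_coord i).contDiffOn

lemma smooth_rad : ContDiffOn ℝ ∞ rad X.offU := by
  refine ContDiffOn.sqrt (f := fun p : Pt => p 1 ^ 2 + p 2 ^ 2 + p 3 ^ 2) (by fun_prop) fun p hp => ?_
  have := X.rad_pos_of_mem hp
  exact (Real.sqrt_pos.1 this).ne'

lemma smooth_cosT : ContDiffOn ℝ ∞ cosT X.offU := (X.smooth_coord 3).div X.smooth_rad fun _ h => (X.rad_pos_of_mem h).ne'

lemma smooth_sinT2 : ContDiffOn ℝ ∞ sinT2 X.offU := contDiffOn_const.sub (X.smooth_cosT.pow 2)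

lemma smooth_Del : ContDiffOn ℝ ∞ X.B.Del X.offU :=
  ((X.smooth_rad.pow 2).sub (contDiffOn_const.mul X.smooth_rad)).add contDiffOn_const

lemma smooth_Sig : ContDiffOn ℝ ∞ X.B.Sig X.offU := (X.smooth_rad.pow 2).add (contDiffOn_const.mul (X.smooth_cosT.pow 2))

lemma Del_ne {p : Pt} (h : p ∈ X.offU) : X.B.Del p ≠ 0 := (X.Del_pos h.1).ne'

lemma Sig_ne {p : Pt} (h : p ∈ X.offU) : X.B.Sig p ≠ 0 := by
  have := X.rad_pos_of_mem h
  unfold Background.Sig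
  positivity

lemma smooth_iota : ContDiffOn ℝ ∞ (fun p => X.B.ι (rad p)) X.offU := X.hι.1.comp_contDiffOn X.smooth_rad

lemma smooth_hgt : ContDiffOn ℝ ∞ X.B.hgt X.offU :=
  ((X.contDiff_deriv_f.comp_contDiffOn X.smooth_rad).add (((contDiffOn_const.sub X.smooth_iota).mul
    ((X.smooth_rad.pow 2).add contDiffOn_const)).div X.smooth_Del fun _ h => X.Del_ne h)).add
    X.smooth_iota

lemma smooth_twist : ContDiffOn ℝ ∞ X.B.twist X.offU :=
  ((contDiffOn_const.sub X.smooth_iota).mul contDiffOn_const).div X.smooth_Del fun _ h => X.Del_ne h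

lemma smooth_drForm (v : Pt) : ContDiffOn ℝ ∞ (fun p => drForm p v) X.offU :=
  ContDiffOn.div ((((X.smooth_coord 1).mul contDiffOn_const).add
    ((X.smooth_coord 2).mul contDiffOn_const)).add ((X.smooth_coord 3).mul contDiffOn_const))
    X.smooth_rad fun _ h => (X.rad_pos_of_mem h).ne'

lemma smooth_dphiForm (v : Pt) : ContDiffOn ℝ ∞ (fun p => dphiForm p v) X.offU :=
  ContDiffOn.div (((X.smooth_coord 1).mul contDiffOn_const).sub
    ((X.smooth_coord 2).mul contDiffOn_const)) (X.smooth_rad.pow 2)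
    fun _ h => (pow_pos (X.rad_pos_of_mem h) 2).ne'

lemma smooth_dtIn (v : Pt) : ContDiffOn ℝ ∞ (fun p => X.B.dtIn p v) X.offU :=
  contDiffOn_const.add (X.smooth_hgt.mul (X.smooth_drForm v))

lemma smooth_dphiIn (v : Pt) : ContDiffOn ℝ ∞ (fun p => X.B.dphiIn p v) X.offU :=
  (X.smooth_dphiForm v).add ((X.smooth_twist.mul X.smooth_sinT2).mul (X.smooth_drForm v))

lemma smooth_roundForm (u v : Pt) : ContDiffOn ℝ ∞ (fun p => X.B.roundForm p u v) X.offU :=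
  (((contDiffOn_const.sub ((X.smooth_drForm u).mul (X.smooth_drForm v))).div (X.smooth_rad.pow 2)
    fun _ h => (pow_pos (X.rad_pos_of_mem h) 2).ne').add (X.smooth_twist.mul
    (((X.smooth_dphiForm u).mul (X.smooth_drForm v)).add ((X.smooth_drForm u).mul (X.smooth_dphiForm v))))).add
    ((((X.smooth_twist.pow 2).mul X.smooth_sinT2).mul (X.smooth_drForm u)).mul (X.smooth_drForm v))

lemma smooth_met (u v : Pt) : ContDiffOn ℝ ∞ (fun p => X.B.met p u v) X.offU := by
  have hm : ContDiffOn ℝ ∞ (fun p => 2 * X.B.M * rad p / X.B.Sig p) X.offU :=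
    (contDiffOn_const.mul X.smooth_rad).div X.smooth_Sig fun _ h => X.Sig_ne h
  have hm' : ContDiffOn ℝ ∞ (fun p => 2 * X.B.a * X.B.M * rad p / X.B.Sig p) X.offU :=
    (contDiffOn_const.mul X.smooth_rad).div X.smooth_Sig fun _ h => X.Sig_ne h
  have a := X.smooth_dtIn u
  have b := X.smooth_dtIn v
  have c := X.smooth_drForm u
  have d := X.smooth_drForm v
  have e := X.smooth_dphiIn u
  have f := X.smooth_dphiIn v
  exact ((((((contDiffOn_const.sub hm).neg.mul (a.mul b)).add ((a.mul d).add (c.mul b))).add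
    (X.smooth_Sig.mul (X.smooth_roundForm u v))).add ((contDiffOn_const.mul
    (contDiffOn_const.add hm)).mul (e.mul f))).sub (contDiffOn_const.mul ((c.mul f).add
    (e.mul d)))).sub (hm'.mul ((a.mul f).add (e.mul b)))

lemma off_subset_offU : X.off ⊆ X.offU := fun _ h => h.2

lemma smooth_dMet (l μ ν : Fin 4) : ContDiffOn ℝ ∞ (fun p => X.B.dMet p l μ ν) X.offU :=
  ((X.smooth_met (stdVec μ) (stdVec ν)).fderiv_of_isOpen X.isOpen_offU (by simp)).clm_apply contDiffOn_const

variable {X}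

lemma Sf.of_real {F : Pt → ℝ} (h : ContDiffOn ℝ ∞ F X.offU) : X.Sf fun p => (F p : ℂ) := Sf.ofReal (h.mono X.off_subset_offU)

end smooth

lemma met_symm (B : Background) (p u v : Pt) : B.met p u v = B.met p v u := by
  unfold Background.met Background.roundForm
  ring

/-- Complex-bilinear extension of the metric. -/
def metC (B : Background) (p : Pt) (x y : Fin 4 → ℂ) : ℂ := ∑ μ, ∑ ν, (B.met p (stdVec μ) (stdVec ν) : ℂ) * x μ * y ν

/-- Complex-linear extension of a one-form. -/
def formC (f : Pt → ℝ) (x : Fin 4 → ℂ) : ℂ := ∑ μ, (f (stdVec μ) : ℂ) * x μ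

lemma metC_eq (B : Background) (p : Pt) (x y : Fin 4 → ℂ) : metC B p x y =
    -(1 - 2 * B.M * rad p / B.Sig p) * (formC (B.dtIn p) x * formC (B.dtIn p) y)
    + (formC (B.dtIn p) x * formC (drForm p) y + formC (drForm p) x * formC (B.dtIn p) y)
    + B.Sig p * ((x 1 * y 1 + x 2 * y 2 + x 3 * y 3 - formC (drForm p) x * formC (drForm p) y) / rad p ^ 2
      + B.twist p * (formC (dphiForm p) x * formC (drForm p) y + formC (drForm p) x * formC (dphiForm p) y)
      + B.twist p ^ 2 * sinT2 p * formC (drForm p) x * formC (drForm p) y)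
    + B.a ^ 2 * (1 + 2 * B.M * rad p / B.Sig p) * (formC (B.dphiIn p) x * formC (B.dphiIn p) y)
    - B.a * (formC (drForm p) x * formC (B.dphiIn p) y + formC (B.dphiIn p) x * formC (drForm p) y)
    - 2 * B.a * B.M * rad p / B.Sig p
        * (formC (B.dtIn p) x * formC (B.dphiIn p) y + formC (B.dphiIn p) x * formC (B.dtIn p) y) := by
  have key : ∀ (R a b c : Fin 4 → ℂ) (T : Fin 4 → Fin 4 → ℂ) (k₁ k₂ k₃ k₄ k₅ k₆ k₇ k₈ : ℂ),
      ∑ μ, ∑ ν, (k₁ * (a μ * a ν) + (a μ * b ν + b μ * a ν) + k₂ * ((T μ ν - b μ * b ν) * k₃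
        + k₄ * (R μ * b ν + b μ * R ν) + k₅ * b μ * b ν) + k₆ * (c μ * c ν)
        - k₇ * (b μ * c ν + c μ * b ν) - k₈ * (a μ * c ν + c μ * a ν)) * x μ * y ν
      = k₁ * ((∑ μ, a μ * x μ) * (∑ μ, a μ * y μ))
        + ((∑ μ, a μ * x μ) * (∑ μ, b μ * y μ) + (∑ μ, b μ * x μ) * (∑ μ, a μ * y μ))
        + k₂ * (((∑ μ, ∑ ν, T μ ν * x μ * y ν) - (∑ μ, b μ * x μ) * (∑ μ, b μ * y μ)) * k₃
        + k₄ * ((∑ μ, R μ * x μ) * (∑ μ, b μ * y μ) + (∑ μ, b μ * x μ) * (∑ μ, R μ * y μ))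
        + k₅ * (∑ μ, b μ * x μ) * (∑ μ, b μ * y μ)) + k₆ * ((∑ μ, c μ * x μ) * (∑ μ, c μ * y μ))
        - k₇ * ((∑ μ, b μ * x μ) * (∑ μ, c μ * y μ) + (∑ μ, c μ * x μ) * (∑ μ, b μ * y μ))
        - k₈ * ((∑ μ, a μ * x μ) * (∑ μ, c μ * y μ) + (∑ μ, c μ * x μ) * (∑ μ, a μ * y μ)) := by
    intro R a b c T k₁ k₂ k₃ k₄ k₅ k₆ k₇ k₈; simp only [Fin.sum_univ_four]; ring
  have hT : ∑ μ : Fin 4, ∑ ν : Fin 4, ((stdVec μ 1 * stdVec ν 1 + stdVec μ 2 * stdVec ν 2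
      + stdVec μ 3 * stdVec ν 3 : ℝ) : ℂ) * x μ * y ν = x 1 * y 1 + x 2 * y 2 + x 3 * y 3 := by
    simp [Fin.sum_univ_four, stdVec]
  have h := key (fun μ => dphiForm p (stdVec μ)) (fun μ => B.dtIn p (stdVec μ))
    (fun μ => drForm p (stdVec μ)) (fun μ => B.dphiIn p (stdVec μ))
    (fun μ ν => ((stdVec μ 1 * stdVec ν 1 + stdVec μ 2 * stdVec ν 2
      + stdVec μ 3 * stdVec ν 3 : ℝ) : ℂ)) (-(1 - 2 * B.M * rad p / B.Sig p)) (B.Sig p)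
    (((rad p : ℂ) ^ 2)⁻¹) (B.twist p) (B.twist p ^ 2 * sinT2 p)
    (B.a ^ 2 * (1 + 2 * B.M * rad p / B.Sig p)) B.a (2 * B.a * B.M * rad p / B.Sig p)
  rw [hT] at h
  simp only [metC, formC, Background.met, Background.roundForm]
  simp only [div_eq_mul_inv _ ((rad p : ℂ) ^ 2), ← h]
  refine sum_ext fun μ => sum_ext fun ν => ?_
  push_cast
  ring

def gS (X : Adm) (μ ν : Fin 4) : X.Sm := X.pb fun p => (X.B.gMat p μ ν : ℂ)

lemma gS_ap (μ ν : Fin 4) (q : X.dom) : (X.gS μ ν).1 q = (X.B.met (Sph q) (stdVec μ) (stdVec ν) : ℂ) :=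
  pb_ap (F := fun p => (X.B.gMat p μ ν : ℂ)) (Sf.of_real (X.smooth_met _ _)) q

/-- The metric on vectors given by their Cartesian components. -/
def Gc (x y : Fin 4 → X.Sm) : X.Sm := ∑ μ, ∑ ν, X.gS μ ν * x μ * y ν

lemma Gc_ap (x y : Fin 4 → X.Sm) (q : X.dom) :
    (Gc x y).1 q = metC X.B (Sph q) (fun μ => (x μ).1 q) (fun μ => (y μ).1 q) := by
  simp [Gc, metC, gS_ap]

/-- The metric in the commuting frame. -/
def gEx (v w : X.VF) : X.Sm := -(1 - 2 * X.kS X.B.M * X.rS * X.zeS 1 * X.zeS (-1)) * (v 0 * w 0) + (v 0 * w 1 + v 1 * w 0)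
    + (X.rS ^ 2 - X.AS ^ 2 * X.cS ^ 2) * (v 2 * w 2 + X.sS ^ 2 * (v 3 * w 3))
    - X.AS ^ 2 * (1 + 2 * X.kS X.B.M * X.rS * X.zeS 1 * X.zeS (-1)) * X.sS ^ 4 * (v 3 * w 3)
    + X.AS * X.iS * X.sS ^ 2 * (v 1 * w 3 + v 3 * w 1)
    + X.AS * X.iS * (2 * X.kS X.B.M * X.rS * X.zeS 1 * X.zeS (-1)) * X.sS ^ 2 * (v 0 * w 3 + v 3 * w 0)

lemma hgt_Sph (q : X.dom) : X.B.hgt (Sph q) = X.hgtFun (q.1 1) := by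
  rw [Background.hgt, hgtFun, Background.Del, rad_Sph (X.r_pos q).le]

lemma twist_Sph (q : X.dom) : X.B.twist (Sph q) = X.twistFun (q.1 1) := by
  rw [Background.twist, twistFun, Background.Del, rad_Sph (X.r_pos q).le]

lemma Sig_Sph (q : X.dom) : X.B.Sig (Sph q) = q.1 1 ^ 2 + X.B.a ^ 2 * cos (q.1 2) ^ 2 := by
  rw [Background.Sig, rad_Sph (X.r_pos q).le, cosT_Sph (X.r_pos q)]

lemma Del_Sph (q : X.dom) : X.B.Del (Sph q) = q.1 1 ^ 2 - 2 * X.B.M * q.1 1 + X.B.a ^ 2 := by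
  rw [Background.Del, rad_Sph (X.r_pos q).le]

lemma sinT2_Sph (q : X.dom) : sinT2 (Sph q) = sin (q.1 2) ^ 2 := by
  rw [sinT2, cosT_Sph (X.r_pos q)]
  linear_combination -sin_sq_add_cos_sq (q.1 2)

@[simp] lemma cfS_ap (q : X.dom) : X.cfS.1 q = (cos (q.1 3) : ℝ) := rfl
@[simp] lemma sfS_ap (q : X.dom) : X.sfS.1 q = (sin (q.1 3) : ℝ) := rfl

lemma dr_cart (v : X.VF) (q : X.dom) : formC (drForm (Sph q)) (fun μ => (cart v μ).1 q) = (v 1).1 q := by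
  have hr := X.r_ne q
  have h1 := sq_c (q.1 2)
  have h2 := sq_c (q.1 3)
  simp only [formC, drForm, Fin.sum_univ_four, rad_Sph (X.r_pos q).le, Sph_one, Sph_two, Sph_three,
    cart_zero, cart_one, cart_two, cart_three, add_ap, sub_ap, mul_ap, rS_ap, sS_ap, cS_ap, cfS_ap,
    sfS_ap, stdVec]
  simp only [Pi.single_apply, Fin.reduceEq, if_true, if_false, mul_zero, mul_one, add_zero, zero_add,
    Complex.ofReal_div, Complex.ofReal_mul, zero_div, Complex.ofReal_zero, zero_mul, Fin.isValue,
    Complex.ofReal_add]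
  field_simp
  grind

lemma dphi_cart (v : X.VF) (q : X.dom) : formC (dphiForm (Sph q)) (fun μ => (cart v μ).1 q)
      = X.sS.1 q ^ 2 * ((v 3).1 q - X.wS.1 q * (v 1).1 q) := by
  have hr := X.r_ne q
  have h2 := sq_c (q.1 3)
  simp only [formC, dphiForm, Fin.sum_univ_four, rad_Sph (X.r_pos q).le, Sph_one, Sph_two,
    cart_zero, cart_one, cart_two, cart_three, add_ap, sub_ap, mul_ap, rS_ap, sS_ap, cS_ap, cfS_ap,
    sfS_ap, stdVec]
  simp only [Pi.single_apply, Fin.reduceEq, if_true, if_false, mul_zero, mul_one, add_zero, zero_add,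
    Complex.ofReal_div, Complex.ofReal_mul, zero_div, Complex.ofReal_zero, zero_mul, Fin.isValue,
    sub_zero, zero_sub, ofReal_neg,
    Complex.ofReal_pow]
  field_simp
  grind

lemma dot_cart (v w : X.VF) (q : X.dom) : (cart v 1).1 q * (cart w 1).1 q + (cart v 2).1 q * (cart w 2).1 q
      + (cart v 3).1 q * (cart w 3).1 q = (v 1).1 q * (w 1).1 q + (q.1 1 : ℂ) ^ 2 *
        ((v 2).1 q * (w 2).1 q + X.sS.1 q ^ 2 * ((v 3).1 q - X.wS.1 q * (v 1).1 q)
          * ((w 3).1 q - X.wS.1 q * (w 1).1 q)) := by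
  have h1 := sq_c (q.1 2)
  have h2 := sq_c (q.1 3)
  simp only [cart_one, cart_two, cart_three, add_ap, sub_ap, mul_ap, rS_ap, sS_ap, cS_ap, cfS_ap, sfS_ap]
  grind

lemma dtIn_cart (v : X.VF) (q : X.dom) : formC (X.B.dtIn (Sph q)) (fun μ => (cart v μ).1 q) = (v 0).1 q := by
  have : formC (X.B.dtIn (Sph q)) (fun μ => (cart v μ).1 q) = (cart v 0).1 q
      + X.hS.1 q * formC (drForm (Sph q)) (fun μ => (cart v μ).1 q) := by
    simp only [formC, Background.dtIn, Fin.sum_univ_four, hgt_Sph, hS_ap]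
    simp only [stdVec, Pi.single_apply, Fin.reduceEq, if_true, if_false, Fin.isValue]; push_cast; ring
  rw [this, dr_cart, cart_zero, sub_ap, mul_ap]
  ring

lemma dphiIn_cart (v : X.VF) (q : X.dom) :
    formC (X.B.dphiIn (Sph q)) (fun μ => (cart v μ).1 q) = X.sS.1 q ^ 2 * (v 3).1 q := by
  have : formC (X.B.dphiIn (Sph q)) (fun μ => (cart v μ).1 q) = formC (dphiForm (Sph q)) (fun μ => (cart v μ).1 q)
      + X.wS.1 q * X.sS.1 q ^ 2 * formC (drForm (Sph q)) (fun μ => (cart v μ).1 q) := by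
    simp only [formC, Background.dphiIn, Fin.sum_univ_four, twist_Sph, sinT2_Sph, wS_ap, sS_ap]; push_cast; ring
  rw [this, dr_cart, dphi_cart]
  ring

lemma sig_inv (q : X.dom) : ((q.1 1 : ℂ) ^ 2 + (X.B.a : ℂ) ^ 2 * (cos (q.1 2) : ℂ) ^ 2)⁻¹
    = (X.zeS 1).1 q * (X.zeS (-1)).1 q := by
  rw [zp_ap, zm_ap, ← mul_inv]
  congr 1
  linear_combination ((X.B.a : ℂ) ^ 2 * (cos (q.1 2) : ℂ) ^ 2) * I_sq

lemma Gc_cart (v w : X.VF) : Gc (cart v) (cart w) = gEx v w := by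
  ext q : 1
  have hr := X.r_ne q
  rw [Gc_ap, metC_eq, dot_cart, dr_cart, dr_cart, dphi_cart, dphi_cart, dtIn_cart, dtIn_cart,
    dphiIn_cart, dphiIn_cart, Sig_Sph, rad_Sph (X.r_pos q).le, sinT2_Sph, twist_Sph]
  simp only [div_eq_mul_inv _ (((q.1 1 ^ 2 + X.B.a ^ 2 * cos (q.1 2) ^ 2 : ℝ)) : ℂ)]
  simp only [Complex.ofReal_add, Complex.ofReal_mul, Complex.ofReal_pow, sig_inv]
  simp only [gEx, add_ap, mul_ap, neg_ap, sub_ap, pow_ap, one_ap, ofNat_ap, rS_ap, algebraMap_ap,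
    AS_ap, iS_ap, cS_ap, sS_ap, wS_ap]
  have hI := I_sq
  field_simp
  grind

variable (X) in
def E3 : X.VF := ![0, -1, 0, 0]
variable (X) in
def E4 : X.VF := ![X.zeS 1 * X.zeS (-1) * (2 * (X.rS ^ 2 - X.AS ^ 2 * (X.sS ^ 2 + X.cS ^ 2))),
  X.zeS 1 * X.zeS (-1) * X.DelS, 0, X.zeS 1 * X.zeS (-1) * (-2 * X.AS * X.iS)]
variable (X) in
def Ep : X.VF := ![X.zeS (-1) * (X.AS * X.sS), 0, X.zeS (-1), X.zeS (-1) * (X.iS * X.siS)]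
variable (X) in
def Em : X.VF := ![-(X.zeS 1 * (X.AS * X.sS)), 0, X.zeS 1, -(X.zeS 1 * (X.iS * X.siS))]

variable (X) in
def fr : Fin 4 → X.VF := ![X.E3, X.E4, X.Ep, X.Em]

lemma Vd_E3 (u : X.Sm) : Vd X.E3 u = X.op3 u := by simp [Vd_apply, E3, op3]
lemma Vd_E4 (u : X.Sm) : Vd X.E4 u = X.e4op u := by simp [Vd_apply, E4, e4op]; ring
lemma Vd_Ep (u : X.Sm) : Vd X.Ep u = X.zeS (-1) * X.Lop 1 u := by simp [Vd_apply, Ep, Lop]; ring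
lemma Vd_Em (u : X.Sm) : Vd X.Em u = X.zeS 1 * X.Lop (-1) u := by simp [Vd_apply, Em, Lop]; ring

/-- The inner products of the null frame. -/
def eta : Matrix (Fin 4) (Fin 4) ℂ := !![0, -2, 0, 0; -2, 0, 0, 0; 0, 0, 0, 2; 0, 0, 2, 0]

lemma gEx_symm (v w : X.VF) : gEx v w = gEx w v := by unfold gEx; ring

lemma gEx_fr (a b : Fin 4) : gEx (X.fr a) (X.fr b) = X.kS (eta a b) := by
  have key : ∀ a b : Fin 4, a ≤ b → gEx (X.fr a) (X.fr b) = X.kS (eta a b) := by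
    intro a b hab; ext q : 1
    have hz : (X.zeS 1).1 q * (((q.1 1 : ℝ) : ℂ) + I * X.B.a * (cos (q.1 2) : ℝ)) = 1 := by
      rw [zp_ap]; exact inv_mul_cancel₀ (X.zp_ne q)
    have hzb : (X.zeS (-1)).1 q * (((q.1 1 : ℝ) : ℂ) - I * X.B.a * (cos (q.1 2) : ℝ)) = 1 := by
      rw [zm_ap]; exact inv_mul_cancel₀ (X.zm_ne q)
    have hs := X.s_ne q; have hsi : X.siS.1 q * ((sin (q.1 2) : ℝ) : ℂ) = 1 := by rw [siS_ap]; exact inv_mul_cancel₀ hs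
    have h1 := sq_c (q.1 2); have hI := I_sq
    fin_cases a <;> fin_cases b <;> first | (exact absurd hab (by decide)) | skip
    all_goals
      simp only [gEx, fr, E3, E4, Ep, Em, eta, Matrix.cons_val, Fin.isValue, Fin.mk_one, Fin.zero_eta,
        Fin.reduceFinMk, of_apply, cons_val_zero, cons_val_one, 
        add_ap, mul_ap, neg_ap, sub_ap, pow_ap, one_ap, zero_ap, ofNat_ap, rS_ap, algebraMap_ap,
        AS_ap, iS_ap, cS_ap, sS_ap, DelS_ap]
      clear hs hab; grind
  rcases le_total a b with h | h
  · exact key a b h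
  · rw [gEx_symm, key b a h]; congr 1
    fin_cases a <;> fin_cases b <;> rfl

lemma exists_Sph {p : Pt} (hp : p ∈ X.off) : ∃ q ∈ X.dom, Sph q = p := by
  obtain ⟨h0, hr, hs⟩ := hp
  have hr0 : 0 < rad p := X.rPlus_pos.trans hr
  have hsq : rad p ^ 2 = p 1 ^ 2 + p 2 ^ 2 + p 3 ^ 2 := Real.sq_sqrt (by positivity)
  have hx : (p 3 / rad p) ^ 2 < 1 := by rw [div_pow, div_lt_one (by positivity)]; linarith
  obtain ⟨hx1, hx2⟩ := abs_lt.1 ((sq_lt_one_iff_abs_lt_one _).1 hx)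
  set z : ℂ := ⟨p 1, p 2⟩ with hz
  have hn : rad p * Real.sqrt (1 - (p 3 / rad p) ^ 2) = ‖z‖ := by
    rw [Complex.norm_eq_sqrt_sq_add_sq]
    nth_rw 1 [← Real.sqrt_sq hr0.le]
    rw [← Real.sqrt_mul (by positivity)]
    congr 1; field_simp; linarith
  have hc : rad p * cos (Real.arccos (p 3 / rad p)) = p 3 := by rw [Real.cos_arccos hx1.le hx2.le]; field_simp
  refine ⟨![p 0, rad p, Real.arccos (p 3 / rad p), z.arg], ⟨h0, hr, ?_, ?_⟩, ?_⟩
  · exact Real.arccos_pos.2 hx2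
  · refine lt_of_le_of_ne (Real.arccos_le_pi _) fun h => ?_; exact absurd (Real.arccos_eq_pi.1 h) (not_le.2 hx1)
  · ext i; fin_cases i
    · rfl
    · show rad p * sin (Real.arccos (p 3 / rad p)) * cos z.arg = p 1; rw [Real.sin_arccos, hn, Complex.norm_mul_cos_arg]
    · show rad p * sin (Real.arccos (p 3 / rad p)) * sin z.arg = p 2; rw [Real.sin_arccos, hn, Complex.norm_mul_sin_arg]
    · exact hc

def fc (X : Adm) (a : Fin 4) : Fin 4 → X.Sm := cart (X.fr a)

def etai : Matrix (Fin 4) (Fin 4) ℂ := !![0, -1/2, 0, 0; -1/2, 0, 0, 0; 0, 0, 0, 1/2; 0, 0, 1/2, 0]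

lemma etai_mul : etai * eta = 1 := by
  ext a b
  fin_cases a <;> fin_cases b <;> simp [etai, eta, mul_apply, Fin.sum_univ_four]

/-- The frame matrix. -/
def frM (q : X.dom) : Matrix (Fin 4) (Fin 4) ℂ := Matrix.of fun μ a => (X.fc a μ).1 q

def gM (q : X.dom) : Matrix (Fin 4) (Fin 4) ℂ := (X.B.gMat (Sph q)).map (algebraMap ℝ ℂ)

lemma gM_apply (q : X.dom) (μ ν : Fin 4) : gM q μ ν = (X.gS μ ν).1 q := (gS_ap μ ν q).symm

lemma frM_gM (q : X.dom) : (frM q).transpose * gM q * frM q = eta := by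
  ext a b
  have h := congrArg (fun u => u.1 q) (gEx_fr (X := X) a b)
  simp only [← Gc_cart, Gc, sum_ap, mul_ap, algebraMap_ap] at h
  rw [← h]
  simp only [mul_apply, sum_mul, gM_apply, Matrix.transpose_apply]
  rw [sum_comm]
  refine sum_ext fun μ => sum_ext fun ν => ?_
  simp only [frM, of_apply, fc]
  ring

lemma frM_inv (q : X.dom) : frM q * etai * (frM q).transpose * gM q = 1 := by
  have h : (etai * (frM q).transpose * gM q) * frM q = 1 := by
    have := congrArg (etai * ·) (frM_gM q); simpa only [etai_mul, Matrix.mul_assoc] using this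
  have := mul_eq_one_comm.1 h
  simpa only [Matrix.mul_assoc] using this

lemma det_gM_ne (q : X.dom) : (gM q).det ≠ 0 := by
  intro h
  have := congrArg Matrix.det (frM_inv q)
  rw [det_mul, h] at this
  simp at this

lemma det_gMat (q : X.dom) : ((X.B.gMat (Sph q)).det : ℂ) = (gM q).det := by
  rw [gM, ← RingHom.mapMatrix_apply, ← RingHom.map_det]; rfl

lemma det_gMat_ne {p : Pt} (hp : p ∈ X.off) : (X.B.gMat p).det ≠ 0 := by
  obtain ⟨q, hq, rfl⟩ := exists_Sph hp
  have := det_gM_ne (X := X) ⟨q, hq⟩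
  rw [← det_gMat] at this
  exact_mod_cast this

lemma gInv_map (q : X.dom) : (X.B.gInv (Sph q)).map (algebraMap ℝ ℂ) = frM q * etai * (frM q).transpose := by
  have h : X.B.gMat (Sph q) * X.B.gInv (Sph q) = 1 :=
    Matrix.mul_nonsing_inv _ (isUnit_iff_ne_zero.2 (det_gMat_ne (X.Sph_mem_off q.2)))
  have h' : gM q * (X.B.gInv (Sph q)).map (algebraMap ℝ ℂ) = 1 := by
    rw [gM, ← Matrix.map_mul, h]; simp
  have := congrArg (· * (X.B.gInv (Sph q)).map (algebraMap ℝ ℂ)) (frM_inv q)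
  grind

lemma smooth_det {A : Pt → Matrix (Fin 4) (Fin 4) ℝ} (h : ∀ i j, ContDiffOn ℝ ∞ (fun p => A p i j) X.off) :
    ContDiffOn ℝ ∞ (fun p => (A p).det) X.off := by
  simp only [Matrix.det_apply']
  exact ContDiffOn.sum fun σ _ => contDiffOn_const.mul (contDiffOn_prod fun i _ => h _ _)

lemma smooth_gMat (i j : Fin 4) : ContDiffOn ℝ ∞ (fun p => X.B.gMat p i j) X.off :=
  (X.smooth_met (stdVec i) (stdVec j)).mono X.off_subset_offU

lemma smooth_gInv (i j : Fin 4) : ContDiffOn ℝ ∞ (fun p => X.B.gInv p i j) X.off := by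
  have h1 : ContDiffOn ℝ ∞ (fun p => (X.B.gMat p).adjugate i j) X.off := by
    simp only [Matrix.adjugate_apply]; refine smooth_det fun k l => ?_; rcases eq_or_ne k j with rfl | h
    · simp only [Matrix.updateRow_self]; exact contDiffOn_const
    · simp only [Matrix.updateRow_ne h]; exact smooth_gMat k l
  refine ((smooth_det smooth_gMat).inv fun p hp => det_gMat_ne hp).mul h1 |>.congr fun p hp => ?_
  rw [Background.gInv, Matrix.inv_def, Ring.inverse_eq_inv', Matrix.smul_apply, smul_eq_mul]
  rfl

lemma smooth_chr (l μ ν : Fin 4) : ContDiffOn ℝ ∞ (fun p => X.B.chr p l μ ν) X.off := by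
  have h : ∀ l μ ν, ContDiffOn ℝ ∞ (fun p => X.B.dMet p l μ ν) X.off := fun l μ ν =>
    (X.smooth_dMet l μ ν).mono X.off_subset_offU
  exact ContDiffOn.sum fun s _ => ((smooth_gInv l s).mul (((h μ s ν).add (h ν s μ)).sub (h s μ ν))).div_const _

lemma smooth_e3 (μ : Fin 4) : ContDiffOn ℝ ∞ (fun p => X.B.e3 p μ) X.offU := by
  have hr : ∀ i : Fin 4, ContDiffOn ℝ ∞ (fun p : Pt => p i / rad p) X.offU := fun i =>
    (X.smooth_coord i).div X.smooth_rad fun _ h => (X.rad_pos_of_mem h).ne'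
  fin_cases μ
  · exact X.smooth_hgt
  · exact (hr 1).neg.sub (X.smooth_twist.mul (X.smooth_coord 2))
  · exact (hr 2).neg.add (X.smooth_twist.mul (X.smooth_coord 1))
  · exact (hr 3).neg

lemma smooth_e4 (μ : Fin 4) : ContDiffOn ℝ ∞ (fun p => X.B.e4 p μ) X.offU := by
  have hr : ∀ i : Fin 4, ContDiffOn ℝ ∞ (fun p : Pt => p i / rad p) X.offU := fun i =>
    (X.smooth_coord i).div X.smooth_rad fun _ h => (X.rad_pos_of_mem h).ne'
  have hD : ContDiffOn ℝ ∞ (fun p => X.B.Del p / X.B.Sig p) X.offU := X.smooth_Del.div X.smooth_Sig fun _ h => X.Sig_ne h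
  have hA : ContDiffOn ℝ ∞ X.B.e4Ang X.offU := (contDiffOn_const.div X.smooth_Sig fun _ h => X.Sig_ne h).sub
      ((X.smooth_twist.mul X.smooth_Del).div X.smooth_Sig fun _ h => X.Sig_ne h)
  fin_cases μ
  · exact ((contDiffOn_const.mul ((X.smooth_rad.pow 2).add contDiffOn_const)).div X.smooth_Sig
      fun _ h => X.Sig_ne h).sub ((X.smooth_hgt.mul X.smooth_Del).div X.smooth_Sig
      fun _ h => X.Sig_ne h)
  · exact (hD.mul (hr 1)).sub (hA.mul (X.smooth_coord 2))
  · exact (hD.mul (hr 2)).add (hA.mul (X.smooth_coord 1))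
  · exact hD.mul (hr 3)

lemma met_eq_sum (B : Background) (p u v : Pt) : B.met p u v = ∑ μ, ∑ ν, u μ * v ν * B.met p (stdVec μ) (stdVec ν) := by
  have h1 : ∀ f : Pt → ℝ, (f = drForm p ∨ f = dphiForm p ∨ f = B.dtIn p ∨ f = B.dphiIn p) →
      ∀ u, f u = u 0 * f (stdVec 0) + u 1 * f (stdVec 1) + u 2 * f (stdVec 2) + u 3 * f (stdVec 3) := by
    rintro f (rfl | rfl | rfl | rfl) u <;>
    simp [drForm, dphiForm, Background.dtIn, Background.dphiIn, stdVec] <;> ring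
  have hd := h1 _ (.inl rfl)
  have hp := h1 _ (.inr (.inl rfl))
  have ht := h1 _ (.inr (.inr (.inl rfl)))
  have hi := h1 _ (.inr (.inr (.inr rfl)))
  unfold Background.met Background.roundForm
  rw [hd u, hd v, hp u, hp v, ht u, ht v, hi u, hi v]
  generalize drForm p = F1
  generalize dphiForm p = F2
  generalize B.dtIn p = F3
  generalize B.dphiIn p = F4
  simp only [Fin.sum_univ_four, stdVec]
  simp
  ring

lemma smooth_prj (i j : Fin 4) : ContDiffOn ℝ ∞ (fun p => X.B.prj p i j) X.off := by
  have h : ∀ {V : Pt → Pt}, (∀ μ, ContDiffOn ℝ ∞ (fun p => V p μ) X.offU) → ∀ i,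
      ContDiffOn ℝ ∞ (fun p => X.B.met p (V p) (stdVec i)) X.offU := by
    intro V hV i; simp only [met_eq_sum X.B _ _ (stdVec i)]
    exact ContDiffOn.sum fun μ _ => ContDiffOn.sum fun ν _ =>
      ((hV μ).mul contDiffOn_const).mul (X.smooth_met _ _)
  exact (contDiffOn_const.add ((((h X.smooth_e3 i).mul (X.smooth_e4 j)).add
    ((h X.smooth_e4 i).mul (X.smooth_e3 j))).div_const _)).mono X.off_subset_offU

lemma smooth_hInv (i j : Fin 4) : ContDiffOn ℝ ∞ (fun p => X.B.hInv p i j) X.off :=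
  (smooth_gInv i j).add (((((X.smooth_e3 i).mul (X.smooth_e4 j)).add
    ((X.smooth_e4 i).mul (X.smooth_e3 j))).div_const _).mono X.off_subset_offU)

variable (X) in
def pbr (F : Pt → ℝ) : X.Sm := X.pb fun p => (F p : ℂ)

lemma pbr_ap {F : Pt → ℝ} (h : ContDiffOn ℝ ∞ F X.off) (q : X.dom) : (X.pbr F).1 q = (F (Sph q) : ℂ) := pb_ap (Sf.ofReal h) q

lemma pbr_ap' {F : Pt → ℝ} (h : ContDiffOn ℝ ∞ F X.offU) (q : X.dom) :
    (X.pbr F).1 q = (F (Sph q) : ℂ) := pb_ap (Sf.of_real h) q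

lemma zp_mul (q : X.dom) : (X.zeS 1).1 q * (((q.1 1 : ℝ) : ℂ) + I * X.B.a * (cos (q.1 2) : ℝ)) = 1 := by
  rw [zp_ap]; exact inv_mul_cancel₀ (X.zp_ne q)

lemma zm_mul (q : X.dom) : (X.zeS (-1)).1 q * (((q.1 1 : ℝ) : ℂ) - I * X.B.a * (cos (q.1 2) : ℝ)) = 1 := by
  rw [zm_ap]; exact inv_mul_cancel₀ (X.zm_ne q)

lemma pbr_e3 (μ : Fin 4) : X.pbr (fun p => X.B.e3 p μ) = X.fc 0 μ := by
  ext q : 1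
  rw [pbr_ap' (X.smooth_e3 μ)]
  have hr := X.r_ne q
  have e : X.fc 0 = cart X.E3 := rfl
  rw [e]
  fin_cases μ <;>
  simp only [Fin.mk_one, Fin.zero_eta, Fin.reduceFinMk, Fin.isValue, cart_zero, cart_one, cart_two,
    cart_three, Background.e3, Matrix.cons_val, cons_val_zero, cons_val_one, E3,
    hgt_Sph, twist_Sph, rad_Sph (X.r_pos q).le, Sph_one, Sph_two, Sph_three, Complex.ofReal_mul,
    Complex.ofReal_add, Complex.ofReal_sub, ofReal_neg, Complex.ofReal_div, zero_ap, one_ap,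
    neg_ap, mul_ap, add_ap, sub_ap, rS_ap, sS_ap, cS_ap, cfS_ap, sfS_ap, wS_ap, hS_ap] <;>
  (field_simp; try ring)

lemma pbr_e4 (μ : Fin 4) : X.pbr (fun p => X.B.e4 p μ) = X.fc 1 μ := by
  ext q : 1
  rw [pbr_ap' (X.smooth_e4 μ)]
  have hr := X.r_ne q
  have e : X.fc 1 = cart X.E4 := rfl
  have h1 := sq_c (q.1 2)
  have hI := I_sq
  rw [e]
  fin_cases μ <;>
  simp only [Fin.mk_one, Fin.zero_eta, Fin.reduceFinMk, Fin.isValue, cart_zero, cart_one, cart_two,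
    cart_three, Background.e4, Background.e4Ang, Matrix.cons_val, cons_val_zero,
    cons_val_one, E4,
    hgt_Sph, twist_Sph, rad_Sph (X.r_pos q).le, Sph_one, Sph_two, Sph_three, Complex.ofReal_mul,
    Complex.ofReal_add, Complex.ofReal_sub, Complex.ofReal_pow,
    div_eq_mul_inv, Complex.ofReal_inv, Complex.ofReal_ofNat, zero_ap, 
    neg_ap, mul_ap, add_ap, sub_ap, pow_ap, ofNat_ap, rS_ap, sS_ap, cS_ap, cfS_ap, sfS_ap, wS_ap,
    hS_ap, AS_ap, iS_ap, DelS_ap, Sig_Sph, Del_Sph, sig_inv] <;>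
  grind

lemma pbr_met (a : Fin 4) {V : Pt → Pt} (hV : ∀ μ, ContDiffOn ℝ ∞ (fun p => V p μ) X.offU)
    (h : ∀ μ, X.pbr (fun p => V p μ) = X.fc a μ) (ν : Fin 4) :
    X.pbr (fun p => X.B.met p (V p) (stdVec ν)) = ∑ μ, X.gS μ ν * X.fc a μ := by
  have hs : ContDiffOn ℝ ∞ (fun p => X.B.met p (V p) (stdVec ν)) X.offU := by
    simp only [met_eq_sum X.B _ _ (stdVec ν)]
    exact ContDiffOn.sum fun μ _ => ContDiffOn.sum fun ν _ =>
      ((hV μ).mul contDiffOn_const).mul (X.smooth_met _ _)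
  ext q : 1
  rw [pbr_ap' hs, met_eq_sum]
  simp only [sum_ap, mul_ap, ← h, pbr_ap' (hV _), gS_ap]
  simp [stdVec, Pi.single_apply, mul_comm]

/-- Projection of a vector to the horizontal distribution. -/
def hz (V : Fin 4 → X.Sm) (ν : Fin 4) : X.Sm := V ν + X.kS (1/2) * (Gc (X.fc 0) V * X.fc 1 ν + Gc (X.fc 1) V * X.fc 0 ν)

lemma sum_prj (V : Fin 4 → X.Sm) (ν : Fin 4) : ∑ μ, V μ * X.pbr (fun p => X.B.prj p μ ν) = hz V ν := by
  have h : ∀ μ, X.pbr (fun p => X.B.prj p μ ν) = (if μ = ν then 1 else 0) + X.kS (1/2) *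
      ((∑ κ, X.gS κ μ * X.fc 0 κ) * X.fc 1 ν + (∑ κ, X.gS κ μ * X.fc 1 κ) * X.fc 0 ν) := by
    intro μ; have a3 := pbr_met 0 X.smooth_e3 pbr_e3 μ; have a4 := pbr_met 1 X.smooth_e4 pbr_e4 μ
    rw [← a3, ← a4, ← pbr_e3, ← pbr_e4]; ext q : 1
    have hs : ∀ {V : Pt → Pt}, (∀ μ, ContDiffOn ℝ ∞ (fun p => V p μ) X.offU) →
        ContDiffOn ℝ ∞ (fun p => X.B.met p (V p) (stdVec μ)) X.offU := by
      intro V hV; simp only [met_eq_sum X.B _ _ (stdVec μ)]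
      exact ContDiffOn.sum fun μ _ => ContDiffOn.sum fun ν _ =>
        ((hV μ).mul contDiffOn_const).mul (X.smooth_met _ _)
    rw [pbr_ap (smooth_prj μ ν)]
    simp only [add_ap, mul_ap, algebraMap_ap, pbr_ap' (hs X.smooth_e3), pbr_ap' (hs X.smooth_e4),
      pbr_ap' (X.smooth_e3 _), pbr_ap' (X.smooth_e4 _), Background.prj]
    split_ifs <;> simp <;> ring
  simp only [h, hz, Gc, mul_add, sum_add_distrib, mul_ite, mul_one, mul_zero,
    Finset.sum_ite_eq', Finset.mem_univ, if_true, sum_mul, mul_sum]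
  congr 1
  congr 1 <;>
  (rw [sum_comm]
   refine sum_ext fun _ => sum_ext fun _ => ?_
   ring)

lemma Gc_fc (a b : Fin 4) : Gc (X.fc a) (X.fc b) = X.kS (eta a b) := by rw [fc, fc, Gc_cart, gEx_fr]

lemma hz_fc (a : Fin 4) : hz (X.fc a) = if a = 2 ∨ a = 3 then X.fc a else 0 := by
  funext ν
  have h : (1 : X.Sm) - X.kS (1/2) * X.kS 2 = 0 := by rw [← map_mul]; norm_num
  simp only [hz, Gc_fc]
  fin_cases a
  · simp only [eta, Fin.zero_eta, of_apply, cons_val_zero, cons_val_one, map_neg,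
      map_zero, Fin.isValue, Fin.reduceEq, or_self, if_false, Pi.zero_apply]
    grind
  · simp only [eta, Fin.mk_one, of_apply, cons_val_zero, cons_val_one, map_neg,
      map_zero, Fin.isValue, Fin.reduceEq, or_self, if_false, Pi.zero_apply]
    grind
  · simp [eta]
  · simp [eta]

lemma pbr_hInv (μ ν : Fin 4) : X.pbr (fun p => X.B.hInv p μ ν) =
    X.kS (1/2) * (X.fc 2 μ * X.fc 3 ν + X.fc 3 μ * X.fc 2 ν) := by
  ext q : 1
  have h := congrFun (congrFun (gInv_map q) μ) ν
  have h' : (X.B.gInv (Sph q) μ ν : ℂ) = _ := h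
  rw [pbr_ap (smooth_hInv μ ν)]
  simp only [Background.hInv, Complex.ofReal_add, h', Complex.ofReal_div, Complex.ofReal_mul]
  rw [← pbr_ap' (X.smooth_e3 μ), ← pbr_ap' (X.smooth_e3 ν), ← pbr_ap' (X.smooth_e4 μ),
    ← pbr_ap' (X.smooth_e4 ν), pbr_e3, pbr_e3, pbr_e4, pbr_e4]
  simp only [mul_apply, Matrix.transpose_apply, frM, etai, of_apply,
    Fin.sum_univ_four, Matrix.cons_val, cons_val_zero, cons_val_one, mul_ap, add_ap,
    algebraMap_ap, Fin.isValue]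
  push_cast
  ring

lemma frame_complete (V : Fin 4 → X.Sm) (μ : Fin 4) : V μ = ∑ a, ∑ b, X.fc a μ * X.kS (etai a b) * Gc (X.fc b) V := by
  ext q : 1
  have h := congrArg (fun A => (A.mulVec fun ν => (V ν).1 q) μ) (frM_inv q)
  simp only [Matrix.one_mulVec] at h
  rw [← h]
  simp only [sum_ap, mul_ap, algebraMap_ap, Gc]
  simp only [Matrix.mulVec, dotProduct, mul_apply, Fin.sum_univ_four, frM, of_apply,
    Matrix.transpose_apply, gM_apply, etai, Matrix.cons_val, cons_val_zero,
    cons_val_one, Fin.isValue]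
  ring

lemma det_frM (q : X.dom) : (frM q).det = -4 * I * (q.1 1) ^ 2 * ((X.zeS 1).1 q * (X.zeS (-1)).1 q) := by
  have hz := zp_mul q
  have hzb := zm_mul q
  have h1 := sq_c (q.1 2)
  have h2 := sq_c (q.1 3)
  have hs := X.s_ne q
  have hsi : X.siS.1 q * ((sin (q.1 2) : ℝ) : ℂ) = 1 := by rw [siS_ap]; exact inv_mul_cancel₀ hs
  have hI := I_sq
  obtain ⟨r, hr⟩ : ∃ r, r = ((q.1 1 : ℝ) : ℂ) := ⟨_, rfl⟩
  obtain ⟨s, hs'⟩ : ∃ s, s = ((sin (q.1 2) : ℝ) : ℂ) := ⟨_, rfl⟩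
  obtain ⟨c, hc'⟩ : ∃ c, c = ((cos (q.1 2) : ℝ) : ℂ) := ⟨_, rfl⟩
  obtain ⟨sf, hsf⟩ : ∃ s, s = ((sin (q.1 3) : ℝ) : ℂ) := ⟨_, rfl⟩
  obtain ⟨cf, hcf⟩ : ∃ s, s = ((cos (q.1 3) : ℝ) : ℂ) := ⟨_, rfl⟩
  simp only [← hr, ← hs', ← hc', ← hsf, ← hcf] at h1 h2 hs hsi hz hzb ⊢
  let K : Matrix (Fin 4) (Fin 4) ℂ := Matrix.of fun i a => (X.fr a i).1 q
  let C : Matrix (Fin 4) (Fin 4) ℂ := !![1, -X.hS.1 q, 0, 0; 0, s * cf + r * s * X.wS.1 q * sf, r * c * cf, -(r * s * sf);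
    0, s * sf - r * s * X.wS.1 q * cf, r * c * sf, r * s * cf;
    0, c, -(r * s), 0]
  have hF : frM q = C * K := by
    ext μ a; simp only [frM, of_apply, mul_apply, K, C, fc, Fin.sum_univ_four]
    fin_cases μ <;> simp [cart_zero, cart_one, cart_two, cart_three, -Complex.ofReal_sin,
      -Complex.ofReal_cos, ← hr, ← hs', ← hc', ← hsf, ← hcf] <;> ring
  have hC : C.det = r ^ 2 * s := by
    simp only [C, det_succ_row_zero, Fin.sum_univ_succ]; simp [Fin.succAbove, Matrix.submatrix]; grind
  have hK : K.det * s = -4 * I * ((X.zeS 1).1 q * (X.zeS (-1)).1 q) := by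
    simp only [K, det_succ_row_zero, Fin.sum_univ_succ]
    simp [Fin.succAbove, Matrix.submatrix, fr, E3, E4, Ep, Em, -siS_ap, -Complex.ofReal_sin,
      -Complex.ofReal_cos, ← hr, ← hs', ← hc']
    clear hC hF; grind
  rw [hF, det_mul, hC]
  linear_combination r ^ 2 * hK

variable (X) in
def dgS (l μ ν : Fin 4) : X.Sm := X.pbr fun p => X.B.dMet p l μ ν

variable (X) in
def chS (l μ ν : Fin 4) : X.Sm := X.pbr fun p => X.B.chr p l μ ν

lemma dW_gMat {p : Pt} (hp : p ∈ X.off) (l μ ν : Fin 4) : X.dW (fun p => (X.B.gMat p μ ν : ℂ)) l p = X.B.dMet p l μ ν := by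
  rw [dW, X.fderivWithin_region hp]
  have h : HasFDerivAt (fun p => X.B.gMat p μ ν) (fderiv ℝ (fun p => X.B.gMat p μ ν) p) p :=
    (((X.smooth_met (stdVec μ) (stdVec ν)).contDiffAt (X.isOpen_offU.mem_nhds hp.2)).differentiableAt (by simp)).hasFDerivAt
  have h' := (Complex.ofRealCLM.hasFDerivAt.comp p h).hasFDerivWithinAt (s := X.off)
  have e := h'.fderivWithin (X.uniqueDiffOn_off p hp)
  exact congrArg (fun L => L (stdVec l)) e

lemma Vd_gS (v : X.VF) (μ ν : Fin 4) : Vd v (X.gS μ ν) = ∑ l, cart v l * X.dgS l μ ν := by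
  rw [gS, Vd_pb (F := fun p => (X.B.gMat p μ ν : ℂ)) (Sf.of_real (X.smooth_met _ _))]
  refine sum_ext fun l => congrArg _ (hext fun q => ?_)
  rw [pb_ap (Sf.dW (F := fun p => (X.B.gMat p μ ν : ℂ)) (Sf.of_real (X.smooth_met _ _)) l), dgS, pbr_ap' (X.smooth_dMet l μ ν)]
  exact dW_gMat (X.Sph_mem_off q.2) l μ ν

lemma gS_chS (z μ ν : Fin 4) : 2 * ∑ l, X.gS z l * X.chS l μ ν = X.dgS μ z ν + X.dgS ν z μ - X.dgS z μ ν := by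
  ext q : 1
  have hp := X.Sph_mem_off q.2
  have h : X.B.gMat (Sph q) * X.B.gInv (Sph q) = 1 := Matrix.mul_nonsing_inv _ (isUnit_iff_ne_zero.2 (det_gMat_ne hp))
  simp only [mul_ap, sum_ap, add_ap, sub_ap, ofNat_ap, dgS, chS, pbr_ap (smooth_chr _ _ _), gS_ap,
    pbr_ap' (X.smooth_dMet _ _ _)]
  have key : 2 * ∑ l, X.B.gMat (Sph q) z l * X.B.chr (Sph q) l μ ν
      = X.B.dMet (Sph q) μ z ν + X.B.dMet (Sph q) ν z μ - X.B.dMet (Sph q) z μ ν := by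
    set Y : Fin 4 → ℝ := fun s => X.B.dMet (Sph q) μ s ν + X.B.dMet (Sph q) ν s μ - X.B.dMet (Sph q) s μ ν with hY
    have e : ∀ l, X.B.chr (Sph q) l μ ν = (X.B.gInv (Sph q)).mulVec Y l / 2 := by
      intro l; rw [Background.chr, Matrix.mulVec, dotProduct, Finset.sum_div]
    have h2 := congrFun (congrArg (fun A => A.mulVec Y) h) z; simp only [Matrix.one_mulVec, ← Matrix.mulVec_mulVec] at h2
    simp only [e]; refine Eq.trans ?_ h2; rw [Matrix.mulVec, dotProduct, mul_sum]; refine sum_ext fun l => ?_; ring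
  have key' := congrArg (fun x : ℝ => (x : ℂ)) key
  push_cast at key'
  exact key'

/-- The contraction of the derivatives of the metric with three vectors. -/
def D3 (x y z : Fin 4 → X.Sm) : X.Sm := ∑ l, ∑ μ, ∑ ν, X.dgS l μ ν * x l * y μ * z ν

lemma dgS_symm (l μ ν : Fin 4) : X.dgS l μ ν = X.dgS l ν μ := by
  have : (fun p => X.B.gMat p μ ν) = fun p => X.B.gMat p ν μ := by funext p; exact met_symm _ _ _ _
  simp only [dgS, Background.dMet, this]

lemma D3_symm (x y z : Fin 4 → X.Sm) : D3 x y z = D3 x z y := by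
  refine sum_ext fun l => ?_
  rw [sum_comm]
  refine sum_ext fun μ => sum_ext fun ν => ?_
  rw [dgS_symm]; ring

lemma gS_symm (μ ν : Fin 4) : X.gS μ ν = X.gS ν μ := hext fun q => by rw [gS_ap, gS_ap, met_symm]

lemma Gc_symm (x y : Fin 4 → X.Sm) : Gc x y = Gc y x := by
  rw [Gc, Gc, sum_comm]
  refine sum_ext fun μ => sum_ext fun ν => ?_
  rw [gS_symm]; ring

lemma Gc_add (x x' y : Fin 4 → X.Sm) : Gc (fun μ => x μ + x' μ) y = Gc x y + Gc x' y := by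
  simp only [Gc, mul_add, add_mul, sum_add_distrib]

lemma Gc_sub (x x' y : Fin 4 → X.Sm) : Gc (fun μ => x μ - x' μ) y = Gc x y - Gc x' y := by
  simp only [Gc, mul_sub, sub_mul, sum_sub_distrib]

lemma Vd_Gc (v : X.VF) (y z : Fin 4 → X.Sm) : Vd v (Gc y z) = D3 (cart v) y z
    + Gc (fun μ => Vd v (y μ)) z + Gc y (fun μ => Vd v (z μ)) := by
  have : D3 (cart v) y z = ∑ μ, ∑ ν, Vd v (X.gS μ ν) * y μ * z ν := by
    simp only [D3, Vd_gS, sum_mul]; rw [sum_comm]; refine sum_ext fun μ => ?_; rw [sum_comm]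
    refine sum_ext fun ν => sum_ext fun l => ?_; ring
  rw [this]
  simp only [Gc, map_sum, leibniz, smul_eq_mul, ← sum_add_distrib]
  refine sum_ext fun μ => sum_ext fun ν => ?_
  ring

/-- The covariant derivative of a vector field along a vector field, in components. -/
def nablaC (v : X.VF) (w : Fin 4 → X.Sm) (l : Fin 4) : X.Sm := Vd v (w l) + ∑ μ, ∑ ν, X.chS l μ ν * cart v μ * w ν

lemma Gc_chS (x y z : Fin 4 → X.Sm) :
    2 * Gc z (fun l => ∑ μ, ∑ ν, X.chS l μ ν * x μ * y ν) = D3 x z y + D3 y z x - D3 z x y := by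
  have h1 : 2 * Gc z (fun l => ∑ μ, ∑ ν, X.chS l μ ν * x μ * y ν)
      = ∑ k, ∑ μ, ∑ ν, (2 * ∑ l, X.gS k l * X.chS l μ ν) * z k * x μ * y ν := by
    simp only [Gc, mul_sum, sum_mul]; refine sum_ext fun k => ?_; rw [sum_comm]; refine sum_ext fun μ => ?_; rw [sum_comm]
    refine sum_ext fun ν => sum_ext fun l => ?_; ring
  have h2 : D3 x z y = ∑ k, ∑ μ, ∑ ν, X.dgS μ k ν * z k * x μ * y ν := by
    rw [D3, sum_comm]
    refine sum_ext fun k => sum_ext fun μ =>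
      sum_ext fun ν => ?_
    ring
  have h3 : D3 y z x = ∑ k, ∑ μ, ∑ ν, X.dgS ν k μ * z k * x μ * y ν := by
    rw [D3, sum_comm]; refine sum_ext fun k => ?_; rw [sum_comm]; refine sum_ext fun μ => sum_ext fun ν => ?_; ring
  rw [h1, h2, h3, D3]
  simp only [gS_chS, ← sum_add_distrib, ← sum_sub_distrib]
  refine sum_ext fun k => sum_ext fun μ =>
      sum_ext fun ν => ?_
  ring

lemma Gc_nablaC (v : X.VF) (w z : Fin 4 → X.Sm) : 2 * Gc (nablaC v w) z =
    2 * Gc (fun l => Vd v (w l)) z + (D3 (cart v) z w + D3 w z (cart v) - D3 z (cart v) w) := by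
  rw [← Gc_chS, Gc_symm z, ← mul_add, ← Gc_add]
  rfl

lemma two_cancel {u v : X.Sm} (h : 2 * u = 2 * v) : u = v := by
  ext q : 1
  have := congrArg (fun u => u.1 q) h
  simpa using this

lemma metric_compat (v : X.VF) (w z : Fin 4 → X.Sm) : Vd v (Gc w z) = Gc (nablaC v w) z + Gc w (nablaC v z) := by
  refine two_cancel ?_
  rw [mul_add, Gc_nablaC, Gc_symm w (nablaC v z), Gc_nablaC, Vd_Gc, D3_symm w, D3_symm z, D3_symm _ z w,
    Gc_symm w (fun μ => Vd v (z μ))]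
  ring

lemma koszul (v w z : X.VF) : 2 * Gc (nablaC v (cart w)) (cart z) =
    Vd v (Gc (cart w) (cart z)) + Vd w (Gc (cart v) (cart z)) - Vd z (Gc (cart v) (cart w))
    + Gc (cart (brk v w)) (cart z) - Gc (cart (brk v z)) (cart w)
    - Gc (cart (brk w z)) (cart v) := by
  have hb : ∀ v w : X.VF, cart (brk v w) = fun μ => Vd v (cart w μ) - Vd w (cart v μ) :=
    fun v w => funext fun μ => cart_brk v w μ
  rw [Gc_nablaC, hb, hb, hb, Gc_sub, Gc_sub, Gc_sub, Vd_Gc, Vd_Gc, Vd_Gc,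
    D3_symm (cart w) (cart z), D3_symm (cart v) (cart z),
    Gc_symm (cart w) (fun μ => Vd v _), Gc_symm (cart v) (fun μ => Vd w _),
    Gc_symm (cart v) (fun μ => Vd z _)]
  ring

/-- The inner products `g(∇_a e_b, e_c)`. -/
def conn (X : Adm) (a b c : Fin 4) : X.Sm := Gc (nablaC (X.fr a) (X.fc b)) (X.fc c)

lemma conn_antisymm (a b c : Fin 4) : X.conn a b c = -X.conn a c b := by
  have h := metric_compat (X.fr a) (X.fc b) (X.fc c)
  rw [Gc_fc, D_kS, Gc_symm (X.fc b)] at h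
  rw [conn, conn]
  linear_combination -h

lemma conn_self (a b : Fin 4) : X.conn a b b = 0 := by
  refine two_cancel ?_
  linear_combination conn_antisymm (X := X) a b b

lemma two_conn (a b c : Fin 4) : 2 * X.conn a b c = gEx (brk (X.fr a) (X.fr b)) (X.fr c)
    - gEx (brk (X.fr a) (X.fr c)) (X.fr b) - gEx (brk (X.fr b) (X.fr c)) (X.fr a) := by
  have h := koszul (X.fr a) (X.fr b) (X.fr c)
  have e : ∀ a b, Gc (cart (X.fr a)) (cart (X.fr b)) = X.kS (eta a b) := Gc_fc
  rw [e, e, e, D_kS, D_kS, D_kS] at h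
  simp only [Gc_cart] at h
  rw [conn, fc, fc, h]
  ring

/-- The connection coefficients of the complex horizontal frame. -/
structure ConnEqs (X : Adm) : Prop where
  e3 : X.conn 0 2 3 = 0
  ep : X.conn 2 2 3 = -2 * (X.zeS (-1) * X.kpS 1)
  e4 : X.conn 1 2 3 = -2 * X.gamS
  em : X.conn 3 2 3 = -2 * (X.zeS 1 * X.kpS (-1))

lemma connEqs (X : Adm) : X.ConnEqs := by
  constructor <;>
  ( refine two_cancel ?_
    rw [two_conn]; ext q : 1; have hz := zp_mul q; have hzb := zm_mul q; have hs := X.s_ne q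
    have hsi : X.siS.1 q * ((sin (q.1 2) : ℝ) : ℂ) = 1 := by rw [siS_ap]; exact inv_mul_cancel₀ hs
    have h1 := sq_c (q.1 2); have hI := I_sq
    simp only [gEx, fr, brk, E3, E4, Ep, Em, Vd_apply, kpS, gamS, Matrix.cons_val, cons_val_zero,
      cons_val_one, leibniz, leibniz_pow, map_add, map_neg, map_sub,
      smul_eq_mul, map_zero, Derivation.map_one_eq_zero,
      dP_zeS, dP_cS, dP_rS, dP_sS, dP_siS, dP_DelS, pd_DelS, pd_zp, pd_zm, pd_cS, pd_sS, pd_rS,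
      pd_siS, D_AS, D_iS, D_ofNat, neg_neg, add_ap, mul_ap, neg_ap, pow_ap, sub_ap, cS_ap, rS_ap,
      sS_ap, DelS_ap, AS_ap, iS_ap, algebraMap_ap, nsmul_eq_mul, natCast_ap, zero_ap, one_ap, ofNat_ap,
      if_true, if_false, Fin.isValue, Fin.reduceEq]
    push_cast at hz hzb hsi h1 ⊢; simp only [mul_zero, zero_mul, add_zero, zero_add, sub_zero, neg_zero]
    generalize Complex.cos (q.1 2) = c at *; generalize Complex.sin (q.1 2) = s at *; generalize ((q.1 1 : ℝ) : ℂ) = r at *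
    generalize (X.zeS 1).1 q = zp at *; generalize (X.zeS (-1)).1 q = zm at *; generalize X.siS.1 q = si at *
    generalize (X.B.a : ℂ) = a at *; generalize I = i at *; clear hs)
  · grind
  · grind
  all_goals
    have hr : s ≠ 0 := left_ne_zero_of_mul (b := si) (by rw [mul_comm, hsi]; exact one_ne_zero)
    have hz0 : r + i * a * c ≠ 0 := right_ne_zero_of_mul (a := zp) (by rw [hz]; exact one_ne_zero)
    have hzb0 : r - i * a * c ≠ 0 := right_ne_zero_of_mul (a := zm) (by rw [hzb]; exact one_ne_zero)
    obtain rfl : si = s⁻¹ := eq_inv_of_mul_eq_one_left hsi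
    obtain rfl : zp = (r + i * a * c)⁻¹ := eq_inv_of_mul_eq_one_left hz
    obtain rfl : zm = (r - i * a * c)⁻¹ := eq_inv_of_mul_eq_one_left hzb
    have hs2 : s ^ 2 = 1 - c ^ 2 := by linear_combination h1
    have ha : a ^ 2 = -(i * a) ^ 2 := by linear_combination a ^ 2 * hI
    clear hz hzb hsi h1; generalize i * a = A at *; have hs4 : s ^ 4 = (1 - c ^ 2) ^ 2 := by rw [← hs2]; ring
    have hs6 : s ^ 6 = (1 - c ^ 2) ^ 3 := by rw [← hs2]; ring
    have hs8 : s ^ 8 = (1 - c ^ 2) ^ 4 := by rw [← hs2]; ring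
    field_simp; simp only [hI, ha]; ring_nf; try (simp only [hs2]; ring)

/-- Smoothness of a tensor field on `off`. -/
def TSf (X : Adm) {k : ℕ} (T : Tens k) : Prop := ∀ I, X.Sf fun p => T p I

/-- A tensor field as a multilinear map on vectors given by Cartesian components. -/
def tm (X : Adm) {k : ℕ} (T : Tens k) : MultilinearMap X.Sm (fun _ : Fin k => Fin 4 → X.Sm) X.Sm :=
  ∑ I : Fin k → Fin 4, (X.pb fun p => T p I) • (MultilinearMap.mkPiAlgebra X.Sm (Fin k) X.Sm).compLinearMap
    fun i => LinearMap.proj (I i)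

lemma tm_apply {k : ℕ} (T : Tens k) (V : Fin k → Fin 4 → X.Sm) :
    X.tm T V = ∑ I : Fin k → Fin 4, (X.pb fun p => T p I) * ∏ i, V i (I i) := by
  simp [tm, sum_apply]

lemma pb_congr {F G : Pt → ℂ} (hF : X.Sf F) (hG : X.Sf G) (h : ∀ p ∈ X.off, F p = G p) : X.pb F = X.pb G :=
  hext fun q => by rw [pb_ap hF, pb_ap hG, h _ (X.Sph_mem_off q.2)]

lemma pb_add {F G : Pt → ℂ} (hF : X.Sf F) (hG : X.Sf G) : X.pb (fun p => F p + G p) = X.pb F + X.pb G :=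
  hext fun q => by rw [pb_ap (hF.add hG), add_ap, pb_ap hF, pb_ap hG]

lemma pb_sub {F G : Pt → ℂ} (hF : X.Sf F) (hG : X.Sf G) : X.pb (fun p => F p - G p) = X.pb F - X.pb G :=
  hext fun q => by rw [pb_ap (hF.sub hG), sub_ap, pb_ap hF, pb_ap hG]

lemma pb_mul {F G : Pt → ℂ} (hF : X.Sf F) (hG : X.Sf G) : X.pb (fun p => F p * G p) = X.pb F * X.pb G :=
  hext fun q => by rw [pb_ap (hF.mul hG), mul_ap, pb_ap hF, pb_ap hG]

lemma pb_neg {F : Pt → ℂ} (hF : X.Sf F) : X.pb (fun p => -F p) = -X.pb F :=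
  hext fun q => by rw [pb_ap hF.neg, neg_ap, pb_ap hF]

lemma pb_sum {ι : Type*} {s : Finset ι} {F : ι → Pt → ℂ} (h : ∀ i ∈ s, X.Sf (F i)) :
    X.pb (fun p => ∑ i ∈ s, F i p) = ∑ i ∈ s, X.pb (F i) :=
  hext fun q => by
    rw [pb_ap (Sf.sum h), sum_ap]; exact sum_congr rfl fun i hi => (pb_ap (h i hi) q).symm

lemma pb_prod {ι : Type*} {s : Finset ι} {F : ι → Pt → ℂ} (h : ∀ i ∈ s, X.Sf (F i)) :
    X.pb (fun p => ∏ i ∈ s, F i p) = ∏ i ∈ s, X.pb (F i) :=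
  hext fun q => by
    rw [pb_ap (Sf.prod h), prod_ap]; exact Finset.prod_congr rfl fun i hi => (pb_ap (h i hi) q).symm

section alg

variable {k : ℕ} {T T' : Tens k}

lemma TSf.add (h : X.TSf T) (h' : X.TSf T') : X.TSf (T + T') := fun I => (h I).add (h' I)
lemma TSf.sub (h : X.TSf T) (h' : X.TSf T') : X.TSf (T - T') := fun I => (h I).sub (h' I)
lemma TSf.neg (h : X.TSf T) : X.TSf (-T) := fun I => (h I).neg
lemma TSf.wt {w : Pt → ℝ} (hw : ContDiffOn ℝ ∞ w X.off) (h : X.TSf T) : X.TSf (wt w T) := fun I => (Sf.ofReal hw).mul (h I)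

lemma tm_add (h : X.TSf T) (h' : X.TSf T') : X.tm (T + T') = X.tm T + X.tm T' := by
  refine MultilinearMap.ext fun V => ?_
  rw [add_apply, tm_apply, tm_apply, tm_apply, ← sum_add_distrib]
  refine sum_ext fun I => ?_
  rw [← add_mul, ← pb_add (h I) (h' I)]; rfl

lemma tm_sub (h : X.TSf T) (h' : X.TSf T') : X.tm (T - T') = X.tm T - X.tm T' := by
  refine MultilinearMap.ext fun V => ?_
  rw [sub_apply, tm_apply, tm_apply, tm_apply, ← sum_sub_distrib]
  refine sum_ext fun I => ?_
  rw [← sub_mul, ← pb_sub (h I) (h' I)]; rfl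

lemma tm_neg (h : X.TSf T) : X.tm (-T) = -X.tm T := by
  refine MultilinearMap.ext fun V => ?_
  rw [neg_apply, tm_apply, tm_apply, ← Finset.sum_neg_distrib]
  refine sum_ext fun I => ?_
  rw [← neg_mul, ← pb_neg (h I)]; rfl

lemma tm_wt {w : Pt → ℝ} (hw : ContDiffOn ℝ ∞ w X.off) (h : X.TSf T) (V) : X.tm (Kerr.wt w T) V = X.pbr w * X.tm T V := by
  rw [tm_apply, tm_apply, mul_sum]
  refine sum_ext fun I => ?_
  rw [← mul_assoc, pbr, ← pb_mul (Sf.ofReal hw) (h I)]; rfl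

lemma TSf.proj (h : X.TSf T) : X.TSf (X.B.proj T) := fun _ =>
  Sf.sum fun J _ => (Sf.prod fun _ _ => Sf.ofReal (smooth_prj _ _)).mul (h J)

lemma tm_proj (h : X.TSf T) (V) : X.tm (X.B.proj T) V = X.tm T fun i => hz (V i) := by
  have e : ∀ I : Fin k → Fin 4, (X.pb fun p => X.B.proj T p I) =
      ∑ J : Fin k → Fin 4, (∏ i, X.pbr fun p => X.B.prj p (I i) (J i)) * X.pb fun p => T p J := by
    intro I
    have h1 : ∀ J : Fin k → Fin 4, ∀ i ∈ (Finset.univ : Finset (Fin k)),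
        X.Sf fun p => (X.B.prj p (I i) (J i) : ℂ) := fun J i _ => Sf.ofReal (smooth_prj _ _)
    unfold Background.proj; rw [pb_sum fun J _ => (Sf.prod (h1 J)).mul (h J)]; refine sum_ext fun J => ?_
    rw [pb_mul (Sf.prod (h1 J)) (h J), pb_prod (h1 J)]; rfl
  rw [tm_apply, tm_apply]
  simp only [e, ← sum_prj, sum_mul, Finset.prod_univ_sum, Fintype.piFinset_univ, mul_sum, Finset.prod_mul_distrib]
  rw [sum_comm]
  grind

end alg

lemma leibniz_prod {ι : Type*} [Fintype ι] [DecidableEq ι] (D : Derivation ℂ X.Sm X.Sm)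
    (u : ι → X.Sm) : D (∏ i, u i) = ∑ i, ∏ j, update u i (D (u i)) j := by
  have key : ∀ s : Finset ι, D (∏ i ∈ s, u i) = ∑ i ∈ s, D (u i) * ∏ j ∈ s.erase i, u j := by
    intro s
    induction s using Finset.induction_on with
    | empty => simp
    | insert a s ha ih =>
      rw [Finset.prod_insert ha, leibniz, ih, Finset.sum_insert ha,
        Finset.erase_insert ha, smul_eq_mul, smul_eq_mul, add_comm, mul_comm (D (u a)),
        mul_comm _ (D (u a)), mul_sum]
      congr 1; refine sum_congr rfl fun i hi => ?_
      rw [Finset.erase_insert_of_ne (by rintro rfl; exact ha hi), Finset.prod_insert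
        (fun h => ha (Finset.mem_of_mem_erase h))]
      ring
  rw [key]
  refine sum_ext fun i => ?_
  rw [Finset.prod_update_of_mem (Finset.mem_univ i), Finset.erase_eq]

variable {k : ℕ} {T : Tens k}

lemma TSf.cov (h : X.TSf T) : X.TSf (X.B.cov T) := fun I =>
  ((h (Fin.tail I)).dW (I 0)).sub (Sf.sum fun _ _ => Sf.sum fun _ _ =>
    (Sf.ofReal (smooth_chr _ _ _)).mul (h _))

lemma pb_cov (h : X.TSf T) (μ : Fin 4) (I : Fin k → Fin 4) :
    (X.pb fun p => X.B.cov T p (Fin.cons μ I)) = X.pb (X.dW (fun p => T p I) μ)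
      - ∑ i, ∑ l, X.chS l μ (I i) * X.pb fun p => T p (update I i l) := by
  have h2 : ∀ i ∈ (Finset.univ : Finset (Fin k)), ∀ l ∈ (Finset.univ : Finset (Fin 4)),
      X.Sf fun p => (X.B.chr p l μ (I i) : ℂ) * T p (update I i l) :=
    fun i _ l _ => (Sf.ofReal (smooth_chr _ _ _)).mul (h _)
  have h1 : ∀ i ∈ (Finset.univ : Finset (Fin k)), X.Sf fun p => ∑ l,
      (X.B.chr p l μ (I i) : ℂ) * T p (update I i l) := fun i hi => Sf.sum (h2 i hi)
  have e : (fun p => X.B.cov T p (Fin.cons μ I)) = fun p => X.dW (fun p => T p I) μ p - ∑ i, ∑ l,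
      (X.B.chr p l μ (I i) : ℂ) * T p (update I i l) := by
    funext p; simp only [Background.cov, Fin.tail_cons, Fin.cons_zero, dW]
  rw [e, pb_sub ((h I).dW μ) (Sf.sum h1), pb_sum h1]
  congr 1
  refine sum_congr rfl fun i hi => ?_
  rw [pb_sum (h2 i hi)]
  refine sum_congr rfl fun l hl => ?_
  rw [pb_mul (Sf.ofReal (smooth_chr _ _ _)) (h _)]
  rfl

/-- The exchange of an entry of a multi-index with an index. -/
def swapEntry {k : ℕ} (i : Fin k) : (Fin k → Fin 4) × Fin 4 ≃ (Fin k → Fin 4) × Fin 4 :=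
  Function.Involutive.toPerm (fun x => (update x.1 i x.2, x.1 i)) fun x => by simp

lemma swapEntry_apply {k : ℕ} (i : Fin k) (I : Fin k → Fin 4) (l : Fin 4) : swapEntry i (I, l) = (update I i l, I i) := rfl

lemma tm_update_lin (A : Fin 4 → Fin 4 → X.Sm) (V : Fin k → Fin 4 → X.Sm) (i : Fin k) :
    X.tm T (update V i fun l => ∑ ν, A l ν * V i ν) = ∑ I : Fin k → Fin 4, ∑ l,
      A l (I i) * (X.pb fun p => T p (update I i l)) * ∏ j, V j (I j) := by
  rw [← Fintype.sum_prod_type' (f := fun I l => A l (I i) * (X.pb fun p => T p (update I i l)) * ∏ j, V j (I j)),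
    ← (swapEntry i).sum_comp, Fintype.sum_prod_type, tm_apply]
  refine sum_ext fun I => ?_
  simp only [swapEntry_apply, Function.update_self, Function.update_idem, update_eq_self]
  have h3 : (fun j => update V i (fun l => ∑ ν, A l ν * V i ν) j (I j)) =
      update (fun j => V j (I j)) i (∑ ν, A (I i) ν * V i ν) := by
    funext j; rcases eq_or_ne j i with rfl | hj
    · simp
    · simp [hj]
  have h4 : ∀ ν, (fun j => V j (update I i ν j)) = update (fun j => V j (I j)) i (V i ν) := by
    intro ν; funext j; rcases eq_or_ne j i with rfl | hj
    · simp
    · simp [hj]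
  rw [h3]
  simp only [h4, Finset.prod_update_of_mem (Finset.mem_univ i)]
  rw [sum_mul, mul_sum]
  refine sum_ext fun ν => ?_
  ring

lemma tm_cov (h : X.TSf T) (v : X.VF) (V : Fin k → Fin 4 → X.Sm) : X.tm (X.B.cov T) (Fin.cons (cart v) V) = Vd v (X.tm T V)
      - ∑ i, X.tm T (update V i (nablaC v (V i))) := by
  have e1 : Vd v (X.tm T V) = (∑ i, X.tm T (update V i fun μ => Vd v (V i μ)))
      + ∑ I : Fin k → Fin 4, Vd v (X.pb fun p => T p I) * ∏ i, V i (I i) := by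
    simp only [tm_apply, map_sum, leibniz, smul_eq_mul, sum_add_distrib]; rw [sum_comm (s := Finset.univ (α := Fin k))]
    congr 1; swap
    · exact sum_ext fun I => mul_comm _ _
    refine sum_ext fun I => ?_; rw [leibniz_prod, mul_sum]; refine sum_ext fun i => ?_; congr 1
    refine Finset.prod_congr rfl fun j _ => ?_; rcases eq_or_ne j i with rfl | hj
    · simp
    · simp [hj]
  have e2 : ∀ i, X.tm T (update V i (nablaC v (V i))) = X.tm T (update V i fun μ => Vd v (V i μ)) + X.tm T (update V i
        fun l => ∑ μ, ∑ ν, X.chS l μ ν * cart v μ * V i ν) := by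
    intro i; rw [← MultilinearMap.map_update_add]; rfl
  have e3 : ∀ i, X.tm T (update V i fun l => ∑ μ, ∑ ν, X.chS l μ ν * cart v μ * V i ν) =
      ∑ I : Fin k → Fin 4, ∑ l, (∑ μ, X.chS l μ (I i) * cart v μ) * (X.pb fun p => T p (update I i l)) * ∏ j, V j (I j) := by
    intro i; rw [← tm_update_lin (fun l ν => ∑ μ, X.chS l μ ν * cart v μ)]; congr 2; funext l; rw [sum_comm]
    simp only [sum_mul]
  rw [e1]
  simp only [e2, sum_add_distrib, e3]
  rw [tm_apply, ← (Fin.consEquiv fun _ => Fin 4).sum_comp, Fintype.sum_prod_type]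
  simp only [Fin.consEquiv, Equiv.coe_fn_mk, Fin.prod_univ_succ, Fin.cons_zero, Fin.cons_succ,
    pb_cov h, Vd_pb (h _), sub_mul, sum_sub_distrib]
  rw [add_sub_add_left_eq_sub]
  congr 1
  · rw [sum_comm]; refine sum_ext fun I => ?_; rw [sum_mul]; refine sum_ext fun μ => ?_; ring
  · rw [sum_comm (s := Finset.univ (α := Fin k))]; rw [sum_comm]; refine sum_ext fun I => ?_; simp only [sum_mul]
    rw [sum_comm]; refine sum_ext fun i => ?_; rw [sum_comm]; refine sum_ext fun l => sum_ext fun μ => ?_; ring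

/-- Horizontality: vanishing on `e₃` and `e₄` in each slot. -/
def Hor (X : Adm) {k : ℕ} (T : Tens k) : Prop := ∀ (V : Fin k → Fin 4 → X.Sm) i, V i = X.fc 0 ∨ V i = X.fc 1 → X.tm T V = 0

lemma hor_proj (h : X.TSf T) : X.Hor (X.B.proj T) := by
  intro V i hi
  rw [tm_proj h]
  refine MultilinearMap.map_coord_zero _ i ?_
  rcases hi with hi | hi <;> simp [hi, hz_fc]

lemma hor_scalar (T : Tens 0) : X.Hor T := fun _ i => i.elim0

def hb (b : Bool) : Fin 4 := if b then 2 else 3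

/-- Components of a tensor field in the horizontal frame `e₊, e₋`. -/
def comp (X : Adm) {k : ℕ} (T : Tens k) (σ : Fin k → Bool) : X.Sm := X.tm T fun i => X.fc (hb (σ i))

/-- The spin weight of a component. -/
def spin {k : ℕ} (σ : Fin k → Bool) : ℤ := ∑ i, if σ i then 1 else -1

lemma hz_hb (b : Bool) : hz (X.fc (hb b)) = X.fc (hb b) := by rw [hz_fc]; cases b <;> simp [hb]

lemma comp_proj (h : X.TSf T) (σ : Fin k → Bool) : X.comp (X.B.proj T) σ = X.comp T σ := by
  rw [comp, tm_proj h]; simp only [hz_hb]; rfl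

lemma nablaC_hb (a : Fin 4) (b : Bool) : nablaC (X.fr a) (X.fc (hb b)) =
    (X.kS (1/2) * (if b then 1 else -1) * X.conn a 2 3) • X.fc (hb b)
      + (X.kS (-1/2) * X.conn a (hb b) 1) • X.fc 0 + (X.kS (-1/2) * X.conn a (hb b) 0) • X.fc 1 := by
  funext μ
  rw [frame_complete (nablaC (X.fr a) (X.fc (hb b))) μ]
  have hc : ∀ c, Gc (X.fc c) (nablaC (X.fr a) (X.fc (hb b))) = X.conn a (hb b) c := fun c =>
    Gc_symm _ _
  simp only [hc, Fin.sum_univ_four, etai, of_apply, Matrix.cons_val, cons_val_zero,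
    cons_val_one, map_zero, mul_zero, zero_mul, add_zero, zero_add, Fin.isValue]
  cases b
  · simp only [hb, Bool.false_eq_true, if_false, conn_self, mul_zero, Pi.add_apply, Pi.smul_apply,
      smul_eq_mul, add_zero, conn_antisymm a 3 2]
    ring
  · simp only [hb, if_true, conn_self, mul_zero, Pi.add_apply, Pi.smul_apply, smul_eq_mul,  add_zero]; ring

lemma comp_cov (h : X.TSf T) (hT : X.Hor T) (a : Fin 4) (σ : Fin k → Bool) :
    X.tm (X.B.cov T) (Fin.cons (X.fc a) fun i => X.fc (hb (σ i))) =
      Vd (X.fr a) (X.comp T σ) - (spin σ : X.Sm) * (X.kS (1/2) * X.conn a 2 3) * X.comp T σ := by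
  rw [fc, tm_cov h]
  congr 1
  have e : ∀ i, X.tm T (update (fun i => X.fc (hb (σ i))) i (nablaC (X.fr a) (X.fc (hb (σ i))))) =
      (if σ i then 1 else -1) * (X.kS (1/2) * X.conn a 2 3) * X.comp T σ := by
    intro i
    rw [nablaC_hb, MultilinearMap.map_update_add, MultilinearMap.map_update_add,
      MultilinearMap.map_update_smul, MultilinearMap.map_update_smul,
      MultilinearMap.map_update_smul, hT (update (fun i => X.fc (hb (σ i))) i (X.fc 0)) i (.inl (by simp)),
      hT (update (fun i => X.fc (hb (σ i))) i (X.fc 1)) i (.inr (by simp)),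
      update_eq_self i (fun i => X.fc (hb (σ i)))]
    simp only [smul_eq_mul, mul_zero, add_zero, comp]; ring
  rw [sum_ext fun i => e i, ← sum_mul, ← sum_mul, spin]
  push_cast
  rfl

/-- Smooth horizontal tensor fields. -/
def Good (X : Adm) {k : ℕ} (T : Tens k) : Prop := X.TSf T ∧ X.Hor T

def lt (b : Bool) : Letter := if b then .p else .m

lemma half_mul (u : X.Sm) : X.kS (1/2) * (2 * u) = u := by
  have h : X.kS (1/2) * 2 = (1 : X.Sm) := by rw [show (2 : X.Sm) = X.kS 2 from (map_ofNat _ 2).symm, ← map_mul]; norm_num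
  linear_combination u * h

section deriv

variable {k : ℕ} {T T' : Tens k}

lemma Good.proj (h : X.TSf T) : X.Good (X.B.proj T) := ⟨h.proj, hor_proj h⟩

lemma Good.nab (h : X.Good T) : X.Good (X.B.nab T) := Good.proj h.1.cov

lemma comp_nab (h : X.Good T) (b : Bool) (σ : Fin k → Bool) :
    X.comp (X.B.nab T) (Fin.cons b σ) = op X (lt b) (spin σ) (X.comp T σ) := by
  have e : (fun i : Fin (k + 1) => X.fc (hb ((Fin.cons b σ : Fin (k + 1) → Bool) i)))
      = Fin.cons (X.fc (hb b)) fun i => X.fc (hb (σ i)) := by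
    funext i; refine Fin.cases rfl (fun i => rfl) i
  rw [Background.nab, comp_proj h.1.cov, comp, e, comp_cov h.1 h.2]
  cases b
  · have e3 : X.fr (hb false) = X.Em := rfl; have h1 := half_mul (X.zeS 1 * X.kpS (-1))
    rw [e3, Vd_Em, show hb false = 3 from rfl, X.connEqs.em, lt]; simp only [Bool.false_eq_true, if_false, op]; grind
  · have e3 : X.fr (hb true) = X.Ep := rfl; have h1 := half_mul (X.zeS (-1) * X.kpS 1)
    rw [e3, Vd_Ep, show hb true = 2 from rfl, X.connEqs.ep, lt]; simp only [if_true, op]; grind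

lemma tsf_along (h : X.TSf T) {V : Pt → Pt} (hV : ∀ μ, ContDiffOn ℝ ∞ (fun p => V p μ) X.offU) :
    X.TSf (fun p I => ∑ μ, (V p μ : ℂ) * X.B.cov T p (Fin.cons μ I) : Tens k) := fun _ =>
  Sf.sum fun _ _ => (Sf.of_real (hV _)).mul (h.cov _)

lemma tm_along (h : X.TSf T) (a : Fin 4) {V : Pt → Pt} (hV : ∀ μ, ContDiffOn ℝ ∞ (fun p => V p μ) X.offU)
    (e : ∀ μ, X.pbr (fun p => V p μ) = X.fc a μ) (W : Fin k → Fin 4 → X.Sm) :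
    X.tm (fun p I => ∑ μ, (V p μ : ℂ) * X.B.cov T p (Fin.cons μ I) : Tens k) W = X.tm (X.B.cov T) (Fin.cons (X.fc a) W) := by
  rw [tm_apply, tm_apply, ← (Fin.consEquiv fun _ => Fin 4).sum_comp, Fintype.sum_prod_type, sum_comm]
  refine sum_ext fun I => ?_
  have hs : ∀ μ ∈ (Finset.univ : Finset (Fin 4)), X.Sf fun p => (V p μ : ℂ) *
      X.B.cov T p (Fin.cons μ I) := fun μ _ => (Sf.of_real (hV _)).mul (h.cov _)
  rw [pb_sum hs, sum_mul]
  refine sum_ext fun μ => ?_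
  rw [pb_mul (Sf.of_real (hV μ)) (h.cov _)]
  simp only [Fin.consEquiv, Equiv.coe_fn_mk, Fin.prod_univ_succ, Fin.cons_zero, Fin.cons_succ, ← e, pbr]
  ring

lemma Good.nab3 (h : X.Good T) : X.Good (X.B.nab3 T) := Good.proj (tsf_along h.1 X.smooth_e3)
lemma Good.nab4 (h : X.Good T) : X.Good (X.B.nab4 T) := Good.proj (tsf_along h.1 X.smooth_e4)

lemma comp_nab3 (h : X.Good T) (σ : Fin k → Bool) : X.comp (X.B.nab3 T) σ = X.op3 (X.comp T σ) := by
  rw [Background.nab3, Background.nabAlong, comp_proj (tsf_along h.1 X.smooth_e3), comp,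
    tm_along h.1 0 X.smooth_e3 pbr_e3, comp_cov h.1 h.2, X.connEqs.e3, show X.fr 0 = X.E3 from rfl, Vd_E3]
  simp

lemma comp_nab4 (h : X.Good T) (σ : Fin k → Bool) : X.comp (X.B.nab4 T) σ = op X .f (spin σ) (X.comp T σ) := by
  rw [Background.nab4, Background.nabAlong, comp_proj (tsf_along h.1 X.smooth_e4), comp,
    tm_along h.1 1 X.smooth_e4 pbr_e4, comp_cov h.1 h.2, X.connEqs.e4, show X.fr 1 = X.E4 from rfl, Vd_E4,
    op]
  linear_combination (spin σ : X.Sm) * X.comp T σ * half_mul X.gamS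

lemma Good.add (h : X.Good T) (h' : X.Good T') : X.Good (T + T') :=
  ⟨h.1.add h'.1, fun V i hi => by rw [tm_add h.1 h'.1, add_apply, h.2 V i hi, h'.2 V i hi, add_zero]⟩

lemma Good.wt {w : Pt → ℝ} (hw : ContDiffOn ℝ ∞ w X.off) (h : X.Good T) : X.Good (wt w T) :=
  ⟨h.1.wt hw, fun V i hi => by rw [tm_wt hw h.1, h.2 V i hi, mul_zero]⟩

lemma comp_add (h : X.TSf T) (h' : X.TSf T') (σ) : X.comp (T + T') σ = X.comp T σ + X.comp T' σ := by
  rw [comp, tm_add h h']; rfl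

lemma comp_sub (h : X.TSf T) (h' : X.TSf T') (σ) : X.comp (T - T') σ = X.comp T σ - X.comp T' σ := by
  rw [comp, tm_sub h h']; rfl

lemma comp_neg (h : X.TSf T) (σ) : X.comp (-T) σ = -X.comp T σ := by rw [comp, tm_neg h]; rfl

lemma comp_wt {w : Pt → ℝ} (hw : ContDiffOn ℝ ∞ w X.off) (h : X.TSf T) (σ) :
    X.comp (Kerr.wt w T) σ = X.pbr w * X.comp T σ := tm_wt hw h _

lemma smooth_deg : ContDiffOn ℝ ∞ (fun p => 1 - X.B.M / rad p) X.off :=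
  (contDiffOn_const.sub (contDiffOn_const.div X.smooth_rad fun _ h =>
    (X.rad_pos_of_mem h).ne')).mono X.off_subset_offU

lemma pbr_deg : X.pbr (fun p => 1 - X.B.M / rad p) = X.delS := by
  ext q : 1
  rw [pbr_ap smooth_deg, rad_Sph (X.r_pos q).le, delS_ap]
  push_cast
  rw [div_eq_mul_inv]

lemma Good.degNab3 (h : X.Good T) : X.Good (X.B.degNab3 T) := h.nab3.wt smooth_deg

lemma comp_degNab3 (h : X.Good T) (σ : Fin k → Bool) : X.comp (X.B.degNab3 T) σ = op X .d (spin σ) (X.comp T σ) := by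
  rw [Background.degNab3, comp_wt smooth_deg h.nab3.1, comp_nab3 h, pbr_deg, op]

end deriv

lemma conj_fc (μ : Fin 4) (q : X.dom) : starRingEnd ℂ ((X.fc 2 μ).1 q) = (X.fc 3 μ).1 q := by
  have e2 : X.fc 2 = cart X.Ep := rfl
  have e3 : X.fc 3 = cart X.Em := rfl
  rw [e2, e3]
  have hz : starRingEnd ℂ ((X.zeS (-1)).1 q) = (X.zeS 1).1 q := by
    rw [zm_ap, zp_ap, map_inv₀]; congr 1; simp only [map_sub, map_mul, Complex.conj_ofReal, Complex.conj_I]; ring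
  fin_cases μ <;>
  simp only [Fin.mk_one, Fin.zero_eta, Fin.reduceFinMk, Fin.isValue, cart_zero, cart_one, cart_two,
    cart_three, Matrix.cons_val, cons_val_zero, cons_val_one, Ep, Em, zero_ap, neg_ap,
    mul_ap, add_ap, sub_ap, rS_ap, sS_ap, cS_ap, cfS_ap, sfS_ap, wS_ap, hS_ap, AS_ap, iS_ap, siS_ap,
    map_add, map_sub, map_mul, map_zero, hz, Complex.conj_ofReal, Complex.conj_I, map_inv₀] <;>
  ring

lemma conj_fc' (b : Bool) (μ : Fin 4) (q : X.dom) : starRingEnd ℂ ((X.fc (hb b) μ).1 q) = (X.fc (hb !b) μ).1 q := by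
  cases b
  · show starRingEnd ℂ ((X.fc 3 μ).1 q) = (X.fc 2 μ).1 q; rw [← conj_fc, Complex.conj_conj]
  · exact conj_fc μ q

lemma comp_ap {k : ℕ} {T : Tens k} (h : X.TSf T) (σ : Fin k → Bool) (q : X.dom) :
    (X.comp T σ).1 q = ∑ I : Fin k → Fin 4, T (Sph q) I * ∏ i, (X.fc (hb (σ i)) (I i)).1 q := by
  rw [comp, tm_apply, sum_ap]
  refine sum_ext fun I => ?_
  rw [mul_ap, prod_ap, pb_ap (h I)]

lemma normSq_Sph {k : ℕ} {T : Tens k} (h : X.TSf T) (q : X.dom) :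
    X.B.normSq T (Sph q) = (2⁻¹) ^ k * ∑ σ : Fin k → Bool, ‖(X.comp T σ).1 q‖ ^ 2 := by
  have hh : ∀ μ ν, (X.B.hInv (Sph q) μ ν : ℂ) = 2⁻¹ * ∑ b : Bool, (X.fc (hb b) μ).1 q *
      starRingEnd ℂ ((X.fc (hb b) ν).1 q) := by
    intro μ ν; rw [← pbr_ap (smooth_hInv μ ν), pbr_hInv, Fintype.sum_bool, conj_fc', conj_fc']; simp [hb]
  have key : (∑ I : Fin k → Fin 4, ∑ J : Fin k → Fin 4, (∏ i, (X.B.hInv (Sph q) (I i) (J i) : ℂ)) *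
      T (Sph q) I * starRingEnd ℂ (T (Sph q) J)) =
      (((2⁻¹) ^ k * ∑ σ : Fin k → Bool, ‖(X.comp T σ).1 q‖ ^ 2 : ℝ) : ℂ) := by
    have e : ∀ σ : Fin k → Bool, ((‖(X.comp T σ).1 q‖ ^ 2 : ℝ) : ℂ) =
        ∑ I : Fin k → Fin 4, ∑ J : Fin k → Fin 4, (∏ i, (X.fc (hb (σ i)) (I i)).1 q *
          starRingEnd ℂ ((X.fc (hb (σ i)) (J i)).1 q)) * T (Sph q) I *
          starRingEnd ℂ (T (Sph q) J) := by
      intro σ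
      have : ((‖(X.comp T σ).1 q‖ ^ 2 : ℝ) : ℂ) = (X.comp T σ).1 q * starRingEnd ℂ ((X.comp T σ).1 q) := by
        rw [Complex.mul_conj, Complex.normSq_eq_norm_sq]
      rw [this, comp_ap h, map_sum, Finset.sum_mul_sum]; refine sum_ext fun I => sum_ext fun J => ?_
      rw [map_mul, map_prod, Finset.prod_mul_distrib]; ring
    push_cast at e ⊢
    simp only [e, hh, Finset.prod_mul_distrib, Finset.prod_const, Finset.card_univ, Fintype.card_fin,
      mul_sum, Finset.prod_univ_sum, Fintype.piFinset_univ]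
    rw [sum_comm]; rw [sum_comm (s := Finset.univ (α := Fin k → Bool))]; rw [sum_comm]; refine sum_ext fun I => ?_
    rw [sum_comm (s := Finset.univ (α := Fin k → Bool))]; refine sum_ext fun J => ?_; rw [sum_mul, sum_mul]
    refine sum_ext fun σ => ?_; ring
  rw [Background.normSq, key, Complex.ofReal_re]

lemma sig_mul (q : X.dom) : (X.B.Sig (Sph q) : ℂ) * ((X.zeS 1).1 q * (X.zeS (-1)).1 q) = 1 := by
  have hz := zp_mul q
  have hzb := zm_mul q
  rw [Sig_Sph]
  push_cast at hz hzb ⊢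
  have hI := I_sq
  grind

lemma sqrt_det (q : X.dom) : Real.sqrt |(X.B.gMat (Sph q)).det| = X.B.Sig (Sph q) / q.1 1 ^ 2 := by
  have hr := X.r_pos q
  have hS : 0 < X.B.Sig (Sph q) := by rw [Sig_Sph]; positivity
  have h := congrArg Matrix.det (frM_gM q)
  have he : eta.det = 16 := by
    simp [eta, det_succ_row_zero, Fin.sum_univ_succ, Fin.succAbove]; norm_num
  rw [det_mul, det_mul, Matrix.det_transpose, det_frM, he, ← det_gMat] at h
  have hs := sig_mul q
  have hI := I_sq
  have key : ((X.B.gMat (Sph q)).det : ℂ) * (q.1 1 : ℂ) ^ 4 = -(X.B.Sig (Sph q) : ℂ) ^ 2 := by grind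
  have key' : (X.B.gMat (Sph q)).det = -(X.B.Sig (Sph q) / q.1 1 ^ 2) ^ 2 := by
    have : (X.B.gMat (Sph q)).det * q.1 1 ^ 4 = -X.B.Sig (Sph q) ^ 2 := by exact_mod_cast key
    field_simp; linarith
  rw [key', abs_neg, abs_of_nonneg (sq_nonneg _), Real.sqrt_sq (by positivity)]

lemma smooth_vol (i j : Fin 4) : ContDiffOn ℝ ∞ (fun p => X.B.vol p i j) X.off := by
  have h1 : ContDiffOn ℝ ∞ (fun p => X.B.Sig p / rad p ^ 2) X.off :=
    (X.smooth_Sig.div (X.smooth_rad.pow 2) fun _ h => (pow_pos (X.rad_pos_of_mem h) 2).ne').mono X.off_subset_offU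
  have h2 : ContDiffOn ℝ ∞ (fun p => Real.sqrt |(X.B.gMat p).det|) X.off := by
    refine h1.congr fun p hp => ?_; obtain ⟨q, hq, rfl⟩ := exists_Sph hp; rw [sqrt_det ⟨q, hq⟩, rad_Sph (X.r_pos ⟨q, hq⟩).le]
  refine (h2.mul (smooth_det fun k l => ?_)).div_const _
  fin_cases k
  · exact contDiffOn_const
  · exact contDiffOn_const
  · exact (X.smooth_e3 l).mono X.off_subset_offU
  · exact (X.smooth_e4 l).mono X.off_subset_offU

/-- The volume form on vectors given by Cartesian components. -/
def volC (V W : Fin 4 → X.Sm) : X.Sm := ∑ μ, ∑ ν, X.pbr (fun p => X.B.vol p μ ν) * V μ * W ν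

lemma det_rows (u v x y : Fin 4 → ℂ) : ∑ μ, ∑ ν, (Matrix.of ![Pi.single μ 1, Pi.single ν 1, x, y]).det
    * u μ * v ν = (Matrix.of ![u, v, x, y]).det := by
  simp [det_succ_row_zero, Fin.sum_univ_succ, Fin.succAbove, Pi.single_apply]
  ring

lemma det_rows_swap (u v x y : Fin 4 → ℂ) : (Matrix.of ![u, v, x, y]).det = (Matrix.of ![x, y, u, v]).det := by
  simp [det_succ_row_zero, Fin.sum_univ_succ, Fin.succAbove]
  ring

lemma volC_ap (V W : Fin 4 → X.Sm) (q : X.dom) : (volC V W).1 q =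
    (X.B.Sig (Sph q) : ℂ) / (2 * (q.1 1 : ℂ) ^ 2) * (Matrix.of ![fun μ => (X.fc 0 μ).1 q,
      fun μ => (X.fc 1 μ).1 q, fun μ => (V μ).1 q, fun μ => (W μ).1 q]).det := by
  rw [← det_rows_swap, ← det_rows, mul_sum]
  simp only [volC, sum_ap, mul_ap, pbr_ap (smooth_vol _ _)]
  simp only [Background.vol, sqrt_det]
  refine sum_ext fun μ => ?_
  rw [mul_sum]
  refine sum_ext fun ν => ?_
  have : (((Matrix.of ![stdVec μ, stdVec ν, X.B.e3 (Sph q), X.B.e4 (Sph q)]).det : ℝ) : ℂ) =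
      (Matrix.of ![Pi.single μ 1, Pi.single ν 1, fun μ => (X.fc 0 μ).1 q, fun μ => (X.fc 1 μ).1 q]).det := by
    rw [← Complex.coe_algebraMap, RingHom.map_det]; congr 1; ext i j
    simp only [← pbr_e3, ← pbr_e4, pbr_ap' (X.smooth_e3 _), pbr_ap' (X.smooth_e4 _)]
    fin_cases i <;> simp [stdVec, Pi.single_apply] <;> split_ifs <;> simp
  push_cast
  rw [this]
  ring

lemma volC_pm : volC (X.fc 2) (X.fc 3) = X.kS (-2 * I) := by
  ext q : 1
  have hr := X.r_ne q
  have hs := sig_mul q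
  have : (Matrix.of ![fun μ => (X.fc 0 μ).1 q, fun μ => (X.fc 1 μ).1 q, fun μ => (X.fc 2 μ).1 q,
      fun μ => (X.fc 3 μ).1 q]) = (frM q).transpose := by
    ext i j
    fin_cases i <;> rfl
  rw [volC_ap, this, Matrix.det_transpose, det_frM, algebraMap_ap]
  field_simp
  linear_combination -4 * hs

lemma volC_swap (V W : Fin 4 → X.Sm) : volC V W = -volC W V := by
  ext q : 1
  rw [neg_ap, volC_ap, volC_ap]
  simp [det_succ_row_zero, Fin.sum_univ_succ, Fin.succAbove]
  ring

lemma volC_self (V : Fin 4 → X.Sm) : volC V V = 0 := by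
  refine two_cancel ?_
  linear_combination volC_swap V V

lemma volC_e3 (W : Fin 4 → X.Sm) : volC (X.fc 0) W = 0 := by
  ext q : 1
  rw [volC_ap, Matrix.det_zero_of_row_eq (i := 0) (j := 2) (by decide) rfl, mul_zero]; rfl

lemma volC_e4 (W : Fin 4 → X.Sm) : volC (X.fc 1) W = 0 := by
  ext q : 1
  rw [volC_ap, Matrix.det_zero_of_row_eq (i := 1) (j := 2) (by decide) rfl, mul_zero]; rfl

lemma volC_mp : volC (X.fc 3) (X.fc 2) = X.kS (2 * I) := by rw [volC_swap, volC_pm, ← map_neg]; congr 1; ring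

lemma smooth_volMix (i j : Fin 4) : ContDiffOn ℝ ∞ (fun p => X.B.volMix p i j) X.off :=
  ContDiffOn.sum fun _ _ => (smooth_vol _ _).mul (smooth_hInv _ _)

lemma pbr_volMix (μ ν : Fin 4) : X.pbr (fun p => X.B.volMix p μ ν) =
    ∑ s, X.pbr (fun p => X.B.vol p μ s) * X.pbr (fun p => X.B.hInv p s ν) := by
  ext q : 1
  simp only [sum_ap, mul_ap, pbr_ap (smooth_volMix _ _), pbr_ap (smooth_vol _ _), pbr_ap (smooth_hInv _ _)]
  simp only [Background.volMix]
  push_cast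
  rfl

/-- The dual of the horizontal rotation, on vectors. -/
def hst (V : Fin 4 → X.Sm) (ν : Fin 4) : X.Sm := ∑ μ, X.pbr (fun p => X.B.volMix p μ ν) * V μ

lemma hst_eq (V : Fin 4 → X.Sm) (ν : Fin 4) :
    hst V ν = X.kS (1/2) * (volC V (X.fc 2) * X.fc 3 ν + volC V (X.fc 3) * X.fc 2 ν) := by
  simp only [hst, pbr_volMix, pbr_hInv, volC, sum_mul, mul_sum, ← sum_add_distrib]
  grind

def stv (b : Bool) : ℂ := if b then -I else I

lemma hst_hb (b : Bool) : hst (X.fc (hb b)) = X.kS (stv b) • X.fc (hb b) := by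
  funext ν
  rw [hst_eq, Pi.smul_apply, smul_eq_mul]
  cases b
  · show X.kS (1/2) * (volC (X.fc 3) (X.fc 2) * X.fc 3 ν + volC (X.fc 3) (X.fc 3) * X.fc 2 ν) = X.kS I * X.fc 3 ν
    rw [volC_mp, volC_self, zero_mul, add_zero, ← mul_assoc, ← map_mul]; congr 2; ring
  · show X.kS (1/2) * (volC (X.fc 2) (X.fc 2) * X.fc 3 ν + volC (X.fc 2) (X.fc 3) * X.fc 2 ν) = X.kS (-I) * X.fc 2 ν
    rw [volC_pm, volC_self, zero_mul, zero_add, ← mul_assoc, ← map_mul]; congr 2; ring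

lemma hst_vert {V : Fin 4 → X.Sm} (h : V = X.fc 0 ∨ V = X.fc 1) : hst V = 0 := by
  funext ν
  rcases h with rfl | rfl <;> simp [hst_eq, volC_e3, volC_e4]

lemma TSf.star {T : Tens 1} (h : X.TSf T) : X.TSf (X.B.star T) := fun _ =>
  Sf.sum fun _ _ => (Sf.ofReal (smooth_volMix _ _)).mul (h _)

lemma sum_fin_one (F : (Fin 1 → Fin 4) → X.Sm) : ∑ I, F I = ∑ μ, F ![μ] := by
  rw [← (Equiv.funUnique (Fin 1) (Fin 4)).symm.sum_comp]
  refine sum_ext fun μ => congrArg F ?_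
  funext i
  fin_cases i; rfl

lemma tm_star {T : Tens 1} (h : X.TSf T) (V : Fin 1 → Fin 4 → X.Sm) : X.tm (X.B.star T) V = X.tm T fun i => hst (V i) := by
  have e : ∀ μ, (X.pb fun p => X.B.star T p ![μ]) = ∑ ν, X.pbr (fun p => X.B.volMix p μ ν) * X.pb fun p => T p ![ν] := by
    intro μ
    have hs : ∀ ν ∈ (Finset.univ : Finset (Fin 4)), X.Sf fun p => (X.B.volMix p μ ν : ℂ) * T p ![ν] :=
      fun ν _ => (Sf.ofReal (smooth_volMix _ _)).mul (h _)
    refine (pb_sum hs).trans (sum_ext fun ν => ?_); rw [pb_mul (Sf.ofReal (smooth_volMix _ _)) (h _)]; rfl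
  rw [tm_apply, tm_apply, sum_fin_one, sum_fin_one]
  simp only [e, Finset.univ_unique, Fin.default_eq_zero, Finset.prod_singleton, cons_val_zero, hst, sum_mul, mul_sum]
  rw [sum_comm]
  grind

lemma Good.star {T : Tens 1} (h : X.Good T) : X.Good (X.B.star T) := ⟨h.1.star, fun V i hi => by
    rw [tm_star h.1]; exact MultilinearMap.map_coord_zero _ i (hst_vert hi)⟩

lemma comp_star {T : Tens 1} (h : X.TSf T) (σ : Fin 1 → Bool) : X.comp (X.B.star T) σ = X.kS (stv (σ 0)) * X.comp T σ := by
  rw [comp, tm_star h]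
  simp only [hst_hb]
  rw [MultilinearMap.map_smul_univ]
  simp [comp]

section act

variable {k : ℕ} {T : Tens k} {t s : Pt → ℝ}

lemma TSf.act (ht : ContDiffOn ℝ ∞ t X.off) (hs : ContDiffOn ℝ ∞ s X.off) (h : X.TSf T) : X.TSf (X.B.act t s T) := fun _ =>
  Sf.sum fun _ _ => Sf.sum fun _ _ => (Sf.ofReal (((ht.div_const _).mul (smooth_prj _ _)).add
    ((hs.div_const _).mul (smooth_volMix _ _)))).mul (h _)

lemma tm_act (ht : ContDiffOn ℝ ∞ t X.off) (hs : ContDiffOn ℝ ∞ s X.off) (h : X.TSf T) (V) :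
    X.tm (X.B.act t s T) V = ∑ i, X.tm T (update V i
      ((X.kS (1/2) * X.pbr t) • hz (V i) + (X.kS (1/2) * X.pbr s) • hst (V i))) := by
  have e1 : ∀ i, ((X.kS (1/2) * X.pbr t) • hz (V i) + (X.kS (1/2) * X.pbr s) • hst (V i)) =
      fun l => ∑ ν, (X.kS (1/2) * X.pbr t * X.pbr (fun p => X.B.prj p ν l)
        + X.kS (1/2) * X.pbr s * X.pbr (fun p => X.B.volMix p ν l)) * V i ν := by
    intro i; funext l
    simp only [Pi.add_apply, Pi.smul_apply, smul_eq_mul, ← sum_prj, hst, add_mul, sum_add_distrib, mul_sum]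
    congr 1 <;> refine sum_ext fun _ => ?_ <;> ring
  have hw : ∀ ν l, ContDiffOn ℝ ∞ (fun p => t p / 2 * X.B.prj p ν l + s p / 2 * X.B.volMix p ν l)
      X.off := fun ν l => ((ht.div_const _).mul (smooth_prj _ _)).add ((hs.div_const _).mul (smooth_volMix _ _))
  have e2 : ∀ ν l, X.pbr (fun p => t p / 2 * X.B.prj p ν l + s p / 2 * X.B.volMix p ν l) =
      X.kS (1/2) * X.pbr t * X.pbr (fun p => X.B.prj p ν l) + X.kS (1/2) * X.pbr s * X.pbr (fun p => X.B.volMix p ν l) := by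
    intro ν l; ext q : 1; rw [pbr_ap (hw ν l)]
    simp only [add_ap, mul_ap, algebraMap_ap, pbr_ap ht, pbr_ap hs, pbr_ap (smooth_prj _ _), pbr_ap (smooth_volMix _ _)]
    push_cast; ring
  have hs1 : ∀ (I : Fin k → Fin 4) (i : Fin k), ∀ ν ∈ (Finset.univ : Finset (Fin 4)), X.Sf fun p =>
      ((t p / 2 * X.B.prj p (I i) ν + s p / 2 * X.B.volMix p (I i) ν : ℝ) : ℂ) *
        T p (update I i ν) := fun I i ν _ => (Sf.ofReal (hw _ _)).mul (h _)
  simp only [e1, tm_update_lin, ← e2]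
  rw [tm_apply, sum_comm]
  refine sum_ext fun I => ?_
  have e3 : (X.pb fun p => X.B.act t s T p I) = ∑ i, ∑ ν, X.pbr (fun p => t p / 2 *
      X.B.prj p (I i) ν + s p / 2 * X.B.volMix p (I i) ν) *
      X.pb fun p => T p (update I i ν) := by
    refine (pb_sum fun i _ => Sf.sum (hs1 I i)).trans (sum_ext fun i => ?_)
    refine (pb_sum (hs1 I i)).trans (sum_ext fun ν => ?_); rw [pb_mul (Sf.ofReal (hw _ _)) (h _)]; rfl
  rw [e3, sum_mul]
  refine sum_ext fun i => ?_
  rw [sum_mul]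

lemma Good.act (ht : ContDiffOn ℝ ∞ t X.off) (hs : ContDiffOn ℝ ∞ s X.off) (h : X.Good T) : X.Good (X.B.act t s T) := by
  refine ⟨h.1.act ht hs, fun V j hj => ?_⟩
  rw [tm_act ht hs h.1]
  refine Finset.sum_eq_zero fun i _ => ?_
  rcases eq_or_ne j i with rfl | hij
  · refine MultilinearMap.map_coord_zero _ j ?_; rw [Function.update_self, hst_vert hj]
    rcases hj with hj | hj <;> simp [hj, hz_fc]
  · exact h.2 _ j (by rw [Function.update_of_ne hij]; exact hj)

lemma comp_act (ht : ContDiffOn ℝ ∞ t X.off) (hs : ContDiffOn ℝ ∞ s X.off) (h : X.TSf T)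
    (σ : Fin k → Bool) : X.comp (X.B.act t s T) σ = X.kS (1/2) * ((k : X.Sm) * X.pbr t
      - X.iS * (spin σ : X.Sm) * X.pbr s) * X.comp T σ := by
  rw [comp, tm_act ht hs h]
  have e : ∀ i, X.tm T (update (fun i => X.fc (hb (σ i))) i
      ((X.kS (1/2) * X.pbr t) • hz (X.fc (hb (σ i))) + (X.kS (1/2) * X.pbr s) •
        hst (X.fc (hb (σ i))))) = (X.kS (1/2) * X.pbr t) * X.comp T σ -
      (X.kS (1/2) * X.pbr s * X.iS) * (if σ i then 1 else -1) * X.comp T σ := by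
    intro i
    rw [hz_hb, hst_hb, smul_smul, ← add_smul, MultilinearMap.map_update_smul,
      update_eq_self i (fun i => X.fc (hb (σ i))), smul_eq_mul, comp]
    have : X.kS (stv (σ i)) = -(X.iS * (if σ i then 1 else -1)) := by cases σ i <;> simp [stv, iS]
    rw [this]; ring
  rw [sum_ext fun i => e i, sum_sub_distrib, Finset.sum_const,
    Finset.card_univ, Fintype.card_fin, nsmul_eq_mul, ← sum_mul, ← mul_sum, spin]
  push_cast
  ring

end act

lemma sum_fin_two (F : (Fin 2 → Fin 4) → X.Sm) : ∑ I, F I = ∑ μ, ∑ ν, F ![μ, ν] := by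
  rw [← (finTwoArrowEquiv (Fin 4)).symm.sum_comp, Fintype.sum_prod_type]
  rfl

lemma tm_two (T : Tens 2) (V W : Fin 4 → X.Sm) : X.tm T ![V, W] = ∑ μ, ∑ ν, (X.pb fun p => T p ![μ, ν]) * (V μ * W ν) := by
  rw [tm_apply, sum_fin_two]
  simp only [Fin.prod_univ_two, cons_val_zero, cons_val_one]

lemma comp_zero (T : Tens 0) (σ : Fin 0 → Bool) : X.comp T σ = X.pb fun p => T p ![] := by
  rw [comp, tm_apply, Fintype.sum_unique]
  simp only [Finset.univ_eq_empty, Finset.prod_empty, mul_one]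
  congr 1

lemma smooth_volUp (i j : Fin 4) : ContDiffOn ℝ ∞ (fun p => X.B.volUp p i j) X.off :=
  ContDiffOn.sum fun _ _ => ContDiffOn.sum fun _ _ =>
    ((smooth_hInv _ _).mul (smooth_hInv _ _)).mul (smooth_vol _ _)

lemma pbr_volUp (μ ν : Fin 4) : X.pbr (fun p => X.B.volUp p μ ν) =
    X.kS (I / 2) * (X.fc 2 μ * X.fc 3 ν - X.fc 3 μ * X.fc 2 ν) := by
  have h : X.pbr (fun p => X.B.volUp p μ ν) = ∑ s, ∑ t, X.pbr (fun p => X.B.hInv p μ s) *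
      X.pbr (fun p => X.B.hInv p ν t) * X.pbr (fun p => X.B.vol p s t) := by
    ext q : 1; simp only [sum_ap, mul_ap, pbr_ap (smooth_volUp _ _), pbr_ap (smooth_vol _ _), pbr_ap (smooth_hInv _ _)]
    simp only [Background.volUp]; push_cast; rfl
  have h' : X.pbr (fun p => X.B.volUp p μ ν) = X.kS (1/4) * (X.fc 2 μ * X.fc 2 ν * volC (X.fc 3) (X.fc 3)
      + X.fc 2 μ * X.fc 3 ν * volC (X.fc 3) (X.fc 2) + X.fc 3 μ * X.fc 2 ν * volC (X.fc 2) (X.fc 3)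
      + X.fc 3 μ * X.fc 3 ν * volC (X.fc 2) (X.fc 2)) := by
    have e : X.kS (1/4) = X.kS (1/2) * X.kS (1/2) := by rw [← map_mul]; norm_num
    rw [h, e]; simp only [pbr_hInv, volC, mul_sum, ← sum_add_distrib]; refine sum_ext fun s => sum_ext fun t => ?_; ring
  have e1 : X.kS (1/4) * X.kS (2 * I) = X.kS (I / 2) := by rw [← map_mul]; congr 1; ring
  have e2 : X.kS (-2 * I) = -X.kS (2 * I) := by rw [← map_neg]; congr 1; ring
  rw [h', volC_self, volC_self, volC_mp, volC_pm, e2, ← e1]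
  ring

section divcurl

variable {T : Tens 1}

lemma TSf.div (h : X.TSf (X.B.nab T)) : X.TSf (X.B.div T) := fun _ =>
  Sf.sum fun _ _ => Sf.sum fun _ _ => (Sf.ofReal (smooth_hInv _ _)).mul (h _)

lemma TSf.curl (h : X.TSf (X.B.nab T)) : X.TSf (X.B.curl T) := fun _ =>
  Sf.sum fun _ _ => Sf.sum fun _ _ => (Sf.ofReal (smooth_volUp _ _)).mul (h _)

lemma tm_nab_pm (h : X.Good T) : X.tm (X.B.nab T) ![X.fc 2, X.fc 3] = op X .p (-1) (X.comp T ![false]) := by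
  have e := comp_nab h true ![false]
  have e' : (fun i : Fin 2 => X.fc (hb ((Fin.cons true ![false] : Fin 2 → Bool) i))) = ![X.fc 2, X.fc 3] := by
    funext i; fin_cases i <;> rfl
  rw [comp, e'] at e
  rw [e]
  rfl

lemma tm_nab_mp (h : X.Good T) : X.tm (X.B.nab T) ![X.fc 3, X.fc 2] = op X .m 1 (X.comp T ![true]) := by
  have e := comp_nab h false ![true]
  have e' : (fun i : Fin 2 => X.fc (hb ((Fin.cons false ![true] : Fin 2 → Bool) i))) = ![X.fc 3, X.fc 2] := by
    funext i; fin_cases i <;> rfl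
  rw [comp, e'] at e
  rw [e]
  rfl

lemma comp_div (h : X.Good T) (σ : Fin 0 → Bool) : X.comp (X.B.div T) σ =
    X.kS (1/2) * (op X .p (-1) (X.comp T ![false]) + op X .m 1 (X.comp T ![true])) := by
  have hs : ∀ μ ν, X.Sf fun p => (X.B.hInv p μ ν : ℂ) * X.B.nab T p ![μ, ν] := fun μ ν =>
    (Sf.ofReal (smooth_hInv _ _)).mul (h.nab.1 _)
  have e : X.comp (X.B.div T) σ = ∑ μ, ∑ ν, X.pbr (fun p => X.B.hInv p μ ν) * X.pb fun p => X.B.nab T p ![μ, ν] := by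
    rw [comp_zero]; refine (pb_sum fun μ _ => Sf.sum fun ν _ => hs μ ν).trans (sum_ext fun μ => ?_)
    refine (pb_sum fun ν _ => hs μ ν).trans (sum_ext fun ν => ?_); exact pb_mul (Sf.ofReal (smooth_hInv _ _)) (h.nab.1 _)
  rw [e, ← tm_nab_pm h, ← tm_nab_mp h, tm_two, tm_two]
  simp only [pbr_hInv, mul_sum, ← sum_add_distrib]
  refine sum_ext fun μ => sum_ext fun ν => ?_
  ring

lemma comp_curl (h : X.Good T) (σ : Fin 0 → Bool) : X.comp (X.B.curl T) σ =
    X.kS (I / 2) * (op X .p (-1) (X.comp T ![false]) - op X .m 1 (X.comp T ![true])) := by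
  have hs : ∀ μ ν, X.Sf fun p => (X.B.volUp p μ ν : ℂ) * X.B.nab T p ![μ, ν] := fun μ ν =>
    (Sf.ofReal (smooth_volUp _ _)).mul (h.nab.1 _)
  have e : X.comp (X.B.curl T) σ = ∑ μ, ∑ ν, X.pbr (fun p => X.B.volUp p μ ν) * X.pb fun p => X.B.nab T p ![μ, ν] := by
    rw [comp_zero]; refine (pb_sum fun μ _ => Sf.sum fun ν _ => hs μ ν).trans (sum_ext fun μ => ?_)
    refine (pb_sum fun ν _ => hs μ ν).trans (sum_ext fun ν => ?_); exact pb_mul (Sf.ofReal (smooth_volUp _ _)) (h.nab.1 _)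
  rw [e, ← tm_nab_pm h, ← tm_nab_mp h, tm_two, tm_two]
  simp only [pbr_volUp, mul_sum, ← sum_sub_distrib]
  refine sum_ext fun μ => sum_ext fun ν => ?_
  ring

end divcurl

lemma pbr_eq {F : Pt → ℝ} (h : ContDiffOn ℝ ∞ F X.offU) {u : X.Sm}
    (e : ∀ q : X.dom, (F (Sph q) : ℂ) = u.1 q) : X.pbr F = u :=
  hext fun q => by rw [pbr_ap' h, e]

lemma pbr_rad : X.pbr rad = X.rS := pbr_eq X.smooth_rad fun q => by rw [rad_Sph (X.r_pos q).le]; rfl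

lemma smooth_radInv : ContDiffOn ℝ ∞ (fun p => (rad p)⁻¹) X.offU := X.smooth_rad.inv fun _ h => (X.rad_pos_of_mem h).ne'

lemma pbr_radInv : X.pbr (fun p => (rad p)⁻¹) = X.riS :=
  pbr_eq smooth_radInv fun q => by rw [rad_Sph (X.r_pos q).le, riS_ap]; push_cast; rfl

lemma pbr_rad_sq : X.pbr (fun p => rad p ^ 2) = X.rS ^ 2 :=
  pbr_eq (X.smooth_rad.pow 2) fun q => by rw [rad_Sph (X.r_pos q).le]; push_cast; rfl

variable (X) in
def SigS : X.Sm := X.rS ^ 2 - X.AS ^ 2 * X.cS ^ 2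

lemma SigS_ap (q : X.dom) : (X.SigS).1 q = (X.B.Sig (Sph q) : ℂ) := by
  rw [Sig_Sph, SigS]
  simp only [sub_ap, mul_ap, pow_ap, rS_ap, AS_ap, cS_ap]
  push_cast
  linear_combination -((X.B.a : ℂ) ^ 2 * Complex.cos (q.1 2) ^ 2) * I_sq

lemma pbr_Sig : X.pbr X.B.Sig = X.SigS := pbr_eq X.smooth_Sig fun q => (SigS_ap q).symm

lemma SigS_mul : X.SigS * ζ(X) = 1 := hext fun q => by rw [mul_ap, SigS_ap, mul_ap, sig_mul]; rfl

lemma div_Sig (u : ℂ) (q : X.dom) : u / (X.B.Sig (Sph q) : ℂ) = u * ((X.zeS 1).1 q * (X.zeS (-1)).1 q) := by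
  have h := sig_mul q
  grind

lemma smooth_trChi : ContDiffOn ℝ ∞ X.B.trChi X.offU :=
  ((contDiffOn_const.mul X.smooth_rad).mul X.smooth_Del).div (X.smooth_Sig.pow 2) fun _ h => pow_ne_zero 2 (X.Sig_ne h)
lemma smooth_trUChi : ContDiffOn ℝ ∞ X.B.trUChi X.offU :=
  (contDiffOn_const.mul X.smooth_rad).neg.div X.smooth_Sig fun _ h => X.Sig_ne h
lemma smooth_epsChi : ContDiffOn ℝ ∞ X.B.epsChi X.offU :=
  ((contDiffOn_const.mul X.smooth_Del).mul X.smooth_cosT).div (X.smooth_Sig.pow 2) fun _ h => pow_ne_zero 2 (X.Sig_ne h)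
lemma smooth_epsUChi : ContDiffOn ℝ ∞ X.B.epsUChi X.offU :=
  (contDiffOn_const.mul X.smooth_cosT).div X.smooth_Sig fun _ h => X.Sig_ne h
lemma smooth_omegaHat : ContDiffOn ℝ ∞ X.B.omegaHat X.offU :=
  (contDiffOn_const.mul ((((contDiffOn_const.mul (contDiffOn_const.sub X.smooth_rad)).mul
    (X.smooth_cosT.pow 2)).add (contDiffOn_const.mul X.smooth_rad)).sub (contDiffOn_const.mul
    (X.smooth_rad.pow 2)))).neg.div (X.smooth_Sig.pow 2) fun _ h => pow_ne_zero 2 (X.Sig_ne h)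
lemma smooth_cA : ContDiffOn ℝ ∞ X.B.cA X.offU :=
  (X.smooth_Sig.mul ((smooth_trUChi.pow 2).sub (smooth_epsUChi.pow 2))).div_const _
lemma smooth_cB : ContDiffOn ℝ ∞ X.B.cB X.offU := (X.smooth_Sig.mul (smooth_epsUChi.mul smooth_trUChi)).div_const _

lemma div_Sig_sq (u : ℂ) (q : X.dom) : u / (X.B.Sig (Sph q) : ℂ) ^ 2 = u * ((X.zeS 1).1 q * (X.zeS (-1)).1 q) ^ 2 := by
  rw [pow_two, ← div_div, div_Sig, div_Sig]; ring

lemma pbr_trUChi : X.pbr X.B.trUChi = -2 * X.rS * ζ(X) := pbr_eq smooth_trUChi fun q => by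
    rw [Background.trUChi]; push_cast; rw [div_Sig, rad_Sph (X.r_pos q).le]; simp
lemma pbr_iepsUChi : X.iS * X.pbr X.B.epsUChi = 2 * X.AS * X.cS * ζ(X) := by
  ext q : 1
  rw [mul_ap, pbr_ap' smooth_epsUChi, Background.epsUChi]
  push_cast
  rw [div_Sig, cosT_Sph (X.r_pos q)]
  simp
  ring
lemma pbr_trChi : X.pbr X.B.trChi = 2 * X.rS * X.DelS * ζ(X) ^ 2 := pbr_eq smooth_trChi fun q => by
    rw [Background.trChi]; push_cast; rw [div_Sig_sq, rad_Sph (X.r_pos q).le, Del_Sph]; simp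
lemma pbr_iepsChi : X.iS * X.pbr X.B.epsChi = 2 * X.AS * X.cS * X.DelS * ζ(X) ^ 2 := by
  ext q : 1
  rw [mul_ap, pbr_ap' smooth_epsChi, Background.epsChi]
  push_cast
  rw [div_Sig_sq, cosT_Sph (X.r_pos q), Del_Sph]
  simp
  ring
lemma pbr_omegaHat : X.pbr X.B.omegaHat = 2 * X.omS * ζ(X) ^ 2 := pbr_eq smooth_omegaHat fun q => by
    rw [Background.omegaHat]; push_cast; rw [div_Sig_sq, cosT_Sph (X.r_pos q), rad_Sph (X.r_pos q).le]; have hI := I_sq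
    simp [omS]; grind

variable (X) in
/-- `r ± i a cos θ`. -/
def zb (b : Bool) : X.Sm := X.rS + (if b then 1 else -1) * (X.AS * X.cS)

/-- The sign as an integer. -/
def sg (b : Bool) : ℤ := if b then 1 else -1

lemma zeS_zb (X : Adm) (b : Bool) : X.zeS (sg b) * X.zb b = 1 := by
  cases b
  · ext q : 1; have := zm_mul q; simp only [sg, zb, Bool.false_eq_true, if_false]; push_cast at this ⊢
    simp only [mul_ap, add_ap, rS_ap, neg_ap, one_ap, AS_ap, cS_ap]; push_cast; linear_combination this
  · ext q : 1; have := zp_mul q; simp only [sg, zb, if_true]; push_cast at this ⊢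
    simp only [mul_ap, add_ap, rS_ap, one_ap, AS_ap, cS_ap]; push_cast; linear_combination this

lemma SigS_eq (b : Bool) : X.SigS = X.zb b * X.zb (!b) := by cases b <;> simp [SigS, zb] <;> ring

lemma cA_cB (b : Bool) : X.pbr X.B.cA - (sg b : X.Sm) * X.iS * X.pbr X.B.cB = X.zb b * X.zeS (sg (!b)) := by
  have h1 : X.zb b * X.zeS (sg (!b)) = X.zb b ^ 2 * ζ(X) := by
    have e := X.zeS_zb b
    have e2 : X.zeS 1 * X.zeS (-1) = X.zeS (sg b) * X.zeS (sg (!b)) := by cases b <;> simp [sg] <;> ring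
    rw [e2]; grind
  have h2 : X.pbr X.B.cA = X.kS (1/4) * (X.SigS * ((X.pbr X.B.trUChi) ^ 2 + (X.iS * X.pbr X.B.epsUChi) ^ 2)) := by
    ext q : 1; have hI := I_sq
    simp only [mul_ap, pow_ap, add_ap, pbr_ap' smooth_cA, pbr_ap' smooth_trUChi,
      pbr_ap' smooth_epsUChi, SigS_ap, iS_ap, algebraMap_ap, Background.cA]
    push_cast; grind
  have h3 : X.iS * X.pbr X.B.cB = X.kS (1/2) * (X.SigS * ((X.iS * X.pbr X.B.epsUChi) * X.pbr X.B.trUChi)) := by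
    ext q : 1
    simp only [mul_ap, pbr_ap' smooth_cB, pbr_ap' smooth_trUChi,
      pbr_ap' smooth_epsUChi, SigS_ap, iS_ap, algebraMap_ap, Background.cB]
    push_cast; ring
  have hS := SigS_mul (X := X)
  have k1 : X.kS (1/4) * 4 = (1 : X.Sm) := by rw [show (4 : X.Sm) = X.kS 4 from (map_ofNat _ 4).symm, ← map_mul]; norm_num
  have k2 : X.kS (1/2) * 2 = (1 : X.Sm) := by rw [show (2 : X.Sm) = X.kS 2 from (map_ofNat _ 2).symm, ← map_mul]; norm_num
  rw [h1, h2, mul_assoc, h3, pbr_iepsUChi, pbr_trUChi]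
  have e1 : X.kS (1/4) * (X.SigS * ((-2 * X.rS * ζ(X)) ^ 2 + (2 * X.AS * X.cS * ζ(X)) ^ 2)) =
      (X.rS ^ 2 + (X.AS * X.cS) ^ 2) * ζ(X) := by
    grind
  have e2 : X.kS (1/2) * (X.SigS * (2 * X.AS * X.cS * ζ(X) * (-2 * X.rS * ζ(X)))) = -2 * X.rS * (X.AS * X.cS) * ζ(X) := by
    grind
  rw [e1, e2]
  cases b <;> simp [sg, zb] <;> ring

section frakT

variable {k : ℕ} {T : Tens k}

lemma off_of {F : Pt → ℝ} (h : ContDiffOn ℝ ∞ F X.offU) : ContDiffOn ℝ ∞ F X.off := h.mono X.off_subset_offU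

lemma smooth_halfSig : ContDiffOn ℝ ∞ (fun p => X.B.Sig p / 2) X.off := off_of (X.smooth_Sig.div_const _)

lemma pbr_halfSig : X.pbr (fun p => X.B.Sig p / 2) = X.kS (1/2) * X.SigS := pbr_eq (X.smooth_Sig.div_const _) fun q => by
    rw [mul_ap, SigS_ap, algebraMap_ap]; push_cast; ring

lemma Good.frakT (h : X.Good T) : X.Good (X.B.frakT T) :=
  (h.nab3.add (h.act (off_of smooth_trUChi) (off_of smooth_epsUChi))).wt smooth_halfSig

lemma Good.frakTU (h : X.Good T) : X.Good (X.B.frakTU T) :=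
  ((h.nab4.add (h.act (off_of smooth_trChi) (off_of smooth_epsChi))).add (h.wt (off_of smooth_omegaHat))).wt smooth_halfSig

lemma Good.frakTUr (h : X.Good T) : X.Good (X.B.frakTUr T) :=
  Good.wt (off_of X.smooth_rad) (Good.frakTU (h.wt (off_of smooth_radInv)))

lemma comp_frakT (h : X.Good T) (σ : Fin k → Bool) : X.comp (X.B.frakT T) σ =
    X.kS (1/2) * X.SigS * (X.op3 (X.comp T σ) - ((k : X.Sm) * X.rS + (spin σ : X.Sm) * (X.AS * X.cS))
      * ζ(X) * X.comp T σ) := by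
  have ha := h.act (off_of (smooth_trUChi (X := X))) (off_of smooth_epsUChi)
  rw [Background.frakT, comp_wt smooth_halfSig (h.nab3.add ha).1, comp_add h.nab3.1 ha.1,
    comp_nab3 h, comp_act (off_of smooth_trUChi) (off_of smooth_epsUChi) h.1, pbr_halfSig]
  have k2 : X.kS (1/2) * 2 = (1 : X.Sm) := by rw [show (2 : X.Sm) = X.kS 2 from (map_ofNat _ 2).symm, ← map_mul]; norm_num
  rw [show X.iS * (spin σ : X.Sm) * X.pbr X.B.epsUChi =
    (spin σ : X.Sm) * (X.iS * X.pbr X.B.epsUChi) by ring, pbr_iepsUChi, pbr_trUChi]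
  congr 2
  grind

lemma comp_frakTU (h : X.Good T) (σ : Fin k → Bool) : X.comp (X.B.frakTU T) σ =
    X.kS (1/2) * X.SigS * (op X .f (spin σ) (X.comp T σ) + (ES X k (spin σ) + X.DZS * X.riS) * X.comp T σ) := by
  have ha := h.act (off_of (smooth_trChi (X := X))) (off_of smooth_epsChi)
  have ho := h.wt (off_of (smooth_omegaHat (X := X)))
  rw [Background.frakTU, comp_wt smooth_halfSig ((h.nab4.add ha).add ho).1,
    comp_add (h.nab4.add ha).1 ho.1, comp_add h.nab4.1 ha.1,
    comp_nab4 h, comp_act (off_of smooth_trChi) (off_of smooth_epsChi) h.1,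
    comp_wt (off_of smooth_omegaHat) h.1, pbr_halfSig, pbr_omegaHat]
  have k2 : X.kS (1/2) * 2 = (1 : X.Sm) := by rw [show (2 : X.Sm) = X.kS 2 from (map_ofNat _ 2).symm, ← map_mul]; norm_num
  rw [show X.iS * (spin σ : X.Sm) * X.pbr X.B.epsChi =
    (spin σ : X.Sm) * (X.iS * X.pbr X.B.epsChi) by ring, pbr_iepsChi, pbr_trChi, ES, DZS, add_assoc]
  congr 2
  grind

lemma op_f_riS (s : ℤ) (u : X.Sm) : op X .f s (X.riS * u) = X.riS * op X .f s u - X.DZS * X.riS ^ 2 * u := by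
  simp only [op, e4op, leibniz, pd_riS, dP_riS, smul_eq_mul, DZS, Fin.reduceEq, if_false, Fin.isValue]
  ring

lemma comp_frakTUr (h : X.Good T) (σ : Fin k → Bool) : X.comp (X.B.frakTUr T) σ =
    X.kS (1/2) * X.SigS * (op X .f (spin σ) (X.comp T σ) + ES X k (spin σ) * X.comp T σ) := by
  have hr := h.wt (off_of (smooth_radInv (X := X)))
  rw [Background.frakTUr, comp_wt (off_of X.smooth_rad) hr.frakTU.1, comp_frakTU hr,
    comp_wt (off_of smooth_radInv) h.1, pbr_rad, pbr_radInv, op_f_riS]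
  linear_combination (X.kS (1/2) * X.SigS * (op X .f (spin σ) (X.comp T σ) + ES X k (spin σ) * X.comp T σ)) * X.riS_mul

end frakT

variable (X)

def Zb (b : Bool) : X.Sm := 1 + (sg b : X.Sm) * (X.AS * X.cS * X.riS)

variable {X}

lemma zb_ri (X : Adm) (b : Bool) : X.zb b * X.riS = X.Zb b := by
  have := X.riS_mul
  cases b <;> simp [zb, Zb, sg] <;> linear_combination this

lemma coef_Zb (b : Bool) : Coef 0 0 0 fun X => X.Zb b :=
  one.add (((int (sg b)).mul' ((rot.mul' cos).mul' Coef.ri)).cast fun _ => rfl)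

lemma coef_rze (b : Bool) : Coef 0 0 0 fun X => X.rS * X.zeS (sg b) := by
  cases b
  · exact oneAdd.congr fun X => by rw [← rzb_eq]; simp [sg]
  · exact oneSub.congr fun X => by rw [← rz_eq]; simp [sg]

lemma coef_ze (b : Bool) : Coef 0 1 0 fun X => X.zeS (sg b) := by
  cases b
  · exact zm.congr fun X => by simp [sg]
  · exact zp.congr fun X => by simp [sg]

lemma sp_lt (b : Bool) : (lt b).sp = sg b := by cases b <;> rfl
lemma sg_not (b : Bool) : sg (!b) = -sg b := by cases b <;> rfl
lemma lt_ne (b : Bool) : lt b ≠ .d ∧ lt b ≠ .f := by cases b <;> simp [lt]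
lemma lt_not_ne (b : Bool) : lt (!b) ≠ lt b := by cases b <;> simp [lt]

/-- Contribution of `∇̸₃ α` to the derivatives of a middle component. -/
def midF₁ (b : Bool) (l : Letter) (X : Adm) (v : X.Sm) : X.Sm := if l = lt (!b) then X.Zb b ^ 2 * v else 0

/-- Contribution of `α` to the derivatives of a middle component. -/
def midF₂ (b : Bool) (l : Letter) (X : Adm) (v : X.Sm) : X.Sm :=
  if l = .f then X.Zb b * (X.rS * X.zeS (sg (!b))) * op X (lt b) (sg (!b)) (X.Zb b * X.Zb (!b) * v)
  else if l = lt (!b) then X.Zb b ^ 2 * (2 * X.riS - X.zeS (sg b)) * v else 0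

/-- Contribution of `α̲` to the derivatives of a middle component. -/
def midG (b : Bool) (l : Letter) (X : Adm) (u : X.Sm) : X.Sm :=
  if l = .d then -(X.delS * X.Zb b ^ 2 * op X (lt (!b)) (sg b) u)
  else if l = lt b then -(X.Zb b ^ 2 * (op X .f (sg b) u + ES X 1 (sg b) * u)) else 0

lemma midEqs (b : Bool) : MidEqs (sg (!b)) (sg b) (midF₁ b) (midF₂ b) (midG b) where
  hF₁ l _ := by
    by_cases h : l = lt (!b)
    · subst h
      refine ((LC.term0 ((coef_Zb b).mul' (coef_Zb b)) (by simp [Cstr.len])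
        (by simp [sp_lt]) : LC (sg (!b)) _ _ _)).congr fun X u => ?_
      simp [midF₁, sq]
    · exact (LC.zero _).congr fun X u => by simp [midF₁, h]
  hF₂ l hl := by
    by_cases h : l = .f
    · subst h
      have h1 : LC (sg (!b)) (Cstr.len 0 fun _ _ _ => True) (0 + 0 + sg (!b)) fun X u => X.Zb b * X.Zb (!b) * u :=
        LC.term0 ((coef_Zb b).mul' (coef_Zb (!b))) (by simp [Cstr.len]) rfl
      have h2 := LC.op (Q' := Cstr.len 1 QA) h1 (lt b) (by
        intro W w d hW; have : W = [] := by simpa [Cstr.len] using hW.1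
        subst this; simp [Cstr.len, QA])
      have h3 := h2.coef_mul (Q' := Cstr.len 1 QA) ((coef_Zb b).mul' (coef_rze (!b))) (by
        intro W w d hW; simpa using hW)
      have e : (0 : ℤ) + 0 + (0 + 0 + sg (!b) + (lt b).sp) = Letter.f.sp := by rw [sp_lt, sg_not]; simp [Letter.sp]
      rw [e] at h3; exact h3.congr fun X u => by simp [midF₂]
    · by_cases h' : l = lt (!b)
      · subst h'
        refine ((LC.term0 (((coef_Zb b).mul' (coef_Zb b)).mul' (((const 2).mul' Coef.ri).sub
          ((coef_ze b).weak (by simp) (by simp)))) (by simp [Cstr.len, QA])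
          (by simp [sp_lt]) : LC (sg (!b)) _ _ _)).congr fun X u => ?_
        rw [midF₂, if_neg (lt_ne (!b)).2, if_pos rfl, show X.kS 2 = 2 from map_ofNat _ 2]; ring
      · exact (LC.zero _).congr fun X u => by simp [midF₂, h, h']
  hG l hl := by
    by_cases h' : l = lt b
    · subst h'
      have h1 : LC (sg b) (Cstr.len 1 QG) (lt b).sp fun X u => X.Zb b * X.Zb b * op X .f (sg b) u :=
        LC.term1 .f ((coef_Zb b).mul' (coef_Zb b)) (by simp [Cstr.len, QG]) (by rw [sp_lt]; simp [Letter.sp])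
      have h2 : LC (sg b) (Cstr.len 1 QG) (lt b).sp fun X u => X.Zb b * X.Zb b * ES X 1 (sg b) * u :=
        LC.term0 (((coef_Zb b).mul' (coef_Zb b)).mul' (coef_ES_one _)) (by simp [Cstr.len, QG]) (by simp [sp_lt])
      refine (h1.add h2).neg.congr fun X u => ?_; simp [midG, hl]; ring
    · exact (LC.zero _).congr fun X u => by simp [midG, hl, h']
  hGd := by
    refine (LC.neg (LC.term1 (lt (!b)) ((del.mul' (coef_Zb b)).mul' (coef_Zb b)) ?_ ?_)).congr fun X u => ?_
    · cases b <;> simp [Cstr.len, QD, lt]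
    · rw [sp_lt, sg_not]; simp
    · simp [midG]; ring

lemma iS_mul_iS (X : Adm) : X.iS * X.iS = -1 := by simp only [iS, ← map_mul, Complex.I_mul_I]; simp
lemma half_add_half (X : Adm) : X.kS (1/2) + X.kS (1/2) = 1 := by rw [← map_add]; norm_num
lemma kS_I_half : X.kS (I / 2) = X.iS * X.kS (1/2) := by rw [iS, ← map_mul]; congr 1; ring

section solution

variable {S : MaxwellFields}

lemma Sf_of_isSmooth {k : ℕ} {T : Tens k} (h : X.B.IsSmooth T) : X.TSf T := fun I => (h I).mono X.off_subset_region

lemma tm_one (T : Tens 1) (V : Fin 1 → Fin 4 → X.Sm) : X.tm T V = ∑ μ, (X.pb fun p => T p ![μ]) * V 0 μ := by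
  rw [tm_apply, sum_fin_one]
  simp

lemma good_of_horizontal {T : Tens 1} (hs : X.B.IsSmooth T) (h : X.B.IsHorizontal T) : X.Good T := by
  refine ⟨Sf_of_isSmooth hs, fun V i hi => ?_⟩
  have hT := Sf_of_isSmooth hs
  rw [Subsingleton.elim i 0] at hi
  rw [tm_one]
  ext q : 1
  have hm := X.off_subset_region (X.Sph_mem_off q.2)
  rcases hi with hi | hi
  · rw [hi, zero_ap, ← (h _ hm).1]; simp only [← pbr_e3, sum_ap, mul_ap, pb_ap (hT _), pbr_ap' (X.smooth_e3 _), mul_comm]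
  · rw [hi, zero_ap, ← (h _ hm).2]; simp only [← pbr_e4, sum_ap, mul_ap, pb_ap (hT _), pbr_ap' (X.smooth_e4 _), mul_comm]

lemma good_scalar {T : Tens 0} (hs : X.B.IsSmooth T) : X.Good T := ⟨Sf_of_isSmooth hs, hor_scalar T⟩

lemma comp_congr {k : ℕ} {T T' : Tens k} (h : X.TSf T) (h' : X.TSf T')
    (e : ∀ p ∈ X.off, T p = T' p) (σ : Fin k → Bool) : X.comp T σ = X.comp T' σ := by
  rw [comp, comp, tm_apply, tm_apply]
  exact sum_ext fun I => by rw [pb_congr (h I) (h' I) fun p hp => congrFun (e p hp) I]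

variable (X S)

/-- The complex combination `ρ̂ ± i σ̂`. -/
def Phi (b : Bool) : X.Sm := X.comp S.rho ![] + (sg b : X.Sm) * X.iS * X.comp S.sig ![]

/-- The components of `r² α`. -/
def alC (b : Bool) : X.Sm := X.comp (wt (fun p => rad p ^ 2) S.al) ![b]

/-- The components of `r α̲`. -/
def ualC (b : Bool) : X.Sm := X.comp (wt rad S.ual) ![b]

variable {X S}

lemma spin_one (b : Bool) : spin ![b] = sg b := by cases b <;> simp [spin, sg]

lemma op_Phi (l : Letter) (b : Bool) : op X l 0 (X.Phi S b) =
    op X l 0 (X.comp S.rho ![]) + (sg b : X.Sm) * X.iS * op X l 0 (X.comp S.sig ![]) := by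
  rw [Phi, op_add, show (sg b : X.Sm) * X.iS * X.comp S.sig ![] = (sg b * I : ℂ) • X.comp S.sig ![] by
      rw [Algebra.smul_def, map_mul, iS]; simp, op_smul, Algebra.smul_def, map_mul, iS]
  simp

lemma kS_stv (c : Bool) : X.kS (stv c) = -((sg c : X.Sm) * X.iS) := by cases c <;> simp [stv, sg, iS]

lemma Phi_rho : X.comp S.rho ![] = X.kS (1/2) * (X.Phi S true + X.Phi S false) := by
  simp only [Phi, sg, if_true, Bool.false_eq_true, if_false]
  push_cast
  linear_combination (-X.comp S.rho ![]) * X.half_add_half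

lemma Phi_sig : X.comp S.sig ![] = -(X.kS (1/2) * X.iS * (X.Phi S true - X.Phi S false)) := by
  simp only [Phi, sg, if_true, Bool.false_eq_true, if_false]
  push_cast
  linear_combination (X.iS * X.iS * X.comp S.sig ![]) * X.half_add_half + (X.comp S.sig ![]) * X.iS_mul_iS

variable (h : X.B.IsSolution S)
include h

lemma good_al : X.Good S.al := good_of_horizontal h.smooth_al h.horizontal_al
lemma good_ual : X.Good S.ual := good_of_horizontal h.smooth_ual h.horizontal_ual
lemma good_rho : X.Good S.rho := good_scalar h.smooth_rho
lemma good_sig : X.Good S.sig := good_scalar h.smooth_sig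

lemma alC_eq (b : Bool) : X.alC S b = X.rS ^ 2 * X.comp S.al ![b] := by
  rw [alC, comp_wt (off_of (X.smooth_rad.pow 2)) (good_al h).1, pbr_rad_sq]

lemma ualC_eq (b : Bool) : X.ualC S b = X.rS * X.comp S.ual ![b] := by
  rw [ualC, comp_wt (off_of X.smooth_rad) (good_ual h).1, pbr_rad]

lemma op3_Phi (b : Bool) : X.op3 (X.Phi S b) = -(X.zb b ^ 2 * op X (lt (!b)) (sg b) (X.comp S.ual ![b])) := by
  have hu := good_ual h
  have hd := TSf.div hu.nab.1
  have hc := TSf.curl hu.nab.1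
  have sA : ContDiffOn ℝ ∞ (fun p => X.B.Sig p * X.B.cA p) X.off := off_of (X.smooth_Sig.mul smooth_cA)
  have sB : ContDiffOn ℝ ∞ (fun p => X.B.Sig p * X.B.cB p) X.off := off_of (X.smooth_Sig.mul smooth_cB)
  have pA : X.pbr (fun p => X.B.Sig p * X.B.cA p) = X.SigS * X.pbr X.B.cA := pbr_eq (X.smooth_Sig.mul smooth_cA) fun q => by
      rw [mul_ap, SigS_ap, pbr_ap' smooth_cA]; push_cast; rfl
  have pB : X.pbr (fun p => X.B.Sig p * X.B.cB p) = X.SigS * X.pbr X.B.cB := pbr_eq (X.smooth_Sig.mul smooth_cB) fun q => by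
      rw [mul_ap, SigS_ap, pbr_ap' smooth_cB]; push_cast; rfl
  have e1 := comp_nab3 (good_rho h) ![]
  rw [comp_congr (good_rho h).nab3.1 ((hd.wt sA).neg.sub (hc.wt sB))
    (fun p hp => h.nab3_rho p (X.off_subset_region hp)), comp_sub (hd.wt sA).neg (hc.wt sB),
    comp_neg (hd.wt sA), comp_wt sA hd, comp_wt sB hc, comp_div hu, comp_curl hu, pA, pB] at e1
  have e2 := comp_nab3 (good_sig h) ![]
  rw [comp_congr (good_sig h).nab3.1 ((hd.wt sB).sub (hc.wt sA))
    (fun p hp => h.nab3_sig p (X.off_subset_region hp)), comp_sub (hd.wt sB) (hc.wt sA),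
    comp_wt sA hc, comp_wt sB hd, comp_div hu, comp_curl hu, pA, pB] at e2
  have hI := X.iS_mul_iS
  have hk := X.half_add_half
  have hz1 := X.zeS_zb (!b)
  have e3 : X.op3 (X.Phi S b) = X.op3 (X.comp S.rho ![]) + (sg b : X.Sm) * X.iS * X.op3 (X.comp S.sig ![]) := by
    rw [Phi, op3_add, op3_mul, show X.op3 ((sg b : X.Sm) * X.iS) = 0 by
      rw [op3, leibniz, D_iS, Derivation.map_intCast]; simp]
    ring
  rw [e3, ← e1, ← e2, kS_I_half]
  have hh : X.SigS * (X.zb b * X.zeS (sg (!b))) = X.zb b ^ 2 := by rw [SigS_eq b]; grind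
  rw [← hh, ← cA_cB b]
  cases b <;> simp [sg, lt] <;> grind

lemma op_f_Phi (b : Bool) : op X .f 0 (X.Phi S b) = X.zb b * X.zeS (sg (!b)) *
    op X (lt b) (sg (!b)) (X.SigS * X.comp S.al ![!b]) := by
  have hu := (good_al h).wt (off_of X.smooth_Sig)
  have hd := TSf.div hu.nab.1
  have hc := TSf.curl hu.nab.1
  have sA := off_of (smooth_cA (X := X))
  have sB := off_of (smooth_cB (X := X))
  have e1 := comp_nab4 (good_rho h) ![]
  rw [comp_congr (good_rho h).nab4.1 ((hd.wt sA).sub (hc.wt sB))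
    (fun p hp => h.nab4_rho p (X.off_subset_region hp)), comp_sub (hd.wt sA) (hc.wt sB),
    comp_wt sA hd, comp_wt sB hc, comp_div hu, comp_curl hu] at e1
  have e2 := comp_nab4 (good_sig h) ![]
  rw [comp_congr (good_sig h).nab4.1 ((hd.wt sB).neg.sub (hc.wt sA))
    (fun p hp => h.nab4_sig p (X.off_subset_region hp)), comp_sub (hd.wt sB).neg (hc.wt sA),
    comp_neg (hd.wt sB), comp_wt sA hc, comp_wt sB hd, comp_div hu, comp_curl hu] at e2
  have hI := X.iS_mul_iS
  have hk := X.half_add_half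
  rw [show spin (![] : Fin 0 → Bool) = 0 from rfl] at e1 e2
  rw [op_Phi, ← e1, ← e2, kS_I_half, ← cA_cB b, ← pbr_Sig, ← comp_wt (off_of X.smooth_Sig) (good_al h).1]
  cases b <;> simp [sg, lt] <;> grind

lemma op_ang_Phi (b c : Bool) : op X (lt c) 0 (X.Phi S b) = X.zb b * X.zeS (sg (!b)) *
    (if c = b then -2 * X.comp (X.B.frakTU S.ual) ![c] else 2 * X.comp (X.B.frakT S.al) ![c]) := by
  have hP := (good_al h).frakT.1
  have hQ := (good_ual h).frakTU.1
  have hP' := (good_al h).frakT.star.1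
  have hQ' := (good_ual h).frakTU.star.1
  have sA := off_of (smooth_cA (X := X))
  have sB := off_of (smooth_cB (X := X))
  have e1 := comp_nab (good_rho h) c ![]
  rw [comp_congr (good_rho h).nab.1 (((hP.sub hQ).wt sA).sub ((hP'.add hQ').wt sB))
    (fun p hp => h.nab_rho p (X.off_subset_region hp)),
    comp_sub ((hP.sub hQ).wt sA) ((hP'.add hQ').wt sB),
    comp_wt sA (hP.sub hQ), comp_wt sB (hP'.add hQ'), comp_add hP' hQ', comp_sub hP hQ,
    comp_star hP, comp_star hQ, Fin.cons_zero] at e1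
  have e2 := comp_nab (good_sig h) c ![]
  rw [comp_congr (good_sig h).nab.1 (((hP.sub hQ).wt sB).neg.sub ((hP'.add hQ').wt sA))
    (fun p hp => h.nab_sig p (X.off_subset_region hp)),
    comp_sub ((hP.sub hQ).wt sB).neg ((hP'.add hQ').wt sA), comp_neg ((hP.sub hQ).wt sB),
    comp_wt sB (hP.sub hQ), comp_wt sA (hP'.add hQ'), comp_add hP' hQ', comp_sub hP hQ,
    comp_star hP, comp_star hQ, Fin.cons_zero] at e2
  have hI := X.iS_mul_iS
  rw [show spin (![] : Fin 0 → Bool) = 0 from rfl] at e1 e2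
  rw [op_Phi, ← e1, ← e2, kS_stv, ← cA_cB b, show (Fin.cons c ![] : Fin 1 → Bool) = ![c] from rfl]
  cases b <;> cases c <;> simp [sg] <;> grind

lemma holds (b : Bool) : MidEqs.Holds (midF₁ b) (midF₂ b) (midG b) X (X.Phi S b) (X.alC S (!b)) (X.ualC S b) := by
  have hri := X.riS_mul
  have hzr := X.zb_ri b
  have hzr' := X.zb_ri (!b)
  have hz := SigS_eq (X := X) b
  have hz1 := X.zeS_zb (!b)
  have hz0 := X.zeS_zb b
  have k2 : X.kS (1/2) * 2 = (1 : X.Sm) := by linear_combination X.half_add_half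
  have hal : X.comp S.al ![!b] = X.riS ^ 2 * X.alC S (!b) := by rw [alC_eq h]; grind
  have hual : X.comp S.ual ![b] = X.riS * X.ualC S b := by rw [ualC_eq h]; grind
  refine ⟨fun l hl => ?_, ?_⟩
  · by_cases hf : l = .f
    · subst hf; rw [op_f_Phi h]
      simp only [midF₁, midF₂, midG, if_neg (lt_ne _).2.symm, if_pos, if_neg hl, zero_add, mul_zero, add_zero]
      rw [hal, ← mul_assoc X.SigS, show X.SigS * X.riS ^ 2 = X.Zb b * X.Zb (!b) by rw [hz, ← hzr, ← hzr']; ring]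
      rw [← hzr]; grind
    obtain ⟨c, rfl⟩ : ∃ c, l = lt c := by
      cases l
      · exact absurd rfl hl
      · exact absurd rfl hf
      · exact ⟨true, rfl⟩
      · exact ⟨false, rfl⟩
    rw [op_ang_Phi h]; by_cases hc : c = b
    · subst hc; rw [if_pos rfl]
      simp only [midF₁, midF₂, midG, if_neg hf, if_neg hl, if_neg (lt_not_ne _).symm, if_true, zero_add, zero_mul]
      rw [comp_frakTU (good_ual h), hual, spin_one, op_f_riS, hz, ← hzr]; grind
    · obtain rfl : c = !b := by cases b <;> cases c <;> simp_all
      rw [if_neg hc]; simp only [midF₁, midF₂, midG, if_neg hf, if_neg hl, if_neg (lt_not_ne _), if_true, mul_zero, add_zero]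
      have hzz : X.rS + (sg (!b) : X.Sm) * (X.AS * X.cS) = X.zb (!b) := by cases b <;> simp [sg, zb]
      have hzzz : X.zeS 1 * X.zeS (-1) = X.zeS (sg b) * X.zeS (sg !b) := by cases b <;> simp [sg]; ring
      have h3 : X.op3 (X.riS ^ 2) = 2 * X.riS ^ 3 := by rw [op3, sq, leibniz, dP_riS]; simp; ring
      rw [comp_frakT (good_al h), hal, spin_one, Nat.cast_one, one_mul, hzz, hzzz, hz, op3_mul, h3, ← hzr]; grind
  · rw [midG, if_pos rfl, show op X .d 0 (X.Phi S b) = X.delS * X.op3 (X.Phi S b) from rfl]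
    have e : op X (lt (!b)) (sg b) (X.riS * X.ualC S b) = X.riS * op X (lt (!b)) (sg b) (X.ualC S b) := by
      have e := op_mul (lt (!b)) 0 (sg b) X.riS (X.ualC S b); rw [zero_add] at e; rw [e]
      cases b <;> simp only [lt, Bool.not_true, Bool.not_false, if_true, Bool.false_eq_true, if_false,
        op_p_of_isSt X.isSt_riS, op_m_of_isSt X.isSt_riS, pd_riS] <;> simp
    rw [op3_Phi h, hual, ← hzr, e]; grind

end solution

section comm

variable {k : ℕ} {T : Tens k}

lemma spin_fin_cons (b : Bool) (σ : Fin k → Bool) : spin (Fin.cons b σ : Fin (k + 1) → Bool) = spin σ + (lt b).sp := by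
  rw [spin, Fin.sum_univ_succ, spin]
  cases b <;> simp [lt, Letter.sp] <;> ring

lemma Good.nabIter (h : X.Good T) : ∀ j, X.Good (X.B.nabIter j T)
  | 0 => h
  | j + 1 => (Good.nabIter h j).nab

lemma exists_nabIter (h : X.Good T) (V : List Letter) (hV : ∀ l ∈ V, l = .p ∨ l = .m)
    (σ : Fin k → Bool) : ∀ j, V.length = j → ∃ τ : Fin (k + j) → Bool,
      spin τ = spin σ + wsp V ∧ X.comp (X.B.nabIter j T) τ = app X V (spin σ) (X.comp T σ) := by
  induction V using List.reverseRecOn with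
  | nil => rintro _ rfl; exact ⟨σ, by simp, rfl⟩
  | append_singleton V l ih =>
    rintro _ rfl; rw [List.length_append, List.length_singleton]
    obtain ⟨τ, hτ, e⟩ := ih (fun l hl => hV l (by simp [hl])) _ rfl
    obtain ⟨b, rfl⟩ : ∃ b, l = lt b := by
      rcases hV l (by simp) with rfl | rfl
      · exact ⟨true, rfl⟩
      · exact ⟨false, rfl⟩
    refine ⟨Fin.cons b τ, ?_, ?_⟩
    · rw [spin_fin_cons, hτ, wsp_append]; simp [add_assoc]
    · rw [app_concat, ← hτ, ← e]; exact comp_nab (h.nabIter _) b τ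

lemma nabIter_exists (h : X.Good T) : ∀ j (τ : Fin (k + j) → Bool), ∃ (V : List Letter) (σ : Fin k → Bool),
    V.length = j ∧ (∀ l ∈ V, l = .p ∨ l = .m) ∧ spin τ = spin σ + wsp V ∧
      X.comp (X.B.nabIter j T) τ = app X V (spin σ) (X.comp T σ)
  | 0, τ => ⟨[], τ, rfl, by simp, by simp, rfl⟩
  | j + 1, τ => by
    obtain ⟨V, σ, hl, hV, hs, e⟩ := nabIter_exists h j (Fin.tail τ)
    have ht : τ = Fin.cons (τ 0) (Fin.tail τ) := (Fin.cons_self_tail τ).symm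
    refine ⟨V ++ [lt (τ 0)], σ, by simp [hl], ?_, ?_, ?_⟩
    · intro l hl; rcases List.mem_append.1 hl with hl | hl
      · exact hV l hl
      · rw [List.mem_singleton.1 hl]
        cases τ 0 <;> simp [lt]
    · rw [ht, spin_fin_cons, hs, wsp_append]; simp [add_assoc]
    · rw [app_concat, ← hs, ← e, ht]; exact comp_nab (h.nabIter _) _ _

lemma Good.iter4 (h : X.Good T) (j : ℕ) : X.Good (X.B.nab4^[j] T) := by
  induction j with
  | zero => exact h
  | succ j ih => rw [iterate_succ_apply']; exact ih.nab4

lemma Good.iterd (h : X.Good T) (j : ℕ) : X.Good (X.B.degNab3^[j] T) := by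
  induction j with
  | zero => exact h
  | succ j ih => rw [iterate_succ_apply']; exact ih.degNab3

lemma wsp_replicate_f (j : ℕ) : wsp (List.replicate j .f) = 0 := by simp [wsp, Letter.sp]
lemma wsp_replicate_d (j : ℕ) : wsp (List.replicate j .d) = 0 := by simp [wsp, Letter.sp]

lemma comp_iter4 (h : X.Good T) (j : ℕ) (τ : Fin k → Bool) :
    X.comp (X.B.nab4^[j] T) τ = app X (List.replicate j .f) (spin τ) (X.comp T τ) := by
  induction j with
  | zero => rfl
  | succ j ih =>
    rw [iterate_succ_apply', List.replicate_succ', app_concat, ← ih, wsp_replicate_f, add_zero]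
    exact comp_nab4 (h.iter4 _) τ

lemma comp_iterd (h : X.Good T) (j : ℕ) (τ : Fin k → Bool) :
    X.comp (X.B.degNab3^[j] T) τ = app X (List.replicate j .d) (spin τ) (X.comp T τ) := by
  induction j with
  | zero => rfl
  | succ j ih =>
    rw [iterate_succ_apply', List.replicate_succ', app_concat, ← ih, wsp_replicate_d, add_zero]
    exact comp_degNab3 (h.iterd _) τ

lemma Good.comm (h : X.Good T) (j₁ j₂ j₃ : ℕ) : X.Good (X.B.comm j₁ j₂ j₃ T) := ((h.nabIter j₃).iter4 j₂).iterd j₁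

lemma comp_comm (h : X.Good T) (j₁ j₂ j₃ : ℕ) (τ : Fin (k + j₃) → Bool) : X.comp (X.B.comm j₁ j₂ j₃ T) τ =
      app X (List.replicate j₂ .f ++ List.replicate j₁ .d) (spin τ) (X.comp (X.B.nabIter j₃ T) τ) := by
  rw [app_append, ← comp_iter4 (h.nabIter _), wsp_replicate_f, add_zero]
  exact comp_iterd ((h.nabIter j₃).iter4 j₂) j₁ τ

lemma exists_comm (h : X.Good T) {W : List Letter} (hW : IsCan W) {n : ℕ} (hn : W.length ≤ n)
    (σ : Fin k → Bool) : ∃ j ∈ Background.orders n, j.2.2 = (W.filter fun l => l = .p ∨ l = .m).length ∧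
      ∃ τ : Fin (k + j.2.2) → Bool, spin τ = spin σ + wsp W ∧
        X.comp (X.B.comm j.1 j.2.1 j.2.2 T) τ = app X W (spin σ) (X.comp T σ) := by
  obtain ⟨V, j₂, j₁, hV, rfl⟩ := hW
  obtain ⟨τ, hτ, e⟩ := exists_nabIter h V hV σ _ rfl
  simp only [List.length_append, List.length_replicate] at hn
  refine ⟨(j₁, j₂, V.length), ?_, ?_, τ, ?_, ?_⟩
  · simp only [Background.orders, Finset.mem_filter, Finset.mem_product, Finset.mem_range]; omega
  · rw [List.filter_append, List.filter_append, List.filter_eq_self.2 (by simpa using hV),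
      List.filter_eq_nil_iff.2 (by simp), List.filter_eq_nil_iff.2 (by simp)]
    simp
  · rw [hτ, wsp_append, wsp_append, wsp_replicate_f, wsp_replicate_d]; simp
  · rw [comp_comm h, e, hτ, List.append_assoc, app_append V]

lemma comm_exists (h : X.Good T) {j : ℕ × ℕ × ℕ} {n : ℕ} (hj : j ∈ Background.orders n)
    (τ : Fin (k + j.2.2) → Bool) : ∃ (W : List Letter) (σ : Fin k → Bool), W.length ≤ n ∧ spin τ = spin σ + wsp W ∧
        X.comp (X.B.comm j.1 j.2.1 j.2.2 T) τ = app X W (spin σ) (X.comp T σ) := by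
  obtain ⟨V, σ, hl, hV, hs, e⟩ := nabIter_exists h _ τ
  refine ⟨V ++ (List.replicate j.2.1 .f ++ List.replicate j.1 .d), σ, ?_, ?_, ?_⟩
  · simp only [Background.orders, Finset.mem_filter, Finset.mem_product, Finset.mem_range] at hj
    simp only [List.length_append, List.length_replicate]; omega
  · rw [hs, wsp_append, wsp_append, wsp_replicate_f, wsp_replicate_d]; simp
  · rw [comp_comm h, e, hs, app_append V]

lemma normSq_nonneg (h : X.TSf T) (q : X.dom) : 0 ≤ X.B.normSq T (Sph q) := by rw [normSq_Sph h]; positivity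

lemma comp_le (h : X.TSf T) (q : X.dom) (σ : Fin k → Bool) : ‖(X.comp T σ).1 q‖ ^ 2 ≤ 2 ^ k * X.B.normSq T (Sph q) := by
  rw [normSq_Sph h, ← mul_assoc, ← mul_pow]
  norm_num
  exact single_le_sum (f := fun σ => ‖(X.comp T σ).1 q‖ ^ 2) (fun _ _ => by positivity) (Finset.mem_univ σ)

lemma normSq_le (h : X.TSf T) (q : X.dom) {K : ℝ} (hK : ∀ σ, ‖(X.comp T σ).1 q‖ ≤ K) : X.B.normSq T (Sph q) ≤ K ^ 2 := by
  rw [normSq_Sph h]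
  calc _ ≤ (2⁻¹ : ℝ) ^ k * ∑ σ : Fin k → Bool, K ^ 2 := by
        gcongr with σ
        exact hK σ
    _ = K ^ 2 := by
        rw [Finset.sum_const, Finset.card_univ, Fintype.card_fun, Fintype.card_bool, Fintype.card_fin,
          nsmul_eq_mul, ← mul_assoc]
        push_cast; rw [← mul_pow]; norm_num

lemma Del_Sph_nonneg (q : X.dom) : 0 ≤ X.B.Del (Sph q) := by rw [Del_Sph]; exact (X.Del_pos q.2.2.1).le

lemma rad_dom (q : X.dom) : rad (Sph q) = q.1 1 := rad_Sph (X.r_pos q).le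

lemma densAl_terms (h : X.Good T) (q : X.dom) : X.B.normSq (X.B.nab T) (Sph q) ≤ X.B.densAl T (Sph q) ∧
    X.B.normSq (X.B.nab4 T) (Sph q) ≤ X.B.densAl T (Sph q) ∧
    X.B.normSq (X.B.nab3 T) (Sph q) ≤ X.B.densAl T (Sph q) ∧
    X.B.normSq T (Sph q) / rad (Sph q) ^ 2 ≤ X.B.densAl T (Sph q) := by
  have h1 := normSq_nonneg h.nab.nab.1 q
  have h2 := normSq_nonneg h.nab4.nab.1 q
  have h3 := normSq_nonneg h.nab4.nab4.1 q
  have h4 := mul_nonneg (sq_nonneg (rad (Sph q))) (normSq_nonneg h.nab3.nab4.1 q)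
  have h5 := mul_nonneg (div_nonneg (Del_Sph_nonneg q) (sq_nonneg (rad (Sph q)))) (normSq_nonneg h.nab3.nab3.1 q)
  have h6 := mul_nonneg (sq_nonneg (rad (Sph q))) (normSq_nonneg h.nab3.nab.1 q)
  have h7 := normSq_nonneg h.nab3.1 q
  have h8 := normSq_nonneg h.nab4.1 q
  have h9 := normSq_nonneg h.nab.1 q
  have h10 := div_nonneg (normSq_nonneg h.1 q) (sq_nonneg (rad (Sph q)))
  unfold Background.densAl
  refine ⟨?_, ?_, ?_, ?_⟩ <;> linarith

lemma densUAl_terms (h : X.Good T) (q : X.dom) : (rad (Sph q) - X.B.M) ^ 2 / rad (Sph q) ^ 2 * X.B.normSq (X.B.nab T) (Sph q)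
      ≤ X.B.densUAl T (Sph q) ∧
    (rad (Sph q) - X.B.M) ^ 2 / rad (Sph q) ^ 2 * (X.B.normSq T (Sph q) / rad (Sph q) ^ 2) ≤ X.B.densUAl T (Sph q) ∧
    X.B.normSq (X.B.frakTUr T) (Sph q) / rad (Sph q) ^ 2 ≤ X.B.densUAl T (Sph q) := by
  have hD := Del_Sph_nonneg q
  have h1 := normSq_nonneg h.nab.nab.1 q
  have h2 := normSq_nonneg h.nab.nab3.1 q
  have h3 := normSq_nonneg h.nab3.nab3.1 q
  have h4 := normSq_nonneg h.frakTUr.nab4.1 q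
  have h5 := normSq_nonneg h.frakTUr.nab3.1 q
  have h6 := normSq_nonneg h.frakTUr.nab.1 q
  have h7 := normSq_nonneg h.frakTUr.1 q
  have h8 := normSq_nonneg h.nab3.1 q
  have h9 := normSq_nonneg h.nab.1 q
  have h10 := normSq_nonneg h.1 q
  unfold Background.densUAl
  generalize X.B.normSq _ (Sph q) = n₅ at *
  generalize X.B.normSq _ (Sph q) = n₆ at *
  generalize X.B.normSq _ (Sph q) = n₇ at *
  generalize X.B.normSq _ (Sph q) = n₈ at *
  generalize X.B.normSq _ (Sph q) = n₉ at *
  generalize X.B.normSq _ (Sph q) = n₁₀ at *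
  generalize X.B.Del (Sph q) = D at *
  generalize rad (Sph q) = r at *
  clear h
  rw [mul_add ((r - X.B.M) ^ 2 / r ^ 2)]
  have a1 : 0 ≤ (r - X.B.M) ^ 2 / r ^ 2 := by positivity
  have a2 : 0 ≤ (r - X.B.M) ^ 4 / r ^ 6 := by positivity
  have a3 : 0 ≤ (r - X.B.M) ^ 2 * D / r ^ 6 := by positivity
  generalize (r - X.B.M) ^ 2 / r ^ 2 = w₁ at *
  generalize (r - X.B.M) ^ 4 / r ^ 6 = w₂ at *
  generalize (r - X.B.M) ^ 2 * D / r ^ 6 = w₃ at *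
  refine ⟨?_, ?_, ?_⟩
  · rw [← sub_nonneg]; ring_nf; positivity
  · rw [← sub_nonneg]; ring_nf; positivity
  · rw [← sub_nonneg]; ring_nf; positivity

lemma densAl_nonneg (h : X.Good T) (q : X.dom) : 0 ≤ X.B.densAl T (Sph q) :=
  (normSq_nonneg h.nab.1 q).trans (densAl_terms h q).1

lemma densUAl_nonneg (h : X.Good T) (q : X.dom) : 0 ≤ X.B.densUAl T (Sph q) :=
  (mul_nonneg (by positivity) (normSq_nonneg h.nab.1 q)).trans (densUAl_terms h q).1

end comm

variable (X) in
/-- The sum of the integrands of the commuted energies of `α` and `α̲`. -/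
def dens (S : MaxwellFields) (n : ℕ) (p : Pt) : ℝ :=
  ∑ j ∈ Background.orders n, (X.B.densAl (X.B.comm j.1 j.2.1 j.2.2 (wt (fun p => rad p ^ 2) S.al)) p
    + X.B.densUAl (X.B.comm j.1 j.2.1 j.2.2 (wt rad S.ual)) p)

variable (X) in
/-- A bound for the commuted components of `α` and `α̲`. -/
def bd (S : MaxwellFields) (n : ℕ) (q : X.dom) : ℝ := Real.sqrt (2 ^ (n + 4) * X.dens S n (Sph q))

lemma orders_le {n : ℕ} {j : ℕ × ℕ × ℕ} (hj : j ∈ Background.orders n) : j.2.2 ≤ n := by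
  simp only [Background.orders, Finset.mem_filter, Finset.mem_product, Finset.mem_range] at hj
  omega

section bounds

variable {S : MaxwellFields} (h : X.B.IsSolution S) {n : ℕ} (q : X.dom)
include h

lemma good_wal : X.Good (wt (fun p => rad p ^ 2) S.al) := (good_al h).wt (off_of (X.smooth_rad.pow 2))
lemma good_wual : X.Good (wt rad S.ual) := (good_ual h).wt (off_of X.smooth_rad)

lemma densAl_le {j : ℕ × ℕ × ℕ} (hj : j ∈ Background.orders n) :
    X.B.densAl (X.B.comm j.1 j.2.1 j.2.2 (wt (fun p => rad p ^ 2) S.al)) (Sph q) ≤ X.dens S n (Sph q) := by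
  refine le_trans ?_ (single_le_sum (fun j _ => add_nonneg
    (densAl_nonneg ((good_wal h).comm _ _ _) q) (densUAl_nonneg ((good_wual h).comm _ _ _) q)) hj)
  exact le_add_of_nonneg_right (densUAl_nonneg ((good_wual h).comm _ _ _) q)

lemma densUAl_le {j : ℕ × ℕ × ℕ} (hj : j ∈ Background.orders n) :
    X.B.densUAl (X.B.comm j.1 j.2.1 j.2.2 (wt rad S.ual)) (Sph q) ≤ X.dens S n (Sph q) := by
  refine le_trans ?_ (single_le_sum (fun j _ => add_nonneg
    (densAl_nonneg ((good_wal h).comm _ _ _) q) (densUAl_nonneg ((good_wual h).comm _ _ _) q)) hj)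
  exact le_add_of_nonneg_left (densAl_nonneg ((good_wal h).comm _ _ _) q)

lemma dens_nonneg : 0 ≤ X.dens S n (Sph q) := Finset.sum_nonneg fun _ _ => add_nonneg
    (densAl_nonneg ((good_wal h).comm _ _ _) q) (densUAl_nonneg ((good_wual h).comm _ _ _) q)

lemma le_bd {x E : ℝ} {k : ℕ} (hk : k ≤ n + 4) (hx : x ^ 2 ≤ 2 ^ k * E) (hE : E ≤ X.dens S n (Sph q)) : x ≤ X.bd S n q := by
  refine Real.le_sqrt_of_sq_le (hx.trans ?_)
  have h0 := dens_nonneg h (n := n) q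
  calc 2 ^ k * E ≤ 2 ^ k * X.dens S n (Sph q) := by gcongr
    _ ≤ _ := by gcongr; norm_num

lemma hypA (b : Bool) : HypA X n (sg b) (X.alC S b) q (X.bd S n q) := by
  refine ⟨Real.sqrt_nonneg _, fun W hW hn => ?_⟩
  obtain ⟨j, hj, hj3, τ, hτ, e⟩ := exists_comm (good_wal h) hW hn ![b]
  rw [spin_one] at hτ e
  have hg := (good_wal h).comm j.1 j.2.1 j.2.2
  have hjn := orders_le hj
  have ht := densAl_terms hg q
  have hd := densAl_le h q hj
  rw [show app X W (sg b) (X.alC S b) = _ from e.symm, ← hτ]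
  have h3 : ‖(X.op3 (X.comp (X.B.comm j.1 j.2.1 j.2.2 (wt (fun p => rad p ^ 2) S.al)) τ)).1 q‖ ≤ X.bd S n q := by
    rw [← comp_nab3 hg]; exact le_bd h q (by omega) (comp_le hg.nab3.1 q τ) (ht.2.2.1.trans hd)
  have hang : ∀ c, ‖(op X (lt c) (spin τ) (X.comp (X.B.comm j.1 j.2.1 j.2.2 (wt (fun p => rad p ^ 2) S.al)) τ)).1 q‖ ≤ X.bd S n q := by
    intro c; rw [← comp_nab hg]; exact le_bd h q (by omega) (comp_le hg.nab.1 q _) (ht.1.trans hd)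
  refine ⟨fun l => ?_, h3, ?_⟩
  · cases l
    · rw [op, mul_ap, norm_mul, X.norm_delS]; exact (mul_le_of_le_one_left (norm_nonneg _) (X.de_le q)).trans h3
    · rw [← comp_nab4 hg]; exact le_bd h q (by omega) (comp_le hg.nab4.1 q τ) (ht.2.1.trans hd)
    · exact hang true
    · exact hang false
  · refine le_bd h q (k := 1 + j.2.2) (by omega) ?_ (ht.2.2.2.trans hd)
    have := comp_le hg.1 q τ; have hr := X.r_pos q; rw [mul_pow, ri, inv_pow, rad_dom, ← mul_div_assoc, inv_mul_eq_div]
    gcongr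

lemma hypU (b : Bool) : HypU X n (sg b) (X.ualC S b) q (X.bd S n q) := by
  refine ⟨Real.sqrt_nonneg _, fun W hW hn => ?_⟩
  obtain ⟨j, hj, hj3, τ, hτ, e⟩ := exists_comm (good_wual h) hW hn ![b]
  rw [spin_one] at hτ e
  have hg := (good_wual h).comm j.1 j.2.1 j.2.2
  have hjn := orders_le hj
  have ht := densUAl_terms hg q
  have hd := densUAl_le h q hj
  have hr := X.r_pos q
  have hde : (rad (Sph q) - X.B.M) ^ 2 / rad (Sph q) ^ 2 = X.de q ^ 2 := by
    rw [rad_dom, de, ← div_pow, sub_div, div_self hr.ne']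
  rw [hde] at ht
  rw [show app X W (sg b) (X.ualC S b) = _ from e.symm, ← hτ, ← hj3]
  have hang : ∀ c, X.de q * ‖(op X (lt c) (spin τ) (X.comp (X.B.comm j.1 j.2.1 j.2.2 (wt rad S.ual)) τ)).1 q‖ ≤ X.bd S n q := by
    intro c; rw [← comp_nab hg]; refine le_bd h q (k := 1 + j.2.2 + 1) (by omega) ?_ (ht.1.trans hd)
    rw [mul_pow, mul_left_comm]; gcongr; exact comp_le hg.nab.1 q _
  refine ⟨?_, ?_, ?_⟩
  · rintro l (rfl | rfl)
    · exact hang true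
    · exact hang false
  · refine le_bd h q (k := 1 + j.2.2) (by omega) ?_ (ht.2.1.trans hd)
    have := comp_le hg.1 q τ
    rw [mul_pow, mul_pow, ri, inv_pow, rad_dom, mul_left_comm, mul_assoc, ← mul_div_assoc, inv_mul_eq_div]; gcongr
  · refine le_bd h q (k := 1 + j.2.2 + 2) (by omega) ?_ (ht.2.2.trans hd)
    have h1 := comp_le hg.frakTUr.1 q τ
    rw [comp_frakTUr hg, mul_ap, mul_ap, norm_mul, norm_mul, algebraMap_ap, SigS_ap, norm_real, Real.norm_eq_abs] at h1
    have h2 : q.1 1 ^ 2 ≤ |X.B.Sig (Sph q)| := by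
      rw [Sig_Sph]; refine le_trans ?_ (le_abs_self _); nlinarith [sq_nonneg (X.B.a * cos (q.1 2))]
    generalize ‖(op X Letter.f (spin τ) (X.comp (X.B.comm j.1 j.2.1 j.2.2 (wt rad S.ual)) τ) +
      ES X (1 + j.2.2) (spin τ) * X.comp (X.B.comm j.1 j.2.1 j.2.2 (wt rad S.ual)) τ).1 q‖ = y at *
    have h3 : (1 / 2 * q.1 1 ^ 2 * |y|) ^ 2 ≤
        2 ^ (1 + j.2.2) * X.B.normSq (X.B.frakTUr (X.B.comm j.1 j.2.1 j.2.2 (wt rad S.ual))) (Sph q) := by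
      refine le_trans ?_ h1; rw [show ‖(1 / 2 : ℂ)‖ = 1 / 2 by simp, ← sq_abs (1 / 2 * |_| * y), abs_mul, abs_mul, abs_abs]
      rw [abs_of_pos (by norm_num : (0 : ℝ) < 1 / 2)]
      gcongr
    rw [rad_dom, ri, inv_inv, ← sub_nonneg]
    have h4 : 0 ≤ (4 / q.1 1 ^ 2) * (2 ^ (1 + j.2.2) * X.B.normSq (X.B.frakTUr (X.B.comm j.1 j.2.1 j.2.2 (wt rad S.ual))) (Sph q)
      - (1 / 2 * q.1 1 ^ 2 * |y|) ^ 2) := mul_nonneg (by positivity) (sub_nonneg.2 h3)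
    refine h4.trans (le_of_eq ?_); rw [mul_pow _ |y|, sq_abs]; field_simp; ring

end bounds

lemma app_smul (W : List Letter) (s : ℤ) (c : ℂ) (u : X.Sm) : app X W s (c • u) = c • app X W s u := by
  induction W generalizing s u with
  | nil => rfl
  | cons l W ih => rw [app_cons, op_smul, ih]; rfl

/-- A middle component. -/
inductive IsMid (S : MaxwellFields) : Tens 0 → Prop
  | rho : IsMid S S.rho
  | sig : IsMid S S.sig

lemma IsMid.good {S : MaxwellFields} (h : X.B.IsSolution S) {T : Tens 0} (hT : IsMid S T) : X.Good T := by
  cases hT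
  · exact good_rho h
  · exact good_sig h

lemma IsMid.eq {S : MaxwellFields} {T : Tens 0} (hT : IsMid S T) :
    ∃ c₁ c₂ : ℂ, ‖c₁‖ = 1 / 2 ∧ ‖c₂‖ = 1 / 2 ∧ ∀ X : Adm, X.comp T ![] = c₁ • X.Phi S true + c₂ • X.Phi S false := by
  cases hT
  · refine ⟨1/2, 1/2, by simp, by simp, fun X => ?_⟩
    rw [Phi_rho, Algebra.smul_def, Algebra.smul_def]; ring
  · refine ⟨-(1/2 * I), 1/2 * I, by simp, by simp, fun X => ?_⟩
    rw [Phi_sig, Algebra.smul_def, Algebra.smul_def, map_neg, map_mul, iS]; ring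

section mid

variable {M : ℝ} (hM : 0 < M) (n : ℕ)
include hM

lemma Phi_words : ∃ C, 0 ≤ C ∧ ∀ W : List Letter, W.length ≤ n → W ≠ [] →
    ∀ X : Adm, X.B.M = M → ∀ S, X.B.IsSolution S → ∀ (b : Bool) q, X.ri q * ‖(app X W 0 (X.Phi S b)).1 q‖ ≤ C * X.bd S n q ∧
        ((∃ l ∈ W, l ≠ Letter.d) → ‖(app X W 0 (X.Phi S b)).1 q‖ ≤ C * X.bd S n q) := by
  obtain ⟨C₁, hC₁, h₁⟩ := mid_words (midEqs true) hM n
  obtain ⟨C₂, hC₂, h₂⟩ := mid_words (midEqs false) hM n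
  refine ⟨C₁ + C₂, by positivity, fun W hW hW' X hX S hS b q => ?_⟩
  have hK : 0 ≤ X.bd S n q := Real.sqrt_nonneg _
  have k1 : 0 ≤ C₁ * X.bd S n q := by positivity
  have k2 : 0 ≤ C₂ * X.bd S n q := by positivity
  rw [add_mul]
  cases b
  · obtain ⟨a1, a2⟩ := h₂ W hW hW' X hX _ _ _ q _ (holds hS false) (hypA hS q _) (hypU hS q _)
    exact ⟨by linarith, fun h => by linarith [a2 h]⟩
  · obtain ⟨a1, a2⟩ := h₁ W hW hW' X hX _ _ _ q _ (holds hS true) (hypA hS q _) (hypU hS q _)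
    exact ⟨by linarith, fun h => by linarith [a2 h]⟩

lemma mid_app : ∃ C, 0 ≤ C ∧ ∀ W : List Letter, W.length ≤ n → W ≠ [] →
    ∀ X : Adm, X.B.M = M → ∀ S, X.B.IsSolution S → ∀ T, IsMid S T → ∀ q,
      X.ri q * ‖(app X W 0 (X.comp T ![])).1 q‖ ≤ C * X.bd S n q ∧
        ((∃ l ∈ W, l ≠ Letter.d) → ‖(app X W 0 (X.comp T ![])).1 q‖ ≤ C * X.bd S n q) := by
  obtain ⟨C, hC, h⟩ := Phi_words hM n
  refine ⟨C, hC, fun W hW hW' X hX S hS T hT q => ?_⟩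
  obtain ⟨c₁, c₂, e₁, e₂, e⟩ := hT.eq
  obtain ⟨a1, a2⟩ := h W hW hW' X hX S hS true q
  obtain ⟨b1, b2⟩ := h W hW hW' X hX S hS false q
  have key : ‖(app X W 0 (X.comp T ![])).1 q‖ ≤ 1 / 2 * ‖(app X W 0 (X.Phi S true)).1 q‖
      + 1 / 2 * ‖(app X W 0 (X.Phi S false)).1 q‖ := by
    rw [e X, app_add, app_smul, app_smul, add_ap, smul_ap, smul_ap]
    exact (norm_add_le _ _).trans (le_of_eq (by rw [norm_mul, norm_mul, e₁, e₂]))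
  have hr := X.ri_pos q
  refine ⟨?_, fun hl => ?_⟩
  · have := mul_le_mul_of_nonneg_left key hr.le; linarith
  · linarith [a2 hl, b2 hl]

lemma densMid_le : ∃ C, 0 ≤ C ∧ ∀ X : Adm, X.B.M = M → ∀ S, X.B.IsSolution S → ∀ T, IsMid S T →
    ∀ j ∈ Background.orders n, ∀ q : X.dom,
      X.B.densMid (X.B.comm j.1 j.2.1 j.2.2 T) (Sph q) ≤ C * X.dens S (n + 1) (Sph q) := by
  obtain ⟨C, hC, h⟩ := mid_app hM (n + 1)
  refine ⟨3 * C ^ 2 * 2 ^ (n + 5), by positivity, fun X hX S hS T hT j hj q => ?_⟩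
  have hg := (hT.good hS).comm j.1 j.2.1 j.2.2
  have hK : (C * X.bd S (n + 1) q) ^ 2 = C ^ 2 * 2 ^ (n + 5) * X.dens S (n + 1) (Sph q) := by
    rw [mul_pow, bd, Real.sq_sqrt (by have := dens_nonneg hS (n := n + 1) q; positivity)]
    ring
  have hword : ∀ (l : Letter) τ, ∃ W : List Letter, W.length ≤ n + 1 ∧ W ≠ [] ∧ l ∈ W ∧
      op X l (spin τ) (X.comp (X.B.comm j.1 j.2.1 j.2.2 T) τ) = app X W 0 (X.comp T ![]) := by
    intro l τ; obtain ⟨W, σ, hW, hs, e⟩ := comm_exists (hT.good hS) hj τ; rw [Subsingleton.elim σ ![]] at hs e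
    refine ⟨W ++ [l], by simpa using hW, by simp, by simp, ?_⟩
    rw [show spin (![] : Fin 0 → Bool) = 0 from rfl] at hs e; rw [e, hs, app_concat]
  have h4 : X.B.normSq (X.B.nab4 (X.B.comm j.1 j.2.1 j.2.2 T)) (Sph q) ≤ (C * X.bd S (n + 1) q) ^ 2 := by
    refine normSq_le hg.nab4.1 q fun τ => ?_; obtain ⟨W, hW, hW', hl, e⟩ := hword .f τ; rw [comp_nab4 hg, e]
    exact (h W hW hW' X hX S hS T hT q).2 ⟨_, hl, by simp⟩
  have ha : X.B.normSq (X.B.nab (X.B.comm j.1 j.2.1 j.2.2 T)) (Sph q) ≤ (C * X.bd S (n + 1) q) ^ 2 := by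
    refine normSq_le hg.nab.1 q fun τ => ?_; obtain ⟨W, hW, hW', hl, e⟩ := hword (lt (τ 0)) (Fin.tail τ)
    rw [← Fin.cons_self_tail τ, comp_nab hg, e]; exact (h W hW hW' X hX S hS T hT q).2 ⟨_, hl, (lt_ne _).1⟩
  have h3 : X.B.normSq (X.B.degNab3 (X.B.comm j.1 j.2.1 j.2.2 T)) (Sph q) ≤ ((X.ri q)⁻¹ * (C * X.bd S (n + 1) q)) ^ 2 := by
    refine normSq_le hg.degNab3.1 q fun τ => ?_; obtain ⟨W, hW, hW', hl, e⟩ := hword .d τ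
    rw [comp_degNab3 hg, e, ← div_eq_inv_mul, le_div_iff₀' (X.ri_pos q)]; exact (h W hW hW' X hX S hS T hT q).1
  have hr := X.r_pos q
  have h3' : X.B.Del (Sph q) / rad (Sph q) ^ 4 * X.B.normSq (X.B.nab3 (X.B.comm j.1 j.2.1 j.2.2 T)) (Sph q)
      ≤ (C * X.bd S (n + 1) q) ^ 2 := by
    have e : X.B.normSq (X.B.degNab3 (X.B.comm j.1 j.2.1 j.2.2 T)) (Sph q) =
        X.de q ^ 2 * X.B.normSq (X.B.nab3 (X.B.comm j.1 j.2.1 j.2.2 T)) (Sph q) := by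
      rw [normSq_Sph hg.degNab3.1, normSq_Sph hg.nab3.1, mul_left_comm]; congr 1; rw [mul_sum]; refine sum_ext fun τ => ?_
      rw [comp_degNab3 hg, comp_nab3 hg, op, mul_ap, norm_mul, X.norm_delS, mul_pow]
    rw [e, mul_pow, inv_pow, ← div_eq_inv_mul, le_div_iff₀' (by have := X.ri_pos q; positivity)] at h3
    refine le_trans ?_ h3; have hn := normSq_nonneg hg.nab3.1 q; rw [← mul_assoc]; gcongr
    rw [rad_dom, Del_Sph, ri, de, div_le_iff₀ (by positivity), ← sub_nonneg]
    have hb := X.beta_nonneg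
    have : ((q.1 1)⁻¹ ^ 2 * (1 - X.B.M / q.1 1) ^ 2 * q.1 1 ^ 4 - (q.1 1 ^ 2 - 2 * X.B.M * q.1 1 + X.B.a ^ 2))
      = X.B.M ^ 2 - X.B.a ^ 2 := by field_simp; ring
    rw [this]; exact hb
  rw [Background.densMid]
  linarith

end mid

open MeasureTheory Background

def box2 : Set (ℝ × ℝ) := Ioo 0 pi ×ˢ Ioo 0 (2 * pi)

def m2 : Measure (ℝ × ℝ) := (volume.restrict (Ioo 0 pi)).prod (volume.restrict (Ioo 0 (2 * pi)))

/-- The point at time `t` and radius `r` with angular coordinates `x`. -/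
notation:max "pt(" t "," r "," x ")" => ![t, r, Prod.fst x, Prod.snd x]

lemma measurableSet_box2 : MeasurableSet box2 := measurableSet_Ioo.prod measurableSet_Ioo

lemma m2_eq : m2 = (volume : Measure (ℝ × ℝ)).restrict box2 := by rw [m2, Measure.prod_restrict]; rfl

lemma mem_dom {τ r : ℝ} {x : ℝ × ℝ} (hτ : 0 ≤ τ) (hr : X.B.rPlus < r) (hx : x ∈ box2) :
    ![τ, r, x.1, x.2] ∈ X.dom := ⟨hτ, hr, hx.1.1, hx.1.2⟩

lemma sphInt_eq {F : Pt → ℝ} {τ r : ℝ} (hF : ContinuousOn (fun x : ℝ × ℝ => F (sph τ r x.1 x.2)) box2) :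
    sphInt F τ r = ∫⁻ x, ofReal (F (sph τ r x.1 x.2) * sin x.1) ∂m2 := by
  rw [m2, lintegral_prod]
  · rfl
  · rw [← m2, m2_eq]; exact (hF.mul (by fun_prop)).aemeasurable measurableSet_box2 |>.ennreal_ofReal

lemma sphInt_mono {F G : Pt → ℝ} {τ r C : ℝ} (hC : 0 ≤ C) (h : ∀ x ∈ box2, F (sph τ r x.1 x.2) ≤ C * G (sph τ r x.1 x.2)) :
    sphInt F τ r ≤ ofReal C * sphInt G τ r := by
  rw [sphInt, sphInt, ← lintegral_const_mul' _ _ ofReal_ne_top]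
  refine setLIntegral_mono' measurableSet_Ioo fun θ hθ => ?_
  rw [← lintegral_const_mul' _ _ ofReal_ne_top]
  refine setLIntegral_mono' measurableSet_Ioo fun φ hφ => ?_
  rw [← ofReal_mul hC, ← mul_assoc]
  refine ofReal_le_ofReal (mul_le_mul_of_nonneg_right (h (θ, φ) ⟨hθ, hφ⟩) ?_)
  exact (Real.sin_pos_of_mem_Ioo hθ).le

lemma sliceInt_mono {F G : Pt → ℝ} {τ C : ℝ} (hτ : 0 ≤ τ) (hC : 0 ≤ C) (h : ∀ q : X.dom, F (Sph q) ≤ C * G (Sph q)) :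
    X.B.sliceInt F τ ≤ ofReal C * X.B.sliceInt G τ := by
  rw [Background.sliceInt, Background.sliceInt, ← lintegral_const_mul' _ _ ofReal_ne_top]
  exact setLIntegral_mono' measurableSet_Ioi fun r hr =>
    sphInt_mono hC fun x hx => h ⟨_, mem_dom hτ hr hx⟩

section additivity

variable {F G : Pt → ℝ} {τ : ℝ} (hτ : 0 ≤ τ)

include hτ in
lemma continuousOn_sph (hF : ContinuousOn F X.off) {r : ℝ} (hr : X.B.rPlus < r) :
    ContinuousOn (fun x : ℝ × ℝ => F (sph τ r x.1 x.2)) box2 :=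
  hF.comp (f := fun x : ℝ × ℝ => sph τ r x.1 x.2)
    (by unfold sph; rw [continuousOn_pi]; intro i; fin_cases i <;> simp <;> fun_prop)
    fun _ hx => X.Sph_mem_off (mem_dom hτ hr hx)

include hτ in
lemma aemeasurable_sphInt (hF : ContinuousOn F X.off) :
    AEMeasurable (fun r => sphInt F τ r) (volume.restrict (Set.Ioi X.B.rPlus)) := by
  have h : AEMeasurable (fun y : ℝ × ℝ × ℝ => ofReal (F (sph τ y.1 y.2.1 y.2.2) * sin y.2.1))
      ((volume.restrict (Set.Ioi X.B.rPlus)).prod m2) := by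
    rw [m2_eq, Measure.prod_restrict]
    refine (ContinuousOn.aemeasurable ?_ (measurableSet_Ioi.prod measurableSet_box2)).ennreal_ofReal
    refine ContinuousOn.mul (hF.comp (f := fun y : ℝ × ℝ × ℝ => sph τ y.1 y.2.1 y.2.2)
      (by unfold sph; rw [continuousOn_pi]; intro i; fin_cases i <;> simp <;> fun_prop) ?_) (by fun_prop)
    exact fun y hy => X.Sph_mem_off (mem_dom hτ hy.1 hy.2)
  have : SFinite m2 := by unfold m2; infer_instance
  refine h.lintegral_prod_right'.congr ?_
  filter_upwards [ae_restrict_mem measurableSet_Ioi] with r hr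
  rw [sphInt_eq (continuousOn_sph hτ hF hr)]

include hτ in
lemma sphInt_add (hF : ContinuousOn F X.off) (hG : ContinuousOn G X.off) {r : ℝ} (hr : X.B.rPlus < r)
    (hF' : ∀ p ∈ X.off, 0 ≤ F p) (hG' : ∀ p ∈ X.off, 0 ≤ G p) :
    sphInt (fun p => F p + G p) τ r = sphInt F τ r + sphInt G τ r := by
  have cF := continuousOn_sph hτ hF hr
  have cG := continuousOn_sph hτ hG hr
  rw [sphInt_eq cF, sphInt_eq cG, sphInt_eq (cF.add cG), ← lintegral_add_left', m2_eq]
  · refine setLIntegral_congr_fun measurableSet_box2 fun x hx => ?_; have hs := (Real.sin_pos_of_mem_Ioo hx.1).le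
    have hm : sph τ r x.1 x.2 ∈ X.off := X.Sph_mem_off (mem_dom hτ hr hx)
    rw [add_mul, ofReal_add (mul_nonneg (hF' _ hm) hs) (mul_nonneg (hG' _ hm) hs)]
  · rw [m2_eq]; exact ((cF.mul (by fun_prop)).aemeasurable measurableSet_box2).ennreal_ofReal

include hτ in
lemma sliceInt_add (hF : ContinuousOn F X.off) (hG : ContinuousOn G X.off)
    (hF' : ∀ p ∈ X.off, 0 ≤ F p) (hG' : ∀ p ∈ X.off, 0 ≤ G p) :
    X.B.sliceInt (fun p => F p + G p) τ = X.B.sliceInt F τ + X.B.sliceInt G τ := by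
  simp only [Background.sliceInt]
  rw [← lintegral_add_left' (aemeasurable_sphInt hτ hF)]
  exact setLIntegral_congr_fun measurableSet_Ioi fun r hr => sphInt_add hτ hF hG hr hF' hG'

include hτ in
lemma sliceInt_sum {ι : Type*} (s : Finset ι) {F : ι → Pt → ℝ} (hF : ∀ i, ContinuousOn (F i) X.off)
    (hF' : ∀ i, ∀ p ∈ X.off, 0 ≤ F i p) :
    X.B.sliceInt (fun p => ∑ i ∈ s, F i p) τ = ∑ i ∈ s, X.B.sliceInt (F i) τ := by
  classical
  induction s using Finset.induction_on with
  | empty => simp [Background.sliceInt, sphInt]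
  | insert i s hi ih =>
    simp only [Finset.sum_insert hi]
    rw [sliceInt_add hτ (hF i) (continuousOn_finsetSum _ fun j _ => hF j) (hF' i)
      (fun p hp => Finset.sum_nonneg fun j _ => hF' j p hp), ih]

end additivity

section continuity

variable {k : ℕ} {T : Tens k}

lemma continuousOn_normSq (h : X.TSf T) : ContinuousOn (X.B.normSq T) X.off := by
  refine Complex.continuous_re.comp_continuousOn (continuousOn_finsetSum _ fun I _ =>
    continuousOn_finsetSum _ fun J _ => ContinuousOn.mul (ContinuousOn.mul
      (continuousOn_finsetProd _ fun i _ => ?_) (h I).continuousOn)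
      (Complex.continuous_conj.comp_continuousOn (h J).continuousOn))
  exact Complex.continuous_ofReal.comp_continuousOn (smooth_hInv _ _).continuousOn

lemma continuousOn_radInv (X : Adm) (n : ℕ) : ContinuousOn (fun p => (rad p ^ n)⁻¹) X.off :=
  (continuous_rad.continuousOn.pow n).inv₀ fun _ hp => (pow_pos (X.rad_pos_of_mem hp.2) n).ne'

lemma continuousOn_densAl (h : X.Good T) : ContinuousOn (X.B.densAl T) X.off := by
  have c1 := continuousOn_normSq h.nab.nab.1
  have c2 := continuousOn_normSq h.nab4.nab.1
  have c3 := continuousOn_normSq h.nab4.nab4.1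
  have c4 := continuousOn_normSq h.nab3.nab4.1
  have c5 := continuousOn_normSq h.nab3.nab3.1
  have c6 := continuousOn_normSq h.nab3.nab.1
  have c7 := continuousOn_normSq h.nab3.1
  have c8 := continuousOn_normSq h.nab4.1
  have c9 := continuousOn_normSq h.nab.1
  have c0 := continuousOn_normSq h.1
  have hD : ContinuousOn X.B.Del X.off := (off_of X.smooth_Del).continuousOn
  have hr : ContinuousOn rad X.off := continuous_rad.continuousOn
  have hr2 := X.continuousOn_radInv 2
  have e : X.B.densAl T = fun p => X.B.normSq (X.B.nab (X.B.nab T)) p + X.B.normSq (X.B.nab (X.B.nab4 T)) p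
    + X.B.normSq (X.B.nab4 (X.B.nab4 T)) p
    + rad p ^ 2 * X.B.normSq (X.B.nab4 (X.B.nab3 T)) p
    + X.B.Del p * (rad p ^ 2)⁻¹ * X.B.normSq (X.B.nab3 (X.B.nab3 T)) p
    + rad p ^ 2 * X.B.normSq (X.B.nab (X.B.nab3 T)) p
    + X.B.normSq (X.B.nab3 T) p
    + X.B.normSq (X.B.nab4 T) p + X.B.normSq (X.B.nab T) p + X.B.normSq T p * (rad p ^ 2)⁻¹ := rfl
  rw [e]
  exact ((((((((c1.add c2).add c3).add ((hr.pow 2).mul c4)).add ((hD.mul hr2).mul c5)).add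
    ((hr.pow 2).mul c6)).add c7).add c8).add c9).add (c0.mul hr2)

lemma continuousOn_densUAl (h : X.Good T) : ContinuousOn (X.B.densUAl T) X.off := by
  have c1 := continuousOn_normSq h.nab.nab.1
  have c2 := continuousOn_normSq h.nab.nab3.1
  have c3 := continuousOn_normSq h.nab3.nab3.1
  have c4 := continuousOn_normSq h.frakTUr.nab4.1
  have c5 := continuousOn_normSq h.frakTUr.nab3.1
  have c6 := continuousOn_normSq h.frakTUr.nab.1
  have c7 := continuousOn_normSq h.frakTUr.1
  have c8 := continuousOn_normSq h.nab3.1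
  have c9 := continuousOn_normSq h.nab.1
  have c0 := continuousOn_normSq h.1
  have hD : ContinuousOn X.B.Del X.off := (off_of X.smooth_Del).continuousOn
  have hr : ContinuousOn (fun p => rad p - X.B.M) X.off := (continuous_rad.sub continuous_const).continuousOn
  have hr2 := X.continuousOn_radInv 2
  have hr4 := X.continuousOn_radInv 4
  have hr6 := X.continuousOn_radInv 6
  exact (((((((hD.mul hr2).mul ((c1.add (((hr.pow 2).mul hr2).mul c2)).add
    (((hr.pow 4).mul hr6).mul c3))).add c4).add ((hD.mul hr4).mul c5)).add c6).add (c7.mul hr2)).add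
    ((((hr.pow 2).mul hD).mul hr6).mul c8)).add (((hr.pow 2).mul hr2).mul (c9.add (c0.mul hr2)))

lemma nonneg_off {F : Pt → ℝ} (h : ∀ q : X.dom, 0 ≤ F (Sph q)) : ∀ p ∈ X.off, 0 ≤ F p := by
  intro p hp
  obtain ⟨q, hq, rfl⟩ := exists_Sph hp
  exact h ⟨q, hq⟩

end continuity

lemma sliceInt_dens {S : MaxwellFields} (h : X.B.IsSolution S) (n : ℕ) {τ : ℝ} (hτ : 0 ≤ τ) :
    X.B.sliceInt (X.dens S n) τ = X.B.energyAl (n + 1) S.al τ + X.B.energyUAl (n + 1) S.ual τ := by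
  have cA := fun j : ℕ × ℕ × ℕ => continuousOn_densAl ((good_wal h).comm j.1 j.2.1 j.2.2)
  have cU := fun j : ℕ × ℕ × ℕ => continuousOn_densUAl ((good_wual h).comm j.1 j.2.1 j.2.2)
  have nA := fun j : ℕ × ℕ × ℕ => nonneg_off (densAl_nonneg ((good_wal h).comm j.1 j.2.1 j.2.2))
  have nU := fun j : ℕ × ℕ × ℕ => nonneg_off (densUAl_nonneg ((good_wual h).comm j.1 j.2.1 j.2.2))
  have := sliceInt_sum hτ (Background.orders n) (fun j => (cA j).add (cU j))
    (fun j p hp => add_nonneg (nA j p hp) (nU j p hp))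
  refine this.trans ?_
  rw [Background.energyAl, Background.energyUAl, ← sum_add_distrib, Nat.add_sub_cancel]
  exact sum_ext fun j => sliceInt_add hτ (cA j) (cU j) (nA j) (nU j)

lemma energyMid_deriv_le {M : ℝ} (hM : 0 < M) (n : ℕ) : ∃ C, 0 ≤ C ∧ ∀ X : Adm, X.B.M = M →
    ∀ S, X.B.IsSolution S → ∀ T, IsMid S T → ∀ τ, 0 ≤ τ →
      ∑ j ∈ Background.orders n, X.B.sliceInt (X.B.densMid (X.B.comm j.1 j.2.1 j.2.2 T)) τ ≤
        ofReal C * (X.B.energyAl (n + 2) S.al τ + X.B.energyUAl (n + 2) S.ual τ) := by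
  obtain ⟨C, hC, h⟩ := densMid_le hM n
  refine ⟨(Background.orders n).card * C, by positivity, fun X hX S hS T hT τ hτ => ?_⟩
  rw [← sliceInt_dens hS _ hτ, ofReal_mul (by positivity), mul_assoc, ENNReal.ofReal_natCast, ← nsmul_eq_mul]
  exact Finset.sum_le_card_nsmul _ _ _ fun j hj => sliceInt_mono hτ hC (h X hX S hS T hT j hj)

variable (X) in
/-- The derivation along `L_±`. -/
def Lb (b : Bool) (u : X.Sm) : X.Sm := X.Lop (sg b) u

lemma op_lt (b : Bool) (s : ℤ) (u : X.Sm) : op X (lt b) s u = X.zeS (sg (!b)) *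
    (X.Lb b u + (s : X.Sm) * (-((sg b : X.Sm) * (X.cS * X.siS)) + X.AS * X.sS * X.zeS (sg (!b))) * u) := by
  cases b <;> simp [op, lt, Lb, sg, kpS]

lemma SigS_ze (b : Bool) : X.SigS * X.zeS (sg b) = X.zb (!b) := by rw [SigS_eq b]; linear_combination X.zb (!b) * X.zeS_zb b

lemma pd_zb (b : Bool) (i : Fin 4) : pd i (X.zb b) =
    if i = 1 then 1 else if i = 2 then -((sg b : X.Sm) * (X.AS * X.sS)) else 0 := by
  have : X.zb b = X.rS + (sg b : X.Sm) * (X.AS * X.cS) := by cases b <;> simp [zb, sg]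
  rw [this]
  simp only [map_add, leibniz, pd_rS, pd_cS, D_AS, Derivation.map_intCast, smul_eq_mul]
  fin_cases i <;> simp

lemma dP_zb (b : Bool) : X.dP (X.zb b) = 1 := by simp [dP_apply, pd_zb]

lemma sg_sq (X : Adm) (b : Bool) : (sg b : X.Sm) * (sg b : X.Sm) = 1 := by cases b <;> simp [sg]

lemma pd_ze (b : Bool) (i : Fin 4) : pd i (X.zeS (sg b)) = -X.zeS (sg b) ^ 2 * pd i (X.zb b) := by
  rw [leibniz_of_mul_eq_one _ (X.zeS_zb b)]; simp

lemma dP_ze (b : Bool) : X.dP (X.zeS (sg b)) = -X.zeS (sg b) ^ 2 := by rw [leibniz_of_mul_eq_one _ (X.zeS_zb b), dP_zb]; simp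

lemma kS_sg (b : Bool) : X.kS ((sg b : ℝ) : ℂ) = (sg b : X.Sm) := by cases b <;> simp [sg]

lemma Lb_eq (b : Bool) (u : X.Sm) : X.Lb b u = pd 2 u + (sg b : X.Sm) * (X.AS * X.sS * pd 0 u + X.iS * X.siS * pd 3 u) := by
  rw [Lb, Lop, kS_sg]

lemma Lb_mul (b : Bool) (u v : X.Sm) : X.Lb b (u * v) = X.Lb b u * v + u * X.Lb b v := by
  simp only [Lb_eq, leibniz, smul_eq_mul]; ring

lemma zb_not (X : Adm) (b : Bool) : X.zb (!b) = X.zb b - 2 * (sg b : X.Sm) * (X.AS * X.cS) := by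
  cases b <;> simp [zb, sg] <;> ring

lemma zeS_zeS (b : Bool) : X.zeS 1 * X.zeS (-1) = X.zeS (sg b) * X.zeS (sg (!b)) := by cases b <;> simp [sg]; ring

lemma dP_DZS : X.dP X.DZS = 2 * X.omS * ζ(X) ^ 2 := by
  have h1 := X.zeS_zb true
  have h2 := X.zeS_zb false
  have e1 : X.dP (X.zeS 1) = -X.zeS 1 ^ 2 := by simpa [sg] using dP_ze (X := X) true
  have e2 : X.dP (X.zeS (-1)) = -X.zeS (-1) ^ 2 := by simpa [sg] using dP_ze (X := X) false
  have e3 : X.dP X.DelS = 2 * (X.rS - X.kS X.B.M) := by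
    simp only [dP_apply, DelS, map_add, map_sub, leibniz, leibniz_pow, pd_rS, D_kS, D_ofNat, smul_eq_mul, nsmul_eq_mul]
    simp; ring
  simp only [sg, zb, if_true, Bool.false_eq_true, if_false] at h1 h2
  push_cast at h1 h2
  rw [DZS, leibniz, leibniz, e1, e2, e3, omS]
  simp only [smul_eq_mul]
  grind

section solution

variable (S : MaxwellFields)

variable (X) in
/-- The component of `α` along `L_∓`. -/
def vS (b : Bool) : X.Sm := X.zb b * X.comp S.al ![!b]
variable (X) in
/-- The component of `α̲` along `L_±`. -/
def uS (b : Bool) : X.Sm := X.zb (!b) * X.comp S.ual ![b]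

variable {S}

lemma al_vS (b : Bool) : X.comp S.al ![!b] = X.zeS (sg b) * X.vS S b := by
  rw [vS]; linear_combination (-X.comp S.al ![!b]) * X.zeS_zb b
lemma ual_uS (b : Bool) : X.comp S.ual ![b] = X.zeS (sg (!b)) * X.uS S b := by
  rw [uS]; linear_combination (-X.comp S.ual ![b]) * X.zeS_zb (!b)

variable (X S) in
/-- The `θφ`-component of the two-form. -/
def formI (b : Bool) : X.Sm := X.sS * (X.rS ^ 2 - X.AS ^ 2) * X.Phi S b * X.zeS (sg b) ^ 2
  - X.kS (1/2) * (sg b : X.Sm) * X.AS * X.sS ^ 2 * (X.vS S b + X.DZS * X.uS S b)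
variable (X S) in
/-- The flux of the two-form in the direction of `θ` under `∂_t`. -/
def fluxT (b : Bool) : X.Sm := X.kS (1/2) * X.sS * (X.vS S b - X.DZS * X.uS S b)
variable (X S) in
/-- The flux of the two-form in the direction of `φ` under `∂_t`. -/
def twistT (b : Bool) : X.Sm := X.kS (1/2) * (sg b : X.Sm) * X.iS * (X.vS S b + X.DZS * X.uS S b)
  + X.iS * X.AS * X.sS * X.Phi S b * X.zeS (sg b) ^ 2
variable (X S) in
/-- The flux of the two-form in the direction of `θ` under `-e₃`. -/
def fluxP (b : Bool) : X.Sm := X.sS * (X.rS ^ 2 - X.AS ^ 2) * X.uS S b * ζ(X)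
  + (sg b : X.Sm) * X.AS * X.sS ^ 2 * X.Phi S b * X.zeS (sg b) ^ 2
variable (X S) in
/-- The flux of the two-form in the direction of `φ` under `-e₃`. -/
def twistP (b : Bool) : X.Sm := -((sg b : X.Sm) * X.iS * X.uS S b)

lemma pd_yy (i : Fin 4) : pd i ζ(X) = if i = 1 then -2 * X.rS * ζ(X) ^ 2
    else if i = 2 then -2 * X.AS ^ 2 * X.sS * X.cS * ζ(X) ^ 2 else 0 := by
  have h1 := X.zeS_zb true
  have h2 := X.zeS_zb false
  simp only [sg, zb, if_true, Bool.false_eq_true, if_false] at h1 h2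
  push_cast at h1 h2
  rw [leibniz, pd_zp, pd_zm]
  fin_cases i <;> simp <;> grind

lemma yy_zb (X : Adm) (b : Bool) : X.zeS 1 * X.zeS (-1) * (X.zb b * X.zb !b) = 1 := by
  rw [zeS_zeS b]
  linear_combination X.zeS (sg !b) * X.zb (!b) * X.zeS_zb b + X.zeS_zb !b

lemma sS_sq_add : X.sS ^ 2 + X.cS ^ 2 = 1 := by
  ext q : 1
  simp only [add_ap, pow_ap, sS_ap, cS_ap, one_ap]
  exact_mod_cast sin_sq_add_cos_sq _

variable (h : X.B.IsSolution S)
include h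

lemma e4_Phi (b : Bool) : X.e4op (X.Phi S b) = X.zb b * X.zeS (sg (!b)) * (X.Lb b (X.vS S b) + X.cS * X.siS * X.vS S b) := by
  have e0 := op_f_Phi h b
  rw [al_vS, ← mul_assoc X.SigS, SigS_ze, op_lt, Lb_mul] at e0
  have e1 : X.Lb b (X.zb (!b)) = (sg b : X.Sm) * (X.AS * X.sS) := by rw [Lb_eq]; simp [pd_zb, sg_not]
  have e2 : op X .f 0 (X.Phi S b) = X.e4op (X.Phi S b) := by simp [op]
  rw [e2, e1] at e0
  rw [e0]
  have hz := X.zeS_zb (!b)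
  have he := X.sg_sq b
  have hn : (sg (!b) : X.Sm) = -(sg b : X.Sm) := by rw [sg_not]; push_cast; rfl
  rw [hn]
  grind

lemma dP_Phi (b : Bool) : X.dP (X.Phi S b) = X.zb b * X.zeS (sg (!b)) *
    (X.Lb (!b) (X.uS S b) + (X.cS * X.siS - 2 * X.AS ^ 2 * X.sS * X.cS * ζ(X)) * X.uS S b) := by
  have e0 := op3_Phi h b
  rw [ual_uS, op_lt, Lb_mul, op3] at e0
  have e1 : X.Lb (!b) (X.zeS (sg (!b))) = -(X.zeS (sg (!b)) ^ 2 * (sg b : X.Sm) * (X.AS * X.sS)) := by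
    simp only [Lb_eq, pd_ze, pd_zb, Fin.reduceEq, if_true, if_false, Fin.isValue]; rw [sg_not]; push_cast; ring
  rw [e1, Bool.not_not] at e0
  have hz := X.zeS_zb (!b)
  have hz' := X.zeS_zb b
  have he := X.sg_sq b
  have hn : (sg (!b) : X.Sm) = -(sg b : X.Sm) := by rw [sg_not]; push_cast; rfl
  have h3 := X.zb_not b
  rw [zeS_zeS b]
  rw [hn] at e0
  grind

lemma Lm_Phi (b : Bool) : X.Lb (!b) (X.Phi S b) = -(X.zb b ^ 2 * X.dP (X.vS S b)) := by
  have e0 := op_ang_Phi h b (!b)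
  have hb : ¬ ((!b) = b) := by cases b <;> simp
  have k2 := X.half_add_half
  rw [if_neg hb, op_lt, comp_frakT (good_al h), spin_one, al_vS, Bool.not_not, op3, leibniz, dP_ze,
    zeS_zeS b, SigS_eq b] at e0
  have hz := X.zeS_zb (!b)
  have hz' := X.zeS_zb b
  have h3 : X.rS + (sg (!b) : X.Sm) * (X.AS * X.cS) = X.zb (!b) := by cases b <;> simp [sg, zb]
  simp only [smul_eq_mul, Nat.cast_one, Int.cast_zero, zero_mul, add_zero, one_mul] at e0
  rw [h3] at e0
  grind

lemma Lp_Phi (b : Bool) : X.Lb b (X.Phi S b) = -(X.zb b ^ 2 * (X.e4op (X.uS S b) + X.dP X.DZS * X.uS S b)) := by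
  have e0 := op_ang_Phi h b b
  have k2 := X.half_add_half
  have e4 : X.e4op (X.zeS (sg !b) * X.uS S b) = X.zeS (sg !b) * X.e4op (X.uS S b)
      - X.DZS * X.zeS (sg !b) ^ 2 * X.uS S b := by
    simp only [e4op, leibniz, dP_ze, pd_ze, pd_zb, smul_eq_mul, DZS, Fin.reduceEq, if_false, Fin.isValue]; ring
  rw [if_pos rfl, op_lt, comp_frakTU (good_ual h), spin_one, ual_uS, op, e4, SigS_eq b, gamS, ES] at e0
  rw [dP_DZS, zeS_zeS b]
  have hzz := zeS_zeS (X := X) b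
  have hD : X.DZS = X.DelS * X.zeS 1 * X.zeS (-1) := rfl
  push_cast at e0
  have hz := X.zeS_zb (!b)
  have hz' := X.zeS_zb b
  have h3 : X.zb b = X.rS + (sg b : X.Sm) * (X.AS * X.cS) := by cases b <;> simp [sg, zb]
  simp only [zero_mul, add_zero] at e0
  grind

lemma pd0_formI (b : Bool) : pd 0 (X.formI S b) = pd 2 (X.fluxT S b) + pd 3 (X.twistT S b) := by
  have E4 := e4_Phi h b
  have E3 := dP_Phi h b
  have hz := X.zeS_zb (!b)
  have hz' := X.zeS_zb b
  have hy := X.yy_zb b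
  have hs := X.siS_mul
  have hc := X.sS_sq_add
  have k2 := X.half_add_half
  rw [e4op] at E4
  have F1 : 2 * (X.rS ^ 2 - X.AS ^ 2) * pd 0 (X.Phi S b) - 2 * X.AS * X.iS * pd 3 (X.Phi S b) =
      X.zb b ^ 2 * (X.Lb b (X.vS S b) + X.cS * X.siS * X.vS S b - X.DZS * (X.Lb (!b) (X.uS S b) +
        (X.cS * X.siS - 2 * X.AS ^ 2 * X.sS * X.cS * ζ(X)) * X.uS S b)) := by
    have E5 : 2 * (X.rS ^ 2 - X.AS ^ 2) * pd 0 (X.Phi S b) - 2 * X.AS * X.iS * pd 3 (X.Phi S b) + X.DelS * X.dP (X.Phi S b) =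
        X.zb b ^ 2 * (X.Lb b (X.vS S b) + X.cS * X.siS * X.vS S b) := by
      clear * - E4 hc hz hy; grind
    rw [E3] at E5; rw [DZS]; clear * - E5 hz hy; grind
  clear E3 E4
  have hD0 : pd 0 X.DZS = 0 := by rw [DZS, mul_assoc, leibniz, pd_yy]; simp [DelS, pd_rS, D_ofNat]
  have hD2 : pd 2 X.DZS = -2 * X.AS ^ 2 * X.sS * X.cS * X.DZS * ζ(X) := by
    rw [DZS, mul_assoc, leibniz, pd_yy]; simp [DelS, pd_rS, D_ofNat]; ring
  have hD3 : pd 3 X.DZS = 0 := by rw [DZS, mul_assoc, leibniz, pd_yy]; simp [DelS, pd_rS, D_ofNat]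
  simp only [formI, fluxT, twistT, map_add, map_sub, leibniz, leibniz_pow, pd_rS, pd_sS, D_AS,
    D_iS, D_kS, pd_ze, pd_zb, hD0, hD2, hD3, Derivation.map_intCast, smul_eq_mul, nsmul_eq_mul,
    Fin.reduceEq, if_true, if_false, Fin.isValue, mul_zero, add_zero, zero_add]
  simp only [Lb_eq, sg_not] at F1
  push_cast at F1
  generalize X.zeS 1 * X.zeS (-1) = yy at *
  grind

lemma dP_formI (b : Bool) : X.dP (X.formI S b) = pd 2 (X.fluxP S b) + pd 3 (X.twistP S b) := by
  have E3 := dP_Phi h b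
  have E1 := Lp_Phi h b
  have E2 := Lm_Phi h b
  have hz := X.zeS_zb (!b)
  have hz' := X.zeS_zb b
  have hy := X.yy_zb b
  have hs := X.siS_mul
  have hc := X.sS_sq_add
  have he := X.sg_sq b
  have k2 := X.half_add_half
  have h3 : X.zb b = X.rS + (sg b : X.Sm) * (X.AS * X.cS) := by cases b <;> simp [sg, zb]
  have h4 := X.zb_not b
  have F2 : X.dP (X.Phi S b) * X.zeS (sg b) ^ 2 = X.zeS 1 * X.zeS (-1) * (X.Lb (!b) (X.uS S b) +
      (X.cS * X.siS - 2 * X.AS ^ 2 * X.sS * X.cS * ζ(X)) * X.uS S b) := by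
    rw [E3, zeS_zeS b]; grind
  have F3 : pd 2 (X.Phi S b) * X.zeS (sg b) ^ 2 = -X.kS (1/2) *
      (X.dP (X.vS S b) + X.e4op (X.uS S b) + X.dP X.DZS * X.uS S b) := by
    rw [Lb_eq] at E1 E2; rw [sg_not] at E2; push_cast at E2
    linear_combination (X.kS (1/2) * X.zeS (sg b) ^ 2) * (E1 + E2) - pd 2 (X.Phi S b) * X.zeS (sg b) ^ 2 * k2
      - X.kS (1/2) * (X.dP (X.vS S b) + X.e4op (X.uS S b) + X.dP X.DZS * X.uS S b) * (X.zeS (sg b) * X.zb b + 1) * hz'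
  clear E3 E1 E2
  have hr : X.dP X.rS = 1 := by simp [dP_apply, pd_rS]
  have hs' : X.dP X.sS = 0 := by simp [dP_apply, pd_sS]
  have G : pd 2 (X.fluxP S b) = (X.sS * (X.rS ^ 2 - X.AS ^ 2) * X.uS S b) * (-2 * X.AS ^ 2 * X.sS * X.cS * ζ(X) ^ 2)
      + ζ(X) * pd 2 (X.sS * (X.rS ^ 2 - X.AS ^ 2) * X.uS S b)
      + pd 2 ((sg b : X.Sm) * X.AS * X.sS ^ 2 * X.Phi S b * X.zeS (sg b) ^ 2) := by
    rw [fluxP, map_add, leibniz _ _ ζ(X), pd_yy]; simp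
  rw [G]
  simp only [formI, twistP, map_add, map_sub, map_neg, leibniz, leibniz_pow, pd_rS, pd_sS, D_AS,
    D_iS, D_kS, pd_ze, pd_zb, dP_ze, hr, hs', Derivation.map_intCast, smul_eq_mul, nsmul_eq_mul,
    Fin.reduceEq, if_true, if_false, Fin.isValue, mul_zero, add_zero]
  simp only [Lb_eq, sg_not, e4op, hc] at F2 F3
  push_cast at F2 ⊢
  rw [DZS] at F3 ⊢
  have F4 : X.rS * X.zeS (sg b) ^ 2 - (X.rS ^ 2 - X.AS ^ 2) * X.zeS (sg b) ^ 3 =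
      (sg b : X.Sm) * X.AS * X.cS * X.zeS (sg b) ^ 2 + X.AS ^ 2 * X.sS ^ 2 * X.zeS (sg b) ^ 3 := by
    clear * - hz' h3 he hc; grind
  have F5 : (X.rS ^ 2 - X.AS ^ 2 * X.cS ^ 2) * ζ(X) = 1 := by clear * - hy h4 h3 he; grind
  generalize X.zeS (sg b) = y at *
  generalize hyy : X.zeS 1 * X.zeS (-1) = yy at *
  generalize X.Phi S b = Φ at *
  generalize X.uS S b = u at *
  linear_combination (X.sS * (X.rS ^ 2 - X.AS ^ 2)) * F2 - (sg b : X.Sm) * X.AS * X.sS ^ 2 * F3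
    + 2 * X.sS * Φ * F4 + (X.rS ^ 2 - X.AS ^ 2) * yy * (X.cS * u - (sg b : X.Sm) * X.iS * pd 3 u) * hs
    - (sg b : X.Sm) * X.iS * pd 3 u * F5 - (sg b : X.Sm) * X.iS * pd 3 u * yy * X.AS ^ 2 * hc
    + (sg b : X.Sm) * X.AS * X.sS ^ 2 * yy * ((X.rS ^ 2 - X.AS ^ 2) * pd 0 u - X.AS * X.iS * pd 3 u) * k2
    - (2 * X.sS ^ 3 * X.AS ^ 2 * Φ * y ^ 3) * he
    - (X.sS ^ 2 * X.AS * X.kS (1 / 2) * (sg b : X.Sm) * X.DelS * X.dP u) * hyy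

lemma pd1_formI (b : Bool) : pd 1 (X.formI S b) = pd 2 (X.fluxP S b + X.hS * X.fluxT S b)
    + pd 3 (X.twistP S b + X.hS * X.twistT S b + X.wS * X.formI S b) := by
  have e1 := dP_formI h b
  have e0 := pd0_formI h b
  rw [dP_apply] at e1
  simp only [map_add, leibniz, X.pd_hS 2 (by decide), X.pd_hS 3 (by decide), X.pd_wS 3 (by decide), smul_eq_mul,
    mul_zero, add_zero]
  grind

end solution

lemma setIntegral_fin_two (G : (Fin 2 → ℝ) → ℂ) {a b : Fin 2 → ℝ} (ha : a = ![0, 0]) (hb : b = ![pi, 2 * pi]) :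
    ∫ y in Icc a b, G y = ∫ x, G ![x.1, x.2] ∂m2 := by
  have e := (volume_preserving_finTwoArrow ℝ).symm.setIntegral_preimage_emb
    (MeasurableEquiv.finTwoArrow (α := ℝ)).symm.measurableEmbedding G
    (Set.pi Set.univ fun i => Ioo (a i) (b i))
  rw [← setIntegral_congr_set (μ := volume) (s := Set.pi Set.univ fun i => Ioo (a i) (b i)) Measure.univ_pi_Ioo_ae_eq_Icc]
  rw [m2_eq]
  refine e.symm.trans ?_
  have : (⇑(MeasurableEquiv.finTwoArrow (α := ℝ)).symm ⁻¹' Set.pi Set.univ fun i => Ioo (a i) (b i)) = box2 := by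
    ext x; subst ha hb; simp [box2, MeasurableEquiv.finTwoArrow, Fin.forall_fin_two, Set.mem_pi]
  rw [this]
  rfl

lemma box_conserved {F V W : (Fin 3 → ℝ) → ℂ} (cF : ContinuousOn F (Icc 0 ![1, pi, 2 * pi]))
    (cV : ContinuousOn V (Icc 0 ![1, pi, 2 * pi]))
    (cW : ContinuousOn W (Icc 0 ![1, pi, 2 * pi]))
    (hd : ∀ x : Fin 3 → ℝ, (∀ i, x i ∈ Ioo 0 ((![1, pi, 2 * pi] : Fin 3 → ℝ) i)) →
      ∃ f v w : (Fin 3 → ℝ) →L[ℝ] ℂ, HasFDerivAt F f x ∧ HasFDerivAt V v x ∧ HasFDerivAt W w x ∧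
        f (Pi.single 0 1) = v (Pi.single 1 1) + w (Pi.single 2 1))
    (hV : ∀ x y, V ![x, 0, y] = 0 ∧ V ![x, pi, y] = 0)
    (hW : ∀ x y, W ![x, y, 0] = W ![x, y, 2 * pi]) :
    ∫ x, F ![1, x.1, x.2] ∂m2 = ∫ x, F ![0, x.1, x.2] ∂m2 := by
  classical
  have hp := Real.pi_pos
  set U : Set (Fin 3 → ℝ) := {x | ∀ i, x i ∈ Ioo 0 ((![1, pi, 2 * pi] : Fin 3 → ℝ) i)} with hU
  choose! f v w h1 h2 h3 h4 using hd
  have key := integral_divergence_of_hasFDerivAt_off_countable' (0 : Fin 3 → ℝ) ![1, pi, 2 * pi]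
    (by intro i; fin_cases i <;> simp <;> positivity)
    ![F, fun x => -V x, fun x => -W x]
    (fun i x => if x ∈ U then (![f x, -v x, -w x] : Fin 3 → ((Fin 3 → ℝ) →L[ℝ] ℂ)) i else 0) ∅ Set.countable_empty
    (by intro i; fin_cases i <;> [exact cF; exact cV.neg; exact cW.neg])
    (by
      intro x hx i; have hx' : x ∈ U := by simpa [hU] using hx
      rw [if_pos hx']; fin_cases i
      · exact h1 x hx'
      · exact (h2 x hx').neg
      · exact (h3 x hx').neg)
  have hz : ∀ x, ∑ i : Fin 3, (if x ∈ U then (![f x, -v x, -w x] : Fin 3 → ((Fin 3 → ℝ) →L[ℝ] ℂ)) i else 0)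
      (Pi.single i 1) = 0 := by
    intro x; by_cases hx : x ∈ U
    · simp [hx, Fin.sum_univ_three, h4 x hx]
    · simp [hx]
  simp only [hz, integral_zero, integrableOn_zero, forall_const] at key
  rw [Fin.sum_univ_three] at key
  have ea : ∀ i : Fin 3, (0 : Fin 3 → ℝ) ∘ i.succAbove = ![0, 0] := fun i => by ext j; fin_cases j <;> rfl
  have i0 : ∀ (c : ℝ) (x : Fin 2 → ℝ), (Fin.insertNth (0 : Fin 3) c x : Fin 3 → ℝ) = ![c, x 0, x 1] := fun c x => by
    ext j; fin_cases j <;> rfl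
  have i1 : ∀ (c : ℝ) (x : Fin 2 → ℝ), (Fin.insertNth (1 : Fin 3) c x : Fin 3 → ℝ) = ![x 0, c, x 1] := fun c x => by
    ext j; fin_cases j <;> rfl
  have i2 : ∀ (c : ℝ) (x : Fin 2 → ℝ), (Fin.insertNth (2 : Fin 3) c x : Fin 3 → ℝ) = ![x 0, x 1, c] := fun c x => by
    ext j; fin_cases j <;> rfl
  simp only [i0, i1, i2] at key
  have k1 : ∀ s : Set (Fin 2 → ℝ), (∫ x in s, (![F, fun x => -V x, fun x => -W x] : Fin 3 → (Fin 3 → ℝ) → ℂ) 1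
      ![x 0, (![1, pi, 2 * pi] : Fin 3 → ℝ) 1, x 1]) = 0 := fun s => by simp [(hV _ _).2]
  have k1' : ∀ s : Set (Fin 2 → ℝ), (∫ x in s, (![F, fun x => -V x, fun x => -W x] : Fin 3 → (Fin 3 → ℝ) → ℂ) 1
      ![x 0, (0 : Fin 3 → ℝ) 1, x 1]) = 0 := fun s => by simp [(hV _ _).1]
  have k2 : ∀ s : Set (Fin 2 → ℝ), (∫ x in s, (![F, fun x => -V x, fun x => -W x] : Fin 3 → (Fin 3 → ℝ) → ℂ) 2
      ![x 0, x 1, (![1, pi, 2 * pi] : Fin 3 → ℝ) 2]) =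
      ∫ x in s, (![F, fun x => -V x, fun x => -W x] : Fin 3 → (Fin 3 → ℝ) → ℂ) 2
      ![x 0, x 1, (0 : Fin 3 → ℝ) 2] := fun s => by simp [hW]
  rw [k1, k1', k2, sub_self, sub_self, add_zero, add_zero, setIntegral_fin_two _ (ea 0) (by ext j; fin_cases j <;> rfl),
    setIntegral_fin_two _ (ea 0) (by ext j; fin_cases j <;> rfl)] at key
  exact (sub_eq_zero.1 key.symm)

lemma lintegral_sq_le {α : Type*} [MeasurableSpace α] {μ : Measure α} {f : α → ℝ≥0∞} (hf : AEMeasurable f μ) :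
    (∫⁻ x, f x ∂μ) ^ 2 ≤ μ Set.univ * ∫⁻ x, f x ^ 2 ∂μ := by
  have h := ENNReal.lintegral_mul_le_Lp_mul_Lq μ (p := 2) (q := 2) (by constructor <;> norm_num) hf
    (aemeasurable_const (b := (1 : ℝ≥0∞)))
  simp only [Pi.mul_apply, mul_one, ENNReal.one_rpow, lintegral_const, one_mul] at h
  calc _ ≤ _ := pow_le_pow_left' h 2
    _ = _ := by
      rw [mul_pow, ← ENNReal.rpow_natCast, ← ENNReal.rpow_natCast, ← ENNReal.rpow_mul, ← ENNReal.rpow_mul]; norm_num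
      rw [mul_comm]

lemma enorm_sub_sq_le {g g' : ℝ → ℂ} {a b : ℝ} (hab : a ≤ b) (hc : ContinuousOn g (Icc a b))
    (hd : ∀ x ∈ Ioo a b, HasDerivAt g (g' x) x) (hg' : ContinuousOn g' (Ioo a b)) :
    ‖g b - g a‖ₑ ^ 2 ≤ ofReal (b - a) * ∫⁻ x in Ioo a b, ‖g' x‖ₑ ^ 2 := by
  have hm : AEMeasurable (fun x => ‖g' x‖ₑ) (volume.restrict (Ioo a b)) := (hg'.aemeasurable measurableSet_Ioo).enorm
  have h := lintegral_sq_le hm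
  rw [Measure.restrict_apply_univ, Real.volume_Ioo] at h
  refine le_trans ?_ h
  refine pow_le_pow_left' ?_ 2
  by_cases hi : ∫⁻ x in Ioo a b, ‖g' x‖ₑ = ⊤
  · rw [hi]; exact le_top
  have hI : IntegrableOn g' (Ioo a b) := ⟨hg'.aestronglyMeasurable measurableSet_Ioo, lt_top_iff_ne_top.2 hi⟩
  have := intervalIntegral.integral_eq_sub_of_hasDerivAt_of_le hab hc hd
    ((intervalIntegrable_iff_integrableOn_Ioo_of_le hab).2 hI)
  rw [← this, intervalIntegral.integral_of_le hab, integral_Ioc_eq_integral_Ioo]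
  exact enorm_integral_le_lintegral_enorm _

def sn (θ : ℝ) : ℝ≥0∞ := ofReal (sin θ)

lemma sn_le_one (θ : ℝ) : sn θ ≤ 1 := by rw [sn, ← ENNReal.ofReal_one]; exact ofReal_le_ofReal (Real.sin_le_one _)

lemma sn_mul_sn_le {a b x : ℝ} (ha : 0 < a) (hb : b < pi) (hx : x ∈ Ioo a b) : sn a * sn b ≤ sn x := by
  have hmin : min (sin a) (sin b) ≤ sin x := by
    have := strictConcaveOn_sin_Icc.concaveOn.min_le_of_mem_Icc (x := a) (y := b) (z := x)
      ⟨ha.le, by linarith [hx.1, hx.2]⟩ ⟨by linarith [hx.1, hx.2], hb.le⟩ ⟨hx.1.le, hx.2.le⟩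
    exact this
  rcases min_le_iff.1 hmin with h | h
  · calc sn a * sn b ≤ sn a * 1 := by gcongr; exact sn_le_one _
      _ ≤ sn x := by rw [mul_one]; exact ofReal_le_ofReal h
  · calc sn a * sn b ≤ 1 * sn b := by gcongr; exact sn_le_one _
      _ ≤ sn x := by rw [one_mul]; exact ofReal_le_ofReal h

lemma enn_add_sq (a b : ℝ≥0∞) : (a + b) ^ 2 ≤ 4 * (a ^ 2 + b ^ 2) := by
  wlog h : a ≤ b generalizing a b
  · rw [add_comm a, add_comm (a ^ 2)]; exact this b a (le_of_not_ge h)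
  calc (a + b) ^ 2 ≤ (b + b) ^ 2 := by gcongr
    _ = 4 * b ^ 2 := by rw [← two_mul, mul_pow]; norm_num
    _ ≤ _ := by gcongr; exact le_add_self

lemma poincare : ∃ C : ℝ≥0∞, C ≠ ⊤ ∧ ∀ (Φ Φθ Φφ : ℝ × ℝ → ℂ) (κ : ℝ × ℝ → ℝ≥0∞) (q : ℂ) (ρ : ℝ≥0∞),
    ContinuousOn Φ box2 → ContinuousOn Φθ box2 → ContinuousOn Φφ box2 → AEMeasurable κ m2 →
    (∀ x ∈ box2, HasDerivAt (fun t => Φ (t, x.2)) (Φθ x) x.1) →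
    (∀ x ∈ box2, HasDerivAt (fun t => Φ (x.1, t)) (Φφ x) x.2) →
    (∀ x ∈ box2, ‖Φθ x‖ₑ ^ 2 ≤ κ x) → (∀ x ∈ box2, ‖Φφ x‖ₑ ^ 2 ≤ sn x.1 ^ 2 * κ x) →
    (∀ y ∈ box2, ‖q - Φ y‖ₑ ≤ ∫⁻ x, sn x.1 * ‖Φ x - Φ y‖ₑ ∂m2 + ρ) →
    ∫⁻ y, sn y.1 * ‖Φ y - q‖ₑ ^ 2 ∂m2 ≤ C * (∫⁻ x, sn x.1 * κ x ∂m2 + ρ ^ 2) := by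
  set P := ofReal (2 * pi) with hP
  set Q := ofReal pi with hQ
  set V := m2 Set.univ with hV
  have hQP : Q ≤ P := ofReal_le_ofReal (by linarith [Real.pi_pos])
  have hVt : V ≠ ⊤ := by rw [hV, m2, ← Set.univ_prod_univ, Measure.prod_prod]; simp; finiteness
  refine ⟨4 * (V * (4 * P * (P * V + V * Q))) + 4 * V, by simp only [hP, hQ]; finiteness, ?_⟩
  intro Φ Φθ Φφ κ q ρ c0 c1 c2 hκ d1 d2 b1 b2 hq
  have hsn : Measurable sn := by unfold sn; fun_prop
  have hsk : AEMeasurable (fun x : ℝ × ℝ => sn x.1 * κ x) m2 := (hsn.comp measurable_fst).aemeasurable.mul hκ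
  set A : ℝ → ℝ≥0∞ := fun θ => ∫⁻ φ in Ioo 0 (2 * pi), sn θ * κ (θ, φ)
  set B : ℝ → ℝ≥0∞ := fun φ => ∫⁻ θ in Ioo 0 pi, sn θ * κ (θ, φ)
  set E := ∫⁻ x, sn x.1 * κ x ∂m2 with hE
  have eA : ∫⁻ θ in Ioo 0 pi, A θ = E := by rw [hE, m2, lintegral_prod _ hsk]
  have eB : ∫⁻ φ in Ioo 0 (2 * pi), B φ = E := by rw [hE, m2, lintegral_prod_symm _ hsk]
  have hφ : ∀ θ ∈ Ioo 0 pi, ∀ s t, 0 < s → s ≤ t → t < 2 * pi → sn θ * ‖Φ (θ, t) - Φ (θ, s)‖ₑ ^ 2 ≤ P * A θ := by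
    intro θ hθ s t hs hst ht; have hb : ∀ x ∈ Icc s t, (θ, x) ∈ box2 := fun x hx => ⟨hθ, hs.trans_le hx.1, hx.2.trans_lt ht⟩
    have := enorm_sub_sq_le (g := fun x => Φ (θ, x)) (g' := fun x => Φφ (θ, x)) hst
      (c0.comp (by fun_prop) hb) (fun x hx => d2 _ (hb x (Ioo_subset_Icc_self hx)))
      (c2.comp (by fun_prop) fun x hx => hb x (Ioo_subset_Icc_self hx))
    calc sn θ * ‖Φ (θ, t) - Φ (θ, s)‖ₑ ^ 2 ≤ 1 * ‖Φ (θ, t) - Φ (θ, s)‖ₑ ^ 2 := by gcongr; exact sn_le_one _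
      _ ≤ ofReal (t - s) * ∫⁻ x in Ioo s t, ‖Φφ (θ, x)‖ₑ ^ 2 := by rw [one_mul]; exact this
      _ ≤ P * ∫⁻ x in Ioo s t, sn θ * κ (θ, x) := by
        refine mul_le_mul' (ofReal_le_ofReal (by linarith)) (setLIntegral_mono' measurableSet_Ioo fun x hx => ?_)
        refine (b2 _ (hb x (Ioo_subset_Icc_self hx))).trans ?_; gcongr; rw [sq]
        exact (mul_le_mul' (sn_le_one θ) le_rfl).trans (one_mul _).le
      _ ≤ _ := by
        gcongr; exact lintegral_mono_set (Set.Ioo_subset_Ioo (b₁ := t) hs.le ht.le)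
  have hθ : ∀ φ ∈ Ioo 0 (2 * pi), ∀ s t, 0 < s → s ≤ t → t < pi → sn s * sn t * ‖Φ (t, φ) - Φ (s, φ)‖ₑ ^ 2 ≤ P * B φ := by
    intro φ hφ s t hs hst ht
    have hb : ∀ x ∈ Icc s t, (x, φ) ∈ box2 := fun x hx => ⟨⟨hs.trans_le hx.1, hx.2.trans_lt ht⟩, hφ⟩
    have := enorm_sub_sq_le (g := fun x => Φ (x, φ)) (g' := fun x => Φθ (x, φ)) hst
      (c0.comp (by fun_prop) hb) (fun x hx => d1 _ (hb x (Ioo_subset_Icc_self hx)))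
      (c1.comp (by fun_prop) fun x hx => hb x (Ioo_subset_Icc_self hx))
    calc sn s * sn t * ‖Φ (t, φ) - Φ (s, φ)‖ₑ ^ 2
        ≤ sn s * sn t * (P * ∫⁻ x in Ioo s t, ‖Φθ (x, φ)‖ₑ ^ 2) := by
          gcongr; refine this.trans ?_; gcongr; exact (ofReal_le_ofReal (by linarith [Real.pi_pos]))
      _ = P * ∫⁻ x in Ioo s t, sn s * sn t * ‖Φθ (x, φ)‖ₑ ^ 2 := by
        rw [lintegral_const_mul' _ _ (by simp only [sn]; finiteness)]; ring
      _ ≤ P * ∫⁻ x in Ioo s t, sn x * κ (x, φ) := by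
        refine mul_le_mul' le_rfl (setLIntegral_mono' measurableSet_Ioo fun x hx => ?_)
        exact mul_le_mul' (sn_mul_sn_le hs ht hx) (b1 _ (hb x (Ioo_subset_Icc_self hx)))
      _ ≤ _ := by
        gcongr; exact lintegral_mono_set (Set.Ioo_subset_Ioo (b₁ := t) hs.le ht.le)
  have pair : ∀ x ∈ box2, ∀ y ∈ box2, sn y.1 * (sn x.1 * ‖Φ x - Φ y‖ₑ ^ 2) ≤ 4 * P * (A x.1 + B y.2) := by
    intro x hx y hy
    have e1 : sn x.1 * ‖Φ (x.1, x.2) - Φ (x.1, y.2)‖ₑ ^ 2 ≤ P * A x.1 := by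
      rcases le_total x.2 y.2 with h | h
      · rw [enorm_sub_rev]; exact hφ _ hx.1 _ _ hx.2.1 h hy.2.2
      · exact hφ _ hx.1 _ _ hy.2.1 h hx.2.2
    have e2 : sn y.1 * sn x.1 * ‖Φ (x.1, y.2) - Φ (y.1, y.2)‖ₑ ^ 2 ≤ P * B y.2 := by
      rcases le_total x.1 y.1 with h | h
      · rw [enorm_sub_rev, mul_comm (sn y.1)]; exact hθ _ hy.2 _ _ hx.1.1 h hy.1.2
      · exact hθ _ hy.2 _ _ hy.1.1 h hx.1.2
    have e3 : ‖Φ x - Φ y‖ₑ ^ 2 ≤ 4 * (‖Φ (x.1, x.2) - Φ (x.1, y.2)‖ₑ ^ 2 + ‖Φ (x.1, y.2) - Φ (y.1, y.2)‖ₑ ^ 2) := by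
      refine le_trans ?_ (enn_add_sq _ _); gcongr; refine le_trans (le_of_eq ?_) (enorm_add_le _ _); simp
    calc sn y.1 * (sn x.1 * ‖Φ x - Φ y‖ₑ ^ 2) ≤ sn y.1 * (sn x.1 * (4 * (‖Φ (x.1, x.2) - Φ (x.1, y.2)‖ₑ ^ 2
          + ‖Φ (x.1, y.2) - Φ (y.1, y.2)‖ₑ ^ 2))) := by gcongr
      _ = 4 * (sn y.1 * (sn x.1 * ‖Φ (x.1, x.2) - Φ (x.1, y.2)‖ₑ ^ 2)
          + sn y.1 * sn x.1 * ‖Φ (x.1, y.2) - Φ (y.1, y.2)‖ₑ ^ 2) := by ring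
      _ ≤ 4 * (1 * (P * A x.1) + P * B y.2) := by gcongr; exact sn_le_one _
      _ = _ := by ring
  have hm : m2 = (volume : Measure (ℝ × ℝ)).restrict box2 := m2_eq
  have sph1 : ∀ y ∈ box2, sn y.1 * ∫⁻ x, sn x.1 * ‖Φ x - Φ y‖ₑ ^ 2 ∂m2 ≤ 4 * P * (P * E + V * B y.2) := by
    intro y hy; rw [← lintegral_const_mul' _ _ (by simp only [sn]; finiteness)]
    calc _ ≤ ∫⁻ x, 4 * P * (A x.1 + B y.2) ∂m2 := by
          rw [hm]; exact setLIntegral_mono' measurableSet_box2 fun x hx => pair x hx y hy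
      _ = 4 * P * (∫⁻ x, A x.1 ∂m2 + V * B y.2) := by
          rw [lintegral_const_mul' _ _ (by simp only [hP]; finiteness), lintegral_add_right _ measurable_const,
            lintegral_const, mul_comm (B y.2)]
      _ ≤ _ := by
          gcongr; refine (lintegral_prod_le _).trans ?_
          simp only [lintegral_const, Measure.restrict_apply_univ, Real.volume_Ioo, sub_zero]
          rw [lintegral_mul_const' _ _ (by finiteness), eA, mul_comm]
  have step : ∀ y ∈ box2, sn y.1 * ‖Φ y - q‖ₑ ^ 2 ≤ 4 * (V * (4 * P * (P * E + V * B y.2))) + 4 * ρ ^ 2 := by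
    intro y hy
    have hmeas : AEMeasurable (fun x : ℝ × ℝ => sn x.1 * ‖Φ x - Φ y‖ₑ) m2 := by
      rw [hm]
      exact (hsn.comp measurable_fst).aemeasurable.mul ((c0.sub continuousOn_const).aemeasurable measurableSet_box2).enorm
    have h1 : (∫⁻ x, sn x.1 * ‖Φ x - Φ y‖ₑ ∂m2) ^ 2 ≤ V * ∫⁻ x, sn x.1 * ‖Φ x - Φ y‖ₑ ^ 2 ∂m2 := by
      refine (lintegral_sq_le hmeas).trans ?_; gcongr with x
      rw [mul_pow]; gcongr; rw [sq]; exact (mul_le_mul' (sn_le_one _) le_rfl).trans (one_mul _).le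
    calc sn y.1 * ‖Φ y - q‖ₑ ^ 2 ≤ sn y.1 * (∫⁻ x, sn x.1 * ‖Φ x - Φ y‖ₑ ∂m2 + ρ) ^ 2 := by
          gcongr; rw [enorm_sub_rev]; exact hq y hy
      _ ≤ sn y.1 * (4 * ((∫⁻ x, sn x.1 * ‖Φ x - Φ y‖ₑ ∂m2) ^ 2 + ρ ^ 2)) := by gcongr; exact enn_add_sq _ _
      _ ≤ sn y.1 * (4 * (V * ∫⁻ x, sn x.1 * ‖Φ x - Φ y‖ₑ ^ 2 ∂m2 + ρ ^ 2)) := by gcongr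
      _ = 4 * (V * (sn y.1 * ∫⁻ x, sn x.1 * ‖Φ x - Φ y‖ₑ ^ 2 ∂m2)) + 4 * (sn y.1 * ρ ^ 2) := by ring
      _ ≤ _ := by
        exact add_le_add (mul_le_mul' le_rfl (mul_le_mul' le_rfl (sph1 y hy)))
          (mul_le_mul' le_rfl ((mul_le_mul' (sn_le_one _) le_rfl).trans (one_mul _).le))
  calc ∫⁻ y, sn y.1 * ‖Φ y - q‖ₑ ^ 2 ∂m2
      ≤ ∫⁻ y, (4 * (V * (4 * P * (P * E + V * B y.2))) + 4 * ρ ^ 2) ∂m2 := by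
        rw [hm]; exact setLIntegral_mono' measurableSet_box2 step
    _ = 4 * (V * (4 * P * (P * E * V + V * ∫⁻ y, B y.2 ∂m2))) + 4 * ρ ^ 2 * V := by
        rw [lintegral_add_right _ measurable_const, lintegral_const, lintegral_const_mul' _ _ (by finiteness),
          lintegral_const_mul' _ _ hVt, lintegral_const_mul' _ _ (by simp only [hP]; finiteness),
          lintegral_add_left measurable_const, lintegral_const, lintegral_const_mul' _ _ hVt]
    _ ≤ 4 * (V * (4 * P * (P * E * V + V * (Q * E)))) + 4 * ρ ^ 2 * V := by
        gcongr; refine (lintegral_prod_le _).trans ?_; change ∫⁻ _ in Ioo 0 pi, (∫⁻ y in Ioo 0 (2 * pi), B y) ≤ Q * E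
        rw [lintegral_const, eB, Measure.restrict_apply_univ, Real.volume_Ioo, sub_zero, mul_comm]
    _ = 4 * (V * (4 * P * (P * V + V * Q))) * E + 4 * V * ρ ^ 2 := by ring
    _ ≤ (4 * (V * (4 * P * (P * V + V * Q))) + 4 * V) * (E + ρ ^ 2) := by
        rw [add_mul]; gcongr
        · exact le_self_add
        · exact le_add_self

lemma continuous_vec {α : Type*} [TopologicalSpace α] {f g h k : α → ℝ} (hf : Continuous f := by fun_prop)
    (hg : Continuous g := by fun_prop) (hh : Continuous h := by fun_prop) (hk : Continuous k := by fun_prop) :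
    Continuous fun x => (![f x, g x, h x, k x] : Pt) := by
  rw [continuous_pi_iff]; intro i; fin_cases i <;> simpa

section explicit

variable (B : Background) (S : MaxwellFields) (b : Bool) (q : Pt)

/-- Cartesian components of `∂_θ ± i (a sin θ ∂_t + ∂_φ / sin θ)`. -/
def Lv (a : ℝ) : Fin 4 → ℂ := ![sg b * I * a * sin (q 2), q 1 * cos (q 2) * cos (q 3) - sg b * I * q 1 * sin (q 3),
    q 1 * cos (q 2) * sin (q 3) + sg b * I * q 1 * cos (q 3),
    -(q 1 * sin (q 2))]

def lc (a : ℝ) (T : Tens 1) : ℂ := ∑ μ, T (Sph q) ![μ] * Lv b q a μ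

/-- `r ± i a cos θ`. -/
def zx (a : ℝ) : ℂ := q 1 + sg b * I * a * cos (q 2)

def PhiX : ℂ := S.rho (Sph q) ![] + sg b * I * S.sig (Sph q) ![]

def DzX : ℂ := ((q 1 : ℂ) ^ 2 - 2 * B.M * q 1 + B.a ^ 2) * (zx b q B.a)⁻¹ * (zx (!b) q B.a)⁻¹

/-- The density of the charge. -/
def IX : ℂ := sin (q 2) * ((q 1 : ℂ) ^ 2 + B.a ^ 2) * PhiX S b q * (zx b q B.a)⁻¹ ^ 2
  - 1 / 2 * sg b * (I * B.a) * (sin (q 2) : ℂ) ^ 2 * (lc (!b) q B.a S.al + DzX B b q * lc b q B.a S.ual)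

/-- The flux of the charge density in `θ` along `∂_t`. -/
def VTX : ℂ := 1 / 2 * sin (q 2) * (lc (!b) q B.a S.al - DzX B b q * lc b q B.a S.ual)

/-- The flux of the charge density in `φ` along `∂_t`. -/
def WTX : ℂ := 1 / 2 * sg b * I * (lc (!b) q B.a S.al + DzX B b q * lc b q B.a S.ual)
  + I * (I * B.a) * sin (q 2) * PhiX S b q * (zx b q B.a)⁻¹ ^ 2

/-- The flux of the charge density in `θ` along `-e₃`. -/
def VPX : ℂ := sin (q 2) * ((q 1 : ℂ) ^ 2 + B.a ^ 2) * lc b q B.a S.ual * ((zx b q B.a)⁻¹ * (zx (!b) q B.a)⁻¹)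
  + sg b * (I * B.a) * (sin (q 2) : ℂ) ^ 2 * PhiX S b q * (zx b q B.a)⁻¹ ^ 2

/-- The flux of the charge density in `φ` along `-e₃`. -/
def WPX : ℂ := -(sg b * I * lc b q B.a S.ual)

end explicit

variable {S : MaxwellFields}

@[simp] lemma kS_ap (c : ℂ) (q : X.dom) : (X.kS c).1 q = c := rfl

lemma zb_ap (b : Bool) (q : X.dom) : (X.zb b).1 q = zx b q X.B.a := by cases b <;> simp [zb, zx, sg]

lemma zx_ne (b : Bool) {q : Pt} (hq : 0 < q 1) (a : ℝ) : zx b q a ≠ 0 := by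
  intro h
  have := congrArg Complex.re h
  cases b <;> simp [zx, sg] at this <;> exact hq.ne' this

lemma ze_ap (b : Bool) (q : X.dom) : (X.zeS (sg b)).1 q = (zx b q X.B.a)⁻¹ := by
  have h := congrArg (fun u : X.Sm => u.1 q) (X.zeS_zb b)
  simp only [mul_ap, zb_ap, one_ap] at h
  exact eq_inv_of_mul_eq_one_left h

lemma yy_ap (b : Bool) (q : X.dom) : ζ(X).1 q = (zx b q X.B.a)⁻¹ * (zx (!b) q X.B.a)⁻¹ := by
  rw [zeS_zeS b, mul_ap, ze_ap, ze_ap]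

lemma DZS_ap (b : Bool) (q : X.dom) : X.DZS.1 q = DzX X.B b q := by rw [DZS, mul_assoc, mul_ap, yy_ap b, DelS_ap, DzX]; ring

lemma lc_ap {T : Tens 1} (h : X.TSf T) (b : Bool) (q : X.dom) : (X.zb (!b) * X.comp T ![b]).1 q = lc b q X.B.a T := by
  have hz := congrArg (fun u : X.Sm => u.1 q) (X.zeS_zb (!b))
  simp only [mul_ap, one_ap] at hz
  rw [comp, tm_one, mul_ap, sum_ap, lc, mul_sum]
  refine sum_ext fun μ => ?_
  rw [mul_ap, pb_ap (h _), mul_left_comm]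
  congr 1
  have hs : (Complex.sin (q.1 2 : ℝ))⁻¹ * Complex.sin (q.1 2 : ℝ) = 1 :=
    inv_mul_cancel₀ (by exact_mod_cast (Real.sin_pos_of_mem_Ioo ⟨q.2.2.2.1, q.2.2.2.2⟩).ne')
  cases b <;> fin_cases μ <;>
    simp [fc, fr, hb, Ep, Em, cart_zero, cart_one, cart_two, cart_three, Lv, sg, sfS, cfS, coordFun] at hz ⊢ <;> grind

section agree

variable (h : X.B.IsSolution S) (b : Bool) (q : X.dom)
include h

lemma vS_ap : (X.vS S b).1 q = lc (!b) q X.B.a S.al := by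
  have := lc_ap (good_al h).1 (!b) q
  rwa [Bool.not_not] at this
lemma uS_ap : (X.uS S b).1 q = lc b q X.B.a S.ual := lc_ap (good_ual h).1 b q

lemma Phi_ap : (X.Phi S b).1 q = PhiX S b q := by
  rw [Phi, add_ap, mul_ap, mul_ap, comp_ap (good_rho h).1, comp_ap (good_sig h).1, intCast_ap, iS_ap]
  rw [Fintype.sum_unique, Fintype.sum_unique]
  simp only [Finset.univ_eq_empty, Finset.prod_empty, mul_one, PhiX]
  exact congrArg₂ (fun J J' => S.rho (Sph q) J + sg b * I * S.sig (Sph q) J') (Subsingleton.elim _ _) (Subsingleton.elim _ _)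

lemma formI_ap : (X.formI S b).1 q = IX X.B S b q := by
  simp only [formI, sub_ap, mul_ap, pow_ap, add_ap, Phi_ap h, vS_ap h, uS_ap h, ze_ap, DZS_ap b, IX, sS_ap, rS_ap, AS_ap,
    kS_ap, intCast_ap]
  rw [mul_pow, I_sq]; ring
lemma fluxT_ap : (X.fluxT S b).1 q = VTX X.B S b q := by
  simp only [fluxT, sub_ap, mul_ap, vS_ap h, uS_ap h, DZS_ap b, VTX, sS_ap, kS_ap]
lemma twistT_ap : (X.twistT S b).1 q = WTX X.B S b q := by
  simp only [twistT, mul_ap, pow_ap, add_ap, Phi_ap h, vS_ap h, uS_ap h, ze_ap, DZS_ap b, WTX, sS_ap, AS_ap,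
    kS_ap, intCast_ap, iS_ap]
lemma fluxP_ap : (X.fluxP S b).1 q = VPX X.B S b q := by
  simp only [fluxP, mul_ap _ ζ(X), add_ap, yy_ap b]
  simp only [sub_ap, mul_ap, pow_ap, Phi_ap h, uS_ap h, ze_ap, VPX, sS_ap, rS_ap, AS_ap, intCast_ap]
  rw [mul_pow, I_sq]; ring
lemma twistP_ap : (X.twistP S b).1 q = WPX X.B S b q := by
  simp only [twistP, neg_ap, mul_ap, uS_ap h, WPX, intCast_ap, iS_ap]

end agree

section continuity

variable (X) in
/-- The exterior in coordinates, with the horizon and the axis. -/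
def clo : Set Pt := {q | 0 ≤ q 0 ∧ X.B.rPlus ≤ q 1}

lemma Sph_mem_region {q : Pt} (hq : q ∈ X.clo) : Sph q ∈ X.B.region :=
  ⟨hq.1, by rw [rad_Sph (X.rPlus_pos.le.trans hq.2)]; exact hq.2⟩

lemma continuousOn_Sph {k : ℕ} {T : Tens k} (hT : X.B.IsSmooth T) (I : Fin k → Fin 4) :
    ContinuousOn (fun q => T (Sph q) I) X.clo :=
  (hT I).continuousOn.comp contDiff_Sph.continuous.continuousOn fun _ hq => Sph_mem_region hq

lemma continuousOn_lc {T : Tens 1} (hT : X.B.IsSmooth T) (b : Bool) : ContinuousOn (fun q => lc b q X.B.a T) X.clo := by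
  unfold lc
  refine continuousOn_finsetSum _ fun μ _ => (continuousOn_Sph hT _).mul ?_
  fin_cases μ <;> simp only [Lv] <;> (apply Continuous.continuousOn; simp; fun_prop)

lemma continuousOn_zi (X : Adm) (b : Bool) : ContinuousOn (fun q => (zx b q X.B.a)⁻¹) X.clo := by
  refine ContinuousOn.inv₀ (by unfold zx; fun_prop) fun q hq => zx_ne b (X.rPlus_pos.trans_le hq.2) _

lemma continuousOn_Dz (b : Bool) : ContinuousOn (fun q => DzX X.B b q) X.clo := by
  unfold DzX
  exact (ContinuousOn.mul (by fun_prop) (X.continuousOn_zi b)).mul (X.continuousOn_zi _)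

lemma rPlus_le : X.B.rPlus ≤ 2 * X.B.M := by
  have : Real.sqrt (X.B.M ^ 2 - X.B.a ^ 2) ≤ X.B.M := Real.sqrt_le_iff.2 ⟨X.hM.le, by nlinarith [sq_nonneg X.B.a]⟩
  unfold Background.rPlus; linarith

lemma hgtFun_near {r : ℝ} (hr : r ≤ 17 * X.B.M / 8) : X.hgtFun r = 1 ∧ X.twistFun r = 0 := by
  have h1 := X.hι.2.2.1 r hr
  have h2 : deriv X.B.f r = 0 := by
    have : X.B.f =ᶠ[nhds r] fun _ => 0 := by
      filter_upwards [Iio_mem_nhds (show r < 3 * X.B.M by linarith [X.hM])] with s hs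
      exact X.hf.2.1 s (le_of_lt hs)
    rw [this.deriv_eq]; simp
  simp [hgtFun, twistFun, h1, h2]

lemma continuousOn_hgtFun : ContinuousOn X.hgtFun (Set.Ici X.B.rPlus) ∧ ContinuousOn X.twistFun (Set.Ici X.B.rPlus) := by
  have hM := X.hM
  have hr := X.rPlus_le
  constructor <;> intro r h <;> apply ContinuousAt.continuousWithinAt
  · rcases (Set.mem_Ici.1 h).eq_or_lt with h | h
    · refine (continuousAt_const (y := (1 : ℝ))).congr ?_
      filter_upwards [Iio_mem_nhds (show r < 17 * X.B.M / 8 by linarith)] with s hs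
      exact (hgtFun_near (le_of_lt hs)).1.symm
    · exact (X.contDiffAt_hgtFun h).continuousAt
  · rcases (Set.mem_Ici.1 h).eq_or_lt with h | h
    · refine (continuousAt_const (y := (0 : ℝ))).congr ?_
      filter_upwards [Iio_mem_nhds (show r < 17 * X.B.M / 8 by linarith)] with s hs
      exact (hgtFun_near (le_of_lt hs)).2.symm
    · exact (X.contDiffAt_twistFun h).continuousAt

variable (h : X.B.IsSolution S) (b : Bool)
include h

lemma continuousOn_PhiX : ContinuousOn (fun q => PhiX S b q) X.clo :=
  (continuousOn_Sph h.smooth_rho _).add (continuousOn_const.mul (continuousOn_Sph h.smooth_sig _))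

lemma continuousOn_IX : ContinuousOn (fun q => IX X.B S b q) X.clo := by
  unfold IX
  have c1 := continuousOn_PhiX h b
  have c2 := continuousOn_lc h.smooth_al !b
  have c3 := continuousOn_lc h.smooth_ual b
  have c4 := X.continuousOn_zi b
  have c5 := continuousOn_Dz (X := X) b
  fun_prop

lemma continuousOn_flux : ContinuousOn (fun q => VTX X.B S b q) X.clo ∧ ContinuousOn (fun q => WTX X.B S b q) X.clo
    ∧ ContinuousOn (fun q => VPX X.B S b q) X.clo ∧ ContinuousOn (fun q => WPX X.B S b q) X.clo := by
  have c1 := continuousOn_PhiX h b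
  have c2 := continuousOn_lc h.smooth_al !b
  have c3 := continuousOn_lc h.smooth_ual b
  have c4 := X.continuousOn_zi b
  have c4' := X.continuousOn_zi !b
  have c5 := continuousOn_Dz (X := X) b
  unfold VTX WTX VPX WPX
  refine ⟨?_, ?_, ?_, ?_⟩ <;> fun_prop

end continuity

/-- The family of coordinate boxes joining two spheres. -/
def line (t r₀ β : ℝ) (x : Fin 3 → ℝ) : Pt := ![x 0 * t, r₀ + x 0 * β, x 1, x 2]

lemma hasFDerivAt_line (u : X.Sm) {G : Pt → ℂ} (hG : ∀ q : X.dom, u.1 q = G q) {t β : ℝ} {U : Set (Fin 3 → ℝ)}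
    (hU : IsOpen U) (hd : ∀ x ∈ U, line t X.B.rPlus β x ∈ X.dom) {x : Fin 3 → ℝ} (hx : x ∈ U) :
    ∃ f : (Fin 3 → ℝ) →L[ℝ] ℂ, HasFDerivAt (fun y => G (line t X.B.rPlus β y)) f x ∧
      f (Pi.single 0 1) = t * (pd 0 u).1 ⟨_, hd x hx⟩ + β * (pd 1 u).1 ⟨_, hd x hx⟩ ∧
      f (Pi.single 1 1) = (pd 2 u).1 ⟨_, hd x hx⟩ ∧ f (Pi.single 2 1) = (pd 3 u).1 ⟨_, hd x hx⟩ := by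
  set q : X.dom := ⟨_, hd x hx⟩
  let p : Fin 3 → (Fin 3 → ℝ) →L[ℝ] ℝ := fun i => ContinuousLinearMap.proj i
  let A' : (Fin 3 → ℝ) →L[ℝ] Pt := ContinuousLinearMap.pi ![t • p 0, β • p 0, p 1, p 2]
  have hA : HasFDerivAt (line t X.B.rPlus β) A' x := by
    rw [hasFDerivAt_pi']; intro i; fin_cases i
    · exact ((p 0).hasFDerivAt (x := x)).mul_const t
    · exact (((p 0).hasFDerivAt (x := x)).mul_const β).const_add _
    · exact (p 1).hasFDerivAt
    · exact (p 2).hasFDerivAt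
  have hu := (X.differentiableWithinAt_ext u q).hasFDerivWithinAt
  have hc := (HasFDerivWithinAt.comp x hu (hA.hasFDerivWithinAt (s := U)) hd).hasFDerivAt (hU.mem_nhds hx)
  refine ⟨_, hc.congr_of_eventuallyEq ?_, ?_, ?_, ?_⟩
  · filter_upwards [hU.mem_nhds hx] with y hy
    exact ((X.ext_apply _ ⟨_, hd y hy⟩).trans (hG ⟨_, hd y hy⟩)).symm
  · have : A' (Pi.single 0 1) = t • stdVec 0 + β • stdVec 1 := by ext i; fin_cases i <;> simp [A', p, stdVec]
    rw [ContinuousLinearMap.comp_apply, this, map_add, map_smul, map_smul, pd_ap, pd_ap, Complex.real_smul,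
      Complex.real_smul]
  · have : A' (Pi.single 1 1) = stdVec 2 := by ext i; fin_cases i <;> simp [A', p, stdVec]
    rw [ContinuousLinearMap.comp_apply, this, pd_ap]
  · have : A' (Pi.single 2 1) = stdVec 3 := by ext i; fin_cases i <;> simp [A', p, stdVec]
    rw [ContinuousLinearMap.comp_apply, this, pd_ap]

theorem charge_const (h : X.B.IsSolution S) (b : Bool) {t r : ℝ} (ht : 0 ≤ t) (hr : X.B.rPlus < r) :
    ∫ x, IX X.B S b pt(t,r,x) ∂m2 = ∫ x, IX X.B S b pt(0,X.B.rPlus,x) ∂m2 := by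
  set β := r - X.B.rPlus with hβ
  have hβ0 : 0 < β := sub_pos.2 hr
  set box := Icc (0 : Fin 3 → ℝ) ![1, pi, 2 * pi] with hbox
  have hcl : Set.MapsTo (line t X.B.rPlus β) box X.clo := fun x hx => by
    have := hx.1 0; exact ⟨mul_nonneg this ht, le_add_of_nonneg_right (mul_nonneg this hβ0.le)⟩
  have cl : Continuous (line t X.B.rPlus β) := continuous_vec
  obtain ⟨c1, c2, c3, c4⟩ := continuousOn_flux h b
  have c0 := continuousOn_IX h b
  have hh : ContinuousOn (fun q : Pt => ((X.hgtFun (q 1) : ℝ) : ℂ)) X.clo :=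
    Complex.continuous_ofReal.comp_continuousOn (continuousOn_hgtFun.1.comp (by fun_prop) fun q hq => hq.2)
  have hw : ContinuousOn (fun q : Pt => ((X.twistFun (q 1) : ℝ) : ℂ)) X.clo :=
    Complex.continuous_ofReal.comp_continuousOn (continuousOn_hgtFun.2.comp (by fun_prop) fun q hq => hq.2)
  let V : Pt → ℂ := fun q => t * VTX X.B S b q + β * (VPX X.B S b q + X.hgtFun (q 1) * VTX X.B S b q)
  let W : Pt → ℂ := fun q => t * WTX X.B S b q + β * (WPX X.B S b q + X.hgtFun (q 1) * WTX X.B S b q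
    + X.twistFun (q 1) * IX X.B S b q)
  let uV : X.Sm := X.kS t * X.fluxT S b + X.kS β * (X.fluxP S b + X.hS * X.fluxT S b)
  let uW : X.Sm := X.kS t * X.twistT S b + X.kS β * (X.twistP S b + X.hS * X.twistT S b + X.wS * X.formI S b)
  have eV : ∀ q : X.dom, uV.1 q = V q := fun q => by simp only [uV, V, add_ap, mul_ap, kS_ap, fluxT_ap h, fluxP_ap h, hS_ap]
  have eW : ∀ q : X.dom, uW.1 q = W q := fun q => by
    simp only [uW, W, add_ap, mul_ap, kS_ap, twistT_ap h, twistP_ap h, formI_ap h, hS_ap, wS_ap]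
  have cV : ContinuousOn V X.clo := by fun_prop
  have cW : ContinuousOn W X.clo := by fun_prop
  have key := box_conserved (F := fun x => IX X.B S b (line t X.B.rPlus β x)) (V := fun x => V (line t X.B.rPlus β x))
    (W := fun x => W (line t X.B.rPlus β x)) (c0.comp cl.continuousOn hcl) (cV.comp cl.continuousOn hcl)
    (cW.comp cl.continuousOn hcl) ?_ ?_ ?_
  · simpa [line, hβ] using key
  · let U : Set (Fin 3 → ℝ) := Set.pi Set.univ fun i => Ioo 0 ((![1, pi, 2 * pi] : Fin 3 → ℝ) i)
    have hU : IsOpen U := isOpen_set_pi Set.finite_univ fun _ _ => isOpen_Ioo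
    have hd : ∀ x ∈ U, line t X.B.rPlus β x ∈ X.dom := fun x hx => by
      have h0 := hx 0 trivial; have h1 := hx 1 trivial
      exact ⟨mul_nonneg h0.1.le ht, lt_add_of_pos_right _ (mul_pos h0.1 hβ0), h1.1, h1.2⟩
    intro x hx; have hx' : x ∈ U := fun i _ => hx i
    obtain ⟨f, f1, f2, -, -⟩ := hasFDerivAt_line (X.formI S b) (formI_ap h b) hU hd hx'
    obtain ⟨v, v1, -, v2, -⟩ := hasFDerivAt_line uV eV hU hd hx'
    obtain ⟨w, w1, -, -, w2⟩ := hasFDerivAt_line uW eW hU hd hx'; refine ⟨f, v, w, f1, v1, w1, ?_⟩; rw [f2, v2, w2]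
    have e : X.kS t * pd 0 (X.formI S b) + X.kS β * pd 1 (X.formI S b) = pd 2 uV + pd 3 uW := by
      simp only [uV, uW]
      rw [map_add, map_add, leibniz, leibniz, leibniz, leibniz, D_kS, D_kS, D_kS, D_kS, pd0_formI h, pd1_formI h]
      simp only [smul_eq_mul, mul_zero, add_zero]; ring
    have := congrArg (fun u : X.Sm => u.1 ⟨_, hd x hx'⟩) e; simpa only [add_ap, mul_ap, kS_ap] using this
  · intro x y
    constructor <;> simp [V, line, VTX, VPX]
  · intro x y
    have e1 : Sph ![x * t, X.B.rPlus + x * β, y, 0] = Sph ![x * t, X.B.rPlus + x * β, y, 2 * pi] := by simp [Sph, sph]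
    have e2 : ∀ T c, lc c ![x * t, X.B.rPlus + x * β, y, 0] X.B.a T = lc c ![x * t, X.B.rPlus + x * β, y, 2 * pi] X.B.a T := by
      intro T c; rw [lc, lc, e1]; simp [Lv]
    simp [W, line, WTX, WPX, IX, e2, DzX, zx, PhiX, e1]

section identities

variable (u : X.Sm)

lemma two_pd2 : 2 * pd 2 u = X.Lb true u + X.Lb false u := by rw [Lb_eq, Lb_eq]; simp [sg]; ring

lemma Lb_sub : X.Lb true u - X.Lb false u = 2 * (X.AS * X.sS * pd 0 u + X.iS * X.siS * pd 3 u) := by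
  rw [Lb_eq, Lb_eq]; simp [sg]; ring

lemma sS_siS (X : Adm) : X.sS * X.siS = 1 := by
  ext q : 1
  have hs := X.s_ne q
  rw [mul_ap, sS_ap, siS_ap, one_ap]
  exact mul_inv_cancel₀ hs

lemma two_pd0 : 2 * pd 0 u = X.e4op u + X.AS * X.sS * ζ(X) * (X.Lb true u - X.Lb false u) - X.DZS * X.dP u := by
  have h1 := X.yy_zb true
  rw [← SigS_eq, SigS] at h1
  rw [Lb_sub, e4op, DZS]
  linear_combination (-2 * pd 0 u) * h1 - ζ(X) * 2 * X.AS * X.iS * pd 3 u * X.sS_siS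
    + (2 * X.AS ^ 2 * ζ(X) * pd 0 u - 2 * X.AS ^ 2 * ζ(X) * pd 0 u) * sS_sq_add (X := X)

lemma two_pd3 : 2 * pd 3 u = -(X.iS * X.sS) * (X.Lb true u - X.Lb false u - X.AS * X.sS * (2 * pd 0 u)) := by
  rw [Lb_sub]
  linear_combination (2 * X.iS * X.iS * pd 3 u) * X.sS_siS + 2 * pd 3 u * X.iS_mul_iS

end identities

section bounds

variable (q : X.dom)

lemma norm_zb_le (b : Bool) : ‖(X.zb b).1 q‖ ≤ 2 * q.1 1 := by
  have hr := X.r_gt q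
  have ha : |X.B.a| ≤ X.B.M := X.ha
  have hc := Real.abs_cos_le_one (q.1 2)
  rw [zb_ap, zx]
  refine (norm_add_le _ _).trans ?_
  have h1 : ‖((q.1 1 : ℝ) : ℂ)‖ = q.1 1 := by rw [norm_real, norm_of_nonneg (X.r_pos q).le]
  have h2 : ‖(sg b : ℂ) * I * X.B.a * (cos (q.1 2) : ℝ)‖ = |X.B.a| * |cos (q.1 2)| := by
    rw [norm_mul, norm_mul, norm_mul, norm_I, norm_real, norm_real]
    cases b <;> simp [sg]
  rw [h1, h2]
  nlinarith [abs_nonneg X.B.a, abs_nonneg (cos (q.1 2))]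

lemma norm_Lb_le (b : Bool) (u : X.Sm) : ‖(X.Lb b u).1 q‖ ≤ 2 * q.1 1 * ‖(op X (lt b) 0 u).1 q‖ := by
  have e : X.Lb b u = X.zb (!b) * op X (lt b) 0 u := by
    rw [op_lt]; simp only [Int.cast_zero, zero_mul, add_zero]; linear_combination (-X.Lb b u) * X.zeS_zb (!b)
  rw [e, mul_ap, norm_mul]
  exact mul_le_mul_of_nonneg_right (norm_zb_le q _) (norm_nonneg _)

lemma norm_DZS_le : ‖X.DZS.1 q‖ ≤ X.de q ^ 2 := by
  have hr := X.r_pos q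
  have h0 := X.Del_pos q.2.2.1
  have hb := X.beta_nonneg
  have e : X.DelS.1 q = ((q.1 1 ^ 2 - 2 * X.B.M * q.1 1 + X.B.a ^ 2 : ℝ) : ℂ) := by rw [DelS_ap]; push_cast; ring
  rw [DZS, mul_ap, mul_ap, norm_mul, norm_mul, e, norm_real, norm_of_nonneg h0.le, mul_assoc]
  have h1 := mul_le_mul (X.norm_zeS 1 q) (X.norm_zeS (-1) q) (norm_nonneg _) (X.ri_pos q).le
  have h2 : q.1 1 ^ 2 - 2 * X.B.M * q.1 1 + X.B.a ^ 2 ≤ (q.1 1 * X.de q) ^ 2 := by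
    rw [de, mul_sub, mul_one, mul_div_cancel₀ _ hr.ne']; nlinarith
  refine (mul_le_mul h2 h1 (by positivity) (by positivity)).trans (le_of_eq ?_)
  rw [ri]; field_simp

lemma norm_pd_le (u : X.Sm) {K : ℝ} (hp : ∀ b, ‖(op X (lt b) 0 u).1 q‖ ≤ K) (hf : ‖(op X .f 0 u).1 q‖ ≤ K)
    (hd : X.ri q * ‖(op X .d 0 u).1 q‖ ≤ K) : ‖(pd 2 u).1 q‖ ≤ (5 + X.B.M) * (q.1 1 * K) ∧
      ‖(pd 3 u).1 q‖ ≤ sin (q.1 2) * ((5 + X.B.M) * (q.1 1 * K)) := by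
  have hr := X.r_pos q
  have hM := X.hM
  have hs := X.sin_pos q
  have hK : 0 ≤ K := (norm_nonneg _).trans hf
  have hL : ∀ b, ‖(X.Lb b u).1 q‖ ≤ 2 * (q.1 1 * K) := fun b => (norm_Lb_le q b u).trans (by
    rw [mul_assoc]; gcongr; exact hp b)
  have hr2 : (1 : ℝ) ≤ 2 := one_le_two
  have hD : ‖(X.Lb true u - X.Lb false u).1 q‖ ≤ 4 * (q.1 1 * K) := by
    rw [sub_ap]; linarith [norm_sub_le ((X.Lb true u).1 q) ((X.Lb false u).1 q), hL true, hL false]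
  have hP : ‖(X.DZS * X.dP u).1 q‖ ≤ q.1 1 * K := by
    rw [mul_ap, norm_mul]
    have e : ‖(op X .d 0 u).1 q‖ = X.de q * ‖(X.dP u).1 q‖ := by rw [op, mul_ap, norm_mul, norm_delS, op3, neg_ap, norm_neg]
    rw [e, ri, inv_mul_le_iff₀ hr] at hd; refine (mul_le_mul_of_nonneg_right (norm_DZS_le q) (norm_nonneg _)).trans ?_
    have := mul_le_mul_of_nonneg_right (X.de_le q) (mul_nonneg (X.de_pos q).le (norm_nonneg ((X.dP u).1 q))); nlinarith
  have ha : ‖(X.AS * X.sS).1 q‖ ≤ X.B.M * sin (q.1 2) := by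
    rw [mul_ap, norm_mul, AS_ap, sS_ap, norm_mul, norm_I, one_mul, norm_real, norm_real, norm_of_nonneg hs.le]
    exact mul_le_mul_of_nonneg_right X.ha hs.le
  have hy : ‖ζ(X).1 q‖ ≤ X.ri q * X.ri q := by
    rw [mul_ap, norm_mul]; exact mul_le_mul (X.norm_zeS 1 q) (X.norm_zeS (-1) q) (norm_nonneg _) (X.ri_pos q).le
  have hMr : X.B.M * X.ri q ≤ 1 := by rw [ri, ← div_eq_mul_inv, div_le_one hr]; exact (X.r_gt q).le
  have h0 : ‖(2 * pd 0 u).1 q‖ ≤ 5 * K + q.1 1 * K := by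
    rw [two_pd0, sub_ap, add_ap, mul_ap, mul_ap (X.AS * X.sS), ]
    refine (norm_sub_le _ _).trans (add_le_add ((norm_add_le _ _).trans ?_) hP)
    have e : X.e4op u = op X .f 0 u := by simp [op]
    rw [e, norm_mul, norm_mul]
    have : ‖(X.AS * X.sS).1 q‖ * ‖ζ(X).1 q‖ * ‖(X.Lb true u - X.Lb false u).1 q‖
        ≤ (X.B.M * 1) * (X.ri q * X.ri q) * (4 * (q.1 1 * K)) := by
      have := X.ri_pos q; gcongr; exact ha.trans (by gcongr; exact Real.sin_le_one _)
    have e2 : (X.B.M * 1) * (X.ri q * X.ri q) * (4 * (q.1 1 * K)) = 4 * ((X.B.M * X.ri q) * K) := by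
      have : X.ri q * q.1 1 = 1 := inv_mul_cancel₀ hr.ne'; grind
    have : (X.B.M * X.ri q) * K ≤ 1 * K := mul_le_mul_of_nonneg_right hMr hK; linarith
  have hrK : 0 ≤ q.1 1 * K := by positivity
  have h2 : ∀ u : X.Sm, ‖(2 * u).1 q‖ = 2 * ‖u.1 q‖ := fun u => by rw [mul_ap, ofNat_ap]; simp
  constructor
  · have : ‖(2 * pd 2 u).1 q‖ ≤ 4 * (q.1 1 * K) := by
      rw [two_pd2, add_ap]; linarith [norm_add_le ((X.Lb true u).1 q) ((X.Lb false u).1 q), hL true, hL false]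
    rw [h2] at this; nlinarith
  · have : ‖(2 * pd 3 u).1 q‖ ≤ sin (q.1 2) * (4 * (q.1 1 * K) + X.B.M * (5 * K + q.1 1 * K)) := by
      rw [two_pd3, mul_ap, norm_mul, neg_ap, norm_neg, mul_ap, norm_mul, iS_ap, norm_I, one_mul, sS_ap,
        norm_real, norm_of_nonneg hs.le, sub_ap, mul_ap]
      refine mul_le_mul_of_nonneg_left ((norm_sub_le _ _).trans (add_le_add hD ?_)) hs.le; rw [norm_mul]
      refine mul_le_mul (ha.trans ?_) h0 (norm_nonneg _) hM.le; nlinarith [Real.sin_le_one (q.1 2)]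
    rw [h2] at this; have h5 : X.B.M * K ≤ q.1 1 * K := mul_le_mul_of_nonneg_right (X.r_gt q).le hK
    have : sin (q.1 2) * (4 * (q.1 1 * K) + X.B.M * (5 * K + q.1 1 * K)) ≤
        sin (q.1 2) * (2 * ((5 + X.B.M) * (q.1 1 * K))) := by
      refine mul_le_mul_of_nonneg_left ?_ hs.le; nlinarith
    linarith

variable {S : MaxwellFields} (h : X.B.IsSolution S) (b : Bool)
include h

lemma norm_vS_le : ‖(X.vS S b).1 q‖ ≤ 2 * X.bd S 1 q := by
  have hr := X.r_pos q
  have : X.ri q * ‖(X.alC S !b).1 q‖ ≤ X.bd S 1 q := ((hypA (n := 1) h q !b).2 [] isCan_nil (by simp)).2.2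
  rw [alC_eq h, mul_ap, pow_ap, rS_ap, norm_mul, norm_pow, norm_real, norm_of_nonneg hr.le,
    ri, inv_mul_le_iff₀ hr, sq, mul_assoc] at this
  have := le_of_mul_le_mul_left this hr
  rw [vS, mul_ap, norm_mul]
  have h2 := mul_le_mul_of_nonneg_right (norm_zb_le q b) (norm_nonneg ((X.comp S.al ![!b]).1 q))
  nlinarith

lemma norm_DZS_uS_le : ‖(X.DZS * X.uS S b).1 q‖ ≤ 2 * (q.1 1 * X.bd S 1 q) := by
  have hr := X.r_pos q
  have hd := X.de_pos q
  have : X.de q * X.ri q * ‖(X.ualC S b).1 q‖ ≤ X.bd S 1 q := ((hypU (n := 1) h q b).2 [] isCan_nil (by simp)).2.1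
  rw [ualC_eq h, mul_ap, rS_ap, norm_mul, norm_real, norm_of_nonneg hr.le] at this
  have e : X.de q * X.ri q * (q.1 1 * ‖(X.comp S.ual ![b]).1 q‖) = X.de q * ‖(X.comp S.ual ![b]).1 q‖ := by
    rw [ri]; field_simp
  rw [e] at this
  rw [mul_ap, uS, mul_ap, norm_mul, norm_mul]
  have h1 : X.de q ^ 2 ≤ X.de q := by nlinarith [X.de_le q]
  refine (mul_le_mul ((norm_DZS_le q).trans h1) (mul_le_mul_of_nonneg_right (norm_zb_le q (!b)) (norm_nonneg _))
    (by positivity) hd.le).trans ?_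
  nlinarith

end bounds

/-- The charge, read off from the initial horizon sphere. -/
def chg (B : Background) (b : Bool) (D : MaxwellFields) : ℂ := (4 * pi : ℂ)⁻¹ * ∫ x, IX B D b pt(0,B.rPlus,x) ∂m2

instance : IsFiniteMeasure m2 := by unfold m2; infer_instance

lemma integral_weight (b : Bool) {t r a : ℝ} (hr : 0 < r) :
    ∫ x : ℝ × ℝ, (sin x.1 : ℂ) * ((r : ℂ) ^ 2 + a ^ 2) * (zx b pt(t,r,x) a)⁻¹ ^ 2 ∂m2 = 4 * pi := by
  have hz : ∀ θ : ℝ, (r : ℂ) + sg b * I * a * cos θ ≠ 0 := fun θ =>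
    zx_ne b (q := ![t, r, θ, 0]) hr a
  have key : ∫ θ in Ioo 0 pi, (sin θ : ℂ) * ((r : ℂ) ^ 2 + a ^ 2) * ((r : ℂ) + sg b * I * a * cos θ)⁻¹ ^ 2 = 2 := by
    rw [← integral_Ioc_eq_integral_Ioo, ← intervalIntegral.integral_of_le Real.pi_pos.le,
      intervalIntegral.integral_eq_sub_of_hasDerivAt (f := fun θ => -((r : ℂ) ^ 2 + a ^ 2) / r * (cos θ : ℂ) *
        ((r : ℂ) + sg b * I * a * cos θ)⁻¹)]
    · have h1 := hz 0; have h2 := hz pi; have hr' : (r : ℂ) ≠ 0 := by exact_mod_cast hr.ne'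
      have hw : (a : ℂ) ^ 2 = -(sg b * I * a) ^ 2 := by cases b <;> simp [sg] <;> linear_combination ((a : ℂ) ^ 2) * I_sq
      simp only [Real.cos_zero, Real.cos_pi, Complex.ofReal_one, ofReal_neg] at h1 h2 ⊢; rw [hw]
      generalize (sg b * I * a : ℂ) = w at *; rw [mul_one] at h1; rw [mul_neg_one, ← sub_eq_add_neg] at h2
      rw [mul_one, mul_neg_one w, ← sub_eq_add_neg (r : ℂ) w]; field_simp; ring
    · intro θ _
      have hc : HasDerivAt (fun θ : ℝ => (cos θ : ℂ)) (-(sin θ : ℂ)) θ := by simpa using (Real.hasDerivAt_cos θ).ofReal_comp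
      have hd := (hc.const_mul (sg b * I * a : ℂ)).const_add (r : ℂ)
      refine ((hc.const_mul (-((r : ℂ) ^ 2 + a ^ 2) / r)).mul (hd.fun_inv (hz θ))).congr_deriv ?_
      have hr' : (r : ℂ) ≠ 0 := by exact_mod_cast hr.ne'
      have := hz θ; field_simp; ring
    · refine Continuous.intervalIntegrable ?_ _ _
      refine Continuous.mul (by fun_prop) (Continuous.pow (Continuous.inv₀ (by fun_prop) hz) 2)
  have := integral_fun_fst (μ := volume.restrict (Ioo 0 pi)) (ν := volume.restrict (Ioo 0 (2 * pi)))
    (f := fun θ : ℝ => (sin θ : ℂ) * ((r : ℂ) ^ 2 + a ^ 2) * ((r : ℂ) + sg b * I * a * cos θ)⁻¹ ^ 2)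
  refine this.trans ?_
  rw [key]
  simp [Measure.real, Real.pi_pos.le]
  ring

lemma im_conj {z : ℂ} (h : z.im = 0) : (starRingEnd ℂ) z = z := Complex.conj_eq_iff_im.2 h

lemma chg_conj (B : Background) {D : MaxwellFields} (hD : D.IsReal) (b : Bool) :
    (starRingEnd ℂ) (chg B b D) = chg B (!b) D := by
  have hs : ∀ b, (starRingEnd ℂ) ((sg b : ℤ) : ℂ) = ((sg b : ℤ) : ℂ) := fun b => by simp
  have hz : ∀ b q, (starRingEnd ℂ) (zx b q B.a) = zx (!b) q B.a := fun b q => by simp [zx, sg_not, -Complex.ofReal_cos]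
  have hl : ∀ (T : Tens 1), (∀ p I, (T p I).im = 0) → ∀ b q, (starRingEnd ℂ) (lc b q B.a T) = lc (!b) q B.a T := by
    intro T hT b q; rw [lc, lc, map_sum]; refine sum_ext fun μ => ?_; rw [map_mul, im_conj (hT _ _)]; congr 1
    fin_cases μ <;> simp [Lv, sg_not, -Complex.ofReal_cos, -Complex.ofReal_sin]
  rw [chg, chg, map_mul, ← integral_conj]
  congr 1
  · simp [Complex.conj_ofNat]
  · refine integral_congr_ae (Filter.Eventually.of_forall fun x => ?_)
    simp only [IX, PhiX, DzX, map_sub, map_mul, map_add, map_pow, map_inv₀, hz, hl _ fun p I => (hD p).1 I,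
      hl _ fun p I => (hD p).2.1 I, im_conj ((hD _).2.2.1 _), im_conj ((hD _).2.2.2 _), Complex.conj_ofReal,
      Complex.conj_I, hs, sg_not, Bool.not_not, map_one, map_div₀, map_ofNat]
    push_cast; ring

lemma chg_seed (b : Bool) : chg X.B b (X.B.seed S) = chg X.B b S := by
  have hm : ∀ x : ℝ × ℝ, Sph pt(0,X.B.rPlus,x) ∈ X.B.initialSphere := fun x =>
    ⟨rfl, rad_Sph (q := pt(0,X.B.rPlus,x)) X.rPlus_pos.le⟩
  have hm' : ∀ x : ℝ × ℝ, Sph pt(0,X.B.rPlus,x) ∈ X.B.initialSlice := fun x => ⟨(hm x).1, (hm x).2.ge⟩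
  simp only [chg, IX, PhiX, lc, Background.seed, Set.indicator_of_mem (hm _), Set.indicator_of_mem (hm' _)]

lemma hasDerivAt_coord (u : X.Sm) {G : Pt → ℂ} (hG : ∀ q : X.dom, u.1 q = G q) (q : X.dom) {i : Fin 4} (hi : i ≠ 0) :
    HasDerivAt (fun s => G (update q.1 i s)) ((pd i u).1 q) (q.1 i) := by
  have hc := hasDerivAt_update q.1 i (q.1 i)
  have hd : ∀ᶠ s in nhds (q.1 i), update q.1 i s ∈ X.dom := by
    have h0 : ∀ s, 0 ≤ update q.1 i s 0 := fun s => by rw [Function.update_of_ne hi.symm]; exact q.2.1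
    have ht : ∀ j, Filter.Tendsto (fun s => update q.1 i s j) (nhds (q.1 i)) (nhds (q.1 j)) := fun j => by
      have := (continuousAt_pi.1 hc.continuousAt j).tendsto
      rwa [update_eq_self] at this
    filter_upwards [(ht 1).eventually (lt_mem_nhds q.2.2.1), (ht 2).eventually (lt_mem_nhds q.2.2.2.1),
      (ht 2).eventually (gt_mem_nhds q.2.2.2.2)] with s h1 h2 h3
    exact ⟨h0 s, h1, h2, h3⟩
  have := HasFDerivWithinAt.comp_hasDerivAt_of_eq _ (X.differentiableWithinAt_ext u q).hasFDerivWithinAt hc hd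
    (update_eq_self _ _).symm
  refine this.congr_of_eventuallyEq ?_
  filter_upwards [hd] with s hs
  exact ((X.ext_apply _ ⟨_, hs⟩).trans (hG ⟨_, hs⟩)).symm

lemma integrable_sphere {G : Pt → ℂ} (hG : ContinuousOn G X.clo) {t r : ℝ} (ht : 0 ≤ t) (hr : X.B.rPlus ≤ r) :
    Integrable (fun x : ℝ × ℝ => G pt(t,r,x)) m2 := by
  have hc : Continuous fun x : ℝ × ℝ => (pt(t,r,x) : Pt) := continuous_vec
  rw [m2_eq]
  have h2 : ContinuousOn (fun x : ℝ × ℝ => G pt(t,r,x)) (Icc 0 pi ×ˢ Icc 0 (2 * pi)) :=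
    hG.comp hc.continuousOn fun x _ => ⟨ht, hr⟩
  exact (h2.integrableOn_compact (isCompact_Icc.prod isCompact_Icc)).mono_set
    (Set.prod_mono Ioo_subset_Icc_self Ioo_subset_Icc_self)

lemma norm_zx_inv_le (b : Bool) {q : Pt} (hr : 0 < q 1) (a : ℝ) : ‖(zx b q a)⁻¹‖ ≤ (q 1)⁻¹ := by
  rw [norm_inv]
  refine inv_anti₀ hr (le_trans (le_of_eq ?_) (Complex.abs_re_le_norm _))
  cases b <;> simp [zx, sg, abs_of_pos hr]

lemma norm_weight_le (b : Bool) {q : Pt} (hr : X.B.M ≤ q 1) (hs : 0 ≤ sin (q 2)) :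
    ‖(sin (q 2) : ℂ) * ((q 1 : ℂ) ^ 2 + X.B.a ^ 2) * (zx b q X.B.a)⁻¹ ^ 2‖ ≤ 2 * sin (q 2) := by
  have hr0 := X.hM.trans_le hr
  have h2 : ‖((q 1 : ℂ) ^ 2 + X.B.a ^ 2)‖ ≤ 2 * q 1 ^ 2 := by
    have e : ((q 1 : ℂ) ^ 2 + X.B.a ^ 2) = ((q 1 ^ 2 + X.B.a ^ 2 : ℝ) : ℂ) := by push_cast; ring
    rw [e, norm_real, norm_of_nonneg (by positivity)]
    have := sq_le_sq' (by linarith [(abs_le.1 X.ha).1]) ((abs_le.1 X.ha).2.trans hr)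
    linarith
  rw [norm_mul, norm_mul, norm_pow, norm_real, norm_of_nonneg hs]
  calc _ ≤ sin (q 2) * (2 * q 1 ^ 2) * (q 1)⁻¹ ^ 2 := by gcongr; exact norm_zx_inv_le b hr0 _
    _ = _ := by field_simp

lemma norm_IX_sub_le (h : X.B.IsSolution S) (b : Bool) (q : X.dom) (c : ℂ) :
    ‖IX X.B S b q - (sin (q.1 2) : ℂ) * ((q.1 1 : ℂ) ^ 2 + X.B.a ^ 2) * (zx b q X.B.a)⁻¹ ^ 2 * c‖ ≤
      2 * (sin (q.1 2) * (‖PhiX S b q - c‖ + (1 + X.B.M) * (q.1 1 * X.bd S 1 q))) := by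
  have hs := X.sin_pos q
  have h1 := norm_vS_le q h b
  have h2 := norm_DZS_uS_le q h b
  have hK : 0 ≤ X.bd S 1 q := Real.sqrt_nonneg _
  have hM := X.hM
  rw [vS_ap h] at h1
  rw [mul_ap, DZS_ap b, uS_ap h] at h2
  have e : IX X.B S b q - (sin (q.1 2) : ℂ) * ((q.1 1 : ℂ) ^ 2 + X.B.a ^ 2) * (zx b q X.B.a)⁻¹ ^ 2 * c =
      (sin (q.1 2) : ℂ) * ((q.1 1 : ℂ) ^ 2 + X.B.a ^ 2) * (zx b q X.B.a)⁻¹ ^ 2 * (PhiX S b q - c) -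
      1 / 2 * sg b * (I * X.B.a) * (sin (q.1 2) : ℂ) ^ 2 *
        (lc (!b) q X.B.a S.al + DzX X.B b q * lc b q X.B.a S.ual) := by rw [IX]; ring
  rw [e]
  refine (norm_sub_le _ _).trans ?_
  rw [norm_mul _ (PhiX S b q - c), norm_mul _ (_ + _)]
  have h3 := mul_le_mul_of_nonneg_right (norm_weight_le b (X.r_gt q).le hs.le) (norm_nonneg (PhiX S b q - c))
  have h4 : ‖(1 / 2 * sg b * (I * X.B.a) * (sin (q.1 2) : ℂ) ^ 2 : ℂ)‖ ≤ sin (q.1 2) * X.B.M := by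
    have : ‖(1 / 2 * sg b * (I * X.B.a) * (sin (q.1 2) : ℂ) ^ 2 : ℂ)‖ = 1 / 2 * |X.B.a| * sin (q.1 2) ^ 2 := by
      rw [norm_mul, norm_mul, norm_mul, norm_mul, norm_pow, norm_real, norm_real, norm_of_nonneg hs.le, norm_I]
      cases b <;> simp [sg]
    rw [this]; have ha : |X.B.a| ≤ X.B.M := X.ha
    nlinarith [Real.sin_le_one (q.1 2), abs_nonneg X.B.a, mul_nonneg hs.le (abs_nonneg X.B.a)]
  have h5 := mul_le_mul h4 ((norm_add_le _ _).trans (add_le_add h1 h2)) (norm_nonneg _) (by positivity)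
  have h6 := mul_le_mul_of_nonneg_right (X.r_gt q).le hK
  have h7 := mul_le_mul_of_nonneg_left h6 hs.le
  nlinarith

lemma continuousOn_dens (h : X.B.IsSolution S) (n : ℕ) : ContinuousOn (X.dens S n) X.off :=
  continuousOn_finsetSum _ fun j _ => (continuousOn_densAl ((good_wal h).comm j.1 j.2.1 j.2.2)).add
    (continuousOn_densUAl ((good_wual h).comm j.1 j.2.1 j.2.2))

variable (X S) in
/-- The bound `bd` times the radius, on a sphere. -/
def kap (t r : ℝ) (x : ℝ × ℝ) : ℝ≥0∞ := ofReal (r * Real.sqrt (2 ^ (1 + 4) * X.dens S 1 (sph t r x.1 x.2)))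

section

variable (h : X.B.IsSolution S) {t r : ℝ} (ht : 0 ≤ t) (hr : X.B.rPlus < r)
include h ht hr

lemma continuousOn_dens_sph (n : ℕ) : ContinuousOn (fun x : ℝ × ℝ => X.dens S n (sph t r x.1 x.2)) box2 := by
  have hc : Continuous fun x : ℝ × ℝ => sph t r x.1 x.2 := continuous_vec
  exact (continuousOn_dens h n).comp hc.continuousOn fun x hx => X.Sph_mem_off (mem_dom ht hr hx)

lemma aemeasurable_kap : AEMeasurable (X.kap S t r) m2 := by
  rw [m2_eq]
  have hc := continuousOn_dens_sph h ht hr 1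
  exact (ContinuousOn.mul continuousOn_const (continuousOn_const.mul hc).sqrt).aemeasurable
    measurableSet_box2 |>.ennreal_ofReal

lemma lintegral_kap : ∫⁻ x, sn x.1 * X.kap S t r x ^ 2 ∂m2 = 32 * (ofReal (r ^ 2) * sphInt (X.dens S 1) t r) := by
  rw [sphInt_eq (continuousOn_dens_sph h ht hr 1), ← mul_assoc, ← lintegral_const_mul' _ _
    (ENNReal.mul_ne_top (by simp) ofReal_ne_top), m2_eq]
  refine setLIntegral_congr_fun measurableSet_box2 fun x hx => ?_
  have hs := (Real.sin_pos_of_mem_Ioo hx.1).le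
  have hd : 0 ≤ X.dens S 1 (sph t r x.1 x.2) := dens_nonneg h ⟨_, mem_dom ht hr hx⟩
  have hr0 := X.rPlus_pos.trans hr
  simp only [kap, sn]
  rw [← ofReal_pow (by positivity), ← ofReal_mul hs, mul_pow, Real.sq_sqrt (by positivity),
    show (32 : ℝ≥0∞) = ofReal 32 by simp, ← ofReal_mul (by norm_num),
    ← ofReal_mul (by positivity)]
  congr 1; ring

end

lemma kap_eq {t r : ℝ} (ht : 0 ≤ t) (hr : X.B.rPlus < r) {x : ℝ × ℝ} (hx : x ∈ box2) : X.kap S t r x =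
    ofReal (r * X.bd S 1 ⟨_, mem_dom ht hr hx⟩) := rfl

lemma enorm_inv_four_pi : ‖(4 * pi : ℂ)⁻¹‖ₑ * 2 ≤ 1 := by
  have e : ‖(4 * pi : ℂ)⁻¹‖ = (4 * pi)⁻¹ := by rw [norm_inv, norm_mul, norm_real, norm_of_nonneg Real.pi_pos.le]; simp
  rw [← ofReal_norm, e, show (2 : ℝ≥0∞) = ofReal 2 by simp,
    ← ofReal_mul (by positivity), ENNReal.ofReal_le_one, inv_mul_le_iff₀ (by positivity)]
  linarith [Real.pi_gt_three]

lemma chg_sub_le (h : X.B.IsSolution S) (b : Bool) {t r : ℝ} (ht : 0 ≤ t) (hr : X.B.rPlus < r) (c : ℂ) :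
    ‖chg X.B b S - c‖ₑ ≤ ∫⁻ x, sn x.1 * ‖PhiX S b pt(t,r,x) - c‖ₑ ∂m2 +
      ∫⁻ x, sn x.1 * (ofReal (1 + X.B.M) * X.kap S t r x) ∂m2 := by
  have hM := X.hM
  have hw : ContinuousOn (fun q : Pt => (sin (q 2) : ℂ) * ((q 1 : ℂ) ^ 2 + X.B.a ^ 2) * (zx b q X.B.a)⁻¹ ^ 2) X.clo := by
    have := X.continuousOn_zi b; fun_prop
  have iw : Integrable (fun x : ℝ × ℝ => (sin x.1 : ℂ) * ((r : ℂ) ^ 2 + X.B.a ^ 2) *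
      (zx b pt(t,r,x) X.B.a)⁻¹ ^ 2 * c) m2 := (integrable_sphere hw ht hr.le).mul_const c
  have iI := integrable_sphere (continuousOn_IX h b) ht hr.le
  have e : chg X.B b S - c = (4 * pi : ℂ)⁻¹ * ∫ x, (IX X.B S b pt(t,r,x) -
      (sin x.1 : ℂ) * ((r : ℂ) ^ 2 + X.B.a ^ 2) * (zx b pt(t,r,x) X.B.a)⁻¹ ^ 2 * c) ∂m2 := by
    have hp : (4 * pi : ℂ) ≠ 0 := by
      have := Real.pi_pos.ne'; simp [this]
    rw [integral_sub iI iw, charge_const h b ht hr, chg, mul_sub]; congr 1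
    have := integral_weight b (t := t) (a := X.B.a) (X.rPlus_pos.trans hr)
    refine Eq.trans ?_ (congrArg _ (integral_mul_const c _).symm)
    refine Eq.trans ?_ (congrArg (fun z => (4 * pi : ℂ)⁻¹ * (z * c)) this.symm); field_simp
  rw [e, enorm_mul]
  refine (mul_le_mul_right (enorm_integral_le_lintegral_enorm _) _).trans ?_
  have hk : AEMeasurable (fun x => sn x.1 * (ofReal (1 + X.B.M) * X.kap S t r x)) m2 :=
    (Measurable.ennreal_ofReal (by fun_prop)).aemeasurable.mul ((aemeasurable_kap h ht hr).const_mul _)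
  rw [← lintegral_add_right' _ hk]
  refine le_trans ?_ ((mul_le_mul_left enorm_inv_four_pi _).trans_eq (one_mul _))
  rw [mul_assoc]
  refine mul_le_mul_right ?_ _
  rw [← lintegral_const_mul' _ _ (by simp), m2_eq]
  refine setLIntegral_mono' measurableSet_box2 fun x hx => ?_
  have hs := (Real.sin_pos_of_mem_Ioo hx.1).le
  have hr0 := X.rPlus_pos.trans hr
  have := norm_IX_sub_le h b ⟨_, mem_dom ht hr hx⟩ c
  have hbd : 0 ≤ (1 + X.B.M) * (r * X.bd S 1 ⟨_, mem_dom ht hr hx⟩) :=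
    mul_nonneg (by positivity) (mul_nonneg hr0.le (Real.sqrt_nonneg _))
  rw [kap_eq ht hr hx, ← ofReal_norm, ← ofReal_norm, sn,
    show (2 : ℝ≥0∞) = ofReal 2 by simp, ← ofReal_mul (show 0 ≤ 1 + X.B.M by positivity),
    ← mul_add, ← ofReal_add (norm_nonneg _) hbd, ← ofReal_mul hs,
    ← ofReal_mul (by norm_num)]
  exact ofReal_le_ofReal this

theorem sphere_le {M : ℝ} (hM : 0 < M) : ∃ C : ℝ≥0∞, C ≠ ⊤ ∧ ∀ X : Adm, X.B.M = M → ∀ S, X.B.IsSolution S →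
    ∀ b t r, 0 ≤ t → X.B.rPlus < r → ∫⁻ y, sn y.1 * ‖PhiX S b ![t, r, y.1, y.2] - chg X.B b S‖ₑ ^ 2 ∂m2 ≤
      C * (ofReal (r ^ 2) * sphInt (X.dens S 1) t r) := by
  obtain ⟨C₁, hC₁, H⟩ := Phi_words hM 1
  obtain ⟨C₂, hC₂, P⟩ := poincare
  set c : ℝ := (5 + M) * C₁ + (1 + M) with hc
  have hc0 : 0 ≤ c := by positivity
  refine ⟨C₂ * ((1 + m2 Set.univ) * (ofReal c ^ 2 * 32)), ?_, fun X hX S h b t r ht hr => ?_⟩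
  · have := measure_ne_top m2 Set.univ
    finiteness
  have hr0 := X.rPlus_pos.trans hr
  let pt : ∀ x ∈ box2, X.dom := fun x hx => ⟨_, mem_dom ht hr hx⟩
  have hw := fun q b' => H [lt b'] (by simp) (by simp) X hX S h b q
  have hgrad := fun q => norm_pd_le q (X.Phi S b) (K := C₁ * X.bd S 1 q)
    (fun b' => (hw q b').2 ⟨_, List.mem_singleton_self _, (lt_ne b').1⟩)
    ((H [.f] (by simp) (by simp) X hX S h b q).2 ⟨_, List.mem_singleton_self _, by simp⟩)
    (H [.d] (by simp) (by simp) X hX S h b q).1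
  have hc : Continuous fun x : ℝ × ℝ => (pt(t,r,x) : Pt) := continuous_vec
  have cu : ∀ u : X.Sm, ContinuousOn (fun x : ℝ × ℝ => X.ext u.1 pt(t,r,x)) box2 := fun u =>
    (X.contDiffOn_ext u).continuousOn.comp hc.continuousOn fun x hx => mem_dom ht hr hx
  have eu : ∀ (u : X.Sm) x (hx : x ∈ box2), X.ext u.1 pt(t,r,x) = u.1 (pt x hx) := fun u x hx =>
    X.ext_apply u.1 (pt x hx)
  have hu : ∀ x : ℝ × ℝ, (fun s => (![t, r, s, x.2] : Pt)) = update pt(t,r,x) 2 ∧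
      (fun s => (![t, r, x.1, s] : Pt)) = update pt(t,r,x) 3 := fun x => by
    constructor <;> funext s i <;> fin_cases i <;> rfl
  have kb : ∀ x (hx : x ∈ box2), ∀ y : ℝ, y ≤ (5 + X.B.M) * (r * (C₁ * X.bd S 1 (pt x hx))) →
      ofReal y ≤ ofReal c * X.kap S t r x := fun x hx y hy => by
    rw [kap_eq ht hr hx, ← ofReal_mul hc0]; refine ofReal_le_ofReal (hy.trans ?_)
    have : 0 ≤ r * X.bd S 1 (pt x hx) := mul_nonneg hr0.le (Real.sqrt_nonneg _); rw [hX]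
    nlinarith [mul_nonneg (show (0 : ℝ) ≤ 1 + M by positivity) this]
  refine (P (fun x => PhiX S b pt(t,r,x)) (fun x => X.ext (pd 2 (X.Phi S b)).1 pt(t,r,x))
    (fun x => X.ext (pd 3 (X.Phi S b)).1 pt(t,r,x)) (fun x => (ofReal c * X.kap S t r x) ^ 2)
    (chg X.B b S) (∫⁻ x, sn x.1 * (ofReal c * X.kap S t r x) ∂m2) ?_ (cu _) (cu _) ?_ ?_ ?_ ?_ ?_ ?_).trans ?_
  · exact (continuousOn_PhiX h b).comp hc.continuousOn fun x hx => ⟨ht, hr.le⟩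
  · exact ((aemeasurable_kap h ht hr).const_mul _).pow_const 2
  · intro x hx; have := hasDerivAt_coord (X.Phi S b) (Phi_ap h b) (pt x hx) (i := 2) (by decide)
    rw [eu _ x hx]
    exact (congrArg (fun g : ℝ → Pt => HasDerivAt (fun s => PhiX S b (g s)) ((pd 2 (X.Phi S b)).1 (pt x hx)) x.1)
      (hu x).1).mpr this
  · intro x hx; have := hasDerivAt_coord (X.Phi S b) (Phi_ap h b) (pt x hx) (i := 3) (by decide)
    rw [eu _ x hx]
    exact (congrArg (fun g : ℝ → Pt => HasDerivAt (fun s => PhiX S b (g s)) ((pd 3 (X.Phi S b)).1 (pt x hx)) x.2)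
      (hu x).2).mpr this
  · intro x hx; rw [eu _ x hx, ← ofReal_norm]; exact pow_le_pow_left' (kb x hx _ (hgrad (pt x hx)).1) 2
  · intro x hx; rw [eu _ x hx, ← ofReal_norm, ← mul_pow]
    refine pow_le_pow_left' ((ofReal_le_ofReal (hgrad (pt x hx)).2).trans ?_) 2; rw [ofReal_mul (X.sin_pos (pt x hx)).le]
    exact mul_le_mul_right (kb x hx _ le_rfl) _
  · intro y hy; refine (chg_sub_le h b ht hr _).trans (add_le_add_right (lintegral_mono fun x => ?_) _)
    refine mul_le_mul_right (mul_le_mul_left (ofReal_le_ofReal ?_) _) _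
    rw [hX]; linarith [mul_nonneg (show (0 : ℝ) ≤ 5 + M by positivity) hC₁]
  · rw [mul_assoc C₂]; refine mul_le_mul_right ?_ _
    have hm : AEMeasurable (fun x => sn x.1 * (ofReal c * X.kap S t r x)) m2 :=
      (Measurable.ennreal_ofReal (by fun_prop)).aemeasurable.mul ((aemeasurable_kap h ht hr).const_mul _)
    have e : ∫⁻ x, sn x.1 * (ofReal c * X.kap S t r x) ^ 2 ∂m2 =
        ofReal c ^ 2 * (32 * (ofReal (r ^ 2) * sphInt (X.dens S 1) t r)) := by
      rw [← lintegral_kap h ht hr, ← lintegral_const_mul' _ _ (by finiteness)]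
      exact lintegral_congr fun x => by ring
    have e2 : (∫⁻ x, sn x.1 * (ofReal c * X.kap S t r x) ∂m2) ^ 2 ≤
        m2 Set.univ * ∫⁻ x, sn x.1 * (ofReal c * X.kap S t r x) ^ 2 ∂m2 := by
      refine (lintegral_sq_le hm).trans (mul_le_mul_right (lintegral_mono fun x => ?_) _); rw [mul_pow, sq (sn x.1)]
      exact mul_le_mul_left (mul_le_of_le_one_left' (sn_le_one _)) _
    refine (add_le_add_right e2 _).trans (le_of_eq ?_); rw [e]; ring

lemma normSq_scalar (B : Background) (T : Tens 0) (p : Pt) : B.normSq T p = ‖T p ![]‖ ^ 2 := by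
  rw [Background.normSq, Fintype.sum_unique, Fintype.sum_unique]
  simp only [Finset.univ_eq_empty, Finset.prod_empty, one_mul, Complex.mul_conj]
  rw [Complex.ofReal_re, Complex.normSq_eq_norm_sq]
  exact congrArg (fun I => ‖T p I‖ ^ 2) (Subsingleton.elim _ _)

/-- The charges of `ρ̂` and `σ̂`. -/
def charges (B : Background) (D : MaxwellFields) : ℂ × ℂ :=
  (1 / 2 * (chg B true D + chg B false D), -(1 / 2 * I * (chg B true D - chg B false D)))

lemma enorm_half_mul_sq (z a b : ℂ) (hz : ‖z‖ = 1 / 2) : ‖z * (a + b)‖ₑ ^ 2 ≤ ‖a‖ₑ ^ 2 + ‖b‖ₑ ^ 2 := by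
  have h1 : ‖z‖ₑ ^ 2 * 4 = 1 := by
    rw [← ofReal_norm, hz, ← ofReal_pow (by norm_num), show (4 : ℝ≥0∞) = ofReal 4 by simp, ← ofReal_mul (by norm_num)]
    norm_num
  calc _ = ‖z‖ₑ ^ 2 * ‖a + b‖ₑ ^ 2 := by rw [enorm_mul, mul_pow]
    _ ≤ ‖z‖ₑ ^ 2 * (‖a‖ₑ + ‖b‖ₑ) ^ 2 := by gcongr; exact enorm_add_le _ _
    _ ≤ ‖z‖ₑ ^ 2 * (4 * (‖a‖ₑ ^ 2 + ‖b‖ₑ ^ 2)) := by gcongr; exact enn_add_sq _ _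
    _ = _ := by rw [← mul_assoc, h1, one_mul]

lemma mid_sub_le (q : Pt) (w : Bool → ℂ) :
    ‖S.rho (Sph q) ![] - 1 / 2 * (w true + w false)‖ₑ ^ 2 ≤ ‖PhiX S true q - w true‖ₑ ^ 2 + ‖PhiX S false q - w false‖ₑ ^ 2 ∧
    ‖S.sig (Sph q) ![] - -(1 / 2 * I * (w true - w false))‖ₑ ^ 2 ≤
      ‖PhiX S true q - w true‖ₑ ^ 2 + ‖PhiX S false q - w false‖ₑ ^ 2 := by
  constructor
  · convert enorm_half_mul_sq (1 / 2) (PhiX S true q - w true) (PhiX S false q - w false) (by simp) using 3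
    simp [PhiX, sg]; ring
  · have := enorm_half_mul_sq (-(1 / 2 * I)) (PhiX S true q - w true) (-(PhiX S false q - w false)) (by simp)
    rw [enorm_neg (PhiX S false q - w false)] at this; convert this using 3; simp [PhiX, sg]
    linear_combination (S.sig (Sph q) ![]) * I_sq

/-- `S - 𝔖_q`. -/
abbrev shift (S : MaxwellFields) (q : ℂ × ℂ) : MaxwellFields := S.sub (MaxwellFields.stationary q.1 q.2)

lemma slice_mid_le {M : ℝ} (hM : 0 < M) : ∃ C : ℝ≥0∞, C ≠ ⊤ ∧ ∀ X : Adm, X.B.M = M → ∀ S, X.B.IsSolution S →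
    ∀ T, IsMid (shift S (charges X.B S)) T → ∀ τ, 0 ≤ τ → X.B.sliceInt (fun p => X.B.normSq T p / rad p ^ 2) τ ≤
      C * (X.B.energyAl 2 S.al τ + X.B.energyUAl 2 S.ual τ) := by
  obtain ⟨C, hC, H⟩ := sphere_le hM
  refine ⟨2 * C, by finiteness, fun X hX S h T hT τ hτ => ?_⟩
  rw [← sliceInt_dens h 1 hτ, sliceInt, sliceInt, ← lintegral_const_mul' _ _ (by finiteness)]
  refine setLIntegral_mono' measurableSet_Ioi fun r hr' => ?_
  have hr : X.B.rPlus < r := hr'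
  have hr0 := X.rPlus_pos.trans hr
  have hsph : ∀ x : ℝ × ℝ, sph τ r x.1 x.2 = Sph pt(τ,r,x) := fun x => rfl
  have hc : Continuous fun x : ℝ × ℝ => (pt(τ,r,x) : Pt) := continuous_vec
  have hcl : Set.MapsTo (fun x : ℝ × ℝ => (pt(τ,r,x) : Pt)) box2 X.clo := fun x _ => ⟨hτ, hr.le⟩
  have hmid : ∀ x : ℝ × ℝ, ‖T (sph τ r x.1 x.2) ![]‖ₑ ^ 2 ≤ ‖PhiX S true pt(τ,r,x) - chg X.B true S‖ₑ ^ 2 +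
      ‖PhiX S false pt(τ,r,x) - chg X.B false S‖ₑ ^ 2 := fun x => by
    have := mid_sub_le (S := S) pt(τ,r,x) fun b => chg X.B b S; rcases hT with _ | _
    exacts [this.1, this.2]
  have hcT : ContinuousOn (fun x : ℝ × ℝ => T (sph τ r x.1 x.2) ![]) box2 := by
    have h1 := ((continuousOn_Sph h.smooth_rho ![]).comp hc.continuousOn hcl).sub (continuousOn_const (c := (charges X.B S).1))
    have h2 := ((continuousOn_Sph h.smooth_sig ![]).comp hc.continuousOn hcl).sub (continuousOn_const (c := (charges X.B S).2))
    rcases hT with _ | _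
    exacts [h1, h2]
  have hm : ∀ b, AEMeasurable (fun x : ℝ × ℝ => sn x.1 * ‖PhiX S b pt(τ,r,x) - chg X.B b S‖ₑ ^ 2) m2 := fun b => by
    rw [m2_eq]
    have := (((continuousOn_PhiX h b).comp hc.continuousOn hcl).sub (continuousOn_const (c := chg X.B b S))).aemeasurable
      (μ := volume) measurableSet_box2
    exact (Measurable.ennreal_ofReal (by fun_prop)).aemeasurable.mul (this.enorm.pow_const 2)
  have hi : ofReal (r ^ 2)⁻¹ * ofReal (r ^ 2) = 1 := by
    rw [← ofReal_mul (by positivity), inv_mul_cancel₀ (by positivity), ENNReal.ofReal_one]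
  rw [sphInt_eq (F := fun p => X.B.normSq T p / rad p ^ 2)]
  · calc _ = ∫⁻ x, ofReal (r ^ 2)⁻¹ * (sn x.1 * ‖T (sph τ r x.1 x.2) ![]‖ₑ ^ 2) ∂m2 := by
          rw [m2_eq]; refine setLIntegral_congr_fun measurableSet_box2 fun x hx => ?_
          have hs := (Real.sin_pos_of_mem_Ioo hx.1).le; simp only [normSq_scalar]
          rw [hsph, rad_Sph (q := pt(τ,r,x)) hr0.le, ← hsph, sn, ← ofReal_norm,
            ← ofReal_pow (norm_nonneg _), ← ofReal_mul hs, ← ofReal_mul (by positivity)]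
          congr 1; change _ / r ^ 2 * _ = _; ring
      _ ≤ ofReal (r ^ 2)⁻¹ * (∫⁻ x, sn x.1 * ‖PhiX S true pt(τ,r,x) - chg X.B true S‖ₑ ^ 2 ∂m2 +
            ∫⁻ x, sn x.1 * ‖PhiX S false pt(τ,r,x) - chg X.B false S‖ₑ ^ 2 ∂m2) := by
          rw [lintegral_const_mul' _ _ (by finiteness), ← lintegral_add_right' _ (hm false)]
          refine mul_le_mul_right (lintegral_mono fun x => ?_) _; simp only []; rw [← mul_add]
          exact mul_le_mul_right (hmid x) _
      _ ≤ ofReal (r ^ 2)⁻¹ * (C * (ofReal (r ^ 2) * sphInt (X.dens S 1) τ r) +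
            C * (ofReal (r ^ 2) * sphInt (X.dens S 1) τ r)) :=
          mul_le_mul_right (add_le_add (H X hX S h true τ r hτ hr) (H X hX S h false τ r hτ hr)) _
      _ = 2 * C * (ofReal (r ^ 2)⁻¹ * ofReal (r ^ 2)) * sphInt (X.dens S 1) τ r := by ring
      _ = _ := by rw [hi, mul_one]
  · have : ContinuousOn (fun x : ℝ × ℝ => ‖T (sph τ r x.1 x.2) ![]‖ ^ 2 / r ^ 2) box2 := (hcT.norm.pow 2).div_const _
    refine this.congr fun x _ => ?_; simp only [normSq_scalar]; rw [hsph, rad_Sph (q := pt(τ,r,x)) hr0.le]; rfl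

lemma sS_Lb_sub (s : ℤ) (u : X.Sm) : X.sS * (X.Lb true u - X.Lb false u) =
    X.sS * (X.zb false * op X (lt true) s u - X.zb true * op X (lt false) s u)
      + (s : X.Sm) * (2 * X.cS - X.AS * X.sS * X.sS * (X.zeS (-1) - X.zeS 1)) * u := by
  have h1 := X.zeS_zb true
  have h2 := X.zeS_zb false
  rw [op_lt, op_lt]
  simp only [sg, Bool.not_true, Bool.not_false, Bool.false_eq_true, if_true, if_false] at h1 h2 ⊢
  push_cast at h1 h2 ⊢
  linear_combination (-X.sS * (X.Lb true u + (s : X.Sm) * (-(X.cS * X.siS) + X.AS * X.sS * X.zeS (-1)) * u)) * h2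
    + (X.sS * (X.Lb false u + (s : X.Sm) * (X.cS * X.siS + X.AS * X.sS * X.zeS 1) * u)) * h1
    + (2 * (s : X.Sm) * X.cS * u) * X.sS_siS

lemma norm_pd1_alC_le (h : X.B.IsSolution S) (c : Bool) (q : X.dom) (hq : q.1 1 ≤ 17 * X.B.M / 8) :
    ‖(pd 1 (X.alC S c)).1 q‖ ≤ 7 * X.bd S 1 q := by
  have hr := X.r_pos q
  have hM := X.hM
  have hs := X.sin_pos q
  have hri := X.ri_pos q
  have HA := (hypA (n := 1) h q c).2 [] isCan_nil (by simp)
  set u := X.alC S c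
  set K := X.bd S 1 q
  have hK : 0 ≤ K := Real.sqrt_nonneg _
  have ho : ∀ l, ‖(op X l (sg c) u).1 q‖ ≤ K := fun l => by simpa [app, wsp] using HA.1 l
  have h3 : ‖(X.dP u).1 q‖ ≤ K := by
    have : ‖(X.op3 u).1 q‖ ≤ K := HA.2.1
    rwa [op3, neg_ap, norm_neg] at this
  have hu : ‖u.1 q‖ ≤ q.1 1 * K := by
    have : X.ri q * ‖u.1 q‖ ≤ K := HA.2.2
    rwa [ri, inv_mul_le_iff₀ hr] at this
  have hMr : X.B.M * X.ri q ≤ 1 := by rw [ri, ← div_eq_mul_inv, div_le_one hr]; exact (X.r_gt q).le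
  have hrr : X.ri q * q.1 1 = 1 := inv_mul_cancel₀ hr.ne'
  have ha : ‖X.AS.1 q‖ ≤ X.B.M := by rw [AS_ap, norm_mul, norm_I, one_mul, norm_real]; exact X.ha
  have hsS : ‖X.sS.1 q‖ ≤ 1 := by rw [sS_ap, norm_real]; exact Real.abs_sin_le_one _
  have hcS : ‖X.cS.1 q‖ ≤ 1 := by rw [cS_ap, norm_real]; exact Real.abs_cos_le_one _
  have hy : ‖ζ(X).1 q‖ ≤ X.ri q * X.ri q := by
    rw [mul_ap, norm_mul]; exact mul_le_mul (X.norm_zeS 1 q) (X.norm_zeS (-1) q) (norm_nonneg _) hri.le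
  have hD : ‖X.DZS.1 q‖ ≤ 1 := (norm_DZS_le q).trans (pow_le_one₀ (X.de_pos q).le (X.de_le q))
  have hsg : ‖((sg c : ℤ) : ℂ)‖ = 1 := by cases c <;> simp [sg]
  have hg : ‖(((sg c : ℤ) : X.Sm) * X.gamS * u).1 q‖ ≤ 2 * K := by
    have e : ((sg c : ℤ) : X.Sm) * X.gamS * u = (sg c : X.Sm) * (2 * (X.AS * X.cS * X.DZS * ζ(X) * u)) := by
      rw [gamS, DZS]; ring
    rw [e, mul_ap, norm_mul, intCast_ap, hsg, one_mul, mul_ap, norm_mul, ofNat_ap, Complex.norm_ofNat, mul_ap, mul_ap,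
      mul_ap, mul_ap, norm_mul, norm_mul, norm_mul, norm_mul]
    have : ‖X.AS.1 q‖ * ‖X.cS.1 q‖ * ‖X.DZS.1 q‖ * ‖ζ(X).1 q‖ * ‖u.1 q‖ ≤
        X.B.M * 1 * 1 * (X.ri q * X.ri q) * (q.1 1 * K) := by gcongr
    have e2 : X.B.M * 1 * 1 * (X.ri q * X.ri q) * (q.1 1 * K) = (X.B.M * X.ri q) * K := by grind
    have := mul_le_mul_of_nonneg_right hMr hK; linarith
  have hL : ‖(X.sS * (X.Lb true u - X.Lb false u)).1 q‖ ≤ 8 * (q.1 1 * K) := by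
    rw [sS_Lb_sub (sg c), add_ap, mul_ap, mul_ap, mul_ap, sub_ap, sub_ap, mul_ap, mul_ap, mul_ap, intCast_ap]
    refine (norm_add_le _ _).trans ?_; rw [norm_mul, norm_mul, norm_mul, hsg, one_mul]
    have h1 : ‖(X.zb false).1 q * (op X (lt true) (sg c) u).1 q - (X.zb true).1 q * (op X (lt false) (sg c) u).1 q‖ ≤
        4 * (q.1 1 * K) := by
      refine (norm_sub_le _ _).trans ?_; rw [norm_mul, norm_mul]
      have := mul_le_mul (norm_zb_le q false) (ho (lt true)) (norm_nonneg _) (by positivity)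
      have := mul_le_mul (norm_zb_le q true) (ho (lt false)) (norm_nonneg _) (by positivity)
      linarith
    have h2 : ‖(2 : X.Sm).1 q * X.cS.1 q - (X.AS * X.sS * X.sS * (X.zeS (-1) - X.zeS 1)).1 q‖ ≤ 4 := by
      refine (norm_sub_le _ _).trans ?_
      rw [norm_mul, ofNat_ap, Complex.norm_ofNat, mul_ap, mul_ap, mul_ap, sub_ap, norm_mul, norm_mul, norm_mul]
      have := (norm_sub_le ((X.zeS (-1)).1 q) ((X.zeS 1).1 q)).trans (add_le_add (X.norm_zeS (-1) q) (X.norm_zeS 1 q))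
      have : ‖X.AS.1 q‖ * ‖X.sS.1 q‖ * ‖X.sS.1 q‖ * ‖(X.zeS (-1)).1 q - (X.zeS 1).1 q‖ ≤
        X.B.M * 1 * 1 * (X.ri q + X.ri q) := by gcongr
      linarith
    have h3 := mul_le_mul hsS h1 (norm_nonneg _) zero_le_one; have h4 := mul_le_mul h2 hu (norm_nonneg _) (by norm_num)
    linarith
  have h0 : ‖(2 * pd 0 u).1 q‖ ≤ 12 * K := by
    have e : 2 * pd 0 u = op X .f (sg c) u - (sg c : X.Sm) * X.gamS * u + X.AS * ζ(X) *
        (X.sS * (X.Lb true u - X.Lb false u)) - X.DZS * X.dP u := by rw [two_pd0, op]; ring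
    rw [e, sub_ap, add_ap, sub_ap, mul_ap (X.AS * _), mul_ap X.AS, mul_ap X.DZS]
    have h5 : ‖X.AS.1 q * ζ(X).1 q * (X.sS * (X.Lb true u - X.Lb false u)).1 q‖ ≤ 8 * K := by
      rw [norm_mul, norm_mul]
      have : ‖X.AS.1 q‖ * ‖ζ(X).1 q‖ * ‖(X.sS * (X.Lb true u - X.Lb false u)).1 q‖ ≤
        X.B.M * (X.ri q * X.ri q) * (8 * (q.1 1 * K)) := by gcongr
      have e2 : X.B.M * (X.ri q * X.ri q) * (8 * (q.1 1 * K)) = 8 * ((X.B.M * X.ri q) * K) := by grind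
      have := mul_le_mul_of_nonneg_right hMr hK; linarith
    have h6 : ‖X.DZS.1 q * (X.dP u).1 q‖ ≤ 1 * K := by rw [norm_mul]; exact mul_le_mul hD h3 (norm_nonneg _) zero_le_one
    refine (norm_sub_le _ _).trans ((add_le_add ((norm_add_le _ _).trans (add_le_add ((norm_sub_le _ _).trans
      (add_le_add (ho .f) hg)) h5)) h6).trans ?_)
    linarith
  rw [mul_ap, norm_mul, ofNat_ap, Complex.norm_ofNat] at h0
  have e : (pd 1 u).1 q = (X.dP u).1 q + (pd 0 u).1 q := by
    rw [dP_apply, sub_ap, sub_ap, mul_ap, mul_ap, hS_ap, wS_ap, (hgtFun_near hq).1, (hgtFun_near hq).2]; push_cast; ring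
  rw [e]
  refine (norm_add_le _ _).trans ?_
  linarith

variable (X S) in
/-- The component of `r² α` entering the charge. -/
def GX (b : Bool) (q : Pt) : ℂ := (q 1 : ℂ) ^ 2 * (zx b q X.B.a)⁻¹ * lc (!b) q X.B.a S.al

lemma alC_ap (h : X.B.IsSolution S) (b : Bool) (q : X.dom) : (X.alC S !b).1 q = X.GX S b q := by
  rw [alC_eq h, al_vS, mul_ap, mul_ap, pow_ap, rS_ap, vS_ap h, ze_ap, GX]; ring

lemma continuousOn_GX (h : X.B.IsSolution S) (b : Bool) : ContinuousOn (X.GX S b) X.clo := by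
  have := X.continuousOn_zi b
  have := continuousOn_lc h.smooth_al !b
  unfold GX
  fun_prop

lemma trace_le {M : ℝ} (hM : 0 < M) : ∃ C : ℝ≥0∞, C ≠ ⊤ ∧ ∀ X : Adm, X.B.M = M → ∀ S, X.B.IsSolution S → ∀ b,
    ∫⁻ x, sn x.1 * ‖X.GX S b pt(0,X.B.rPlus,x)‖ₑ ^ 2 ∂m2 ≤ C * X.B.sliceInt (X.dens S 1) 0 := by
  set L : ℝ≥0∞ := ofReal (M / 8)
  set D : ℝ≥0∞ := L * ofReal (7 / M) ^ 2
  have hL0 : L ≠ 0 := by simp [L]; linarith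
  have hLt : L ≠ ⊤ := ofReal_ne_top
  have hDt : D ≠ ⊤ := by finiteness
  refine ⟨L⁻¹ * (4 * (1 + D * L) * (32 * ofReal ((3 * M) ^ 2))), ?_, fun X hX S h b => ?_⟩
  · have : L⁻¹ ≠ ⊤ := by simpa using hL0
    finiteness
  set ρ := X.B.rPlus with hρ
  have hρ0 : 0 < ρ := X.rPlus_pos
  have hρM : M ≤ ρ := hX ▸ X.rPlus_ge
  have hρ2 : ρ ≤ 2 * M := hX ▸ X.rPlus_le
  set I := Ioo ρ (ρ + M / 8) with hI
  have hc1 : ∀ x : ℝ × ℝ, Continuous fun r : ℝ => (pt(0,r,x) : Pt) := fun x => continuous_vec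
  have hk : ∀ r ∈ I, ∀ x (hx : x ∈ box2), ‖X.GX S b pt(0,r,x)‖ₑ ≤ X.kap S 0 r x ∧
      ‖X.ext (pd 1 (X.alC S !b)).1 pt(0,r,x)‖ₑ ≤ ofReal (7 / M) * X.kap S 0 r x := by
    intro r hr x hx; have hr0 : 0 < r := hρ0.trans hr.1; set q : X.dom := ⟨_, mem_dom le_rfl hr.1 hx⟩ with hq
    rw [kap_eq le_rfl hr.1 hx, ← ofReal_mul (by positivity), ← ofReal_norm, ← ofReal_norm]
    have h2 : X.ri q * ‖(X.alC S !b).1 q‖ ≤ X.bd S 1 q := ((hypA (n := 1) h q !b).2 [] isCan_nil (by simp)).2.2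
    rw [alC_ap h, ri, inv_mul_le_iff₀ (X.r_pos q)] at h2; refine ⟨ofReal_le_ofReal h2, ofReal_le_ofReal ?_⟩
    have h3 := norm_pd1_alC_le h (!b) q (by rw [hX]; change r ≤ _; linarith [hr.2])
    rw [show X.ext (pd 1 (X.alC S !b)).1 pt(0,r,x) = _ from X.ext_apply _ q]; refine h3.trans ?_
    have hb : 0 ≤ X.bd S 1 q := Real.sqrt_nonneg _; have : 7 * X.bd S 1 q = 7 / M * (M * X.bd S 1 q) := by field_simp
    rw [this]; have : M ≤ r := hρM.trans hr.1.le; gcongr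
  have step : ∀ x ∈ box2, L * ‖X.GX S b pt(0,ρ,x)‖ₑ ^ 2 ≤ 4 * (1 + D * L) * ∫⁻ r in I, X.kap S 0 r x ^ 2 := by
    intro x hx; set A := ∫⁻ r in I, X.kap S 0 r x ^ 2
    have h1 : ∀ r ∈ I, ‖X.GX S b pt(0,ρ,x)‖ₑ ^ 2 ≤ 4 * (X.kap S 0 r x ^ 2 + D * A) := by
      intro r hr
      have hu : ∀ r : ℝ, (fun s => (pt(0,s,x) : Pt)) = update pt(0,r,x) 1 := fun r => by funext s i; fin_cases i <;> rfl
      have h2 := enorm_sub_sq_le (g := fun s => X.GX S b pt(0,s,x))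
        (g' := fun s => X.ext (pd 1 (X.alC S !b)).1 pt(0,s,x)) hr.1.le
        ((continuousOn_GX h b).comp (hc1 x).continuousOn fun s hs => ⟨le_rfl, hs.1⟩)
        (fun s hs => by
          set q : X.dom := ⟨_, mem_dom le_rfl hs.1 hx⟩
          have := hasDerivAt_coord (X.alC S !b) (alC_ap h b) q (i := 1) (by decide)
          rw [show X.ext (pd 1 (X.alC S !b)).1 pt(0,s,x) = _ from X.ext_apply _ q]
          exact (congrArg (fun g : ℝ → Pt => HasDerivAt (fun s => X.GX S b (g s)) ((pd 1 (X.alC S !b)).1 q) s)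
            (hu s)).mpr this)
        ((X.contDiffOn_ext _).continuousOn.comp (hc1 x).continuousOn fun s hs => mem_dom le_rfl hs.1 hx)
      have h3 : ofReal (r - ρ) * ∫⁻ s in Ioo ρ r, ‖X.ext (pd 1 (X.alC S !b)).1 pt(0,s,x)‖ₑ ^ 2 ≤ D * A := by
        rw [mul_assoc]; refine mul_le_mul' (ofReal_le_ofReal (by linarith [hr.2])) ?_
        rw [← lintegral_const_mul' _ _ (by finiteness)]
        refine (lintegral_mono_set (Set.Ioo_subset_Ioo_right hr.2.le)).trans
          (setLIntegral_mono' measurableSet_Ioo fun s hs => ?_)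
        rw [← mul_pow]; exact pow_le_pow_left' (hk s hs x hx).2 2
      calc _ = ‖X.GX S b pt(0,r,x) + -(X.GX S b pt(0,r,x) - X.GX S b pt(0,ρ,x))‖ₑ ^ 2 := by
            congr 2; ring
        _ ≤ (‖X.GX S b pt(0,r,x)‖ₑ + ‖X.GX S b pt(0,r,x) - X.GX S b pt(0,ρ,x)‖ₑ) ^ 2 := by
            refine pow_le_pow_left' ((enorm_add_le _ _).trans ?_) 2; rw [enorm_neg]
        _ ≤ _ := enn_add_sq _ _
        _ ≤ _ := by
            gcongr
            · exact (hk r hr x hx).1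
            · exact h2.trans h3
    calc _ = ∫⁻ r in I, ‖X.GX S b pt(0,ρ,x)‖ₑ ^ 2 := by
          rw [lintegral_const, Measure.restrict_apply_univ, hI, Real.volume_Ioo, add_sub_cancel_left, mul_comm]
      _ ≤ ∫⁻ r in I, 4 * (X.kap S 0 r x ^ 2 + D * A) := setLIntegral_mono' measurableSet_Ioo h1
      _ = 4 * (A + D * A * L) := by
          rw [lintegral_const_mul' _ _ (by simp), lintegral_add_right _ measurable_const, lintegral_const,
            Measure.restrict_apply_univ, hI, Real.volume_Ioo, add_sub_cancel_left]
      _ = _ := by ring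
  have hmeas : AEMeasurable (Function.uncurry fun (x : ℝ × ℝ) (r : ℝ) => sn x.1 * X.kap S 0 r x ^ 2)
      (m2.prod (volume.restrict I)) := by
    rw [m2_eq, Measure.prod_restrict]; have hc : Continuous fun z : (ℝ × ℝ) × ℝ => sph 0 z.2 z.1.1 z.1.2 := continuous_vec
    have hd : ContinuousOn (fun z : (ℝ × ℝ) × ℝ => X.dens S 1 (sph 0 z.2 z.1.1 z.1.2)) (box2 ×ˢ I) :=
      (continuousOn_dens h 1).comp hc.continuousOn fun z hz => X.Sph_mem_off (mem_dom le_rfl hz.2.1 hz.1)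
    have hd' := (continuousOn_snd.mul (continuousOn_const (c := (2 : ℝ) ^ (1 + 4)).mul hd).sqrt).aemeasurable
      (μ := volume) (measurableSet_box2.prod measurableSet_Ioo)
    exact (Measurable.ennreal_ofReal (by fun_prop)).aemeasurable.mul (hd'.ennreal_ofReal.pow_const 2)
  have hfin : L * ∫⁻ x, sn x.1 * ‖X.GX S b pt(0,ρ,x)‖ₑ ^ 2 ∂m2 ≤
      4 * (1 + D * L) * (32 * ofReal ((3 * M) ^ 2)) * X.B.sliceInt (X.dens S 1) 0 := by
    calc _ = ∫⁻ x, sn x.1 * (L * ‖X.GX S b pt(0,ρ,x)‖ₑ ^ 2) ∂m2 := by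
          rw [← lintegral_const_mul' _ _ hLt]; exact lintegral_congr fun x => by ring
      _ ≤ ∫⁻ x, 4 * (1 + D * L) * (∫⁻ r in I, sn x.1 * X.kap S 0 r x ^ 2) ∂m2 := by
          rw [m2_eq]; refine setLIntegral_mono' measurableSet_box2 fun x hx => ?_
          rw [lintegral_const_mul' (sn x.1) (fun r => X.kap S 0 r x ^ 2) ofReal_ne_top, mul_left_comm _ (sn x.1)]
          exact mul_le_mul_right (step x hx) _
      _ = 4 * (1 + D * L) * ∫⁻ r in I, (∫⁻ x, sn x.1 * X.kap S 0 r x ^ 2 ∂m2) := by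
          rw [lintegral_const_mul' _ _ (by finiteness), lintegral_lintegral_swap hmeas]
      _ ≤ 4 * (1 + D * L) * ∫⁻ r in I, 32 * ofReal ((3 * M) ^ 2) * sphInt (X.dens S 1) 0 r := by
          refine mul_le_mul_right (setLIntegral_mono' measurableSet_Ioo fun r hr => ?_) _
          rw [lintegral_kap h le_rfl hr.1, ← mul_assoc]; have h1 : 0 < r := hρ0.trans hr.1
          have h2 : r ≤ 3 * M := by linarith [hr.2]
          gcongr
      _ ≤ _ := by
          rw [lintegral_const_mul' _ _ (by finiteness), ← mul_assoc]
          exact mul_le_mul_right (lintegral_mono_set Set.Ioo_subset_Ioi_self) _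
  calc _ = L⁻¹ * (L * ∫⁻ x, sn x.1 * ‖X.GX S b pt(0,ρ,x)‖ₑ ^ 2 ∂m2) := by
        rw [← mul_assoc, ENNReal.inv_mul_cancel hL0 hLt, one_mul]
    _ ≤ _ := by rw [mul_assoc]; exact mul_le_mul_right hfin _

lemma sphInt_normSq {T : Tens 0} (hT : X.B.IsSmooth T) {t r : ℝ} (ht : 0 ≤ t) (hr : X.B.rPlus ≤ r) :
    sphInt (X.B.normSq T) t r = ∫⁻ x, sn x.1 * ‖T (Sph pt(t,r,x)) ![]‖ₑ ^ 2 ∂m2 := by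
  have hc : Continuous fun x : ℝ × ℝ => (pt(t,r,x) : Pt) := continuous_vec
  have h1 : ContinuousOn (fun x : ℝ × ℝ => T (Sph pt(t,r,x)) ![]) box2 :=
    (continuousOn_Sph hT ![]).comp hc.continuousOn fun x _ => ⟨ht, hr⟩
  rw [sphInt_eq ((h1.norm.pow 2).congr fun x _ => normSq_scalar _ _ _), m2_eq]
  refine setLIntegral_congr_fun measurableSet_box2 fun x hx => ?_
  have hs := (Real.sin_pos_of_mem_Ioo hx.1).le
  simp only [normSq_scalar]
  rw [sn, ← ofReal_norm, ← ofReal_pow (norm_nonneg _), ← ofReal_mul hs, mul_comm]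
  rfl

lemma Del_rPlus : ((X.B.rPlus : ℝ) : ℂ) ^ 2 - 2 * X.B.M * X.B.rPlus + X.B.a ^ 2 = 0 := by
  have := Real.sq_sqrt X.beta_nonneg
  have e : X.B.rPlus ^ 2 - 2 * X.B.M * X.B.rPlus + X.B.a ^ 2 = 0 := by rw [Background.rPlus]; linear_combination this
  exact_mod_cast e

lemma chg_sq_le {M : ℝ} (hM : 0 < M) : ∃ C : ℝ≥0∞, C ≠ ⊤ ∧ ∀ X : Adm, X.B.M = M → ∀ S, X.B.IsSolution S → ∀ b,
    ‖chg X.B b S‖ₑ ^ 2 ≤ C * (X.B.horizonL2 S.rho 0 + X.B.horizonL2 S.sig 0 +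
      (X.B.energyAl 2 S.al 0 + X.B.energyUAl 2 S.ual 0)) := by
  obtain ⟨C, hC, H⟩ := trace_le hM
  refine ⟨m2 Set.univ * (4 * (4 + C)), ?_, fun X hX S h b => ?_⟩
  · have := measure_ne_top m2 Set.univ
    finiteness
  set ρ := X.B.rPlus with hρ
  have hρ0 : 0 < ρ := X.rPlus_pos
  have hρM : X.B.M ≤ ρ := X.rPlus_ge
  set Φ : ℝ × ℝ → ℂ := fun x => PhiX S b pt(0,ρ,x)
  set G : ℝ × ℝ → ℂ := fun x => X.GX S b pt(0,ρ,x)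
  have hc : Continuous fun x : ℝ × ℝ => (pt(0,ρ,x) : Pt) := continuous_vec
  have hcl : Set.MapsTo (fun x : ℝ × ℝ => (pt(0,ρ,x) : Pt)) box2 X.clo := fun x _ => ⟨le_rfl, le_rfl⟩
  have hsn : AEMeasurable (fun x : ℝ × ℝ => sn x.1) m2 := (Measurable.ennreal_ofReal (by fun_prop)).aemeasurable
  have hmm : ∀ {F : Pt → ℂ}, ContinuousOn F X.clo → AEMeasurable (fun x : ℝ × ℝ => ‖F pt(0,ρ,x)‖ₑ) m2 := fun hF => by
      rw [m2_eq]; exact ((hF.comp hc.continuousOn hcl).aemeasurable measurableSet_box2).enorm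
  have mΦ : AEMeasurable (fun x => ‖Φ x‖ₑ) m2 := hmm (continuousOn_PhiX h b)
  have mG : AEMeasurable (fun x => ‖G x‖ₑ) m2 := hmm (continuousOn_GX h b)
  have mσ : AEMeasurable (fun x : ℝ × ℝ => ‖S.sig (Sph pt(0,ρ,x)) ![]‖ₑ) m2 := hmm (continuousOn_Sph h.smooth_sig ![])
  have mG' : AEMeasurable (fun x => sn x.1 * ‖G x‖ₑ ^ 2) m2 := hsn.mul (mG.pow_const 2)
  have mσ' : AEMeasurable (fun x => sn x.1 * ‖S.sig (Sph pt(0,ρ,x)) ![]‖ₑ ^ 2) m2 := hsn.mul (mσ.pow_const 2)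
  have hI : ∀ x ∈ box2, ‖IX X.B S b pt(0,ρ,x)‖ₑ ≤ 2 * (sn x.1 * (‖Φ x‖ₑ + ‖G x‖ₑ)) := by
    intro x hx; have hs := (Real.sin_pos_of_mem_Ioo hx.1).le
    rw [sn, ← ofReal_norm, ← ofReal_norm, ← ofReal_norm, ← ofReal_add (norm_nonneg _) (norm_nonneg _),
      ← ofReal_mul hs, show (2 : ℝ≥0∞) = ofReal 2 by simp, ← ofReal_mul (by norm_num)]
    refine ofReal_le_ofReal ?_; set q : Pt := pt(0,ρ,x) with hq
    have hw := norm_weight_le (X := X) b (q := q) hρM hs; have hz := zx_ne b (q := q) hρ0 X.B.a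
    have hD : DzX X.B b q = 0 := by rw [DzX, show q 1 = X.B.rPlus from rfl, Del_rPlus, zero_mul, zero_mul]
    have hr' : ((q 1 : ℝ) : ℂ) ≠ 0 := by exact_mod_cast hρ0.ne'
    have e : IX X.B S b q = (sin (q 2) : ℂ) * ((q 1 : ℂ) ^ 2 + X.B.a ^ 2) * (zx b q X.B.a)⁻¹ ^ 2 * PhiX S b q -
        1 / 2 * sg b * (I * X.B.a) * (sin (q 2) : ℂ) ^ 2 * (zx b q X.B.a * (q 1 : ℂ)⁻¹ ^ 2 * X.GX S b q) := by
      rw [IX, hD, GX]; field_simp; ring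
    have h4 : ‖1 / 2 * sg b * (I * X.B.a) * (sin (q 2) : ℂ) ^ 2 * (zx b q X.B.a * (q 1 : ℂ)⁻¹ ^ 2 * X.GX S b q)‖
        ≤ sin x.1 * ‖X.GX S b q‖ := by
      have h5 : ‖zx b q X.B.a‖ ≤ 2 * ρ := by
        have ha : |X.B.a| ≤ X.B.M := X.ha; rw [zx]; refine (norm_add_le _ _).trans ?_
        rw [norm_mul, norm_mul, norm_mul, norm_I, norm_real, norm_real, norm_real,
          show q 1 = ρ from rfl, norm_of_nonneg hρ0.le]
        have : ‖((sg b : ℤ) : ℂ)‖ = 1 := by cases b <;> simp [sg]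
        rw [this, Real.norm_eq_abs, Real.norm_eq_abs]
        nlinarith [Real.abs_cos_le_one (q 2), abs_nonneg X.B.a, abs_nonneg (cos (q 2))]
      have : ‖1 / 2 * sg b * (I * X.B.a) * (sin (q 2) : ℂ) ^ 2 * (zx b q X.B.a * (q 1 : ℂ)⁻¹ ^ 2 * X.GX S b q)‖
          = 1 / 2 * |X.B.a| * sin x.1 ^ 2 * (‖zx b q X.B.a‖ * ρ⁻¹ ^ 2 * ‖X.GX S b q‖) := by
        simp only [norm_mul, norm_pow, norm_inv, norm_real, norm_I, Real.norm_eq_abs,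
          show q 1 = ρ from rfl, show q 2 = x.1 from rfl, abs_of_nonneg hs, abs_of_pos hρ0]
        cases b <;> simp [sg]
      rw [this]
      calc _ ≤ 1 / 2 * ρ * (sin x.1 * 1) * (2 * ρ * ρ⁻¹ ^ 2 * ‖X.GX S b q‖) := by
            rw [sq (sin _)]; gcongr
            · exact X.ha.trans hρM
            · exact Real.sin_le_one _
        _ = _ := by field_simp
    rw [e]; refine (norm_sub_le _ _).trans ?_; rw [norm_mul _ (PhiX S b q)]
    have := mul_le_mul_of_nonneg_right hw (norm_nonneg (PhiX S b q)); have h6 := mul_nonneg hs (norm_nonneg (X.GX S b q))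
    change _ ≤ 2 * sin x.1 * _ at this; linarith
  have h1 : ‖chg X.B b S‖ₑ ≤ ∫⁻ x, sn x.1 * (‖Φ x‖ₑ + ‖G x‖ₑ) ∂m2 := by
    rw [chg, enorm_mul]; refine le_trans ?_ ((mul_le_mul_left enorm_inv_four_pi _).trans_eq (one_mul _)); rw [mul_assoc]
    refine mul_le_mul_right ((enorm_integral_le_lintegral_enorm _).trans ?_) _
    rw [← lintegral_const_mul' _ _ (by simp), m2_eq]
    exact setLIntegral_mono' measurableSet_box2 hI
  have h2 : ∀ x, (sn x.1 * (‖Φ x‖ₑ + ‖G x‖ₑ)) ^ 2 ≤ 4 * (4 * (sn x.1 * ‖S.rho (Sph pt(0,ρ,x)) ![]‖ₑ ^ 2 +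
      sn x.1 * ‖S.sig (Sph pt(0,ρ,x)) ![]‖ₑ ^ 2) + sn x.1 * ‖G x‖ₑ ^ 2) := fun x => by
    have e1 : sn x.1 ^ 2 ≤ sn x.1 := by rw [sq]; exact mul_le_of_le_one_left' (sn_le_one _)
    have e2 : ‖Φ x‖ₑ ^ 2 ≤ 4 * (‖S.rho (Sph pt(0,ρ,x)) ![]‖ₑ ^ 2 + ‖S.sig (Sph pt(0,ρ,x)) ![]‖ₑ ^ 2) := by
      refine (pow_le_pow_left' (enorm_add_le _ _) 2).trans ((enn_add_sq _ _).trans (le_of_eq ?_)); rw [enorm_mul]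
      have : ‖(sg b : ℂ) * I‖ₑ = 1 := by rw [← ofReal_norm]; cases b <;> simp [sg]
      rw [this, one_mul]
    rw [mul_pow]
    calc _ ≤ sn x.1 * (4 * (4 * (‖S.rho (Sph pt(0,ρ,x)) ![]‖ₑ ^ 2 + ‖S.sig (Sph pt(0,ρ,x)) ![]‖ₑ ^ 2)
            + ‖G x‖ₑ ^ 2)) := mul_le_mul' e1 ((enn_add_sq _ _).trans (by gcongr))
      _ = _ := by ring
  calc _ ≤ _ := pow_le_pow_left' h1 2
    _ ≤ m2 Set.univ * ∫⁻ x, 4 * (4 * (sn x.1 * ‖S.rho (Sph pt(0,ρ,x)) ![]‖ₑ ^ 2 +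
      sn x.1 * ‖S.sig (Sph pt(0,ρ,x)) ![]‖ₑ ^ 2) + sn x.1 * ‖G x‖ₑ ^ 2) ∂m2 :=
        (lintegral_sq_le (hsn.mul (mΦ.add mG))).trans (mul_le_mul_right (lintegral_mono h2) _)
    _ = m2 Set.univ * (4 * (4 * (X.B.horizonL2 S.rho 0 + X.B.horizonL2 S.sig 0) + ∫⁻ x, sn x.1 * ‖G x‖ₑ ^ 2 ∂m2)) := by
        rw [lintegral_const_mul' _ _ (by simp), lintegral_add_right' _ mG',
          lintegral_const_mul' _ _ (by simp), lintegral_add_right' _ mσ', horizonL2, horizonL2,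
          sphInt_normSq h.smooth_rho le_rfl le_rfl, sphInt_normSq h.smooth_sig le_rfl le_rfl]
    _ ≤ m2 Set.univ * (4 * (4 * (X.B.horizonL2 S.rho 0 + X.B.horizonL2 S.sig 0) +
          C * (X.B.energyAl 2 S.al 0 + X.B.energyUAl 2 S.ual 0))) := by
        have := H X hX S h b; rw [sliceInt_dens h 1 le_rfl] at this; gcongr
    _ ≤ _ := by
        rw [mul_assoc, mul_assoc]; refine mul_le_mul_right (mul_le_mul_right ?_ _) _; rw [mul_add (4 + C)]
        exact add_le_add (mul_le_mul_left le_self_add _) (mul_le_mul_left le_add_self _)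

lemma cov_sub_const (B : Background) (T : Tens 0) (c : ℂ) : B.cov (T - fun _ _ => c) = B.cov T := by
  funext p I
  simp only [Background.cov, Pi.sub_apply, fderivWithin_sub_const, Finset.univ_eq_empty, Finset.sum_empty]

lemma shift_isSolution (h : X.B.IsSolution S) (q : ℂ × ℂ) : X.B.IsSolution (shift S q) := by
  have ea : (shift S q).al = S.al := sub_zero _
  have eu : (shift S q).ual = S.ual := sub_zero _
  have e : ∀ (T : Tens 0) (c : ℂ), X.B.nab3 (T - fun _ _ => c) = X.B.nab3 T ∧ X.B.nab4 (T - fun _ _ => c) = X.B.nab4 T ∧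
      X.B.nab (T - fun _ _ => c) = X.B.nab T := fun T c => by
    simp only [nab3, nab4, nabAlong, nab, cov_sub_const, and_self]
  constructor
  · rw [ea]; exact h.smooth_al
  · rw [eu]; exact h.smooth_ual
  · exact fun I => (h.smooth_rho I).sub contDiffOn_const
  · exact fun I => (h.smooth_sig I).sub contDiffOn_const
  · rw [ea]; exact h.horizontal_al
  · rw [eu]; exact h.horizontal_ual
  · rw [eu, show X.B.nab3 (shift S q).sig = _ from (e S.sig q.2).1]; exact h.nab3_sig
  · rw [eu, show X.B.nab3 (shift S q).rho = _ from (e S.rho q.1).1]; exact h.nab3_rho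
  · rw [ea, show X.B.nab4 (shift S q).sig = _ from (e S.sig q.2).2.1]; exact h.nab4_sig
  · rw [ea, show X.B.nab4 (shift S q).rho = _ from (e S.rho q.1).2.1]; exact h.nab4_rho
  · rw [ea, eu, show X.B.nab (shift S q).sig = _ from (e S.sig q.2).2.2]; exact h.nab_sig
  · rw [ea, eu, show X.B.nab (shift S q).rho = _ from (e S.rho q.1).2.2]; exact h.nab_rho

lemma energyAl_mono (B : Background) {J J' : ℕ} (hJ : J ≤ J') (T : Tens 1) (τ : ℝ) :
    B.energyAl J T τ ≤ B.energyAl J' T τ ∧ B.energyUAl J T τ ≤ B.energyUAl J' T τ := by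
  have : Background.orders (J - 1) ⊆ Background.orders (J' - 1) := fun j hj => by
    simp only [Background.orders, Finset.mem_filter, Finset.mem_product, Finset.mem_range] at hj ⊢; omega
  exact ⟨Finset.sum_le_sum_of_subset this, Finset.sum_le_sum_of_subset this⟩

lemma sliceInt_const_le {M : ℝ} (hM : 0 < M) : ∃ C : ℝ≥0∞, C ≠ ⊤ ∧ ∀ X : Adm, X.B.M = M → ∀ (c : ℂ) τ, 
    X.B.sliceInt (fun p => ‖c‖ ^ 2 / rad p ^ 2) τ ≤ C * ‖c‖ₑ ^ 2 := by
  have hi := (integrableOn_Ioi_rpow_of_lt (show (-2 : ℝ) < -1 by norm_num) hM).lintegral_lt_top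
  refine ⟨m2 Set.univ * ∫⁻ r in Set.Ioi M, ofReal (r ^ (-2 : ℝ)),
    ENNReal.mul_ne_top (measure_ne_top _ _) hi.ne, fun X hX c τ => ?_⟩
  have h1 : ∀ r ∈ Set.Ioi X.B.rPlus, sphInt (fun p => ‖c‖ ^ 2 / rad p ^ 2) τ r ≤
      m2 Set.univ * ‖c‖ₑ ^ 2 * ofReal (r ^ (-2 : ℝ)) := by
    intro r hr; have hr0 := X.rPlus_pos.trans hr
    have e : ∀ x : ℝ × ℝ, rad (sph τ r x.1 x.2) = r := fun x => rad_Sph (q := pt(τ,r,x)) hr0.le; rw [sphInt_eq]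
    · simp only [e]; rw [mul_assoc, mul_comm (m2 _), ← lintegral_const, m2_eq]
      refine setLIntegral_mono' measurableSet_box2 fun x hx => ?_
      rw [← ofReal_norm, ← ofReal_pow (norm_nonneg _), ← ofReal_mul (by positivity),
        Real.rpow_neg hr0.le, Real.rpow_ofNat, ← div_eq_mul_inv]
      exact ofReal_le_ofReal (mul_le_of_le_one_right (by positivity) (Real.sin_le_one _))
    · simp only [e]; exact continuousOn_const
  refine (setLIntegral_mono' measurableSet_Ioi h1).trans ?_
  rw [lintegral_const_mul' _ _ (by have := measure_ne_top m2 Set.univ; finiteness), mul_right_comm]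
  exact mul_le_mul_left (mul_le_mul_right (lintegral_mono_set (Set.Ioi_subset_Ioi (hX ▸ X.rPlus_ge))) _) _

lemma charges_sq_le (B : Background) (D : MaxwellFields) :
    ‖(charges B D).1‖ₑ ^ 2 ≤ ‖chg B true D‖ₑ ^ 2 + ‖chg B false D‖ₑ ^ 2 ∧
      ‖(charges B D).2‖ₑ ^ 2 ≤ ‖chg B true D‖ₑ ^ 2 + ‖chg B false D‖ₑ ^ 2 := by
  constructor
  · exact enorm_half_mul_sq _ _ _ (by simp)
  · have := enorm_half_mul_sq (-(1 / 2 * I)) (chg B true D) (-chg B false D) (by simp)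
    rwa [enorm_neg, ← sub_eq_add_neg, neg_mul] at this

lemma sliceInt_add_const_le {T : Tens 0} (hT : X.B.IsSmooth T) (c : ℂ) {τ : ℝ} (hτ : 0 ≤ τ) :
    X.B.sliceInt (fun p => X.B.normSq T p / rad p ^ 2) τ ≤
      2 * (X.B.sliceInt (fun p => X.B.normSq (T - fun _ _ => c) p / rad p ^ 2) τ +
        X.B.sliceInt (fun p => ‖c‖ ^ 2 / rad p ^ 2) τ) := by
  have hs : X.TSf (T - fun _ _ => c) := Sf_of_isSmooth fun I => (hT I).sub contDiffOn_const
  have c1 : ContinuousOn (fun p => X.B.normSq (T - fun _ _ => c) p / rad p ^ 2) X.off :=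
    (continuousOn_normSq hs).mul (X.continuousOn_radInv 2)
  have c2 : ContinuousOn (fun p => ‖c‖ ^ 2 / rad p ^ 2) X.off := continuousOn_const.mul (X.continuousOn_radInv 2)
  rw [← sliceInt_add hτ c1 c2 (fun p _ => div_nonneg (by rw [normSq_scalar]; positivity) (sq_nonneg _))
    (fun p _ => by positivity), show (2 : ℝ≥0∞) = ofReal 2 by simp]
  refine sliceInt_mono hτ zero_le_two fun q => ?_
  simp only [normSq_scalar, Pi.sub_apply]
  rw [← add_div, ← mul_div_assoc]
  refine div_le_div_of_nonneg_right ?_ (sq_nonneg _)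
  have h1 := norm_add_le (T (Sph q) ![] - c) c
  rw [sub_add_cancel] at h1
  nlinarith [sq_nonneg (‖T (Sph q) ![] - c‖ - ‖c‖), norm_nonneg (T (Sph q) ![])]

/-- The estimates of the middle components by the energies of the extremal ones. -/
theorem energyMid_le {M : ℝ} (hM : 0 < M) (J : ℕ) : ∃ K : ℝ≥0∞, K ≠ ⊤ ∧ ∀ X : Adm, X.B.M = M → ∀ S, X.B.IsSolution S →
    ∀ τ, 0 ≤ τ → (X.B.energyMid J S.rho τ + X.B.energyMid J S.sig τ ≤ K * (X.B.horizonL2 S.rho 0 + X.B.horizonL2 S.sig 0 +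
        (X.B.energyAl (J + 2) S.al 0 + X.B.energyUAl (J + 2) S.ual 0) +
        (X.B.energyAl (J + 2) S.al τ + X.B.energyUAl (J + 2) S.ual τ))) ∧
      (X.B.energyMid J (shift S (charges X.B S)).rho τ + X.B.energyMid J (shift S (charges X.B S)).sig τ ≤
        K * (X.B.energyAl (J + 2) S.al τ + X.B.energyUAl (J + 2) S.ual τ)) := by
  obtain ⟨C₁, hC₁, H₁⟩ := energyMid_deriv_le hM J
  obtain ⟨C₂, hC₂, H₂⟩ := slice_mid_le hM
  obtain ⟨C₃, hC₃, H₃⟩ := chg_sq_le hM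
  obtain ⟨C₄, hC₄, H₄⟩ := sliceInt_const_le hM
  refine ⟨2 * (ofReal C₁ + 2 * C₂ + 2 * (C₄ * (2 * C₃))), by finiteness, fun X hX S h τ hτ => ?_⟩
  set F := X.B.horizonL2 S.rho 0 + X.B.horizonL2 S.sig 0
  set E₀ := X.B.energyAl (J + 2) S.al 0 + X.B.energyUAl (J + 2) S.ual 0
  set E := X.B.energyAl (J + 2) S.al τ + X.B.energyUAl (J + 2) S.ual τ
  have hm : ∀ t, X.B.energyAl 2 S.al t + X.B.energyUAl 2 S.ual t ≤
      X.B.energyAl (J + 2) S.al t + X.B.energyUAl (J + 2) S.ual t := fun t =>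
    add_le_add (energyAl_mono _ (Nat.le_add_left _ _) _ _).1 (energyAl_mono _ (Nat.le_add_left _ _) _ _).2
  set S' := shift S (charges X.B S) with hS'
  have h' : X.B.IsSolution S' := shift_isSolution h _
  have ea : S'.al = S.al := sub_zero _
  have eu : S'.ual = S.ual := sub_zero _
  have z' : ∀ T, IsMid S' T → X.B.sliceInt (fun p => X.B.normSq T p / rad p ^ 2) τ ≤ C₂ * E := fun T hT =>
    (H₂ X hX S h T hT τ hτ).trans (mul_le_mul_right (hm τ) _)
  have d' : ∀ T, IsMid S' T → X.B.energyMid J T τ ≤ (ofReal C₁ + C₂) * E := fun T hT => by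
    rw [add_mul]; refine add_le_add ?_ (z' T hT); have := H₁ X hX S' h' T hT τ hτ
    rwa [ea, eu] at this
  have hq : ‖chg X.B true S‖ₑ ^ 2 + ‖chg X.B false S‖ₑ ^ 2 ≤ 2 * C₃ * (F + E₀) := by
    rw [two_mul, add_mul]
    exact add_le_add ((H₃ X hX S h true).trans (mul_le_mul_right (add_le_add_right (hm 0) _) _))
      ((H₃ X hX S h false).trans (mul_le_mul_right (add_le_add_right (hm 0) _) _))
  have d : ∀ T, IsMid S T → X.B.energyMid J T τ ≤ (ofReal C₁ + 2 * C₂) * E + 2 * (C₄ * (2 * C₃)) * (F + E₀) := by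
    intro T hT
    have hz : X.B.sliceInt (fun p => X.B.normSq T p / rad p ^ 2) τ ≤ 2 * (C₂ * E + C₄ * (2 * C₃ * (F + E₀))) := by
      rcases hT with _ | _
      · exact (sliceInt_add_const_le h.smooth_rho (charges X.B S).1 hτ).trans (mul_le_mul_right (add_le_add (z' _ .rho)
          ((H₄ X hX _ τ).trans (mul_le_mul_right ((charges_sq_le _ _).1.trans hq) _))) _)
      · exact (sliceInt_add_const_le h.smooth_sig (charges X.B S).2 hτ).trans (mul_le_mul_right (add_le_add (z' _ .sig)
          ((H₄ X hX _ τ).trans (mul_le_mul_right ((charges_sq_le _ _).2.trans hq) _))) _)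
    refine (add_le_add (H₁ X hX S h T hT τ hτ) hz).trans (le_of_eq ?_); ring
  constructor
  · refine (add_le_add (d _ .rho) (d _ .sig)).trans ?_; rw [← two_mul, mul_assoc 2 (_ + _ + _)]; refine mul_le_mul_right ?_ _
    rw [mul_add _ (F + E₀) E, add_comm]; exact add_le_add (mul_le_mul_left le_add_self _) (mul_le_mul_left le_self_add _)
  · refine (add_le_add (d' _ .rho) (d' _ .sig)).trans ?_; rw [← two_mul, ← mul_assoc]
    refine mul_le_mul_left (mul_le_mul_right (le_add_right (add_le_add_right ?_ _)) _) _; rw [two_mul]; exact le_self_add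

lemma charges_im (B : Background) {D : MaxwellFields} (hD : D.IsReal) : (charges B D).1.im = 0 ∧ (charges B D).2.im = 0 := by
  rw [charges, show chg B false D = _ from (chg_conj B hD true).symm]
  constructor <;> simp

lemma charges_seed : charges X.B (X.B.seed S) = charges X.B S := by simp only [charges, chg_seed]

end Adm

end

end Kerr

theorem theorem5p3 (M η : ℝ) (hM : 0 < M) (hη : 0 < η) (hη' : η < 1) (m : ℤ)
    (ι f : ℝ → ℝ) (hι : Kerr.IsStarCutoff M ι) (hf : Kerr.IsHeight M f)
    (Dbdd Ddec uDbdd uDdec : Kerr.DataEnergy)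
    (hconj : Kerr.TeukolskyConjecture M η m ι f Dbdd Ddec uDbdd uDdec) :
    ∃ q : ℝ → Kerr.MaxwellFields → ℂ × ℂ,
      (∀ a D, Kerr.MaxwellFields.IsReal D → (q a D).1.im = 0 ∧ (q a D).2.im = 0) ∧
      ∃ Jmin : ℕ, 1 ≤ Jmin ∧ ∀ J₁, Jmin ≤ J₁ → ∃ J₂ J₃ : ℕ, J₁ ≤ J₂ ∧ J₁ ≤ J₃ ∧
      ∃ C : ℝ, 0 < C ∧
        ∀ a : ℝ, |a| ≤ M → ∀ (B : Kerr.Background), B = ⟨M, a, ι, f⟩ →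
        ∀ S : Kerr.MaxwellFields, B.IsSolution S → (B.seed S).HasMode m →
        ∀ S' : Kerr.MaxwellFields,
          S' = S.sub (Kerr.MaxwellFields.stationary (q a (B.seed S)).1 (q a (B.seed S)).2) →
        S'.al = S.al ∧ S'.ual = S.ual ∧ ∀ τ : ℝ, 0 ≤ τ →
          -- degenerate energy boundedness
          B.energyAl J₁ S.al τ ≤ ENNReal.ofReal C * Dbdd a J₂ (B.seed S) ∧
          B.energyUAl J₁ S.ual τ ≤ ENNReal.ofReal C * uDbdd a J₂ (B.seed S) ∧
          B.energyMid J₁ S.rho τ + B.energyMid J₁ S.sig τ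
            ≤ ENNReal.ofReal C * (B.horizonL2 S.rho 0 + B.horizonL2 S.sig 0)
              + ENNReal.ofReal C * (Ddec a J₃ (B.seed S) + Dbdd a J₂ (B.seed S))
              + ENNReal.ofReal C * (uDdec a J₃ (B.seed S) + uDbdd a J₂ (B.seed S)) ∧
          -- degenerate energy decay of the extremal components
          B.energyAl J₁ S'.al τ
            ≤ ENNReal.ofReal (C / (1 + τ) ^ (1 - η)) * Ddec a J₃ (B.seed S) ∧
          B.energyUAl J₁ S'.ual τ
            ≤ ENNReal.ofReal (C / (1 + τ) ^ (1 - η)) * uDdec a J₃ (B.seed S) ∧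
          -- degenerate energy decay of the middle components
          B.energyMid J₁ S'.rho τ + B.energyMid J₁ S'.sig τ
            ≤ ENNReal.ofReal (C / (1 + τ) ^ (1 - η)) *
                (Ddec a J₃ (B.seed S) + Dbdd a J₂ (B.seed S))
              + ENNReal.ofReal (C / (1 + τ) ^ (1 - η)) *
                (uDdec a J₃ (B.seed S) + uDbdd a J₂ (B.seed S)) := by
  obtain ⟨Jmin, hJ, H⟩ := hconj
  refine ⟨fun a D => Kerr.Adm.charges ⟨M, a, ι, f⟩ D, fun a D hD => Kerr.Adm.charges_im _ hD, Jmin, hJ,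
    fun J₁ hJ₁ => ?_⟩
  obtain ⟨J₂, J₃, h₂, h₃, c, hc, H⟩ := H (J₁ + 2) (by omega)
  obtain ⟨K, hK, HK⟩ := Kerr.Adm.energyMid_le hM J₁
  lift K to NNReal using hK
  refine ⟨J₂, J₃, by omega, by omega, c + K + 2 * K * c, by positivity, fun a ha B hB S hS hm S' hS' => ?_⟩
  let X : Kerr.Adm := ⟨⟨M, a, ι, f⟩, hM, ha, hι, hf⟩
  obtain rfl : B = X.B := hB
  have hS'' : S' = Kerr.Adm.shift S (Kerr.Adm.charges X.B S) := by
    rw [hS']; exact congrArg (Kerr.Adm.shift S) (Kerr.Adm.charges_seed (X := X))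
  have ea : S'.al = S.al := by rw [hS']; exact sub_zero _
  have eu : S'.ual = S.ual := by rw [hS']; exact sub_zero _
  refine ⟨ea, eu, fun τ hτ => ?_⟩
  obtain ⟨b₁, b₂, d₁, d₂, -⟩ := H a ha X.B rfl S hS hm τ hτ
  obtain ⟨b₁', b₂', -⟩ := H a ha X.B rfl S hS hm 0 le_rfl
  obtain ⟨m₁, m₂⟩ := HK X rfl S hS τ hτ
  obtain ⟨e₁, e₂⟩ := Kerr.Adm.energyAl_mono X.B (Nat.le_add_right J₁ 2) S.al τ
  obtain ⟨-, e₃⟩ := Kerr.Adm.energyAl_mono X.B (Nat.le_add_right J₁ 2) S.ual τ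
  have hp : 0 < (1 + τ) ^ (1 - η) := Real.rpow_pos_of_pos (by linarith) _
  have hK0 : (0 : ℝ) ≤ K := K.2
  have l₁ : ENNReal.ofReal c ≤ ENNReal.ofReal (c + K + 2 * K * c) :=
    ENNReal.ofReal_le_ofReal (by nlinarith [mul_nonneg hK0 hc.le])
  have l₂ : (K : ℝ≥0∞) ≤ ENNReal.ofReal (c + K + 2 * K * c) := by
    rw [← ENNReal.ofReal_coe_nnreal]
    exact ENNReal.ofReal_le_ofReal (by nlinarith [mul_nonneg hK0 hc.le])
  have l₃ : (K : ℝ≥0∞) * (2 * ENNReal.ofReal c) ≤ ENNReal.ofReal (c + K + 2 * K * c) := by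
    rw [← ENNReal.ofReal_coe_nnreal, ← ENNReal.ofReal_ofNat, ← ENNReal.ofReal_mul (by norm_num), ← ENNReal.ofReal_mul hK0]
    exact ENNReal.ofReal_le_ofReal (by nlinarith [mul_nonneg hK0 hc.le])
  have l₄ : ENNReal.ofReal (c / (1 + τ) ^ (1 - η)) ≤ ENNReal.ofReal ((c + K + 2 * K * c) / (1 + τ) ^ (1 - η)) :=
    ENNReal.ofReal_le_ofReal (div_le_div_of_nonneg_right (by nlinarith [mul_nonneg hK0 hc.le]) hp.le)
  have l₅ : (K : ℝ≥0∞) * ENNReal.ofReal (c / (1 + τ) ^ (1 - η)) ≤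
      ENNReal.ofReal ((c + K + 2 * K * c) / (1 + τ) ^ (1 - η)) := by
    rw [← ENNReal.ofReal_coe_nnreal, ← ENNReal.ofReal_mul hK0, ← mul_div_assoc]
    exact ENNReal.ofReal_le_ofReal (div_le_div_of_nonneg_right (by nlinarith [mul_nonneg hK0 hc.le]) hp.le)
  rw [ea, eu]
  refine ⟨e₁.trans (b₁.trans (by gcongr)), e₃.trans (b₂.trans (by gcongr)), ?_, e₁.trans (d₁.trans (by gcongr)),
    e₃.trans (d₂.trans (by gcongr)), ?_⟩
  · set D₁ := Dbdd a J₂ (X.B.seed S)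
    set D₂ := uDbdd a J₂ (X.B.seed S)
    calc _ ≤ _ := m₁
      _ ≤ K * (X.B.horizonL2 S.rho 0 + X.B.horizonL2 S.sig 0 + (ENNReal.ofReal c * D₁ + ENNReal.ofReal c * D₂) +
            (ENNReal.ofReal c * D₁ + ENNReal.ofReal c * D₂)) := by gcongr
      _ = K * (X.B.horizonL2 S.rho 0 + X.B.horizonL2 S.sig 0) + K * (2 * ENNReal.ofReal c) * D₁ +
            K * (2 * ENNReal.ofReal c) * D₂ := by ring
      _ ≤ _ := by gcongr <;> exact le_add_self
  · rw [hS'']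
    set D₁ := Ddec a J₃ (X.B.seed S)
    set D₂ := uDdec a J₃ (X.B.seed S)
    set r := ENNReal.ofReal (c / (1 + τ) ^ (1 - η))
    calc _ ≤ _ := m₂
      _ ≤ K * (r * D₁ + r * D₂) := by gcongr
      _ = K * r * D₁ + K * r * D₂ := by ring
      _ ≤ _ := by gcongr <;> exact le_self_add
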